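/- **Conventions.** A strict partition $\gamma=(\gamma_1>\dots>\gamma_\ell>0)$ has a shifted diagram with $\gamma_r$ cells in row $r$, in columns $r,\dots,r+\gamma_r-1$; rows are numbered from the bottom. Let $n\in\{0,1,2,\dots\}\cup\{\infty\}$. $\mathrm{SSHT}_n(\gamma)$ is the set of fillings of this diagram by letters $k'$ (marked) or $k$ (unmarked), $1\le k\le n$ ($k$ an arbitrary positive integer if $n=\infty$), which weakly increase along rows (left to right) and columns (upwards) for $1'<1<2'<2<\cdots$, with at most one unmarked $k$ per column, at most one marked $k'$ per row, and no marked letter on the main diagonal. The hook reading word $w(T)$ reads, for $i=\max(\gamma_1,\ell),\dots,1$, the marked entries of column $i$ upwards, then the unmarked entries of row $i$ from left to right. Let $m_i(w,r)$ be the number of letters $i$ or $i'$ minus the number of letters $i+1$ or $(i+1)'$ among the first $r$ letters of $w$, and $m_i(w)=\max_r m_i(w,r)$. **Operators.** Let $1\le i<n$. If $m_i(w(T))\le 0$, or if $T$ is empty, then $f_i(T)=0$. Otherwise let $p$ be the least index with $m_i(w(T),p)=m_i(w(T))$, let $x$ be the entry read at position $p$, $y$ the entry north of $x$ and $z$ the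 entry east of $x$. - If $x=i$: (a) if $z=(i+1)'$, change $x$ to $(i+1)'$ and $z$ to $i+1$; (b) else, if $y$ does not exist or $y>i+1$, change $x$ to $i+1$; (c) else change $x$ to $(i+1)'$ and remove the marking, if any, from the northwesternmost cell of the $(i+1)$-ribbon containing $y$. - If $x=i'$: (a) if $y=i$, change $x$ to $i$ and $y$ to $(i+1)'$; (b) else, if $z$ does not exist or $z>(i+1)'$, change $x$ to $(i+1)'$; (c) else change $x$ to $i$, and change to $(i+1)'$ the first entry $i$, going southeast from $x$ along the $i$-ribbon containing $x$, that is not followed on its east side by $i$ or $(i+1)'$. Here the $k$-ribbon containing a cell is the connected set of cells with entries $k$ or $k'$ that contains it. Further, $f_0(T)=0$ if $T$ has no entry $1$ or has an entry $2'$; otherwise $f_0$ changes the rightmost $1$ of $T$ to $2'$, or to $2$ if it is on the main diagonal. The queer crystal on $\mathrm{SSHT}_n(\gamma)$ is the directed graph on $\mathrm{SSHT}_n(\gamma)$ with colors $0\le i<n$ and an edge $S\xrightarrow{i}T$ whenever $f_i(S)=T$. **Graph notation.** Write $F_ix=z$ for $x\xrightarrow{i}z$ and $E_ix=y$ for $y\xrightarrow{i}x$.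 Let $\delta_i(x)$ and $\varepsilon_i(x)$ be the numbers of edges before and after $x$ in the $i$-string through $x$ (both $0$ if $i$ is not a color). Put $\Delta_i\delta_j(x)=\delta_j(x)-\delta_j(E_ix)$, $\Delta_i\varepsilon_j(x)=\varepsilon_j(E_ix)-\varepsilon_j(x)$, $\nabla_i\delta_j(x)=\delta_j(F_ix)-\delta_j(x)$ and $\nabla_i\varepsilon_j(x)=\varepsilon_j(x)-\varepsilon_j(F_ix)$. Below, $i,j$ range over the colors of the graph, and an asserted equality of composites of operators includes that both sides are defined. A graph is **regular** if: - (A1) all monochromatic directed paths have finite length; - (A2) each vertex has at most one incoming and at most one outgoing edge of each color; - (A3) if $E_ix$ is defined, $\Delta_i\delta_j(x)+\Delta_i\varepsilon_j(x)$ is $2$ if $j=i$, $-1$ if $|i-j|=1$, and $0$ if $|i-j|\ge2$; - (A4) if $E_ix$ is defined and $j\ne i$, then $\Delta_i\delta_j(x)\le0$ and $\Delta_i\varepsilon_j(x)\le0$; - (A5) if $E_ix,E_jx$ are defined and $\Delta_i\delta_j(x)=0$, then $E_iE_jx=E_jE_ix=y$ with $\nabla_j\varepsilon_i(y)=0$;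 if $F_ix,F_jx$ are defined and $\nabla_i\varepsilon_j(x)=0$, then $F_iF_jx=F_jF_ix=y$ with $\Delta_j\delta_i(y)=0$; - (A6) if $E_ix,E_jx$ are defined and $\Delta_i\delta_j(x)=\Delta_j\delta_i(x)=-1$, then $E_iE_j^2E_ix=E_jE_i^2E_jx=y$ with $\nabla_i\varepsilon_j(y)=\nabla_j\varepsilon_i(y)=-1$; if $F_ix,F_jx$ are defined and $\nabla_i\varepsilon_j(x)=\nabla_j\varepsilon_i(x)=-1$, then $F_iF_j^2F_ix=F_jF_i^2F_jx=y$ with $\Delta_i\delta_j(y)=\Delta_j\delta_i(y)=-1$. A graph is **queer regular** if: - (B0) the subgraph of the edges with nonzero colors is regular; - (B1) no two $0$-edges are consecutive, and $\delta_1(x)+\varepsilon_1(x)+\varepsilon_2(x)>1$ implies $\delta_0(x)+\varepsilon_0(x)=1$; - (B2) each vertex has at most one incoming and at most one outgoing $0$-edge; - (B3) if $E_0x$ is defined, $\Delta_0\delta_i(x)+\Delta_0\varepsilon_i(x)$ is $2$ if $i\le1$, $-1$ if $i=2$, and $0$ if $i\ge3$; - (B4) if $E_0x$ is defined, then $\Delta_0\delta_1(x)\ge0$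 and $\Delta_0\varepsilon_1(x)>0$; $\Delta_0\delta_2(x)\le0$ and $\Delta_0\varepsilon_2(x)\le0$; $\Delta_0\delta_i(x)=\Delta_0\varepsilon_i(x)=0$ for $i\ge3$ (each for those of these indices that are colors); - (B5) for $i\ge2$, if $E_ix=E_0y=z$, then $F_iF_0z=F_0F_iz$; for $i=1$ or $i\ge3$, if $F_ix=F_0y=z$ and $x\ne y$, then $E_iE_0z=E_0E_iz$; - (B6) if $E_0x$ is defined, then $\Delta_0\delta_1(x)=1$ implies $\varepsilon_1(x)=0$ and $E_0x=E_1x$; and $\Delta_0\varepsilon_2(x)=0$ if and only if $\varepsilon_2(x)=0$. **Theorem 4.5.** Let $\gamma$ be a strict partition and $n\in\{0,1,2,\dots\}\cup\{\infty\}$. If $n\ge2$, then for all $0\le i<n$ the operator $f_i$ is a well-defined map $\mathrm{SSHT}_n(\gamma)\to\mathrm{SSHT}_n(\gamma)\cup\{0\}$; that is, the rules above can always be carried out and give a semistandard shifted tableau whenever the result is not $0$. The queer crystal on $\mathrm{SSHT}_n(\gamma)$ is a queer regular graph. -/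

import Mathlib

/-! ### Directed coloured graphs -/

/-- A directed graph whose edges are coloured by natural numbers from a set `colors`.
`edge i x y` says that there is an edge `x → y` of colour `i`; in operator notation this is
`F_i x = y`, equivalently `E_i y = x`. -/
structure ColoredDigraph (V : Type*) where
  colors : Set ℕ
  edge : ℕ → V → V → Prop
  color_mem : ∀ {i x y}, edge i x y → i ∈ colors

namespace ColoredDigraph

variable {V : Type*} (G : ColoredDigraph V)

/-- `G.Path i d x y`: there is a directed path with `d` edges, all of colour `i`, from `x` to `y`. -/
def Path (i : ℕ) : ℕ → V → V → Prop
  | 0, x, y => x = y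
  | d + 1, x, y => ∃ z, G.edge i x z ∧ Path i d z y

/-- `δ_i(x)`: the number of edges of the `i`-string through `x` that lie before `x`. -/
noncomputable def delta (i : ℕ) (x : V) : ℕ := sSup {d | ∃ y, G.Path i d y x}

/-- `ε_i(x)`: the number of edges of the `i`-string through `x` that lie after `x`. -/
noncomputable def eps (i : ℕ) (x : V) : ℕ := sSup {d | ∃ y, G.Path i d x y}

/-- The change of `δ_j` along an edge `u → x` of colour `i`. It is `Δ_i δ_j(x) = δ_j(x) - δ_j(E_i x)`,
with `u = E_i x`; it is also `∇_i δ_j(u) = δ_j(F_i u) - δ_j(u)`, with `x = F_i u`. -/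
noncomputable def dDelta (j : ℕ) (u x : V) : ℤ := (G.delta j x : ℤ) - G.delta j u

/-- The change of `ε_j` along an edge `u → x` of colour `i`. It is `Δ_i ε_j(x) = ε_j(E_i x) - ε_j(x)`,
with `u = E_i x`; it is also `∇_i ε_j(u) = ε_j(u) - ε_j(F_i u)`, with `x = F_i u`. -/
noncomputable def dEps (j : ℕ) (u x : V) : ℤ := (G.eps j u : ℤ) - G.eps j x

/-- Stembridge regularity. -/
structure IsRegular : Prop where
  /-- All monochromatic directed paths have finite length (there is no forward-infinite one). -/
  finite_forward : ∀ i ∈ G.colors, ¬ ∃ s : ℕ → V, ∀ k, G.edge i (s k) (s (k + 1))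
  /-- All monochromatic directed paths have finite length (there is no backward-infinite one). -/
  finite_backward : ∀ i ∈ G.colors, ¬ ∃ s : ℕ → V, ∀ k, G.edge i (s (k + 1)) (s k)
  /-- At most one edge of each colour enters a vertex. -/
  unique_in : ∀ i ∈ G.colors, ∀ x y z, G.edge i y x → G.edge i z x → y = z
  /-- At most one edge of each colour leaves a vertex. -/
  unique_out : ∀ i ∈ G.colors, ∀ x y z, G.edge i x y → G.edge i x z → y = z
  /-- `Δ_i δ_j(x) + Δ_i ε_j(x)` is the type A Cartan integer. Here `u = E_i x`. -/
  cartan : ∀ i ∈ G.colors, ∀ j ∈ G.colors, ∀ x u, G.edge i u x →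
    G.dDelta j u x + G.dEps j u x =
      if j = i then 2 else if j = i + 1 ∨ i = j + 1 then -1 else 0
  /-- `Δ_i δ_j(x) ≤ 0` and `Δ_i ε_j(x) ≤ 0` for `j ≠ i`. Here `u = E_i x`. -/
  nonpos : ∀ i ∈ G.colors, ∀ j ∈ G.colors, j ≠ i → ∀ x u, G.edge i u x →
    G.dDelta j u x ≤ 0 ∧ G.dEps j u x ≤ 0
  /-- `Δ_i δ_j(x) = 0` implies `E_i E_j x = E_j E_i x = y` and `∇_j ε_i(y) = 0`.
  Here `u = E_i x = F_j y` and `v = E_j x`. -/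
  square_up : ∀ i ∈ G.colors, ∀ j ∈ G.colors, ∀ x u v, G.edge i u x → G.edge j v x →
    G.dDelta j u x = 0 →
      ∃ y, G.edge i y v ∧ G.edge j y u ∧ G.dEps i y u = 0
  /-- `∇_i ε_j(x) = 0` implies `F_i F_j x = F_j F_i x = y` and `Δ_j δ_i(y) = 0`.
  Here `u = F_i x = E_j y` and `v = F_j x`. -/
  square_down : ∀ i ∈ G.colors, ∀ j ∈ G.colors, ∀ x u v, G.edge i x u → G.edge j x v →
    G.dEps j x u = 0 →
      ∃ y, G.edge i v y ∧ G.edge j u y ∧ G.dDelta i u y = 0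
  /-- `Δ_i δ_j(x) = Δ_j δ_i(x) = -1` implies `E_i E_j E_j E_i x = E_j E_i E_i E_j x = y` and
  `∇_i ε_j(y) = ∇_j ε_i(y) = -1`. Here `u = E_i x`, `v = E_j x`, `b = F_i y`, `d = F_j y`. -/
  octagon_up : ∀ i ∈ G.colors, ∀ j ∈ G.colors, ∀ x u v, G.edge i u x → G.edge j v x →
    G.dDelta j u x = -1 → G.dDelta i v x = -1 →
      ∃ y a b c d, (G.edge j a u ∧ G.edge j b a ∧ G.edge i y b) ∧
        (G.edge i c v ∧ G.edge i d c ∧ G.edge j y d) ∧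
        G.dEps j y b = -1 ∧ G.dEps i y d = -1
  /-- `∇_i ε_j(x) = ∇_j ε_i(x) = -1` implies `F_i F_j F_j F_i x = F_j F_i F_i F_j x = y` and
  `Δ_i δ_j(y) = Δ_j δ_i(y) = -1`. Here `u = F_i x`, `v = F_j x`, `b = E_i y`, `d = E_j y`. -/
  octagon_down : ∀ i ∈ G.colors, ∀ j ∈ G.colors, ∀ x u v, G.edge i x u → G.edge j x v →
    G.dEps j x u = -1 → G.dEps i x v = -1 →
      ∃ y a b c d, (G.edge j u a ∧ G.edge j a b ∧ G.edge i b y) ∧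
        (G.edge i v c ∧ G.edge i c d ∧ G.edge j d y) ∧
        G.dDelta j b y = -1 ∧ G.dDelta i d y = -1

/-- The subgraph formed by the edges of non-zero colour. -/
def positivePart : ColoredDigraph V where
  colors := {i | i ∈ G.colors ∧ i ≠ 0}
  edge i x y := G.edge i x y ∧ i ≠ 0
  color_mem h := ⟨G.color_mem h.1, h.2⟩

/-- Queer regularity. In the fields about an edge of colour `0` into `x`, `u = E_0 x`. -/
structure IsQueerRegular : Prop where
  /-- The part with non-zero colours is regular. -/
  regular : G.positivePart.IsRegular
  /-- No two `0`-edges are consecutive. -/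
  zero_path : ∀ x y z, G.edge 0 x y → ¬ G.edge 0 y z
  /-- If `δ_1(x) + ε_1(x) + ε_2(x) > 1` then `δ_0(x) + ε_0(x) = 1`. -/
  zero_edge : ∀ x, 1 < G.delta 1 x + G.eps 1 x + G.eps 2 x → G.delta 0 x + G.eps 0 x = 1
  /-- At most one `0`-edge enters a vertex. -/
  unique_in : ∀ x y z, G.edge 0 y x → G.edge 0 z x → y = z
  /-- At most one `0`-edge leaves a vertex. -/
  unique_out : ∀ x y z, G.edge 0 x y → G.edge 0 x z → y = z
  /-- The value of `Δ_0 δ_i(x) + Δ_0 ε_i(x)`. -/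
  cartan : ∀ i ∈ G.colors, ∀ x u, G.edge 0 u x →
    G.dDelta i u x + G.dEps i u x = if i ≤ 1 then 2 else if i = 2 then -1 else 0
  /-- `Δ_0 δ_1(x) ≥ 0` and `Δ_0 ε_1(x) > 0`. -/
  sign_one : 1 ∈ G.colors → ∀ x u, G.edge 0 u x → 0 ≤ G.dDelta 1 u x ∧ 0 < G.dEps 1 u x
  /-- `Δ_0 δ_2(x) ≤ 0` and `Δ_0 ε_2(x) ≤ 0`. -/
  sign_two : 2 ∈ G.colors → ∀ x u, G.edge 0 u x → G.dDelta 2 u x ≤ 0 ∧ G.dEps 2 u x ≤ 0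
  /-- `Δ_0 δ_i(x) = 0` and `Δ_0 ε_i(x) = 0` for `i ≥ 3`. -/
  sign_far : ∀ i ∈ G.colors, 3 ≤ i → ∀ x u, G.edge 0 u x →
    G.dDelta i u x = 0 ∧ G.dEps i u x = 0
  /-- For `i ≥ 2`, if `E_i x = E_0 y = z` then `F_i F_0 z = F_0 F_i z` (both being defined). -/
  square_down : ∀ i ∈ G.colors, 2 ≤ i → ∀ x y z, G.edge i z x → G.edge 0 z y →
    ∃ w, G.edge i y w ∧ G.edge 0 x w
  /-- For `i = 1` or `i ≥ 3`, if `F_i x = F_0 y = z` and `x ≠ y` then `E_i E_0 z = E_0 E_i z`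
  (both being defined). -/
  square_up : ∀ i ∈ G.colors, (i = 1 ∨ 3 ≤ i) → ∀ x y z, G.edge i x z → G.edge 0 y z → x ≠ y →
    ∃ w, G.edge i w y ∧ G.edge 0 w x
  /-- `Δ_0 δ_1(x) = 1` implies `ε_1(x) = 0` and `E_0 x = E_1 x`. -/
  end_one : ∀ x u, G.edge 0 u x → G.dDelta 1 u x = 1 → G.eps 1 x = 0 ∧ G.edge 1 u x
  /-- `Δ_0 ε_2(x) = 0` if and only if `ε_2(x) = 0`. -/
  end_two : ∀ x u, G.edge 0 u x → (G.dEps 2 u x = 0 ↔ G.eps 2 x = 0)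

end ColoredDigraph

/-! ### Semistandard shifted tableaux -/

namespace Shifted

/-- Marked and unmarked integers, ordered lexicographically with "marked" (`false`) before
"unmarked" (`true`). -/
abbrev Letter : Type := ℕ ×ₗ Bool

/-- The marked letter with value `k`. -/
def mk (k : ℕ) : Letter := toLex (k, false)

/-- The unmarked letter with value `k`. -/
def un (k : ℕ) : Letter := toLex (k, true)

/-- The underlying integer of a letter. -/
def Letter.val (a : Letter) : ℕ := (ofLex a).1

/-- A strict partition: a strictly decreasing sequence of positive integers (possibly empty). -/
structure StrictPartition where
  parts : List ℕ
  strict : parts.Pairwise (· > ·)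
  pos : ∀ p ∈ parts, 0 < p

/-- Cells are pairs (row, column), numbered from `0`; rows are numbered from the bottom. Row `r` of
the shifted diagram has as many cells as the part with index `r`, the first in column `r`. -/
def StrictPartition.diagram (γ : StrictPartition) : Set (ℕ × ℕ) :=
  {q | q.1 ≤ q.2 ∧ q.2 < q.1 + γ.parts.getD q.1 0}

/-- The maximum of the largest part and the number of parts; all row and column indices of cells are
smaller than it. -/
def StrictPartition.size (γ : StrictPartition) : ℕ := max (γ.parts.headD 0) γ.parts.length

/-- A partial filling of the quarter plane; `none` means that the cell is not there. -/
abbrev Filling : Type := ℕ × ℕ → Option Letter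

/-- `T` is a semistandard shifted tableau of shape `γ` whose entries have values in `{1, …, n}`
(all positive integers if `n = ⊤`). -/
structure IsSSHT (γ : StrictPartition) (n : ℕ∞) (T : Filling) : Prop where
  shape : ∀ q, (T q).isSome ↔ q ∈ γ.diagram
  entries : ∀ q a, T q = some a → 1 ≤ a.val ∧ (a.val : ℕ∞) ≤ n
  row_weak : ∀ r c d a b, c < d → T (r, c) = some a → T (r, d) = some b → a ≤ b
  col_weak : ∀ r s c a b, r < s → T (r, c) = some a → T (s, c) = some b → a ≤ b
  /-- At most one unmarked `k` in each column. -/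
  col_unmarked : ∀ r s c k, T (r, c) = some (un k) → T (s, c) = some (un k) → r = s
  /-- At most one marked `k` in each row. -/
  row_marked : ∀ r c d k, T (r, c) = some (mk k) → T (r, d) = some (mk k) → c = d
  /-- No marked letter on the main diagonal. -/
  diag_unmarked : ∀ r k, T (r, r) ≠ some (mk k)

/-- The set of semistandard shifted tableaux of shape `γ` with entries of value at most `n`. -/
def SSHT (γ : StrictPartition) (n : ℕ∞) : Type := {T : Filling // IsSSHT γ n T}

/-! ### The operators -/

/-- The cell `q` of `T` carries a marked letter. -/
def isMarked (T : Filling) (q : ℕ × ℕ) : Bool := (T q).any fun a => !(ofLex a).2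

/-- The cell `q` of `T` carries an unmarked letter. -/
def isUnmarked (T : Filling) (q : ℕ × ℕ) : Bool := (T q).any fun a => (ofLex a).2

/-- The cell `q` of `T` carries a letter of value `k`, marked or not. -/
def hasVal (k : ℕ) (T : Filling) (q : ℕ × ℕ) : Bool := (T q).any fun a => a.val == k

/-- The cells in the order of the hook reading word: for each index `i`, from the last down to the
first, the marked cells going up column `i`, then the unmarked cells of row `i` from left to right. -/
def readingCells (γ : StrictPartition) (T : Filling) : List (ℕ × ℕ) :=
  (List.range γ.size).reverse.flatMap fun i =>
    ((List.range γ.size).map fun r => (r, i)).filter (isMarked T) ++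
      ((List.range γ.size).map fun c => (i, c)).filter (isUnmarked T)

/-- The hook reading word, with markings forgotten. -/
def readingWord (γ : StrictPartition) (T : Filling) : List ℕ :=
  (readingCells γ T).map fun q => ((T q).map Letter.val).getD 0

/-- `m_i(w, r)`: the number of letters `i` minus the number of letters `i + 1` among the first `r`
letters of `w`. -/
def mIndex (i : ℕ) (w : List ℕ) (r : ℕ) : ℤ :=
  ((w.take r).count i : ℤ) - (w.take r).count (i + 1)

/-- The maximum of `m_i(w, r)`. The index `r = 0`, with value `0`, is included, so that the empty
word is covered; this affects neither whether the maximum is positive nor where a positive maximum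
is attained. -/
def mMax (i : ℕ) (w : List ℕ) : ℤ :=
  (Finset.range (w.length + 1)).sup' Finset.nonempty_range_add_one (mIndex i w)

/-- The cell of the letter `w_p`, where `p` is the smallest index with `m_i(w, p) = m_i(w)`, if
`m_i(w) > 0`; otherwise `none`. -/
def activeCell (γ : StrictPartition) (i : ℕ) (T : Filling) : Option (ℕ × ℕ) :=
  let w := readingWord γ T
  if mMax i w ≤ 0 then none
  else ((List.range (w.length + 1)).find? fun p => mIndex i w p == mMax i w).bind
    fun p => (readingCells γ T)[p - 1]?

/-- One step in the northwest direction along the `k`-ribbon: to the cell north or else west if it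
has value `k`; stay at the northwestern end. -/
def stepNW (k : ℕ) (T : Filling) (q : ℕ × ℕ) : ℕ × ℕ :=
  if hasVal k T (q.1 + 1, q.2) then (q.1 + 1, q.2)
  else if q.2 ≠ 0 ∧ hasVal k T (q.1, q.2 - 1) then (q.1, q.2 - 1)
  else q

/-- One step in the southeast direction along the `k`-ribbon: to the cell east or else south if it
has value `k`; stay at the southeastern end. -/
def stepSE (k : ℕ) (T : Filling) (q : ℕ × ℕ) : ℕ × ℕ :=
  if hasVal k T (q.1, q.2 + 1) then (q.1, q.2 + 1)
  else if q.1 ≠ 0 ∧ hasVal k T (q.1 - 1, q.2) then (q.1 - 1, q.2)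
  else q

/-- The northwesternmost cell of the `k`-ribbon containing `q`. A ribbon has fewer than
`2 * γ.size` cells, so the walk has reached its end. -/
def endNW (γ : StrictPartition) (k : ℕ) (T : Filling) (q : ℕ × ℕ) : ℕ × ℕ :=
  (stepNW k T)^[2 * γ.size] q

/-- The first cell, going southeast from `q` along the `i`-ribbon containing `q`, that carries an
unmarked `i` and is followed (on its east side) neither by an unmarked `i` nor by a marked `i + 1`. -/
def firstSE (γ : StrictPartition) (i : ℕ) (T : Filling) (q : ℕ × ℕ) : Option (ℕ × ℕ) :=
  ((List.range (2 * γ.size)).map fun k => (stepSE i T)^[k] q).find? fun s =>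
    decide (T s = some (un i) ∧ T (s.1, s.2 + 1) ≠ some (un i) ∧
      T (s.1, s.2 + 1) ≠ some (mk (i + 1)))

/-- Removes the marking, if any, from the letter in the cell `q`. -/
def unmark (T : Filling) (q : ℕ × ℕ) : Filling :=
  Function.update T q ((T q).map fun a => un a.val)

/-- The shifted lowering operator for a colour `i ≥ 1`; `none` stands for `0`. -/
def lowerPos (γ : StrictPartition) (i : ℕ) (T : Filling) : Option Filling :=
  (activeCell γ i T).bind fun p =>
    let north : ℕ × ℕ := (p.1 + 1, p.2)
    let east : ℕ × ℕ := (p.1, p.2 + 1)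
    if T p = some (un i) then
      if T east = some (mk (i + 1)) then
        some (Function.update (Function.update T p (some (mk (i + 1)))) east (some (un (i + 1))))
      else if (T north).all fun y => decide (un (i + 1) < y) then
        some (Function.update T p (some (un (i + 1))))
      else
        some (Function.update (unmark T (endNW γ (i + 1) T north)) p (some (mk (i + 1))))
    else if T p = some (mk i) then
      if T north = some (un i) then
        some (Function.update (Function.update T p (some (un i))) north (some (mk (i + 1))))
      else if (T east).all fun z => decide (mk (i + 1) < z) then
        some (Function.update T p (some (mk (i + 1))))
      else
        (firstSE γ i T p).map fun s =>
          Function.update (Function.update T p (some (un i))) s (some (mk (i + 1)))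
    else none

/-- The square of cells that contains the diagram of `γ`, column by column from right to left. -/
def boxCells (γ : StrictPartition) : List (ℕ × ℕ) :=
  (List.range γ.size).reverse.flatMap fun c => (List.range γ.size).map fun r => (r, c)

/-- The queer lowering operator; `none` stands for `0`. It is `0` if there is no unmarked `1` or
there is a marked `2`; otherwise it changes the rightmost unmarked `1` into a marked `2`, or into an
unmarked `2` if that cell is on the main diagonal. -/
def lowerZero (γ : StrictPartition) (T : Filling) : Option Filling :=
  if (boxCells γ).any fun q => decide (T q = some (mk 2)) then none
  else ((boxCells γ).find? fun q => decide (T q = some (un 1))).map fun q =>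
    Function.update T q (some (if q.1 = q.2 then un 2 else mk 2))

/-- The lowering operator of colour `i`. -/
def lower (γ : StrictPartition) (i : ℕ) (T : Filling) : Option Filling :=
  if i = 0 then lowerZero γ T else lowerPos γ i T

/-- The queer crystal on the semistandard shifted tableaux of shape `γ` with entries of value at
most `n`: its colours are the integers `0 ≤ i < n`, and there is an edge of colour `i` from `S` to
`T` if the lowering operator of colour `i` sends `S` to `T`. -/
def queerCrystal (γ : StrictPartition) (n : ℕ∞) : ColoredDigraph (SSHT γ n) where
  colors := {i | (i : ℕ∞) < n}
  edge i S T := (i : ℕ∞) < n ∧ lower γ i S.1 = some T.1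
  color_mem h := h.1

end Shifted

open Finset (Ico mem_union mem_erase mem_insert mem_filter mem_Ico mem_of_mem_erase mem_union_left mem_union_right mem_insert_of_mem mem_singleton union_comm card_union_of_disjoint notMem_empty card_insert_of_notMem)

/-! ### Strips of cells on the integer line and their switching -/

namespace Strip

/-- The indicator function of a finite set of contents. -/
def ind (X : Finset ℤ) (c : ℤ) : ℤ := if c ∈ X then 1 else 0

lemma ind_of_mem {X : Finset ℤ} {c : ℤ} (h : c ∈ X) : ind X c = 1 := if_pos h
lemma ind_of_not_mem {X : Finset ℤ} {c : ℤ} (h : c ∉ X) : ind X c = 0 := if_neg h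

/-- The number of elements of `X` that are at most `c`. -/
def cnt (X : Finset ℤ) (c : ℤ) : ℤ := (X.filter (· ≤ c)).card

lemma cnt_step (X : Finset ℤ) (c : ℤ) : cnt X c = cnt X (c-1)+ind X c := by
  unfold cnt ind
  split_ifs with h
  · have : X.filter (· ≤ c) = insert c (X.filter (· ≤ c-1)) := by
      ext x; simp only [mem_filter, mem_insert]
      constructor
      · rintro ⟨h1, h2⟩
        by_cases hx : x = c; exacts [Or.inl hx, Or.inr ⟨h1, by omega⟩]
      · rintro (rfl | ⟨h1, h2⟩); exacts [⟨h, le_rfl⟩, ⟨h1, by omega⟩]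
    rw [this, card_insert_of_notMem (by simp)]
    push_cast; ring
  · have : X.filter (· ≤ c) = X.filter (· ≤ c-1) := by
      ext x; simp only [mem_filter]
      constructor
      · rintro ⟨h1, h2⟩; exact ⟨h1, by rcases eq_or_ne x c with rfl | hx; exact absurd h1 h; omega⟩
      · rintro ⟨h1, h2⟩; exact ⟨h1, by omega⟩
    rw [this]; simp

lemma cnt_succ (X : Finset ℤ) (c : ℤ) : cnt X (c+1) = cnt X c+ind X (c+1) := by
  have := cnt_step X (c+1); rwa [add_sub_cancel_right] at this

lemma cnt_nonneg (X : Finset ℤ) (c : ℤ) : 0 ≤ cnt X c := by unfold cnt; positivity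

lemma exists_lower (X : Finset ℤ) : ∃ B : ℤ, ∀ c ∈ X, B < c := by
  obtain ⟨B, hB⟩ := X.bddBelow; exact ⟨B-1, fun c hc => by have := hB hc; omega⟩

lemma exists_upper (X : Finset ℤ) : ∃ B : ℤ, ∀ c ∈ X, c < B := by
  obtain ⟨B, hB⟩ := X.bddAbove; exact ⟨B+1, fun c hc => by have := hB hc; omega⟩

lemma cnt_eq_zero {X : Finset ℤ} {c : ℤ} (h : ∀ x ∈ X, c < x) : cnt X c = 0 := by
  unfold cnt
  rw [Finset.filter_eq_empty_iff.2 fun x hx => by have := h x hx; omega]; rfl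

/-- `X` is a strip of type `t` (horizontal for `t = 0`, vertical for `t = 1`) that leads from the
site occupation `σ` to the site occupation `τ`: each `c ∈ X` moves a particle from `c` to `c + 1`. -/
structure IsStrip (t : ℤ) (σ τ : ℤ → ℤ) (X : Finset ℤ) : Prop where
  site1 : ∀ c, σ c = 0 ∨ σ c = 1
  site2 : ∀ c, τ c = 0 ∨ τ c = 1
  move : ∀ c, τ c = σ c-ind X c+ind X (c-1)
  cond : ∀ c, c ∈ X → c-1 ∈ X → σ c = t

/-- The conditions of a strip at a single site. -/
def StripAt (t : ℤ) (σ τ : ℤ → ℤ) (X : Finset ℤ) (c : ℤ) : Prop :=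
  (σ c = 0 ∨ σ c = 1) ∧ (τ c = 0 ∨ τ c = 1) ∧ τ c = σ c-ind X c+ind X (c-1) ∧
    (c ∈ X → c-1 ∈ X → σ c = t)

lemma IsStrip.at {t σ τ X} (h : IsStrip t σ τ X) (c : ℤ) : StripAt t σ τ X c :=
  ⟨h.site1 c, h.site2 c, h.move c, h.cond c⟩

lemma isStrip_of_at {t σ τ X} (h : ∀ c, StripAt t σ τ X c) : IsStrip t σ τ X :=
  ⟨fun c => (h c).1, fun c => (h c).2.1, fun c => (h c).2.2.1, fun c => (h c).2.2.2⟩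

/-- Exchange of a pair of strips: on each maximal run of `H ∪ V` the labels are rotated. The
predicate `g` holds on a run when its last label is `H`. -/
structure Rot (H V V' H' : Finset ℤ) (g : ℤ → Prop) : Prop where
  disj : ∀ c, c ∈ H → c ∉ V
  disj' : ∀ c, c ∈ V' → c ∉ H'
  union : ∀ c, (c ∈ H ∨ c ∈ V) ↔ (c ∈ V' ∨ c ∈ H')
  const : ∀ c, (c ∈ H ∨ c ∈ V) → (c+1 ∈ H ∨ c+1 ∈ V) → (g c ↔ g (c+1))
  shift : ∀ c, (c ∈ H ∨ c ∈ V) → (c+1 ∈ H ∨ c+1 ∈ V) → (c+1 ∈ H' ↔ c ∈ H)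
  last : ∀ c, (c ∈ H ∨ c ∈ V) → ¬ (c+1 ∈ H ∨ c+1 ∈ V) → (c ∈ H ↔ g c)
  first : ∀ c, (c ∈ H ∨ c ∈ V) → ¬ (c-1 ∈ H ∨ c-1 ∈ V) → (c ∈ H' ↔ g c)

/-- Switching a horizontal strip followed by a vertical strip into a vertical strip followed by a
horizontal strip. -/
structure Switch (σ0 σ1 τ σ2 : ℤ → ℤ) (H V V' H' : Finset ℤ) : Prop where
  hH : IsStrip 0 σ0 σ1 H
  hV : IsStrip 1 σ1 σ2 V
  hV' : IsStrip 1 σ0 τ V'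
  hH' : IsStrip 0 τ σ2 H'
  rot : ∃ g, Rot H V V' H' g

/-- The occupation after a strip. -/
def after (σ : ℤ → ℤ) (X : Finset ℤ) : ℤ → ℤ := fun c => σ c-ind X c+ind X (c-1)

lemma IsStrip.eq_after {t σ τ X} (h : IsStrip t σ τ X) : τ = after σ X := funext h.move

section
variable {σ0 σ1 τ σ2 : ℤ → ℤ} {H V V' H' : Finset ℤ} {g : ℤ → Prop}

lemma disjoint_of_stripAt {c : ℤ} (hH : StripAt 0 σ0 σ1 H c) (hV : StripAt 1 σ1 σ2 V c)
    (h : c ∈ H) : c ∉ V := by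
  intro h'
  obtain ⟨a0, a1, a2, a3⟩ := hH
  obtain ⟨b0, b1, b2, b3⟩ := hV; grind [ind]

lemma disjoint_of_strips (hH : IsStrip 0 σ0 σ1 H) (hV : IsStrip 1 σ1 σ2 V) (c : ℤ) (h : c ∈ H) :
    c ∉ V :=
  disjoint_of_stripAt (hH.at c) (hV.at c) h

lemma Rot.stripAt (hr : Rot H V V' H' g) {c : ℤ} (hH : StripAt 0 σ0 σ1 H c)
    (hV : StripAt 1 σ1 σ2 V c) :
    StripAt 1 σ0 (after σ0 V') V' c ∧ StripAt 0 (after σ0 V') σ2 H' c := by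
  obtain ⟨a0, a1, a2, a3⟩ := hH
  obtain ⟨-, a5, a6, a7⟩ := hV
  have b2 := hr.disj (c-1); have b3 := hr.disj' c; have b4 := hr.disj' (c-1)
  have b5 := hr.union c; have b6 := hr.union (c-1); have b7 := hr.shift (c-1)
  rw [sub_add_cancel] at b7
  unfold StripAt after
  unfold ind at *
  refine ⟨⟨a0, ?_, ?_, ?_⟩, ?_, a5, ?_, ?_⟩ <;> grind

lemma Rot.strips (hr : Rot H V V' H' g) (hH : IsStrip 0 σ0 σ1 H) (hV : IsStrip 1 σ1 σ2 V) :
    Switch σ0 σ1 (after σ0 V') σ2 H V V' H' :=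
  ⟨hH, hV, isStrip_of_at fun c => (hr.stripAt (hH.at c) (hV.at c)).1,
    isStrip_of_at fun c => (hr.stripAt (hH.at c) (hV.at c)).2, g, hr⟩

/-- The label of the last element of the run of `C` containing `c` is in `H`. -/
def lastIn (C H : Finset ℤ) (c : ℤ) : Prop :=
  ∃ e, c ≤ e ∧ (∀ d, c ≤ d → d ≤ e → d ∈ C) ∧ e+1 ∉ C ∧ e ∈ H

lemma exists_run_end (C : Finset ℤ) (c : ℤ) (hc : c ∈ C) :
    ∃ e, c ≤ e ∧ (∀ d, c ≤ d → d ≤ e → d ∈ C) ∧ e+1 ∉ C := by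
  obtain ⟨B, hB⟩ := exists_upper C
  have key : ∀ n : ℕ, ∀ c ∈ C, B-c = n → ∃ e, c ≤ e ∧ (∀ d, c ≤ d → d ≤ e → d ∈ C) ∧ e+1 ∉ C := by
    intro n
    induction n with
    | zero => intro c hc h; have := hB c hc; omega
    | succ n ih =>
      intro c hc h
      by_cases h' : c+1 ∈ C
      · obtain ⟨e, h1, h2, h3⟩ := ih (c+1) h' (by push_cast at h; omega)
        refine ⟨e, by omega, fun d hd hd' => ?_, h3⟩
        rcases eq_or_ne d c with rfl | hne; exacts [hc, h2 d (by omega) hd']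
      · exact ⟨c, le_rfl, fun d hd hd' => by rwa [show d = c by omega], h'⟩
  have := hB c hc; exact key (B-c).toNat c hc (by omega)

lemma exists_run_start (C : Finset ℤ) (c : ℤ) (hc : c ∈ C) :
    ∃ e, e ≤ c ∧ (∀ d, e ≤ d → d ≤ c → d ∈ C) ∧ e-1 ∉ C := by
  obtain ⟨B, hB⟩ := exists_lower C
  have key : ∀ n : ℕ, ∀ c ∈ C, c-B = n → ∃ e, e ≤ c ∧ (∀ d, e ≤ d → d ≤ c → d ∈ C) ∧ e-1 ∉ C := by
    intro n
    induction n with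
    | zero => intro c hc h; have := hB c hc; omega
    | succ n ih =>
      intro c hc h
      by_cases h' : c-1 ∈ C
      · obtain ⟨e, h1, h2, h3⟩ := ih (c-1) h' (by push_cast at h; omega)
        refine ⟨e, by omega, fun d hd hd' => ?_, h3⟩
        rcases eq_or_ne d c with rfl | hne; exacts [hc, h2 d hd (by omega)]
      · exact ⟨c, le_rfl, fun d hd hd' => by rwa [show d = c by omega], h'⟩
  have := hB c hc; exact key (c-B).toNat c hc (by omega)

lemma lastIn_step {C H : Finset ℤ} {c : ℤ} (h : c ∈ C) (h' : c+1 ∈ C) :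
    lastIn C H c ↔ lastIn C H (c+1) := by
  constructor
  · rintro ⟨e, h1, h2, h3, h4⟩
    have : c ≠ e := by rintro rfl; exact h3 h'
    exact ⟨e, by omega, fun d hd hd' => h2 d (by omega) hd', h3, h4⟩
  · rintro ⟨e, h1, h2, h3, h4⟩
    refine ⟨e, by omega, fun d hd hd' => ?_, h3, h4⟩
    rcases eq_or_ne d c with rfl | hne; exacts [h, h2 d (by omega) hd']

lemma lastIn_last {C H : Finset ℤ} {c : ℤ} (h : c ∈ C) (h' : c+1 ∉ C) :
    lastIn C H c ↔ c ∈ H := by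
  constructor
  · rintro ⟨e, h1, h2, h3, h4⟩
    have : c = e := by
      by_contra hne; exact h' (h2 (c+1) (by omega) (by omega))
    rwa [this]
  · intro hc; exact ⟨c, le_rfl, fun d hd hd' => by rwa [show d = c by omega], h', hc⟩

open Classical in
lemma exists_rot (hd : ∀ c, c ∈ H → c ∉ V) : ∃ V' H' g, Rot H V V' H' g := by
  let g := lastIn (H ∪ V) H
  let P : ℤ → Prop := fun c => (c-1 ∈ H ∪ V ∧ c-1 ∈ H) ∨ (c-1 ∉ H ∪ V ∧ g c)
  refine ⟨(H ∪ V).filter fun c => ¬ P c, (H ∪ V).filter P, g, ?_⟩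
  constructor
  · exact hd
  · intro c; simp only [mem_filter]; tauto
  · intro c; simp only [mem_filter, mem_union]; tauto
  · intro c h1 h2; exact lastIn_step (by simpa using h1) (by simpa using h2)
  · intro c h1 h2
    have h1' : c ∈ H ∪ V := by simpa using h1
    have h2' : c+1 ∈ H ∪ V := by simpa using h2
    simp only [mem_filter, P, add_sub_cancel_right]; tauto
  · intro c h1 h2; exact (lastIn_last (by simpa using h1) (by simpa using h2)).symm
  · intro c h1 h2
    have h1' : c ∈ H ∪ V := by simpa using h1
    have h2' : c-1 ∉ H ∪ V := by simpa using h2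
    simp only [mem_filter, P]; tauto

lemma exists_switch (hH : IsStrip 0 σ0 σ1 H) (hV : IsStrip 1 σ1 σ2 V) :
    ∃ τ V' H', Switch σ0 σ1 τ σ2 H V V' H' := by
  obtain ⟨V', H', g, hr⟩ := exists_rot (disjoint_of_strips hH hV); exact ⟨_, V', H', hr.strips hH hV⟩

lemma Rot.g_iff (hr : Rot H V V' H' g) {c : ℤ} (hc : c ∈ H ∨ c ∈ V) : g c ↔ lastIn (H ∪ V) H c := by
  have hmem : ∀ c, c ∈ H ∪ V ↔ (c ∈ H ∨ c ∈ V) := fun c => mem_union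
  obtain ⟨e, h1, h2, h3⟩ := exists_run_end (H ∪ V) c (by simpa using hc)
  have key : ∀ n : ℕ, ∀ d, c ≤ d → e-d = n → (g d ↔ lastIn (H ∪ V) H d) := by
    intro n
    induction n with
    | zero =>
      intro d hd hn
      have : d = e := by omega
      subst this
      rw [lastIn_last (h2 d h1 le_rfl) h3, hr.last d ((hmem _).1 (h2 d h1 le_rfl)) (by rwa [← hmem])]
    | succ n ih =>
      intro d hd hn
      push_cast at hn
      have m1 := h2 d hd (by omega); have m2 := h2 (d+1) (by omega) (by omega)
      rw [lastIn_step m1 m2, hr.const d ((hmem _).1 m1) ((hmem _).1 m2)]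
      exact ih (d+1) (by omega) (by omega)
  exact key (e-c).toNat c le_rfl (by omega)

lemma Rot.unique {V2 H2 : Finset ℤ} {g₂ : ℤ → Prop} (h : Rot H V V' H' g) (h2 : Rot H V V2 H2 g₂) :
    V' = V2 ∧ H' = H2 := by
  have key : ∀ c, c ∈ H' ↔ c ∈ H2 := by
    intro c
    by_cases hc : c ∈ H ∨ c ∈ V
    · by_cases hc' : c-1 ∈ H ∨ c-1 ∈ V
      · have a := h.shift (c-1) hc'; have b := h2.shift (c-1) hc'
        rw [sub_add_cancel] at a b
        rw [a hc, b hc]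
      · rw [h.first c hc hc', h2.first c hc hc', h.g_iff hc, h2.g_iff hc]
    · have a := h.union c; have b := h2.union c; tauto
  refine ⟨?_, Finset.ext key⟩
  ext c
  have a := h.union c; have b := h2.union c; have a' := h.disj' c; have b' := h2.disj' c; have := key c
  tauto

lemma Switch.unique {τ2 : ℤ → ℤ} {V2 H2 : Finset ℤ} (h : Switch σ0 σ1 τ σ2 H V V' H')
    (h₂ : Switch σ0 σ1 τ2 σ2 H V V2 H2) : V' = V2 ∧ H' = H2 ∧ τ = τ2 := by
  obtain ⟨g, hg⟩ := h.rot
  obtain ⟨g₂, hg2⟩ := h₂.rot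
  obtain ⟨h1, h2⟩ := hg.unique hg2; exact ⟨h1, h2, by rw [h.hV'.eq_after, h₂.hV'.eq_after, h1]⟩

end

/-! #### Reflection of the line -/

/-- The reflection of contents. -/
def refl (X : Finset ℤ) : Finset ℤ := X.image fun c => -1-c

@[simp] lemma mem_refl {X : Finset ℤ} {c : ℤ} : c ∈ refl X ↔ -1-c ∈ X := by
  simp only [refl, Finset.mem_image]
  constructor
  · rintro ⟨d, hd, rfl⟩; simpa using hd
  · intro h; exact ⟨-1-c, h, by ring⟩

@[simp] lemma refl_refl (X : Finset ℤ) : refl (refl X) = X := by ext c; simp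

lemma refl_union (X Y : Finset ℤ) : refl (X ∪ Y) = refl X ∪ refl Y := by ext c; simp

/-- The reflection of site occupations, which also exchanges particles and holes. -/
def reflSite (σ : ℤ → ℤ) : ℤ → ℤ := fun s => 1-σ (-s)

@[simp] lemma reflSite_reflSite (σ : ℤ → ℤ) : reflSite (reflSite σ) = σ := by
  funext c; simp [reflSite]

lemma ind_refl (X : Finset ℤ) (c : ℤ) : ind (refl X) c = ind X (-1-c) := by
  simp [ind]

lemma IsStrip.refl {t : ℤ} {σ τ : ℤ → ℤ} {X : Finset ℤ} (h : IsStrip t σ τ X) :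
    IsStrip (1-t) (reflSite σ) (reflSite τ) (refl X) := by
  constructor
  · intro c; have := h.site1 (-c); unfold reflSite; omega
  · intro c; have := h.site2 (-c); unfold reflSite; omega
  · intro c
    have := h.move (-c)
    rw [ind_refl, ind_refl, show -1-c = -c-1 by ring, show -1-(c-1) = -c by ring]
    unfold reflSite; omega
  · intro c h1 h2
    rw [mem_refl] at h1 h2
    have := h.cond (-c) (by rwa [show -c = -1-(c-1) by ring]) (by rwa [show -c-1 = -1-c by ring])
    unfold reflSite; omega

lemma Rot.refl {H V V' H' : Finset ℤ} {g : ℤ → Prop} (h : Rot H V V' H' g) :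
    Rot (refl V') (refl H') (refl H) (refl V) (fun c => ¬ g (-1-c)) := by
  constructor
  · intro c; have := h.disj' (-1-c); simp only [mem_refl]; exact this
  · intro c; have := h.disj (-1-c); simp only [mem_refl]; exact this
  · intro c; have := h.union (-1-c); simp only [mem_refl]; grind
  · intro c; simp only [mem_refl]
    have u1 := h.union (-1-c); have u2 := h.union (-1-(c+1)); have := h.const (-1-(c+1))
    rw [show -1-(c+1)+1 = -1-c by ring] at this; grind
  · intro c; simp only [mem_refl]
    have u1 := h.union (-1-c); have u2 := h.union (-1-(c+1)); have := h.shift (-1-(c+1))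
    rw [show -1-(c+1)+1 = -1-c by ring] at this
    have d1 := h.disj (-1-(c+1)); have d2 := h.disj' (-1-c); grind
  · intro c; simp only [mem_refl]
    have u1 := h.union (-1-c); have u2 := h.union (-1-(c+1)); have := h.first (-1-c)
    rw [show -1-c-1 = -1-(c+1) by ring] at this
    have d1 := h.disj (-1-c); have d2 := h.disj' (-1-c); grind
  · intro c; simp only [mem_refl]
    have u1 := h.union (-1-c); have u2 := h.union (-1-(c-1)); have := h.last (-1-c)
    rw [show -1-c+1 = -1-(c-1) by ring] at this
    have d1 := h.disj (-1-c); grind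

lemma Switch.refl {σ0 σ1 τ σ2 : ℤ → ℤ} {H V V' H' : Finset ℤ} (h : Switch σ0 σ1 τ σ2 H V V' H') :
    Switch (reflSite σ0) (reflSite τ) (reflSite σ1) (reflSite σ2) (refl V') (refl H') (refl H) (refl V) := by
  obtain ⟨g, hg⟩ := h.rot
  exact ⟨by simpa using h.hV'.refl, by simpa using h.hH'.refl, by simpa using h.hH.refl,
    by simpa using h.hV.refl, _, hg.refl⟩

lemma refl_injective : Function.Injective refl := fun X Y h => by
  rw [← refl_refl X, h, refl_refl]

/-! #### The signature rule and its compatibility with switching -/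

lemma induction_up (X : Finset ℤ) {P : ℤ → Prop} (base : ∀ c, (∀ x ∈ X, c < x) → P c)
    (step : ∀ c, P (c-1) → P c) (c : ℤ) : P c := by
  obtain ⟨B, hB⟩ := exists_lower X
  have key : ∀ n : ℕ, ∀ c, c-B = n → P c := by
    intro n
    induction n with
    | zero => intro c hc; exact base c fun x hx => by have := hB x hx; omega
    | succ n ih => intro c hc; exact step c (ih (c-1) (by push_cast at hc; omega))
  rcases le_or_gt c B with h | h
  · exact base c fun x hx => by have := hB x hx; omega
  · exact key (c-B).toNat c (by omega)

/-- The excess of `K1` over `K2` up to the content `c`. -/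
def ht (K1 K2 : Finset ℤ) (c : ℤ) : ℤ := cnt K1 c-cnt K2 c

lemma ht_step (K1 K2 : Finset ℤ) (c : ℤ) : ht K1 K2 c = ht K1 K2 (c-1)+ind K1 c-ind K2 c := by
  unfold ht; rw [cnt_step K1, cnt_step K2]; ring

lemma ht_succ (K1 K2 : Finset ℤ) (c : ℤ) :
    ht K1 K2 (c+1) = ht K1 K2 c+ind K1 (c+1)-ind K2 (c+1) := by
  unfold ht; rw [cnt_succ K1, cnt_succ K2]; ring

/-- `p` is the first place where the excess of `K1` over `K2` attains its positive maximum `M`. -/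
structure FirstMax (K1 K2 : Finset ℤ) (M p : ℤ) : Prop where
  pos : 0 < M
  le : ∀ c, ht K1 K2 c ≤ M
  eq : ht K1 K2 p = M
  lt : ∀ c, c < p → ht K1 K2 c < M

lemma FirstMax.mem {K1 K2 : Finset ℤ} {M p : ℤ} (h : FirstMax K1 K2 M p) :
    p ∈ K1 ∧ p ∉ K2 ∧ ht K1 K2 (p-1) = M-1 := by
  have h1 := h.eq; have h2 := h.lt (p-1) (by omega)
  rw [ht_step] at h1; grind [ind]

lemma FirstMax.unique {K1 K2 : Finset ℤ} {M M' p p' : ℤ} (h : FirstMax K1 K2 M p)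
    (h' : FirstMax K1 K2 M' p') : M = M' ∧ p = p' := by
  have e : M = M' := le_antisymm (by rw [← h.eq]; exact h'.le p) (by rw [← h'.eq]; exact h.le p')
  subst e
  refine ⟨rfl, ?_⟩
  rcases lt_trichotomy p p' with hlt | heq | hgt
  · have := h'.lt p hlt; have := h.eq; omega
  · exact heq
  · have := h.lt p' hgt; have := h'.eq; omega

open Classical in
lemma Rot.cnt_eq {H V V' H' : Finset ℤ} {g : ℤ → Prop} (h : Rot H V V' H' g) (c : ℤ) :
    cnt H' c = cnt H c+if c ∈ H ∨ c ∈ V then (if g c then 1 else 0)-ind H c else 0 := by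
  induction c using induction_up (H ∪ V) with
  | base c hc =>
    have h1 : c ∉ H := fun hh => by have := hc c (mem_union_left _ hh); omega
    have h2 : c ∉ V := fun hh => by have := hc c (mem_union_right _ hh); omega
    rw [if_neg (by tauto), cnt_eq_zero (X := H) fun x hx => hc x (mem_union_left _ hx),
      cnt_eq_zero (X := H') fun x hx => hc x ?_]
    · rfl
    · have := h.union x; rw [mem_union]; tauto
  | step c ih =>
    rw [cnt_step H', cnt_step H, ih]
    have a1 := h.union c; have a3 := h.const (c-1); have a4 := h.shift (c-1)
    have a5 := h.last (c-1); have a6 := h.first c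
    rw [sub_add_cancel] at a3 a4 a5
    unfold ind; grind

/-- A pair of horizontal strips: the facts about the excess function. -/
structure Pair (K1 K2 : Finset ℤ) : Prop where
  left : ∀ c, c ∈ K1 → c ∈ K2 → c-1 ∈ K2
  right : ∀ c, c ∈ K1 → c ∈ K2 → c+1 ∈ K1

section
variable {σ0 σ1 σ2 σ3 τ ρ : ℤ → ℤ} {K1 K2 U U' U'' K1' K2' : Finset ℤ} {g₁ g₂ : ℤ → Prop} {M p : ℤ}

lemma pair_of_strips (h1 : IsStrip 0 σ0 σ1 K1) (h2 : IsStrip 0 σ1 σ2 K2) : Pair K1 K2 := by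
  constructor
  · intro c a b
    have := h1.move c; have := h1.cond c a; have := h2.move c; have := h1.site1 c; have := h2.site2 c
    grind [ind]
  · intro c a b
    have := h1.move (c+1); have := h2.move (c+1); have := h2.cond (c+1); have := h1.site1 (c+1); have := h2.site2 (c+1)
    grind [ind]

lemma Pair.climb (h : Pair K1 K2) (c : ℤ) (hc : c ∈ K2) : ∃ d < c, ht K1 K2 c+1 ≤ ht K1 K2 d := by
  induction c using induction_up K2 with
  | base c hb => exact absurd (hb c hc) (lt_irrefl c)
  | step c ih =>
    have hs := ht_step K1 K2 c
    rw [ind_of_mem hc] at hs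
    by_cases h1 : c ∈ K1
    · rw [ind_of_mem h1] at hs
      obtain ⟨d, hd, hd'⟩ := ih (h.left c h1 hc); exact ⟨d, by omega, by omega⟩
    · rw [ind_of_not_mem h1] at hs; exact ⟨c-1, by omega, by omega⟩

lemma Pair.not_mem_succ (h : Pair K1 K2) (hM : ∀ c, ht K1 K2 c ≤ M) (c : ℤ) (hc : ht K1 K2 c = M) :
    c+1 ∉ K1 := by
  intro h1
  obtain ⟨B, hB⟩ := exists_upper K1
  have key : ∀ n : ℕ, ht K1 K2 (c+n) = M ∧ c+n+1 ∈ K1 := by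
    intro n
    induction n with
    | zero => simpa using ⟨hc, h1⟩
    | succ n ih =>
      obtain ⟨i1, i2⟩ := ih
      have hs := ht_succ K1 K2 (c+n); have hm := hM (c+n+1)
      rw [ind_of_mem i2] at hs
      push_cast
      rw [← add_assoc]
      by_cases h2 : c+n+1 ∈ K2
      · rw [ind_of_mem h2] at hs; exact ⟨by omega, h.right _ i2 h2⟩
      · rw [ind_of_not_mem h2] at hs; omega
  have := hB _ (key (B-c).toNat).2; have := hB _ h1; omega

lemma Pair.not_mem_of_lt (h : Pair K1 K2) (hf : FirstMax K1 K2 M p) (c : ℤ) (hc : c < p)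
    (he : ht K1 K2 c = M-1) : c ∉ K2 := by
  intro h2
  obtain ⟨d, hd, hd'⟩ := h.climb c h2
  have := hf.lt d (by omega); omega

/-- Moving the first place of maximal excess from `K1` to `K2` gives horizontal strips again. -/
lemma FirstMax.strips (hf : FirstMax K1 K2 M p) (h1 : IsStrip 0 σ0 σ1 K1) (h2 : IsStrip 0 σ1 σ2 K2) :
    IsStrip 0 σ0 (after σ0 (K1.erase p)) (K1.erase p) ∧
      IsStrip 0 (after σ0 (K1.erase p)) σ2 (insert p K2) := by
  have hp := pair_of_strips h1 h2
  obtain ⟨m1, m2, m3⟩ := hf.mem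
  have m4 := hp.not_mem_succ hf.le p hf.eq; have m5 := hp.not_mem_of_lt hf (p-1) (by omega) m3
  have e1 : ∀ c, ind (K1.erase p) c = if c = p then 0 else ind K1 c := by
    intro c; unfold ind; simp only [mem_erase]; grind
  have e2 : ∀ c, ind (insert p K2) c = if c = p then 1 else ind K2 c := by
    intro c; unfold ind; simp only [mem_insert]; grind
  have key : ∀ c, after σ0 (K1.erase p) c = 0 ∨ after σ0 (K1.erase p) c = 1 := by
    intro c
    unfold after
    rw [e1, e1]
    have := h1.move c; have := h1.cond c; have := h1.site1 c; have := h1.site2 c; grind [ind]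
  refine ⟨⟨h1.site1, key, fun c => rfl, fun c a b => ?_⟩, ⟨key, h2.site2, fun c => ?_, fun c a b => ?_⟩⟩
  · exact h1.cond c (mem_of_mem_erase a) (mem_of_mem_erase b)
  · unfold after
    rw [e1, e1, e2, e2]
    have := h1.move c; have := h2.move c; grind [ind]
  · rw [mem_insert] at a b
    unfold after
    rw [e1, e1]
    have := h1.move c; have := h1.cond c; have := h2.cond c; have := h1.site1 c; have := h1.site2 c
    grind [ind]

lemma FirstMax.not_mem_vertical (hf : FirstMax K1 K2 M p) (h1 : IsStrip 0 σ0 σ1 K1)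
    (h2 : IsStrip 0 σ1 σ2 K2) (h3 : IsStrip 1 σ2 σ3 U) : p ∉ U := by
  intro hU
  have hp := pair_of_strips h1 h2
  obtain ⟨m1, m2, m3⟩ := hf.mem
  have m5 := hp.not_mem_of_lt hf (p-1) (by omega) m3; have := h1.move p; have := h1.cond p; have := h2.move p
  have := h3.move p; have := h3.cond p; have := h1.site1 p; have := h3.site2 p; grind [ind]

/-- The data of a pair of horizontal strips exchanged with a vertical strip. -/
structure Slide (σ0 σ1 σ2 σ3 τ ρ : ℤ → ℤ) (K1 K2 U U' U'' K1' K2' : Finset ℤ) : Prop where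
  outer : Switch σ1 σ2 τ σ3 K2 U U' K2'
  inner : Switch σ0 σ1 ρ τ K1 U' U'' K1'

section
variable (S : Slide σ0 σ1 σ2 σ3 τ ρ K1 K2 U U' U'' K1' K2')
  (r₂ : Rot K2 U U' K2' g₂) (r₁ : Rot K1 U' U'' K1' g₁) (hf : FirstMax K1 K2 M p)
include S r₂ r₁ hf

lemma Slide.not_g (h : p+1 ∈ U') : ¬ g₁ p := by
  intro hg
  have hp := pair_of_strips S.inner.hH S.outer.hH
  obtain ⟨m1, m2, m3⟩ := hf.mem
  have m4 := hp.not_mem_succ hf.le p hf.eq; have m6 := hf.not_mem_vertical S.inner.hH S.outer.hH S.outer.hV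
  have key : ∀ n : ℕ, ∀ c, c = p+1+n → (c ∈ K2 ∨ c ∈ U) ∧ (c ∈ K1 ∨ c ∈ U') ∧ ¬ g₂ c ∧ g₁ c ∧
      ht K1 K2 c = M-ind K2 c := by
    intro n
    induction n with
    | zero =>
      intro c hc
      obtain rfl : c = p+1 := by simpa using hc
      have a1 := r₂.union (p+1); have a2 := r₂.first (p+1); have a3 := r₂.disj' (p+1); have a4 := r₁.const p
      have a5 := ht_succ K1 K2 p; have a6 := hf.eq
      rw [add_sub_cancel_right] at a2; grind [ind]
    | succ n ih =>
      intro c hc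
      obtain ⟨i1, i2, i3, i4, i5⟩ := ih (c-1) (by push_cast at hc; omega)
      have a0 := hp.not_mem_succ hf.le (c-1); have a1 := r₂.last (c-1); have a2 := r₁.last (c-1)
      have a3 := r₂.const (c-1); have a4 := r₁.const (c-1); have a5 := r₂.union c; have a6 := r₂.disj' c
      have a7 := r₂.shift (c-1); have a8 := hp.right (c-1); have hs := ht_step K1 K2 c
      have f1 := S.inner.hH.move c; have f2 := S.outer.hH.move c; have f3 := S.outer.hV.move c
      have f4 := S.inner.hH.site1 c; have f5 := S.outer.hV.site2 c
      rw [sub_add_cancel] at a0 a1 a2 a3 a4 a7 a8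
      have g1 : c ∈ K2 ∨ c ∈ U := by grind [ind]
      have g2 : c ∈ K1 ∨ c ∈ U' := by grind [ind]
      refine ⟨g1, g2, by grind, by grind, by grind [ind]⟩
  obtain ⟨B, hB⟩ := exists_upper (K2 ∪ U)
  have := (key (B-p).toNat _ rfl).1
  rw [← mem_union] at this
  have := hB _ this; omega

lemma Slide.rot_of_mem (h : p+1 ∈ U') :
    (∃ g, Rot (insert p K2) U (insert p (U'.erase (p+1))) (insert (p+1) K2') g) ∧
    (∃ g, Rot (K1.erase p) (insert p (U'.erase (p+1))) U'' (K1'.erase (p+1)) g) := by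
  have hg := S.not_g r₂ r₁ hf h; have hp := pair_of_strips S.inner.hH S.outer.hH
  obtain ⟨m1, m2, m3⟩ := hf.mem
  have m4 := hp.not_mem_succ hf.le p hf.eq; have m5 := hp.not_mem_of_lt hf (p-1) (by omega) m3
  have m6 := hf.not_mem_vertical S.inner.hH S.outer.hH S.outer.hV; have x1 := r₂.last (p-1); have x2 := r₂.first (p+1)
  have x3 := r₂.union p; have x4 := r₂.union (p+1); have x5 := r₂.disj' (p+1); have y1 := r₁.const p
  have y2 := r₁.shift p; have y3 := r₁.const (p+1); have y4 := r₁.shift (p+1)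
  have y6 := r₁.disj' (p+1)
  rw [sub_add_cancel] at x1
  rw [add_sub_cancel_right] at x2
  constructor
  · refine ⟨fun c => c ≠ p ∧ g₂ c, ?_, ?_, ?_, ?_, ?_, ?_, ?_⟩ <;> intro c <;>
      simp only [mem_insert, mem_erase]
    · have := r₂.disj c; grind
    · have := r₂.disj' c; grind
    · have := r₂.union c; grind
    · have := r₂.const c; grind
    · have := r₂.shift c; have := r₂.union c; grind
    · have := r₂.last c; grind
    · have := r₂.first c; grind
  · refine ⟨g₁, ?_, ?_, ?_, ?_, ?_, ?_, ?_⟩ <;> intro c <;>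
      simp only [mem_insert, mem_erase]
    · have := r₁.disj c; grind
    · have := r₁.disj' c; grind
    · have := r₁.union c; grind
    · have := r₁.const c; grind
    · have := r₁.shift c; have := r₁.union c; grind
    · have := r₁.last c; grind
    · have := r₁.first c; grind

lemma Slide.rot_of_not_mem (h : p+1 ∉ U') (h' : ¬ (p-1 ∈ K2 ∨ p-1 ∈ U)) :
    (∃ g, Rot (insert p K2) U U' (insert p K2') g) ∧
    (∃ g, Rot (K1.erase p) U' U'' (K1'.erase p) g) ∧ g₁ p := by
  have hp := pair_of_strips S.inner.hH S.outer.hH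
  obtain ⟨m1, m2, m3⟩ := hf.mem
  have m4 := hp.not_mem_succ hf.le p hf.eq; have m6 := hf.not_mem_vertical S.inner.hH S.outer.hH S.outer.hV
  have x2 := r₂.first (p+1); have x3 := r₂.union p; have x4 := r₂.union (p+1); have x5 := r₂.union (p-1)
  have y1 := r₁.last p; have y2 := r₁.shift (p-1); have y3 := r₁.const (p-1); have y4 := r₁.first p
  have y5 := r₁.disj' p
  rw [sub_add_cancel] at y2 y3
  rw [add_sub_cancel_right] at x2
  have hg : g₁ p := by grind
  refine ⟨?_, ?_, hg⟩
  · refine ⟨fun c => c = p ∨ g₂ c, ?_, ?_, ?_, ?_, ?_, ?_, ?_⟩ <;> intro c <;>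
      simp only [mem_insert, mem_erase]
    · have := r₂.disj c; grind
    · have := r₂.disj' c; grind
    · have := r₂.union c; grind
    · have := r₂.const c; grind
    · have := r₂.shift c; have := r₂.union c; grind
    · have := r₂.last c; grind
    · have := r₂.first c; grind
  · refine ⟨g₁, ?_, ?_, ?_, ?_, ?_, ?_, ?_⟩ <;> intro c <;>
      simp only [mem_insert, mem_erase]
    · have := r₁.disj c; grind
    · have := r₁.disj' c; grind
    · have := r₁.union c; grind
    · have := r₁.const c; grind
    · have := r₁.shift c; have := r₁.union c; grind
    · have := r₁.last c; grind
    · have := r₁.first c; grind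

lemma Slide.walk_left (h : p+1 ∉ U') (a : ℤ) (ha : a < p)
    (hrun : ∀ d, a ≤ d → d < p → d ∈ K2 ∨ d ∈ U) (hstart : ¬ (a-1 ∈ K2 ∨ a-1 ∈ U)) :
    (∀ d, a ≤ d → d < p → (d ∈ K1 ∨ d ∈ U') ∧ ht K1 K2 d = M-1-ind K2 d ∧ ¬ g₂ d ∧ g₁ d) ∧ g₁ p := by
  have hp := pair_of_strips S.inner.hH S.outer.hH
  obtain ⟨m1, m2, m3⟩ := hf.mem
  have m4 := hp.not_mem_succ hf.le p hf.eq; have m5 := hp.not_mem_of_lt hf (p-1) (by omega) m3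
  have m6 := hf.not_mem_vertical S.inner.hH S.outer.hH S.outer.hV; have hgp : g₁ p := by have := r₁.last p; grind
  refine ⟨?_, hgp⟩
  have key : ∀ n : ℕ, ∀ d, a ≤ d → d = p-1-n → (d ∈ K1 ∨ d ∈ U') ∧
      ht K1 K2 d = M-1-ind K2 d ∧ ¬ g₂ d ∧ g₁ d := by
    have step : ∀ d, a ≤ d → d < p → ht K1 K2 d = M-1-ind K2 d → ¬ g₂ d → (d ∈ K1 ∨ d ∈ U') := by
      intro d h1 h2 h3 h4
      by_contra hcon
      have a1 := r₂.union d; have a2 := r₂.first d; have a3 := r₂.shift (d-1); have a4 := hrun d h1 h2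
      have a5 := hp.not_mem_of_lt hf (d-1) (by omega); have a6 := ht_step K1 K2 d
      rw [sub_add_cancel] at a3; grind [ind]
    intro n
    induction n with
    | zero =>
      intro d h1 h2
      obtain rfl : d = p-1 := by simpa using h2
      have b1 : ht K1 K2 (p-1) = M-1-ind K2 (p-1) := by rw [ind_of_not_mem m5]; omega
      have b2 : ¬ g₂ (p-1) := by
        have := r₂.last (p-1) (hrun _ h1 (by omega))
        rw [sub_add_cancel] at this
        grind
      have b3 := step _ h1 (by omega) b1 b2; have b4 := r₁.const (p-1) b3
      rw [sub_add_cancel] at b4; exact ⟨b3, b1, b2, (b4 (Or.inl m1)).2 hgp⟩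
    | succ n ih =>
      intro d h1 h2
      obtain ⟨i1, i2, i3, i4⟩ := ih (d+1) (by omega) (by push_cast at h2; omega)
      have r0 := hrun d h1 (by omega); have r1 := hrun (d+1) (by omega) (by push_cast at h2; omega)
      have b2 : ¬ g₂ d := by have := r₂.const d; tauto
      have b1 : ht K1 K2 d = M-1-ind K2 d := by
        have a1 := r₂.shift d; have a2 := r₂.union (d+1); have a3 := r₂.disj' (d+1); have a4 := r₁.disj (d+1)
        have a6 := ht_succ K1 K2 d; grind [ind]
      have b3 := step _ h1 (by omega) b1 b2; have b4 := r₁.const d b3 i1; exact ⟨b3, b1, b2, b4.2 i4⟩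
  intro d h1 h2; exact key (p-1-d).toNat d h1 (by omega)

lemma Slide.rot_of_start (h : p+1 ∉ U') (a : ℤ) (ha : a < p)
    (hrun : ∀ d, a ≤ d → d < p → d ∈ K2 ∨ d ∈ U) (hstart : ¬ (a-1 ∈ K2 ∨ a-1 ∈ U)) :
    (∃ g, Rot (insert p K2) U (insert p (U'.erase a)) (insert a K2') g) ∧
    (∃ g, Rot (K1.erase p) (insert p (U'.erase a)) U'' (K1'.erase a) g) := by
  obtain ⟨hw, hg⟩ := S.walk_left r₂ r₁ hf h a ha hrun hstart
  have hp := pair_of_strips S.inner.hH S.outer.hH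
  obtain ⟨m1, m2, m3⟩ := hf.mem
  have m4 := hp.not_mem_succ hf.le p hf.eq; have m5 := hp.not_mem_of_lt hf (p-1) (by omega) m3
  have m6 := hf.not_mem_vertical S.inner.hH S.outer.hH S.outer.hV
  have x5 := r₂.first a; have x6 := r₂.union a; have x7 := r₂.union (a-1)
  have x9 := r₂.first (p+1); have x10 := r₂.union (p+1); have x11 := r₂.union p
  rw [add_sub_cancel_right] at x9
  have y3 := r₁.disj a; have y4 := r₁.first a; have y5 := r₁.shift (a-1)
  have y6 := r₁.shift a; have y7 := r₁.const (a-1); have y8 := r₁.disj' a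
  rw [sub_add_cancel] at y5 y7
  constructor
  · refine ⟨fun c => (a ≤ c ∧ c ≤ p) ∨ g₂ c, ?_, ?_, ?_, ?_, ?_, ?_, ?_⟩ <;> intro c <;>
      simp only [mem_insert, mem_erase] <;> have r := hrun c <;> have r' := hrun (c+1)
    · have := r₂.disj c; grind
    · have := r₂.disj' c; grind
    · have := r₂.union c; grind
    · have := r₂.const c; have := hw c; have := hw (c+1); grind
    · have := r₂.shift c; have := r₂.union c; have := r₂.disj c; grind
    · have := r₂.last c; grind
    · have := r₂.first c; have r'' := hrun (c-1); grind
  · refine ⟨fun c => ¬ (a < c ∧ c ≤ p) ∧ g₁ c, ?_, ?_, ?_, ?_, ?_, ?_, ?_⟩ <;> intro c <;>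
      simp only [mem_insert, mem_erase] <;> have r := hw c <;> have r' := hw (c+1)
    · have := r₁.disj c; grind
    · have := r₁.disj' c; grind
    · have := r₁.union c; grind
    · have := r₁.const c; grind
    · have := r₁.shift c; have := r₁.union c; grind
    · have := r₁.last c; grind
    · have := r₁.first c; have := hw (c-1); grind

omit hf in
lemma Slide.mid_mono (d : ℤ) (h : d+1 ∈ K1 ∨ d+1 ∈ U') :
    ht K1 K2' d+(ind K1 (d+1)-ind K2' (d+1)) = ht K1 K2' (d+1) ∧
      0 ≤ ind K1 (d+1)-ind K2' (d+1) := by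
  have := ht_succ K1 K2' d; have := r₂.disj' (d+1); grind [ind]

omit hf in
lemma Slide.mid_mono' (x y : ℤ) (hxy : x ≤ y) (h : ∀ d, x < d → d ≤ y → d ∈ K1 ∨ d ∈ U') :
    ht K1 K2' x ≤ ht K1 K2' y := by
  have key : ∀ n : ℕ, ∀ d, d ≤ y → d = x+n → ht K1 K2' x ≤ ht K1 K2' d := by
    intro n
    induction n with
    | zero => intro d _ hd; simp at hd; rw [hd]
    | succ n ih =>
      intro d h1 h2
      push_cast at h2
      have i1 := ih (d-1) (by omega) (by omega)
      have i2 := S.mid_mono r₂ r₁ (d-1) (by rw [sub_add_cancel]; exact h d (by omega) h1)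
      rw [sub_add_cancel] at i2; omega
  exact key (y-x).toNat y le_rfl (by omega)

omit hf in
lemma Slide.mid_le_of_le {m : ℤ} (hm : ∀ c, ht K1 K2 c ≤ m) (c : ℤ) : ht K1 K2' c ≤ m := by
  have h1 := r₂.cnt_eq c; have hp := pair_of_strips S.inner.hH S.outer.hH; have h2 := hm c
  by_cases hc : c ∈ K2
  · obtain ⟨d, hd, hd'⟩ := hp.climb c hc
    have h4 := hm d
    unfold ht at *
    rw [h1, if_pos (Or.inl hc), ind_of_mem hc]
    split_ifs <;> omega
  · unfold ht at *
    rw [h1, ind_of_not_mem hc]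
    split_ifs <;> omega

lemma Slide.mid_le (c : ℤ) : ht K1 K2' c ≤ M ∧ (ht K1 K2' c = M → p ≤ c) := by
  refine ⟨S.mid_le_of_le r₂ r₁ hf.le c, fun h => ?_⟩
  have h1 := r₂.cnt_eq c; have hp := pair_of_strips S.inner.hH S.outer.hH
  by_contra hcon
  have h3 := hf.lt c (by omega)
  by_cases hc : c ∈ K2
  · obtain ⟨d, hd, hd'⟩ := hp.climb c hc
    have h4 := hf.lt d (by omega)
    unfold ht at *
    rw [h1, if_pos (Or.inl hc), ind_of_mem hc] at h
    split_ifs at h <;> omega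
  · unfold ht at *
    rw [h1, ind_of_not_mem hc] at h
    split_ifs at h <;> omega

omit hf in
lemma Slide.run_end (x : ℤ) (hx : x ∈ U') (hg : g₁ x) :
    ∃ e, x < e ∧ (∀ d, x ≤ d → d ≤ e → (d ∈ K1 ∨ d ∈ U') ∧ g₁ d) ∧ ¬ (e+1 ∈ K1 ∨ e+1 ∈ U') ∧
      e ∈ K1 ∧ e ∉ K2' ∧ ht K1 K2' x+1 ≤ ht K1 K2' e ∧ ht K1 K2' e = ht K1 K2' (e-1)+1 := by
  obtain ⟨e, h1, h2, h3⟩ := exists_run_end (K1 ∪ U') x (mem_union_right _ hx)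
  simp only [mem_union] at h2 h3
  have hgd : ∀ n : ℕ, ∀ d, d ≤ e → d = x+n → g₁ d := by
    intro n
    induction n with
    | zero => intro d _ hd; simp at hd; rwa [hd]
    | succ n ih =>
      intro d h4 h5
      push_cast at h5
      have := r₁.const (d-1) (h2 _ (by omega) (by omega))
      rw [sub_add_cancel] at this
      exact (this (h2 _ (by omega) h4)).1 (ih (d-1) (by omega) (by omega))
  have hge : g₁ e := hgd (e-x).toNat e le_rfl (by omega); have he := (r₁.last e (h2 e h1 le_rfl) h3).2 hge
  have hne : x ≠ e := by rintro rfl; exact r₁.disj x he hx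
  have he2 : e ∉ K2' := by
    intro hcon
    have a1 := S.inner.hH.move (e+1); have a2 := S.inner.hH.site1 (e+1)
    have a4 := S.outer.hV'.move (e+1); have a5 := S.outer.hH'.move (e+1); have a6 := S.outer.hH'.site2 (e+1)
    have a7 := S.outer.hH'.cond (e+1); grind [ind]
  have hs := ht_step K1 K2' e
  rw [ind_of_mem he, ind_of_not_mem he2] at hs
  have hm := S.mid_mono' r₂ r₁ x (e-1) (by omega) fun d h4 h5 => h2 d (by omega) (by omega)
  exact ⟨e, by omega, fun d h4 h5 => ⟨h2 d h4 h5, hgd (d-x).toNat d h5 (by omega)⟩, h3, he, he2,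
    by omega, by omega⟩

omit hf in
lemma Slide.ht_le_of_le {m : ℤ} (hm : ∀ c, ht K1 K2 c ≤ m) (c : ℤ) : ht K1' K2' c ≤ m := by
  have h1 := r₁.cnt_eq c; have h2 := S.mid_le_of_le r₂ r₁ hm c
  by_contra hcon
  have h4 : c ∈ U' ∧ g₁ c ∧ ht K1 K2' c = m := by
    have h5 := r₁.disj c
    unfold ht at *; grind [ind]
  obtain ⟨e, -, -, -, -, -, h5, -⟩ := S.run_end r₂ r₁ c h4.1 h4.2.1
  have := S.mid_le_of_le r₂ r₁ hm e; omega

/-- Before the first maximum, the excess of the switched strips can only be attained in a run that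
reaches beyond `p`. -/
lemma Slide.run_of_eq (x : ℤ) (hx : x < p) (h : ht K1' K2' x = M) :
    x ∈ U' ∧ ht K1 K2' x = M-1 ∧ ∃ e, p ≤ e ∧ (∀ d, x ≤ d → d ≤ e → (d ∈ K1 ∨ d ∈ U') ∧ g₁ d) ∧
      ¬ (e+1 ∈ K1 ∨ e+1 ∈ U') ∧ e ∈ K1 ∧ e ∉ K2' ∧ ht K1 K2' (e-1) = M-1 := by
  have h1 := r₁.cnt_eq x; have h2 := S.mid_le r₂ r₁ hf x
  have h4 : x ∈ U' ∧ g₁ x ∧ ht K1 K2' x = M-1 := by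
    have h5 := r₁.disj x
    unfold ht at *; grind [ind]
  obtain ⟨e, h5, h6, h7, h8, h9, h10, h11⟩ := S.run_end r₂ r₁ x h4.1 h4.2.1
  have h12 := S.mid_le r₂ r₁ hf e; exact ⟨h4.1, h4.2.2, e, by omega, h6, h7, h8, h9, by omega⟩

lemma Slide.exists_firstMax : ∃ s V, FirstMax K1' K2' M s ∧
    (∃ g, Rot (insert p K2) U V (insert s K2') g) ∧ (∃ g, Rot (K1.erase p) V U'' (K1'.erase s) g) := by
  have hp := pair_of_strips S.inner.hH S.outer.hH
  obtain ⟨m1, m2, m3⟩ := hf.mem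
  have m4 := hp.not_mem_succ hf.le p hf.eq
  have m6 := hf.not_mem_vertical S.inner.hH S.outer.hH S.outer.hV; have hle := S.ht_le_of_le r₂ r₁ hf.le
  have mlt : ∀ s, (∀ x, x < s → ht K1' K2' x ≠ M) → ∀ x, x < s → ht K1' K2' x < M :=
    fun s hs x hx => lt_of_le_of_ne (hle x) (hs x hx)
  have cp1 := r₁.cnt_eq p; have cp2 := r₂.cnt_eq p; have hfe := hf.eq
  by_cases h : p+1 ∈ U'
  · obtain ⟨q1, q2⟩ := S.rot_of_mem r₂ r₁ hf h
    have hg := S.not_g r₂ r₁ hf h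
    refine ⟨p+1, _, ⟨hf.pos, hle, ?_, mlt _ fun x hx hxM => ?_⟩, q1, q2⟩
    · have y2 := r₁.shift p; have y3 := r₂.disj' (p+1) h; have y5 := ht_succ K1' K2' p
      unfold ht at *; grind [ind]
    · rcases eq_or_ne x p with rfl | hne
      · unfold ht at *; grind [ind]
      · obtain ⟨-, -, e, h5, h6, -⟩ := S.run_of_eq r₂ r₁ hf x (by omega) hxM
        exact hg (h6 p (by omega) h5).2
  · by_cases h' : p-1 ∈ K2 ∨ p-1 ∈ U
    · obtain ⟨a, h1, h2, h3⟩ := exists_run_start (K2 ∪ U) (p-1) (by simpa using h')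
      simp only [mem_union] at h2 h3
      have hrun : ∀ d, a ≤ d → d < p → d ∈ K2 ∨ d ∈ U := fun d hd hd' => h2 d hd (by omega)
      obtain ⟨q1, q2⟩ := S.rot_of_start r₂ r₁ hf h a (by omega) hrun h3
      obtain ⟨w, wg⟩ := S.walk_left r₂ r₁ hf h a (by omega) hrun h3
      refine ⟨a, _, ⟨hf.pos, hle, ?_, mlt _ fun x hx hxM => ?_⟩, q1, q2⟩
      · have c1 := r₁.cnt_eq a; have c2 := r₂.cnt_eq a
        have w2 := hrun a le_rfl (by omega); have w3 := r₂.first a w2 h3; have w4 := r₂.union a; have w5 := r₁.disj a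
        unfold ht at *; grind [ind]
      · obtain ⟨h4, h5, e, h6, h7, h8, h9, h10, h11⟩ := S.run_of_eq r₂ r₁ hf x (by omega) hxM
        have h13 := r₂.union (a-1)
        have h14 : x ≠ a-1 := by rintro rfl; tauto
        have h15 := S.mid_mono' r₂ r₁ x (a-1-1) (by omega) fun d hd hd' => (h7 d (by omega) (by omega)).1
        have h16 := ht_step K1 K2' (a-1)
        have h17 := S.mid_mono' r₂ r₁ (a-1) (e-1) (by omega) fun d hd hd' => (h7 d (by omega) (by omega)).1
        grind [ind]
    · obtain ⟨q1, q2, hg⟩ := S.rot_of_not_mem r₂ r₁ hf h h'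
      refine ⟨p, _, ⟨hf.pos, hle, ?_, mlt _ fun x hx hxM => ?_⟩, q1, q2⟩
      · unfold ht at *; grind [ind]
      · obtain ⟨h4, h5, e, h6, h7, h8, h9, h10, h11⟩ := S.run_of_eq r₂ r₁ hf x (by omega) hxM
        obtain rfl : p = e := by
          by_contra hne
          have := h7 (p+1) (by omega) (by omega); tauto
        have h13 := r₂.union (p-1)
        have h14 : x ≠ p-1 := by rintro rfl; tauto
        have h15 := S.mid_mono' r₂ r₁ x (p-1-1) (by omega) fun d hd hd' => (h7 d (by omega) (by omega)).1
        have h16 := ht_step K1 K2' (p-1); grind [ind]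

end

/-- Switching a vertical strip with a pair of horizontal strips commutes with moving the first place
of maximal excess from the first horizontal strip to the second. -/
lemma Slide.lowering (S : Slide σ0 σ1 σ2 σ3 τ ρ K1 K2 U U' U'' K1' K2') (hf : FirstMax K1 K2 M p) :
    ∃ s V α β, FirstMax K1' K2' M s ∧
      Slide σ0 α σ2 σ3 β ρ (K1.erase p) (insert p K2) U V U'' (K1'.erase s) (insert s K2') := by
  obtain ⟨g₂, r₂⟩ := S.outer.rot
  obtain ⟨g₁, r₁⟩ := S.inner.rot
  obtain ⟨s, V, h1, ⟨g, h2⟩, ⟨g', h3⟩⟩ := S.exists_firstMax r₂ r₁ hf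
  obtain ⟨k1, k2⟩ := hf.strips S.inner.hH S.outer.hH
  have s2 := h2.strips k2 S.outer.hV; have s1 := h3.strips k1 s2.hV'
  rw [← S.inner.hV'.eq_after] at s1; exact ⟨s, V, _, _, h1, s2, s1⟩

lemma exists_firstMax_or (K1 K2 : Finset ℤ) : (∀ c, ht K1 K2 c ≤ 0) ∨ ∃ M p, FirstMax K1 K2 M p := by
  classical
  by_cases h : ∀ c, ht K1 K2 c ≤ 0
  · exact Or.inl h
  right
  push Not at h
  obtain ⟨c0, hc0⟩ := h
  obtain ⟨B, hB⟩ := exists_lower (K1 ∪ K2)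
  have hlow : ∀ c ≤ B, ht K1 K2 c = 0 := by
    intro c hc
    unfold ht
    rw [cnt_eq_zero fun x hx => by have := hB x (mem_union_left _ hx); omega,
      cnt_eq_zero fun x hx => by have := hB x (mem_union_right _ hx); omega]
    rfl
  have hbd : ∀ c, ht K1 K2 c ≤ K1.card := by
    intro c
    have h1 : cnt K1 c ≤ K1.card := by
      unfold cnt; exact_mod_cast Finset.card_filter_le _ _
    have h2 := cnt_nonneg K2 c
    unfold ht; omega
  obtain ⟨M, ⟨c1, hc1⟩, hM⟩ : ∃ M, (∃ c, ht K1 K2 c = M) ∧ ∀ z, (∃ c, ht K1 K2 c = z) → z ≤ M :=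
    Int.exists_greatest_of_bdd ⟨K1.card, by rintro z ⟨c, rfl⟩; exact hbd c⟩ ⟨_, c0, rfl⟩
  have hMpos : 0 < M := lt_of_lt_of_le hc0 (hM _ ⟨c0, rfl⟩)
  obtain ⟨p, hp, hp'⟩ : ∃ p, ht K1 K2 p = M ∧ ∀ z, ht K1 K2 z = M → p ≤ z :=
    Int.exists_least_of_bdd ⟨B, fun z hz => by
      by_contra hcon
      have := hlow z (by omega)
      omega⟩ ⟨c1, hc1⟩
  refine ⟨M, p, hMpos, fun c => hM _ ⟨c, rfl⟩, hp, fun c hc => lt_of_le_of_ne (hM _ ⟨c, rfl⟩) fun he => ?_⟩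
  have := hp' c he; omega

lemma Slide.lifting (S : Slide σ0 σ1 σ2 σ3 τ ρ K1 K2 U U' U'' K1' K2') {s : ℤ}
    (hf : FirstMax K1' K2' M s) :
    ∃ p V α β, FirstMax K1 K2 M p ∧
      Slide σ0 α σ2 σ3 β ρ (K1.erase p) (insert p K2) U V U'' (K1'.erase s) (insert s K2') := by
  rcases exists_firstMax_or K1 K2 with h | ⟨M', p, h⟩
  · obtain ⟨g₂, r₂⟩ := S.outer.rot
    obtain ⟨g₁, r₁⟩ := S.inner.rot
    have := S.ht_le_of_le r₂ r₁ h s; have := hf.eq; have := hf.pos; omega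
  · obtain ⟨s', V, α, β, h1, h2⟩ := S.lowering h
    obtain ⟨rfl, rfl⟩ := h1.unique hf; exact ⟨p, V, α, β, h, h2⟩

end

/-! #### Balanced characterization of switching -/

section
variable {σ0 σ1 σ2 σ3 τ ρ : ℤ → ℤ} {H V V' H' : Finset ℤ} {g : ℤ → Prop}

lemma Rot.balanced (h : Rot H V V' H' g) {c : ℤ} (hc : ¬ (c ∈ H ∨ c ∈ V)) : cnt H' c = cnt H c := by
  rw [h.cnt_eq c, if_neg hc, add_zero]

lemma exists_rot_of_balanced (hd : ∀ c, c ∈ H → c ∉ V) (hd' : ∀ c, c ∈ V' → c ∉ H')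
    (hu : ∀ c, (c ∈ H ∨ c ∈ V) ↔ (c ∈ V' ∨ c ∈ H'))
    (hs : ∀ c, (c ∈ H ∨ c ∈ V) → (c+1 ∈ H ∨ c+1 ∈ V) → (c+1 ∈ H' ↔ c ∈ H))
    (hb : ∀ c, ¬ (c ∈ H ∨ c ∈ V) → cnt H' c = cnt H c) : ∃ g, Rot H V V' H' g := by
  refine ⟨fun c => cnt H' c-cnt H c+ind H c = 1, hd, hd', hu, fun c h1 h2 => ?_, hs,
    fun c h1 h2 => ?_, fun c h1 h2 => ?_⟩
  · have a1 := hs c h1 h2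
    rw [cnt_succ, cnt_succ]
    unfold ind; grind
  · have a1 := hb (c+1) h2
    rw [cnt_succ, cnt_succ] at a1
    have := hu (c+1)
    unfold ind at *; grind
  · rw [cnt_step H', cnt_step H]
    unfold ind at *; grind

lemma switch_of_balanced (hH : IsStrip 0 σ0 σ1 H) (hV : IsStrip 1 σ1 σ2 V) (hV' : IsStrip 1 σ0 τ V')
    (hH' : IsStrip 0 τ σ2 H') (hd' : ∀ c, c ∈ V' → c ∉ H')
    (hu : ∀ c, (c ∈ H ∨ c ∈ V) ↔ (c ∈ V' ∨ c ∈ H'))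
    (hb : ∀ c, ¬ (c ∈ H ∨ c ∈ V) → cnt H' c = cnt H c) : Switch σ0 σ1 τ σ2 H V V' H' := by
  refine ⟨hH, hV, hV', hH', exists_rot_of_balanced (disjoint_of_strips hH hV) hd' hu (fun c h1 h2 => ?_) hb⟩
  have a2 := hV.move (c+1); have a3 := hH.cond (c+1); have a4 := hV.cond (c+1)
  have b1 := hV'.move (c+1); have b2 := hH'.move (c+1); have b3 := hV'.cond (c+1); have b4 := hH'.cond (c+1)
  have s2 := hH.site2 (c+1); have s4 := hV'.site2 (c+1)
  have d1 := disjoint_of_strips hH hV c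
  rw [add_sub_cancel_right] at *
  unfold ind at *; grind

lemma cnt_union {X Y : Finset ℤ} (h : ∀ c, c ∈ X → c ∉ Y) (c : ℤ) : cnt (X ∪ Y) c = cnt X c+cnt Y c := by
  unfold cnt
  rw [Finset.filter_union, card_union_of_disjoint, Nat.cast_add]
  rw [Finset.disjoint_left]
  intro x hx hy; exact h x (mem_filter.1 hx).1 (mem_filter.1 hy).1

lemma ind_union {X Y : Finset ℤ} (h : ∀ c, c ∈ X → c ∉ Y) (c : ℤ) : ind (X ∪ Y) c = ind X c+ind Y c := by
  have := h c
  unfold ind; simp only [mem_union]; grind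

/-- Two consecutive horizontal strips merge if the second one never lies immediately to the left of
the first one. -/
lemma IsStrip.union {X Y : Finset ℤ} (hX : IsStrip 0 σ0 σ1 X) (hY : IsStrip 0 σ1 σ2 Y)
    (hd : ∀ c, c ∈ X → c ∉ Y) (hl : ∀ c, c ∈ X → c-1 ∉ Y) : IsStrip 0 σ0 σ2 (X ∪ Y) := by
  refine ⟨hX.site1, hY.site2, fun c => ?_, fun c h1 h2 => ?_⟩
  · rw [ind_union hd, ind_union hd, hY.move, hX.move]; ring
  · rw [mem_union] at h1 h2
    have a1 := hX.cond c; have a2 := hY.cond c; have a3 := hX.move c; have a4 := hX.site1 c; have a5 := hX.site2 c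
    unfold ind at *; grind

/-- A horizontal strip may be cut at a content: exchanging a vertical strip with the part on the
right and then with the part on the left is exchanging it with the whole. -/
lemma Switch.union {X Y V1 V2 X' Y' : Finset ℤ} (m : ℤ) (hm : ∀ c ∈ X, c ≤ m) (hm' : ∀ c ∈ Y, m < c)
    (hY : Switch σ1 σ2 τ σ3 Y V V1 Y') (hX : Switch σ0 σ1 ρ τ X V1 V2 X') :
    Switch σ0 σ2 ρ σ3 (X ∪ Y) V V2 (X' ∪ Y') := by
  have hdXY : ∀ c, c ∈ X → c ∉ Y := fun c h1 h2 => by have := hm c h1; have := hm' c h2; omega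
  have hXY := hX.hH.union hY.hH hdXY fun c h1 h2 => by have := hm c h1; have := hm' _ h2; omega
  have hdV := disjoint_of_strips hXY hY.hV
  obtain ⟨gY, rY⟩ := hY.rot
  obtain ⟨gX, rX⟩ := hX.rot
  have hd1 : ∀ c, c ∈ X' → c ∉ Y' := by
    intro c h1 h2
    have u1 := rY.union c; have u2 := rX.union c; have u3 := rY.disj' c; have u4 := hdV c; have u5 := hdXY c
    rw [mem_union] at u4; grind
  have hd2 : ∀ c, c ∈ X' → c-1 ∉ Y' := by
    intro c h1 h2
    have u1 := rY.union (c-1); have u2 := rX.union (c-1); have u3 := rY.disj' (c-1)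
    have u4 := hdV (c-1)
    rw [mem_union] at u4
    have hc : c ∈ X ∨ c ∈ V1 := (rX.union c).2 (Or.inr h1); have hg : gX c := (rX.first c hc (by grind)).1 h1
    rw [rX.g_iff hc] at hg
    obtain ⟨e, e1, -, -, e4⟩ := hg
    have u6 := hdV e
    rw [mem_union] at u6
    have hb := rY.balanced (c := e) (by grind)
    rw [cnt_eq_zero (X := Y) fun x hx => lt_of_le_of_lt (hm e e4) (hm' x hx)] at hb
    unfold cnt at hb
    norm_cast at hb
    rw [Finset.card_eq_zero, Finset.filter_eq_empty_iff] at hb; exact hb h2 (by omega)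
  refine switch_of_balanced hXY hY.hV hX.hV' (hX.hH'.union hY.hH' hd1 hd2) (fun c h1 h2 => ?_)
    (fun c => ?_) (fun c hc => ?_)
  · have u1 := rY.union c; have u2 := rX.union c; have u3 := rY.disj' c; have u6 := rX.disj' c
    have u4 := hdV c
    rw [mem_union] at h2 u4; grind
  · have u1 := rY.union c; have u2 := rX.union c; simp only [mem_union]; grind
  · rw [mem_union] at hc
    have u1 := rY.union c
    rw [cnt_union hd1, cnt_union hdXY, rY.balanced (by grind), rX.balanced (by grind)]

end

/-! #### Exchange of a pair of horizontal strips with a pair of vertical strips -/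

/-- The exchange of horizontal strips `A1`, `A2` with vertical strips `P1`, `P2`. -/
def Cross (s t : ℤ → ℤ) (A1 A2 P1 P2 X1 X2 B1 B2 : Finset ℤ) : Prop :=
  ∃ a b c d e f g, ∃ R1 R2 Y1 Y2,
    Slide s a b c d e A1 A2 P1 R1 X1 Y1 Y2 ∧ Slide e d c t f g Y1 Y2 P2 R2 X2 B1 B2

lemma Cross.unique {s t t' A1 A2 P1 P2 X1 X2 B1 B2 X1' X2' B1' B2'}
    (h : Cross s t A1 A2 P1 P2 X1 X2 B1 B2) (h' : Cross s t' A1 A2 P1 P2 X1' X2' B1' B2') :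
    X1 = X1' ∧ X2 = X2' ∧ B1 = B1' ∧ B2 = B2' := by
  obtain ⟨a, b, c, d, e, f, g, R1, R2, Y1, Y2, S, T⟩ := h
  obtain ⟨a', b', c', d', e', f', g', R1', R2', Y1', Y2', S', T'⟩ := h'
  obtain rfl : a = a' := by rw [S.inner.hH.eq_after, S'.inner.hH.eq_after]
  obtain rfl : b = b' := by rw [S.outer.hH.eq_after, S'.outer.hH.eq_after]
  obtain rfl : c = c' := by rw [S.outer.hV.eq_after, S'.outer.hV.eq_after]
  obtain rfl : t = t' := by rw [T.outer.hV.eq_after, T'.outer.hV.eq_after]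
  obtain ⟨rfl, rfl, rfl⟩ := S.outer.unique S'.outer
  obtain ⟨rfl, rfl, rfl⟩ := S.inner.unique S'.inner
  obtain ⟨rfl, rfl, rfl⟩ := T.outer.unique T'.outer
  obtain ⟨rfl, rfl, rfl⟩ := T.inner.unique T'.inner; exact ⟨rfl, rfl, rfl, rfl⟩

lemma Cross.lower_horizontal {s t A1 A2 P1 P2 X1 X2 B1 B2 M p}
    (h : Cross s t A1 A2 P1 P2 X1 X2 B1 B2) (hf : FirstMax A1 A2 M p) :
    ∃ q, FirstMax B1 B2 M q ∧
      Cross s t (A1.erase p) (insert p A2) P1 P2 X1 X2 (B1.erase q) (insert q B2) := by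
  obtain ⟨a, b, c, d, e, f, g, R1, R2, Y1, Y2, S, T⟩ := h
  obtain ⟨r, V, α, β, h1, h2⟩ := S.lowering hf
  obtain ⟨q, V', α', β', h3, h4⟩ := T.lowering h1
  obtain rfl : β = α' := by rw [h2.inner.hH'.eq_after, h4.inner.hH.eq_after]
  exact ⟨q, h3, _, _, _, _, _, _, _, _, _, _, _, h2, h4⟩

lemma refl_erase (X : Finset ℤ) (p : ℤ) : refl (X.erase p) = (refl X).erase (-1-p) := by
  ext c; simp only [mem_refl, mem_erase]; grind

lemma refl_insert (X : Finset ℤ) (p : ℤ) : refl (insert p X) = insert (-1-p) (refl X) := by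
  ext c; simp only [mem_refl, mem_insert]; grind

lemma Cross.lower_vertical {s t A1 A2 P1 P2 X1 X2 B1 B2 M p}
    (h : Cross s t A1 A2 P1 P2 X1 X2 B1 B2) (hf : FirstMax (refl P1) (refl P2) M p) :
    ∃ q, FirstMax (refl X1) (refl X2) M q ∧
      Cross s t A1 A2 (P1.erase (-1-p)) (insert (-1-p) P2) (X1.erase (-1-q))
        (insert (-1-q) X2) B1 B2 := by
  obtain ⟨a, b, c, d, e, f, g, R1, R2, Y1, Y2, S, T⟩ := h
  have S1 : Slide _ _ _ _ _ _ _ _ _ _ _ _ _ := ⟨T.outer.refl, S.outer.refl⟩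
  have S2 : Slide _ _ _ _ _ _ _ _ _ _ _ _ _ := ⟨T.inner.refl, S.inner.refl⟩
  obtain ⟨r, V, α, β, h1, h2⟩ := S1.lifting hf
  obtain ⟨q, V', α', β', h3, h4⟩ := S2.lifting h1
  obtain rfl : α = β' := by rw [h2.inner.hH.eq_after, h4.inner.hH'.eq_after]
  have k1 := h2.outer.refl; have k2 := h2.inner.refl; have k3 := h4.outer.refl; have k4 := h4.inner.refl
  simp only [refl_refl, reflSite_reflSite, refl_erase, refl_insert] at k1 k2 k3 k4
  exact ⟨q, h3, _, _, _, _, _, _, _, _, _, _, _, ⟨k2, k4⟩, ⟨k1, k3⟩⟩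

lemma cnt_le_card (X : Finset ℤ) (c : ℤ) : cnt X c ≤ X.card := by
  unfold cnt; exact_mod_cast Finset.card_filter_le _ _

lemma cnt_eq_card {X : Finset ℤ} {c : ℤ} (h : ∀ x ∈ X, x ≤ c) : cnt X c = X.card := by
  unfold cnt; rw [Finset.filter_true_of_mem h]

lemma Rot.card {H V V' H' : Finset ℤ} {g : ℤ → Prop} (h : Rot H V V' H' g) : H'.card = H.card := by
  obtain ⟨B, hB⟩ := exists_upper (H ∪ V)
  have h1 : ∀ x, x ∈ H ∨ x ∈ V → x < B := fun x hx => hB x (mem_union.2 hx)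
  have := h.balanced (c := B) fun hc => lt_irrefl _ (h1 B hc)
  rw [cnt_eq_card fun x hx => (h1 x ((h.union x).2 (Or.inr hx))).le,
    cnt_eq_card fun x hx => (h1 x (Or.inl hx)).le] at this
  exact_mod_cast this

lemma Cross.card {s t A1 A2 P1 P2 X1 X2 B1 B2} (h : Cross s t A1 A2 P1 P2 X1 X2 B1 B2) :
    B1.card = A1.card ∧ B2.card = A2.card := by
  obtain ⟨a, b, c, d, e, f, g, R1, R2, Y1, Y2, S, T⟩ := h
  obtain ⟨_, r1⟩ := S.inner.rot
  obtain ⟨_, r2⟩ := S.outer.rot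
  obtain ⟨_, r3⟩ := T.inner.rot
  obtain ⟨_, r4⟩ := T.outer.rot; exact ⟨by rw [r3.card, r1.card], by rw [r4.card, r2.card]⟩

lemma Cross.ht_le {s t A1 A2 P1 P2 X1 X2 B1 B2 m} (h : Cross s t A1 A2 P1 P2 X1 X2 B1 B2)
    (hm : ∀ c, ht A1 A2 c ≤ m) (c : ℤ) : ht B1 B2 c ≤ m := by
  obtain ⟨a, b, c, d, e, f, g, R1, R2, Y1, Y2, S, T⟩ := h
  obtain ⟨_, r1⟩ := S.inner.rot
  obtain ⟨_, r2⟩ := S.outer.rot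
  obtain ⟨_, r3⟩ := T.inner.rot
  obtain ⟨_, r4⟩ := T.outer.rot; exact T.ht_le_of_le r4 r3 (S.ht_le_of_le r2 r1 hm) _

lemma Cross.pair {s t A1 A2 P1 P2 X1 X2 B1 B2} (h : Cross s t A1 A2 P1 P2 X1 X2 B1 B2) :
    Pair B1 B2 := by
  obtain ⟨a, b, c, d, e, f, g, R1, R2, Y1, Y2, S, T⟩ := h
  exact pair_of_strips T.inner.hH' T.outer.hH'

/-! #### Strips on the half-line and their doubles -/

/-- A strip on the half-line: only the sites `1, 2, …` are constrained. -/
structure HalfStrip (t : ℤ) (σ τ : ℤ → ℤ) (X : Finset ℤ) : Prop where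
  nonneg : ∀ c ∈ X, 0 ≤ c
  stripAt : ∀ c, 1 ≤ c → StripAt t σ τ X c

/-- The occupation of the whole line with `R` on the right, the value `z` at the origin and the
reflection of `L` on the left. -/
def glue (L : ℤ → ℤ) (z : ℤ) (R : ℤ → ℤ) (s : ℤ) : ℤ :=
  if 0 < s then R s else if s < 0 then 1-L (-s) else z

lemma glue_strip {t z z' : ℤ} {L L' R R' : ℤ → ℤ} {Y Z : Finset ℤ} (hY : HalfStrip (1-t) L L' Y)
    (hZ : HalfStrip t R R' Z) (hz : z = 0 ∨ z = 1) (hz' : z' = 0 ∨ z' = 1)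
    (hm : z' = z-ind Z 0+ind Y 0) (hc : 0 ∈ Y → 0 ∈ Z → z = t) :
    IsStrip t (glue L z R) (glue L' z' R') (refl Y ∪ Z) := by
  refine isStrip_of_at fun c => ?_
  have nY : ∀ c, c < 0 → c ∉ Y := fun c h h' => absurd (hY.nonneg c h') (by omega)
  have nZ : ∀ c, c < 0 → c ∉ Z := fun c h h' => absurd (hZ.nonneg c h') (by omega)
  have hi : ∀ c, ind (refl Y ∪ Z) c = if 0 ≤ c then ind Z c else ind Y (-1-c) := by
    intro c
    unfold ind
    have := nY (-1-c); have := nZ c; simp only [mem_union, mem_refl]; grind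
  unfold StripAt
  rw [hi, hi]; simp only [mem_union, mem_refl]
  rcases lt_trichotomy c 0 with h | h | h
  · obtain ⟨h1, h2, h3, h4⟩ := hY.stripAt (-c) (by omega)
    have a1 := nZ c h; have a2 := nZ (c-1) (by omega)
    rw [if_neg (by omega), if_neg (by omega), show -1-c = -c-1 by ring,
      show -1-(c-1) = -c by ring]
    simp only [glue, if_neg (show ¬ 0 < c by omega), if_pos h]
    refine ⟨by omega, by omega, by omega, fun k1 k2 => ?_⟩
    have := h4 (by tauto) (by tauto); omega
  · subst h
    have a1 := nY (-1) (by omega); have a2 := nZ (-1) (by omega); simp only [glue]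
    norm_num
    refine ⟨hz, hz', hm, fun k1 k2 => hc (by grind) (by grind)⟩
  · obtain ⟨h1, h2, h3, h4⟩ := hZ.stripAt c (by omega)
    have a1 := nY (-1-c) (by omega); have a2 := nY (-1-(c-1)) (by omega)
    rw [if_pos (by omega), if_pos (by omega)]; simp only [glue, if_pos h]
    exact ⟨h1, h2, h3, fun k1 k2 => h4 (by tauto) (by tauto)⟩

lemma halfStrip_empty {t : ℤ} {σ : ℤ → ℤ} (h : ∀ c, 1 ≤ c → σ c = 0 ∨ σ c = 1) :
    HalfStrip t σ σ ∅ :=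
  ⟨by simp, fun c hc => ⟨h c hc, h c hc, by simp [ind], by simp⟩⟩

lemma HalfStrip.site1 {t σ τ X} (h : HalfStrip t σ τ X) (c : ℤ) (hc : 1 ≤ c) : σ c = 0 ∨ σ c = 1 :=
  (h.stripAt c hc).1

lemma HalfStrip.site2 {t σ τ X} (h : HalfStrip t σ τ X) (c : ℤ) (hc : 1 ≤ c) : τ c = 0 ∨ τ c = 1 :=
  (h.stripAt c hc).2.1

lemma HalfStrip.congr {t σ τ τ' X} (h : HalfStrip t σ τ X) (he : ∀ c, 1 ≤ c → τ c = τ' c) :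
    HalfStrip t σ τ' X :=
  ⟨h.nonneg, fun c hc => by
    obtain ⟨h1, h2, h3, h4⟩ := h.stripAt c hc
    rw [he c hc] at h2 h3
    exact ⟨h1, h2, h3, h4⟩⟩

lemma HalfStrip.eq_after {t σ τ X} (h : HalfStrip t σ τ X) (c : ℤ) (hc : 1 ≤ c) : τ c = after σ X c :=
  (h.stripAt c hc).2.2.1

/-- The two strips, vertical and horizontal, formed by the cells of one value. -/
structure Layer (σ τ : ℤ → ℤ) (V H : Finset ℤ) : Prop where
  hV : HalfStrip 1 σ (after σ V) V
  hH : HalfStrip 0 (after σ V) τ H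
  zero : 0 ∉ V
  disj : ∀ c, c ∈ V → c ∉ H

/-- The double of a layer. -/
def Doubled (V H X K : Finset ℤ) : Prop :=
  ∃ h v g, Rot h v V H g ∧ X = refl h ∪ V ∧ K = refl v ∪ H

lemma rot_union {H V V' H' Z : Finset ℤ} {g : ℤ → Prop} (r : Rot H V V' H' g)
    (hZ : ∀ c ∈ Z, c ∉ H ∧ c ∉ V) (h1 : ∀ c ∈ Z, c-1 ∉ H) (h2 : ∀ c ∈ Z, c+1 ∉ H') :
    ∃ g, Rot H (V ∪ Z) (V' ∪ Z) H' g := by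
  apply exists_rot_of_balanced
  · intro c; have := r.disj c; have := hZ c; rw [mem_union]; grind
  · intro c; have := r.disj' c; have := hZ c; have := r.union c; rw [mem_union]; grind
  · intro c; have := r.union c; simp only [mem_union]; grind
  · intro c k1 k2
    have a1 := r.shift c; have a4 := h1 (c+1)
    have a6 := r.union (c+1)
    rw [add_sub_cancel_right] at a4; simp only [mem_union] at k1 k2; grind
  · intro c hc
    rw [mem_union] at hc; exact r.balanced (by tauto)

lemma Doubled.exists {V H : Finset ℤ} (hd : ∀ c, c ∈ V → c ∉ H) : ∃ X K, Doubled V H X K := by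
  have : ∀ c, c ∈ refl V → c ∉ refl H := fun c => by simpa using hd _
  obtain ⟨V', H', g, hr⟩ := exists_rot this
  have := hr.refl
  rw [refl_refl, refl_refl] at this; exact ⟨_, _, _, _, _, this, rfl, rfl⟩

lemma Rot.unique_symm {H V V' H' H2 V2 : Finset ℤ} {g g₂ : ℤ → Prop} (h : Rot H V V' H' g)
    (h₂ : Rot H2 V2 V' H' g₂) : H = H2 ∧ V = V2 := by
  obtain ⟨h1, h2⟩ := h.refl.unique h₂.refl; exact ⟨refl_injective h1, refl_injective h2⟩

lemma Doubled.unique {V H X K X' K' : Finset ℤ} (h : Doubled V H X K) (h' : Doubled V H X' K') :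
    X = X' ∧ K = K' := by
  obtain ⟨a, b, g, r, rfl, rfl⟩ := h
  obtain ⟨a', b', g', r', rfl, rfl⟩ := h'
  obtain ⟨rfl, rfl⟩ := r.unique_symm r'; exact ⟨rfl, rfl⟩

/-- The part of a layer on the right of the origin. -/
lemma Doubled.right {V H X K : Finset ℤ} (h : Doubled V H X K) (hV : ∀ c ∈ V, 0 ≤ c)
    (hH : ∀ c ∈ H, 0 ≤ c) : V = X.filter (0 ≤ ·) ∧ H = K.filter (0 ≤ ·) := by
  obtain ⟨a, b, g, r, rfl, rfl⟩ := h
  constructor <;> ext c <;> simp only [mem_filter, mem_union, mem_refl] <;>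
    have := r.union (-1-c) <;> have := hV c <;> have := hH c <;> have := hV (-1-c) <;>
    have := hH (-1-c) <;> grind

lemma ind_zero_or (X : Finset ℤ) (c : ℤ) : ind X c = 0 ∨ ind X c = 1 := by unfold ind; grind

section
variable {σ τ : ℤ → ℤ} {V H X K : Finset ℤ}

lemma Layer.strip_left (L : Layer σ τ V H) :
    IsStrip 0 (glue σ 0 σ) (glue (after σ V) 0 σ) (refl V) := by
  have := glue_strip (t := 0) (z := 0) (z' := 0) (by simpa using L.hV) (halfStrip_empty L.hV.site1)
    (by simp) (by simp) (by simp [ind, L.zero]) (by simp)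
  simpa using this

lemma Layer.strip_mid (L : Layer σ τ V H) :
    IsStrip 1 (glue (after σ V) 0 σ) (glue τ (ind H 0) (after σ V)) (refl H ∪ V) :=
  glue_strip (t := 1) (by simpa using L.hH) L.hV (by simp) (ind_zero_or _ _)
    (by rw [ind_of_not_mem L.zero]; ring) (fun _ h => absurd h L.zero)

lemma Layer.strip_right (L : Layer σ τ V H) :
    IsStrip 0 (glue τ (ind H 0) (after σ V)) (glue τ 0 τ) H := by
  have := glue_strip (t := 0) (z := ind H 0) (z' := 0) (halfStrip_empty L.hH.site2) L.hH
    (ind_zero_or _ _) (by simp) (by simp [ind]) (by simp)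
  simpa [refl] using this

lemma Doubled.switch (L : Layer σ τ V H) {h v : Finset ℤ} {g : ℤ → Prop} (r : Rot h v V H g) :
    ∃ α, Switch (glue σ 0 σ) (glue (after σ V) 0 σ) α (glue τ (ind H 0) (after σ V))
      (refl V) (refl H ∪ V) (refl h ∪ V) (refl v) := by
  have n1 := L.hV.nonneg; have n2 := L.hH.nonneg
  obtain ⟨g', r'⟩ := rot_union (Z := V) r.refl
    (fun c hc => by
      have := n1 c hc; have := n1 (-1-c); have := n2 (-1-c)
      simp only [mem_refl]; constructor <;> intro h <;> grind)
    (fun c hc => by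
      have : c ≠ 0 := fun h => L.zero (h ▸ hc); have := n1 c hc; have := n1 (-1-(c-1))
      simp only [mem_refl]; intro h; grind)
    (fun c hc => by
      have := n1 c hc; have := n1 (-1-(c+1)); have := n2 (-1-(c+1)); have := r.union (-1-(c+1))
      simp only [mem_refl]; intro h; grind)
  exact ⟨_, r'.strips L.strip_left L.strip_mid⟩

lemma Doubled.strips (L : Layer σ τ V H) (h : Doubled V H X K) :
    ∃ α, IsStrip 1 (glue σ 0 σ) α X ∧ IsStrip 0 α (glue τ 0 τ) K := by
  obtain ⟨h, v, g, r, rfl, rfl⟩ := h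
  obtain ⟨α, S⟩ := Doubled.switch L r
  have n1 := L.hV.nonneg; have n2 := L.hH.nonneg
  refine ⟨α, S.hV', S.hH'.union L.strip_right (fun c h1 h2 => ?_) (fun c h1 h2 => ?_)⟩
  · rw [mem_refl] at h1
    have := n2 c h2; have := r.union (-1-c); have := n1 (-1-c); have := n2 (-1-c); grind
  · rw [mem_refl] at h1
    have := n2 _ h2; have := r.union (-1-c); have := n1 (-1-c); have := n2 (-1-c); grind

end

/-! #### The chart and the word of a pair of layers -/

lemma Rot.nonneg {H V V' H' : Finset ℤ} {g : ℤ → Prop} (r : Rot H V V' H' g) :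
    (∀ c ∈ H, 0 ≤ c) ∧ (∀ c ∈ V, 0 ≤ c) ↔ (∀ c ∈ V', 0 ≤ c) ∧ ∀ c ∈ H', 0 ≤ c := by
  simp only [← forall_and, ← or_imp, r.union]

lemma Rot.halfStrips {σ0 σ1 σ2 : ℤ → ℤ} {H V V' H' : Finset ℤ} {g : ℤ → Prop} (hr : Rot H V V' H' g)
    (hH : HalfStrip 0 σ0 σ1 H) (hV : HalfStrip 1 σ1 σ2 V) :
    HalfStrip 1 σ0 (after σ0 V') V' ∧ HalfStrip 0 (after σ0 V') σ2 H' := by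
  obtain ⟨h1, h2⟩ := hr.nonneg.1 ⟨hH.nonneg, hV.nonneg⟩
  exact ⟨⟨h1, fun c hc => (hr.stripAt (hH.stripAt c hc) (hV.stripAt c hc)).1⟩,
    ⟨h2, fun c hc => (hr.stripAt (hH.stripAt c hc) (hV.stripAt c hc)).2⟩⟩

/-- The chart of a pair of layers: the double of the second layer is moved to the left of the
horizontal strip of the double of the first layer. -/
def Chart (V1 H1 V2 H2 X1 X2 K1 K2 : Finset ℤ) : Prop :=
  ∃ Y L g, Doubled V1 H1 X1 L ∧ Doubled V2 H2 Y K2 ∧ Rot L Y X2 K1 g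

lemma Chart.unique {V1 H1 V2 H2 X1 X2 K1 K2 X1' X2' K1' K2' : Finset ℤ}
    (h : Chart V1 H1 V2 H2 X1 X2 K1 K2) (h' : Chart V1 H1 V2 H2 X1' X2' K1' K2') :
    X1 = X1' ∧ X2 = X2' ∧ K1 = K1' ∧ K2 = K2' := by
  obtain ⟨Y, L, g, a, b, c⟩ := h
  obtain ⟨Y', L', g', a', b', c'⟩ := h'
  obtain ⟨rfl, rfl⟩ := a.unique a'
  obtain ⟨rfl, rfl⟩ := b.unique b'
  obtain ⟨rfl, rfl⟩ := c.unique c'; exact ⟨rfl, rfl, rfl, rfl⟩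

section
variable {σ0 σ1 σ2 : ℤ → ℤ} {V1 H1 V2 H2 : Finset ℤ}

/-- The comparison of the half-line chart with the chart of the doubles. The sets `v`, `η` present
the first layer with the diagonal cell marked or not. -/
lemma cross_of_presentation (L2 : Layer σ1 σ2 V2 H2)
    {a₁ b1 a₂ b2 v η Y V h : Finset ℤ} {g₁ g₂ g g' : ℤ → Prop} (m : ℤ) (hm : m ≤ 0)
    (r₁ : Rot a₁ b1 V1 H1 g₁) (r₂ : Rot a₂ b2 V2 H2 g₂) (r : Rot η V2 V h g)
    (hv : HalfStrip 1 σ0 (after σ0 v) v) (hη : HalfStrip 0 (after σ0 v) σ1 η)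
    (rY : Rot (refl v) (refl η ∪ v) (refl a₁ ∪ V1) Y g') (hY : Y ∪ η = refl b1 ∪ H1)
    (hYm : ∀ c ∈ Y, c ≤ m) (hηm : ∀ c ∈ η, m < c) (c1 : 0 ∈ v → 0 ∉ V) (c2 : 0 ∈ h → 0 ∉ H2)
    (c3 : 0 ∈ v → 0 ∉ η) (c4 : 0 ∈ Y → 1 ∉ V) :
    ∃ t X1 X2 B1 B2, Cross (glue σ0 0 σ0) t (refl v) (refl V) (refl h ∪ v) (refl H2 ∪ V) X1 X2 B1 B2 ∧
      Chart V1 H1 V2 H2 X1 X2 (B1 ∪ h) (B2 ∪ H2) ∧ (∀ c ∈ B1, c ≤ 0) ∧ (∀ c ∈ B2, c ≤ -1) ∧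
      (∀ c ∈ B1, c ∉ h) ∧ Pair (B1 ∪ h) (B2 ∪ H2) := by
  obtain ⟨hV, hh⟩ := r.halfStrips hη L2.hV
  have n1 := hv.nonneg; have n2 := hη.nonneg; have n3 := L2.hV.nonneg; have n4 := hV.nonneg
  have n5 := hh.nonneg; have n6 := L2.hH.nonneg
  obtain ⟨n8, n7⟩ := r₂.nonneg.2 ⟨n3, n6⟩
  have hd := r.disj' 0
  set a := after σ0 v with ha
  set b := after a V with hb
  -- the strips of the symmetric chain
  have s1 : IsStrip 0 (glue σ0 0 σ0) (glue a (ind v 0) σ0) (refl v) := by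
    have := glue_strip (t := 0) (z := 0) (z' := ind v 0) (by simpa using hv)
      (halfStrip_empty hv.site1) (by simp) (ind_zero_or _ _) (by simp [ind]) (by simp)
    simpa using this
  have s2 : IsStrip 0 (glue a (ind v 0) σ0) (glue b (ind v 0+ind V 0) σ0) (refl V) := by
    have := glue_strip (t := 0) (z := ind v 0) (z' := ind v 0+ind V 0) (by simpa using hV)
      (halfStrip_empty hv.site1) (ind_zero_or _ _) (by unfold ind; grind)
      (by simp [ind]) (by simp)
    simpa using this
  have s3 : IsStrip 1 (glue b (ind v 0+ind V 0) σ0) (glue (after σ1 V2) (ind V 0+ind h 0) a)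
      (refl h ∪ v) :=
    glue_strip (t := 1) (by simpa using hh) hv (by unfold ind; grind)
      (by unfold ind; grind) (by unfold ind; grind) (by unfold ind; grind)
  have s4 : IsStrip 1 (glue (after σ1 V2) (ind V 0+ind h 0) a) (glue σ2 (ind h 0+ind H2 0) b)
      (refl H2 ∪ V) :=
    glue_strip (t := 1) (by simpa using L2.hH) hV (by unfold ind; grind)
      (by unfold ind; grind) (by unfold ind; grind) (by unfold ind; grind)
  have s5 : IsStrip 1 (glue a (ind v 0) σ0) (glue σ1 (ind η 0) a) (refl η ∪ v) :=
    glue_strip (t := 1) (by simpa using hη) hv (ind_zero_or _ _) (ind_zero_or _ _)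
      (by ring) (by unfold ind; grind)
  have s6 : IsStrip 0 (glue σ1 (ind η 0) a) (glue σ1 0 σ1) η := by
    have := glue_strip (t := 0) (z := ind η 0) (z' := 0) (halfStrip_empty hη.site2) hη
      (ind_zero_or _ _) (by simp) (by simp [ind]) (by simp)
    simpa [refl] using this
  -- the second horizontal strip moves back through the first vertical strip
  obtain ⟨_, q1⟩ := rot_union (Z := v) r.refl
    (fun c hc => by
      have := n1 c hc; have := n4 (-1-c); have := n5 (-1-c)
      simp only [mem_refl]; constructor <;> intro h <;> grind)
    (fun c hc => by
      have := n1 c hc; have := n4 (-1-(c-1)); simp only [mem_refl]; intro h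
      obtain rfl : c = 0 := by have := this h; omega
      exact c1 hc (by simpa using h))
    (fun c hc => by
      have := n1 c hc; have := n3 (-1-(c+1))
      simp only [mem_refl]; intro h; grind)
  have S_outer := q1.strips s2 s3; have S_inner := rY.strips s1 s5
  rw [← s5.eq_after] at S_outer
  -- it also moves through the second vertical strip
  have p1 : ∃ g, Rot (refl V2) (refl H2 ∪ V) (refl a₂ ∪ V) (refl b2) g :=
    rot_union (Z := V) r₂.refl
      (fun c hc => by
        have := n4 c hc; have := n3 (-1-c); have := n6 (-1-c)
        simp only [mem_refl]; constructor <;> intro h <;> grind)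
      (fun c hc => by
        have := n4 c hc; have := n3 (-1-(c-1)); have := L2.zero
        simp only [mem_refl]; intro h; grind)
      (fun c hc => by
        have := n4 c hc; have := n7 (-1-(c+1))
        simp only [mem_refl]; intro h; grind)
  obtain ⟨_, q2⟩ := p1
  have T_outer := q2.strips S_outer.hH' s4
  obtain ⟨f', X2, B1, T_inner⟩ := exists_switch S_inner.hH' T_outer.hV'
  -- the strips of the chart
  obtain ⟨α, D⟩ := Doubled.switch L2 r₂
  have p3 : ∃ g, Rot η (refl a₂ ∪ V2) (refl a₂ ∪ V) h g := by
    have := rot_union (Z := refl a₂) r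
      (fun c hc => by
        have := n2 c; have := n3 c; have := n8 (-1-c) (by simpa using hc)
        constructor <;> intro h <;> grind)
      (fun c hc => by
        have := n2 (c-1); have := n8 (-1-c) (by simpa using hc)
        intro h; grind)
      (fun c hc => by
        rw [mem_refl] at hc
        have := n8 _ hc
        intro h
        obtain rfl : c = -1 := by have := n5 _ h; omega
        have h0 := (r₂.union 0).1 (Or.inl (by simpa using hc)); have := L2.zero
        exact c2 (by simpa using h) (by tauto))
    rwa [union_comm V2, union_comm V] at this
  obtain ⟨_, q3⟩ := p3
  have E := q3.strips s6 D.hV'; have F := Switch.union m hYm hηm E T_inner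
  obtain ⟨gF, rF⟩ := F.rot
  obtain ⟨_, rB⟩ := T_inner.rot
  have hB2 : ∀ c ∈ refl b2, c ≤ -1 := fun c hc => by
    have := n7 _ (mem_refl.1 hc); omega
  refine ⟨_, _, X2, B1, refl b2, ⟨_, _, _, _, _, _, _, _, _, _, _, ⟨S_outer, S_inner⟩, ⟨T_outer, T_inner⟩⟩,
    ⟨_, _, gF, ⟨a₁, b1, g₁, r₁, rfl, rfl⟩, ⟨a₂, b2, g₂, r₂, rfl, rfl⟩, hY ▸ rF⟩, fun x hx => ?_, hB2,
    fun c hc hc' => ?_, ?_⟩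
  · by_contra hcon
    have hY0 : ∀ y ∈ Y, y ≤ x-1 := fun y hy => by have := hYm y hy; omega
    by_cases hx1 : x-1 ∈ Y ∨ x-1 ∈ refl a₂ ∪ V
    · have a1 := rB.shift (x-1) hx1
      rw [sub_add_cancel] at a1
      have a2 := (a1 ((rB.union x).2 (Or.inr hx))).1 hx; have a3 := hYm _ a2
      obtain rfl : x = 1 := by omega
      have a4 := (rB.union 1).2 (Or.inr hx)
      rw [mem_union, mem_refl] at a4
      have := c4 (by simpa using a2); grind
    · have a1 := rB.balanced hx1
      rw [cnt_eq_card hY0] at a1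
      have a2 := rB.card; have a3 := cnt_le_card B1 x
      rw [cnt_step, ind_of_mem hx, a1, a2] at a3; omega
  · have u1 := rB.union c; have u2 := q3.union c; have u3 := q3.disj' c
    have u6 := disjoint_of_strips (hY ▸ F.hH) F.hV c
    rw [← hY, mem_union] at u6; grind
  · have a1 := D.hH'.union L2.strip_right (fun c h1 h2 => by
      have := hB2 c h1; have := n6 c h2; omega) (fun c h1 h2 => by
      have := hB2 c h1; have := n6 _ h2; omega)
    have a2 := F.hH'
    rw [D.hV'.eq_after] at a1
    rw [F.hV.eq_after] at a2; exact pair_of_strips a2 a1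

end

/-- The word of a pair of layers, as a pair of sets of contents: the vertical strips are reflected to
the negative contents. If the diagonal contains both values and the unmarked smaller one stays there
in the half-line chart, then this cell is presented as a marked one. -/
def Word (V1 H1 V2 H2 W1 W2 : Finset ℤ) : Prop :=
  ∃ V H g, Rot H1 V2 V H g ∧ W2 = refl V ∪ H2 ∧
    ((¬ (0 ∈ H ∧ 0 ∈ H2) ∧ W1 = refl V1 ∪ H) ∨
      ((0 ∈ H ∧ 0 ∈ H2) ∧ W1 = refl (insert 0 V1) ∪ H.erase 0))

lemma filter_neg_union {v h : Finset ℤ} (hv : ∀ c ∈ v, 0 ≤ c) (hh : ∀ c ∈ h, 0 ≤ c) :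
    (refl v ∪ h).filter (· < 0) = refl v ∧ (refl v ∪ h).filter (0 ≤ ·) = h := by
  constructor <;> ext c <;> simp only [mem_filter, mem_union, mem_refl] <;>
    have := hv (-1-c) <;> have := hh c <;> grind

lemma cnt_erase (X : Finset ℤ) (a c : ℤ) (h : a ∈ X) :
    cnt (X.erase a) c = cnt X c-if a ≤ c then 1 else 0 := by
  have : cnt X c = cnt (X.erase a) c+cnt {a} c := by
    rw [← cnt_union (by intro c; simp only [mem_erase, mem_singleton]; tauto)]
    congr 1
    ext x; simp only [mem_union, mem_erase, mem_singleton]; grind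
  have h2 : cnt {a} c = if a ≤ c then 1 else 0 := by
    unfold cnt; rw [Finset.filter_singleton]; split_ifs <;> simp
  omega

lemma cnt_insert (X : Finset ℤ) (a c : ℤ) (h : a ∉ X) :
    cnt (insert a X) c = cnt X c+if a ≤ c then 1 else 0 := by
  have := cnt_erase (insert a X) a c (Finset.mem_insert_self a X)
  rw [Finset.erase_insert h] at this; omega

section
variable {σ0 σ1 σ2 : ℤ → ℤ} {V1 H1 V2 H2 : Finset ℤ}

lemma Word.cross (L1 : Layer σ0 σ1 V1 H1) (L2 : Layer σ1 σ2 V2 H2) {W1 W2 : Finset ℤ}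
    (w : Word V1 H1 V2 H2 W1 W2) :
    ∃ t X1 X2 B1 B2, Cross (glue σ0 0 σ0) t (W1.filter (· < 0)) (W2.filter (· < 0)) (refl W1) (refl W2)
      X1 X2 B1 B2 ∧
      Chart V1 H1 V2 H2 X1 X2 (B1 ∪ W1.filter (0 ≤ ·)) (B2 ∪ W2.filter (0 ≤ ·)) ∧
      (∀ c ∈ B1, c ≤ 0) ∧ (∀ c ∈ B2, c ≤ -1) ∧
      (∀ c ∈ B1, c ∉ W1.filter (0 ≤ ·)) ∧ Pair (B1 ∪ W1.filter (0 ≤ ·)) (B2 ∪ W2.filter (0 ≤ ·)) := by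
  obtain ⟨V, H, g, r, rfl, hW⟩ := w
  obtain ⟨a₁, b₁, g₁, r₁⟩ : ∃ a b g, Rot a b V1 H1 g := by
    obtain ⟨_, _, a, b, g, h, -⟩ := Doubled.exists L1.disj; exact ⟨a, b, g, h⟩
  obtain ⟨a₂, b₂, g₂, r₂⟩ : ∃ a b g, Rot a b V2 H2 g := by
    obtain ⟨_, _, a, b, g, h, -⟩ := Doubled.exists L2.disj; exact ⟨a, b, g, h⟩
  have n1 := L1.hV.nonneg; have n2 := L1.hH.nonneg; have n3 := L2.hV.nonneg; have n4 := L2.hH.nonneg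
  obtain ⟨n5, n6⟩ := r.nonneg.1 ⟨n2, n3⟩
  have n7 := (r₁.nonneg.2 ⟨n1, n2⟩).2
  obtain ⟨e1, e2⟩ := filter_neg_union n5 n4
  obtain ⟨α, D⟩ := Doubled.switch L1 r₁
  obtain ⟨g', rD⟩ := D.rot
  have z1 := L1.zero; have z2 := L2.zero
  rcases hW with ⟨hn, rfl⟩ | ⟨⟨h1, h2⟩, rfl⟩
  · obtain ⟨e3, e4⟩ := filter_neg_union n1 n6
    rw [e1, e2, e3, e4, refl_union, refl_union, refl_refl, refl_refl, union_comm V1,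
      union_comm V]
    exact cross_of_presentation L2 (-1) (by norm_num) r₁ r₂ r L1.hV L1.hH rD rfl
      (fun c hc => by have := n7 _ (mem_refl.1 hc); omega)
      (fun c hc => by have := n2 _ hc; omega)
      (fun h => absurd h z1) (fun h h' => hn ⟨h, h'⟩) (fun h => absurd h z1)
      (fun h => by have := n7 _ (mem_refl.1 h); omega)
  · have n1' : ∀ c ∈ insert 0 V1, 0 ≤ c := fun c hc => by
      rcases mem_insert.1 hc with rfl | hc; exacts [le_rfl, n1 c hc]
    have n6' : ∀ c ∈ H.erase 0, 0 ≤ c := fun c hc => n6 c (mem_of_mem_erase hc)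
    obtain ⟨e3, e4⟩ := filter_neg_union n1' n6'
    rw [e1, e2, e3, e4, refl_union, refl_union, refl_refl, refl_refl, union_comm (insert 0 V1),
      union_comm V]
    have h3 : 0 ∈ H1 := by have := (r.union 0).2 (Or.inr h1); tauto
    have h4 : 1 ∉ V := by
      intro h
      have := r.shift 0 (Or.inl h3) ((r.union 1).2 (Or.inl h)); exact r.disj' 1 h (this.2 h3)
    obtain ⟨_, r'⟩ : ∃ g, Rot (H1.erase 0) V2 V (H.erase 0) g := by
      apply exists_rot_of_balanced
      · intro c; have := r.disj c; rw [mem_erase]; tauto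
      · intro c; have := r.disj' c; rw [mem_erase]; tauto
      · intro c; have := r.union c; have := r.disj' 0; simp only [mem_erase]; grind
      · intro c; have := r.shift c; simp only [mem_erase]
        have := n2 c; have := n3 c; grind
      · intro c hc
        rw [mem_erase] at hc
        rw [cnt_erase _ _ _ h1, cnt_erase _ _ _ h3]
        rcases eq_or_ne c 0 with rfl | hne
        · have a1 := r.cnt_eq 0
          have a2 := r.first 0 (Or.inl h3) (fun h => by
            rcases h with h | h
            · have := n2 _ h; omega
            · have := n3 _ h; omega)
          rw [if_pos (Or.inl h3), if_pos (a2.1 h1), ind_of_mem h3] at a1; omega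
        · rw [r.balanced (by tauto)]
    have k1 : ∀ c, ind (insert 0 V1) c = ind V1 c+if c = 0 then 1 else 0 := by
      intro c; unfold ind; simp only [mem_insert]; grind
    have k2 : ∀ c, ind (H1.erase 0) c = ind H1 c-if c = 0 then 1 else 0 := by
      intro c; unfold ind; simp only [mem_erase]; grind
    have k3 : HalfStrip 1 σ0 (after σ0 (insert 0 V1)) (insert 0 V1) := by
      refine ⟨n1', fun c hc => ?_⟩
      obtain ⟨a1, a2, a3, a4⟩ := L1.hV.stripAt c hc
      obtain ⟨b1, b2, b3, b4⟩ := L1.hH.stripAt c hc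
      unfold StripAt after at *
      rw [k1, k1]; simp only [mem_insert]
      unfold ind at *
      refine ⟨a1, ?_, trivial, ?_⟩ <;> grind
    have k4 : HalfStrip 0 (after σ0 (insert 0 V1)) σ1 (H1.erase 0) := by
      refine ⟨fun c hc => n2 c (mem_of_mem_erase hc), fun c hc => ?_⟩
      obtain ⟨a1, a2, a3, a4⟩ := L1.hV.stripAt c hc
      obtain ⟨b1, b2, b3, b4⟩ := L1.hH.stripAt c hc
      have c1 := (k3.stripAt c hc).2.1
      refine ⟨c1, b2, ?_, ?_⟩
      · unfold after at *
        rw [k1, k1, k2, k2]; omega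
      · unfold after at *
        rw [k1, k1] at *; simp only [mem_erase]
        unfold ind at *; grind
    obtain ⟨_, rY⟩ : ∃ g, Rot (refl (insert 0 V1)) (refl (H1.erase 0) ∪ insert 0 V1) (refl a₁ ∪ V1)
        (insert 0 (refl b₁)) g := by
      have m1 : ∀ c, c ∈ refl (insert 0 V1) ↔ (c = -1 ∨ c ∈ refl V1) := fun c => by
        simp only [mem_refl, mem_insert]; grind
      have m2 : ∀ c, c ∈ refl (H1.erase 0) ∪ insert 0 V1 ↔
          ((c ≠ -1 ∧ c ∈ refl H1) ∨ c = 0 ∨ c ∈ V1) := fun c => by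
        simp only [mem_refl, mem_insert, mem_erase, mem_union]; grind
      have m3 : -1 ∈ refl H1 := by simpa using h3
      have m4 : 0 ∉ refl V1 := fun h => by have := n1 _ (mem_refl.1 h); omega
      have m5 : 0 ∉ refl H1 := fun h => by have := n2 _ (mem_refl.1 h); omega
      have m7 : ∀ c, c ∈ refl b₁ → c ≤ -1 := fun c h => by have := n7 _ (mem_refl.1 h); omega
      have m8 : ∀ c, c ∈ refl V1 → c ≤ -1 := fun c h => by have := n1 _ (mem_refl.1 h); omega
      have m9 : ∀ c, c ∈ refl H1 → c ≤ -1 := fun c h => by have := n2 _ (mem_refl.1 h); omega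
      apply exists_rot_of_balanced
      · intro c; rw [m1, m2]; have := n1 c; have := rD.disj c; rw [mem_union] at this; grind
      · intro c; rw [mem_insert]; have := rD.disj' c; have := rD.union 0
        simp only [mem_union] at *; grind
      · intro c; rw [m1, m2, mem_insert]
        have := rD.union c; simp only [mem_union] at *; grind
      · intro c; rw [m1, m2, m1, m2, mem_insert]
        have := rD.shift c; have := n1 c; have := m7 (c+1); have := m8 (c+1); have := m9 (c+1)
        simp only [mem_union] at *; grind
      · intro c hc
        rw [m1, m2] at hc
        rw [cnt_insert _ _ _ (fun h => by have := m7 _ h; omega), refl_insert, cnt_insert _ _ _ (by simpa using z1),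
          rD.balanced (by rw [mem_union]; grind)]
        split_ifs <;> grind
    refine cross_of_presentation L2 0 le_rfl r₁ r₂ r' k3 k4 rY ?_ ?_ ?_ ?_ ?_ ?_ ?_
    · ext c; simp only [mem_union, mem_insert, mem_erase]; grind
    · intro c hc
      rcases mem_insert.1 hc with rfl | hc
      · exact le_rfl
      · have := n7 _ (mem_refl.1 hc); omega
    · intro c hc
      rw [mem_erase] at hc
      have := n2 c hc.2; omega
    · intro _ h; exact r.disj' 0 h h1
    · simp
    · simp
    · intro _; exact h4

end

lemma Cross.ht_le_vertical {s t A1 A2 P1 P2 X1 X2 B1 B2} (h : Cross s t A1 A2 P1 P2 X1 X2 B1 B2)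
    (hm : ∀ c, ht (refl P1) (refl P2) c ≤ 0) (c : ℤ) : ht (refl X1) (refl X2) c ≤ 0 := by
  obtain ⟨a, b, c, d, e, f, g, R1, R2, Y1, Y2, S, T⟩ := h
  have S1 : Slide _ _ _ _ _ _ _ _ _ _ _ _ _ := ⟨T.outer.refl, S.outer.refl⟩
  have S2 : Slide _ _ _ _ _ _ _ _ _ _ _ _ _ := ⟨T.inner.refl, S.inner.refl⟩
  rcases exists_firstMax_or (refl X1) (refl X2) with h | ⟨M, p, h⟩
  · exact h _
  · obtain ⟨q, _, _, _, h1, -⟩ := S2.lowering h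
    obtain ⟨q, _, _, _, h1, -⟩ := S1.lowering h1
    have := hm q; have := h1.eq; have := h1.pos; omega

lemma cnt_split (W : Finset ℤ) (c : ℤ) :
    cnt W c = cnt (W.filter (· < 0)) c+cnt (W.filter (0 ≤ ·)) c := by
  rw [← cnt_union (by intro c; simp only [mem_filter]; grind)]
  congr 1
  ext c; simp only [mem_union, mem_filter]; grind

lemma ht_split_of_neg (W1 W2 : Finset ℤ) {c : ℤ} (hc : c < 0) :
    ht W1 W2 c = ht (W1.filter (· < 0)) (W2.filter (· < 0)) c := by
  unfold ht
  rw [cnt_split W1, cnt_split W2, cnt_eq_zero (X := W1.filter (0 ≤ ·)),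
    cnt_eq_zero (X := W2.filter (0 ≤ ·))]
  · ring
  all_goals intro x hx; have := (mem_filter.1 hx).2; omega

lemma cnt_neg_of_nonneg (W : Finset ℤ) {c : ℤ} (hc : -1 ≤ c) :
    cnt (W.filter (· < 0)) c = (W.filter (· < 0)).card :=
  cnt_eq_card fun x hx => by have := (mem_filter.1 hx).2; omega

/-- The excess function of the merged horizontal strips, compared with the word. -/
lemma merge_ht {s t : ℤ → ℤ} {W1 W2 P1 P2 X1 X2 B1 B2 : Finset ℤ}
    (h : Cross s t (W1.filter (· < 0)) (W2.filter (· < 0)) P1 P2 X1 X2 B1 B2)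
    (h1 : ∀ c ∈ B1, c ≤ 0) (h2 : ∀ c ∈ B2, c ≤ -1) (h3 : ∀ c ∈ B1, c ∉ W1.filter (0 ≤ ·)) :
    (∀ c, 0 ≤ c → ht (B1 ∪ W1.filter (0 ≤ ·)) (B2 ∪ W2.filter (0 ≤ ·)) c = ht W1 W2 c) ∧
    (∀ c, c < 0 → ht (B1 ∪ W1.filter (0 ≤ ·)) (B2 ∪ W2.filter (0 ≤ ·)) c = ht B1 B2 c) := by
  have h4 : ∀ c ∈ B2, c ∉ W2.filter (0 ≤ ·) := fun c hc hc' => by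
    have := h2 c hc; have := (mem_filter.1 hc').2; omega
  obtain ⟨k1, k2⟩ := h.card
  constructor <;> intro c hc <;> unfold ht
  · rw [cnt_union h3, cnt_union h4, cnt_split W1, cnt_split W2, cnt_neg_of_nonneg _ (by omega),
      cnt_neg_of_nonneg _ (by omega), cnt_eq_card fun x hx => le_trans (h1 x hx) hc,
      cnt_eq_card fun x hx => le_trans (h2 x hx) (by omega), k1, k2]
  · rw [cnt_union h3, cnt_union h4, cnt_eq_zero (X := W1.filter (0 ≤ ·)),
      cnt_eq_zero (X := W2.filter (0 ≤ ·))]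
    · ring
    all_goals intro x hx; have := (mem_filter.1 hx).2; omega

lemma ht_neg_le {W1 W2 : Finset ℤ} {m : ℤ} (hm : ∀ c, c < 0 → ht W1 W2 c ≤ m) (c : ℤ) :
    ht (W1.filter (· < 0)) (W2.filter (· < 0)) c ≤ m := by
  rcases lt_or_ge c 0 with h | h
  · rw [← ht_split_of_neg _ _ h]; exact hm c h
  · have := hm (-1) (by norm_num)
    rw [ht_split_of_neg _ _ (by norm_num)] at this
    unfold ht at *; rwa [cnt_neg_of_nonneg _ (by omega), cnt_neg_of_nonneg _ (by omega)] at this ⊢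

lemma merge_ht_le {s t : ℤ → ℤ} {W1 W2 P1 P2 X1 X2 B1 B2 : Finset ℤ} {m : ℤ}
    (h : Cross s t (W1.filter (· < 0)) (W2.filter (· < 0)) P1 P2 X1 X2 B1 B2)
    (h1 : ∀ c ∈ B1, c ≤ 0) (h2 : ∀ c ∈ B2, c ≤ -1) (h3 : ∀ c ∈ B1, c ∉ W1.filter (0 ≤ ·))
    (hm : ∀ c, ht W1 W2 c ≤ m) (c : ℤ) :
    ht (B1 ∪ W1.filter (0 ≤ ·)) (B2 ∪ W2.filter (0 ≤ ·)) c ≤ m := by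
  obtain ⟨k1, k2⟩ := merge_ht h h1 h2 h3
  rcases lt_or_ge c 0 with hc | hc
  · rw [k2 c hc]; exact h.ht_le (ht_neg_le fun c _ => hm c) c
  · rw [k1 c hc]; exact hm c

/-- The lowering of a word, in the merged horizontal strips. -/
lemma merge_lowering {s t : ℤ → ℤ} {W1 W2 P1 P2 X1 X2 B1 B2 : Finset ℤ} {M p : ℤ}
    (h : Cross s t (W1.filter (· < 0)) (W2.filter (· < 0)) P1 P2 X1 X2 B1 B2)
    (h1 : ∀ c ∈ B1, c ≤ 0) (h2 : ∀ c ∈ B2, c ≤ -1) (h3 : ∀ c ∈ B1, c ∉ W1.filter (0 ≤ ·))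
    (h4 : Pair (B1 ∪ W1.filter (0 ≤ ·)) (B2 ∪ W2.filter (0 ≤ ·))) (hf : FirstMax W1 W2 M p) :
    ∃ r B1' B2', FirstMax (B1 ∪ W1.filter (0 ≤ ·)) (B2 ∪ W2.filter (0 ≤ ·)) M r ∧
      Cross s t ((W1.erase p).filter (· < 0)) ((insert p W2).filter (· < 0)) P1 P2 X1 X2 B1' B2' ∧
      B1' ∪ (W1.erase p).filter (0 ≤ ·) = (B1 ∪ W1.filter (0 ≤ ·)).erase r ∧
      B2' ∪ (insert p W2).filter (0 ≤ ·) = insert r (B2 ∪ W2.filter (0 ≤ ·)) := by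
  obtain ⟨k1, k2⟩ := merge_ht h h1 h2 h3
  obtain ⟨m1, m2, m3⟩ := hf.mem
  rcases lt_or_ge p 0 with hp | hp
  · have hfA : FirstMax (W1.filter (· < 0)) (W2.filter (· < 0)) M p :=
      ⟨hf.pos, ht_neg_le fun c _ => hf.le c, by rw [← ht_split_of_neg _ _ hp]; exact hf.eq,
        fun c hc => by rw [← ht_split_of_neg _ _ (by omega)]; exact hf.lt c hc⟩
    obtain ⟨q, f1, f2⟩ := h.lower_horizontal hfA
    obtain ⟨n1, n2, n3⟩ := f1.mem
    have hq := h1 q n1; have hB := h.pair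
    refine ⟨q, B1.erase q, insert q B2, ⟨f1.pos, merge_ht_le h h1 h2 h3 hf.le, ?_, fun c hc => ?_⟩,
      ?_, ?_, ?_⟩
    · rcases lt_or_eq_of_le hq with hq | rfl
      · rw [k2 q hq]; exact f1.eq
      · rw [ht_step, k2 _ (by norm_num), n3]
        have a1 : (0 : ℤ) ∉ W2.filter (0 ≤ ·) := fun hcon => by
          have a2 := h4.left 0 (mem_union_left _ n1) (mem_union_right _ hcon)
          rw [mem_union, mem_filter] at a2
          rcases a2 with a2 | a2
          · obtain ⟨d, hd, hd'⟩ := hB.climb _ a2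
            have := f1.lt d (by omega); omega
          · have := a2.2; omega
        unfold ind; simp only [mem_union]
        rw [if_pos (Or.inl n1), if_neg (by tauto)]; ring
    · rw [k2 c (by omega)]; exact f1.lt c hc
    · convert f2 using 1 <;> ext c <;> simp only [mem_filter, mem_erase, mem_insert] <;>
        grind
    · ext c; have := h3 c; simp only [mem_filter, mem_erase, mem_union] at *; grind
    · ext c; simp only [mem_filter, mem_insert, mem_union]; grind
  · have hlt : ∀ c, c < 0 → ht B1 B2 c < M := fun c hc => by
      have := h.ht_le (m := M-1) (ht_neg_le fun d hd => by have := hf.lt d (by omega); omega) c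
      omega
    refine ⟨p, B1, B2, ⟨hf.pos, merge_ht_le h h1 h2 h3 hf.le, by rw [k1 p hp]; exact hf.eq, fun c hc => ?_⟩,
      ?_, ?_, ?_⟩
    · rcases lt_or_ge c 0 with hc' | hc'
      · rw [k2 c hc']; exact hlt c hc'
      · rw [k1 c hc']; exact hf.lt c hc
    · convert h using 1 <;> ext c <;> simp only [mem_filter, mem_erase, mem_insert] <;>
        grind
    · ext c; have := h3 c; simp only [mem_filter, mem_erase, mem_union] at *; grind
    · ext c; have := h2 c; simp only [mem_filter, mem_insert, mem_union] at *; grind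

section
variable {σ0 σ1 σ2 σ1' σ2' : ℤ → ℤ} {V1 H1 V2 H2 V1' H1' V2' H2' W1 W2 X1 X2 K1 K2 : Finset ℤ} {M p : ℤ}

/-- Lowering of words is lowering of both parts of the chart. -/
lemma Chart.lowering (L1 : Layer σ0 σ1 V1 H1) (L2 : Layer σ1 σ2 V2 H2) (w : Word V1 H1 V2 H2 W1 W2)
    (L1' : Layer σ0 σ1' V1' H1') (L2' : Layer σ1' σ2' V2' H2')
    (w' : Word V1' H1' V2' H2' (W1.erase p) (insert p W2)) (hf : FirstMax W1 W2 M p)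
    (hc : Chart V1 H1 V2 H2 X1 X2 K1 K2) :
    ∃ q r, FirstMax (refl X1) (refl X2) M q ∧ FirstMax K1 K2 M r ∧
      Chart V1' H1' V2' H2' (X1.erase (-1-q)) (insert (-1-q) X2) (K1.erase r) (insert r K2) := by
  obtain ⟨t, Y1, Y2, B1, B2, c1, c2, c3, c4, c5, c6⟩ := w.cross L1 L2
  obtain ⟨t', Y1', Y2', B1', B2', d1, d2, d3, d4, d5, d6⟩ := w'.cross L1' L2'
  obtain ⟨rfl, rfl, rfl, rfl⟩ := hc.unique c2
  obtain ⟨r, D1, D2, e1, e2, e3, e4⟩ := merge_lowering c1 c3 c4 c5 c6 hf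
  obtain ⟨q, f1, f2⟩ := e2.lower_vertical (p := p) (M := M) (by simpa using hf)
  rw [← refl_erase, ← refl_insert] at f2
  obtain ⟨rfl, rfl, rfl, rfl⟩ := f2.unique d1
  rw [e3, e4] at d2; exact ⟨q, r, f1, e1, d2⟩

lemma Chart.ht_le (L1 : Layer σ0 σ1 V1 H1) (L2 : Layer σ1 σ2 V2 H2) (w : Word V1 H1 V2 H2 W1 W2)
    (hc : Chart V1 H1 V2 H2 X1 X2 K1 K2) (hm : ∀ c, ht W1 W2 c ≤ 0) :
    (∀ c, ht (refl X1) (refl X2) c ≤ 0) ∧ ∀ c, ht K1 K2 c ≤ 0 := by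
  obtain ⟨t, Y1, Y2, B1, B2, c1, c2, c3, c4, c5, c6⟩ := w.cross L1 L2
  obtain ⟨rfl, rfl, rfl, rfl⟩ := hc.unique c2
  exact ⟨c1.ht_le_vertical (by simpa using hm), merge_ht_le c1 c3 c4 c5 hm⟩

end

/-! #### The calculus of triples of strips -/

/-- The maximum of the excess function, including the value `0` of the empty word. -/
structure IsMax (A B : Finset ℤ) (M : ℤ) : Prop where
  nonneg : 0 ≤ M
  le : ∀ c, ht A B c ≤ M
  eq : M = 0 ∨ ∃ c, ht A B c = M

lemma IsMax.unique {A B M M'} (h : IsMax A B M) (h' : IsMax A B M') : M = M' := by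
  have := h.nonneg; have := h'.nonneg
  apply le_antisymm
  · rcases h.eq with h1 | ⟨c, h1⟩
    · omega
    · have := h'.le c; omega
  · rcases h'.eq with h1 | ⟨c, h1⟩
    · omega
    · have := h.le c; omega

lemma FirstMax.isMax {A B M p} (h : FirstMax A B M p) : IsMax A B M :=
  ⟨h.pos.le, h.le, Or.inr ⟨p, h.eq⟩⟩

lemma IsMax.firstMax {A B M} (h : IsMax A B M) (hM : 0 < M) : ∃ p, FirstMax A B M p := by
  rcases exists_firstMax_or A B with h' | ⟨M', p, h'⟩
  · rcases h.eq with h1 | ⟨c, h1⟩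
    · omega
    · have := h' c; omega
  · obtain rfl := h.unique h'.isMax; exact ⟨p, h'⟩

lemma exists_isMax (A B : Finset ℤ) : ∃ M, IsMax A B M := by
  rcases exists_firstMax_or A B with h | ⟨M, p, h⟩; exacts [⟨0, le_rfl, h, Or.inl rfl⟩, ⟨M, h.isMax⟩]

/-- Triples of sets of contents. -/
abbrev Tri : Type := Finset ℤ × Finset ℤ × Finset ℤ

/-- Lowering of the first pair of a triple. -/
def Low1 (M : ℤ) (K K' : Tri) : Prop :=
  ∃ p, FirstMax K.1 K.2.1 M p ∧ K' = (K.1.erase p, insert p K.2.1, K.2.2)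

/-- Lowering of the second pair of a triple. -/
def Low2 (M : ℤ) (K K' : Tri) : Prop :=
  ∃ p, FirstMax K.2.1 K.2.2 M p ∧ K' = (K.1, K.2.1.erase p, insert p K.2.2)

lemma ht_erase_insert {A B : Finset ℤ} {p : ℤ} (h : p ∈ A) (h' : p ∉ B) (c : ℤ) :
    ht (A.erase p) (insert p B) c = ht A B c-if p ≤ c then 2 else 0 := by
  unfold ht; rw [cnt_erase _ _ _ h, cnt_insert _ _ _ h']; split_ifs <;> ring

lemma ht_insert {A B : Finset ℤ} {p : ℤ} (h : p ∉ A) (c : ℤ) :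
    ht (insert p A) B c = ht A B c+if p ≤ c then 1 else 0 := by
  unfold ht; rw [cnt_insert _ _ _ h]; ring

lemma ht_erase {A B : Finset ℤ} {p : ℤ} (h : p ∈ B) (c : ℤ) :
    ht A (B.erase p) c = ht A B c+if p ≤ c then 1 else 0 := by
  unfold ht; rw [cnt_erase _ _ _ h]; ring

lemma ht_eq_zero_of_lower (A B : Finset ℤ) : ∃ b, ∀ c ≤ b, ht A B c = 0 := by
  obtain ⟨b, hb⟩ := exists_lower (A ∪ B)
  refine ⟨b, fun c hc => ?_⟩
  unfold ht
  rw [cnt_eq_zero fun x hx => by have := hb x (mem_union_left _ hx); omega,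
    cnt_eq_zero fun x hx => by have := hb x (mem_union_right _ hx); omega]
  rfl

lemma FirstMax.decrease {A B M p} (h : FirstMax A B M p) : IsMax (A.erase p) (insert p B) (M-1) := by
  obtain ⟨m1, m2, m3⟩ := h.mem
  refine ⟨by have := h.pos; omega, fun c => ?_, Or.inr ⟨p-1, ?_⟩⟩
  · rw [ht_erase_insert m1 m2]
    have := h.le c; have := h.lt c
    split_ifs <;> omega
  · rw [ht_erase_insert m1 m2, if_neg (by omega), m3]; ring

/-- The first place at or after `a` where a condition holds. -/
lemma exists_first {P : ℤ → Prop} (a : ℤ) (h : ∃ c, a ≤ c ∧ P c) :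
    ∃ c, a ≤ c ∧ P c ∧ ∀ d, a ≤ d → d < c → ¬ P d := by
  classical
  obtain ⟨c, ⟨h1, h2⟩, h3⟩ := Int.exists_least_of_bdd (P := fun c => a ≤ c ∧ P c) ⟨a, fun z hz => hz.1⟩ h
  exact ⟨c, h1, h2, fun d hd hd' hP => by have := h3 d ⟨hd, hP⟩; omega⟩

section
variable {K U V A C Y : Tri} {M N : ℤ}

lemma Low1.decrease (h : Low1 M K U) : IsMax U.1 U.2.1 (M-1) := by
  obtain ⟨p, hp, rfl⟩ := h; exact hp.decrease

lemma Low2.decrease (h : Low2 M K U) : IsMax U.2.1 U.2.2 (M-1) := by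
  obtain ⟨p, hp, rfl⟩ := h; exact hp.decrease

lemma Low1.isMax (h : Low1 M K U) : IsMax K.1 K.2.1 M := by
  obtain ⟨p, hp, rfl⟩ := h; exact hp.isMax

lemma Low2.isMax (h : Low2 M K U) : IsMax K.2.1 K.2.2 M := by
  obtain ⟨p, hp, rfl⟩ := h; exact hp.isMax

lemma Low1.unique {M' : ℤ} (h : Low1 M K U) (h' : Low1 M' K V) : U = V := by
  obtain ⟨p, hp, rfl⟩ := h; obtain ⟨p', hp', rfl⟩ := h'
  obtain ⟨rfl, rfl⟩ := hp.unique hp'; rfl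

lemma Low2.unique {M' : ℤ} (h : Low2 M K U) (h' : Low2 M' K V) : U = V := by
  obtain ⟨p, hp, rfl⟩ := h; obtain ⟨p', hp', rfl⟩ := h'
  obtain ⟨rfl, rfl⟩ := hp.unique hp'; rfl

lemma Low1.mono (h : Low1 M K U) (hN : IsMax K.2.1 K.2.2 N) :
    IsMax U.2.1 U.2.2 N ∨ IsMax U.2.1 U.2.2 (N+1) := by
  obtain ⟨p, hp, rfl⟩ := h
  obtain ⟨m1, m2, m3⟩ := hp.mem
  obtain ⟨N', hN'⟩ := exists_isMax (insert p K.2.1) K.2.2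
  have key : N' = N ∨ N' = N+1 := by
    have k1 : N ≤ N' := by
      rcases hN.eq with h | ⟨c, hc⟩
      · have := hN'.nonneg; omega
      · have := hN'.le c; rw [ht_insert m2] at this; split_ifs at this <;> omega
    have k2 : N' ≤ N+1 := by
      rcases hN'.eq with h | ⟨c, hc⟩
      · have := hN.nonneg; omega
      · have := hN.le c; rw [ht_insert m2] at hc; split_ifs at hc <;> omega
    omega
  rcases key with rfl | rfl; exacts [Or.inl hN', Or.inr hN']

lemma Low2.mono (h : Low2 N K V) (hM : IsMax K.1 K.2.1 M) :
    IsMax V.1 V.2.1 M ∨ IsMax V.1 V.2.1 (M+1) := by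
  obtain ⟨p, hp, rfl⟩ := h
  obtain ⟨m1, m2, m3⟩ := hp.mem
  obtain ⟨N', hN'⟩ := exists_isMax K.1 (K.2.1.erase p)
  have key : N' = M ∨ N' = M+1 := by
    have k1 : M ≤ N' := by
      rcases hM.eq with h | ⟨c, hc⟩
      · have := hN'.nonneg; omega
      · have := hN'.le c; rw [ht_erase m1] at this; split_ifs at this <;> omega
    have k2 : N' ≤ M+1 := by
      rcases hN'.eq with h | ⟨c, hc⟩
      · have := hM.nonneg; omega
      · have := hM.le c; rw [ht_erase m1] at hc; split_ifs at hc <;> omega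
    omega
  rcases key with rfl | rfl; exacts [Or.inl hN', Or.inr hN']

lemma Low1.gap (h : Low1 M K U) (hN : IsMax K.2.1 K.2.2 N) (h' : Low2 (N+1) U A) :
    IsMax A.1 A.2.1 (M-1) := by
  obtain ⟨p, hp, rfl⟩ := h; obtain ⟨q, hq, rfl⟩ := h'
  obtain ⟨K1, K2, K3⟩ := K
  dsimp only at *
  obtain ⟨m1, m2, m3⟩ := hp.mem
  obtain ⟨n1, n2, n3⟩ := hq.mem
  have hpq : p ≤ q := by
    by_contra hcon
    have a1 := hq.eq; have a2 := hN.le q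
    rw [ht_insert m2, if_neg (by omega)] at a1; omega
  have hd := hp.decrease
  refine ⟨hd.nonneg, fun c => ?_, Or.inr ⟨p-1, ?_⟩⟩
  · rw [ht_erase n1, ht_erase_insert m1 m2]
    have := hp.le c; have := hp.lt c
    split_ifs <;> omega
  · rw [ht_erase n1, ht_erase_insert m1 m2, if_neg (by omega), if_neg (by omega), m3]; ring

lemma Low2.gap (h : Low2 N K V) (hM : IsMax K.1 K.2.1 M) (h' : Low1 (M+1) V C) :
    IsMax C.2.1 C.2.2 (N-1) := by
  obtain ⟨q, hq, rfl⟩ := h; obtain ⟨p, hp, rfl⟩ := h'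
  obtain ⟨K1, K2, K3⟩ := K
  dsimp only at *
  obtain ⟨m1, m2, m3⟩ := hp.mem
  obtain ⟨n1, n2, n3⟩ := hq.mem
  have hpq : q ≤ p := by
    by_contra hcon
    have a1 := hp.eq; have a2 := hM.le p
    rw [ht_erase n1, if_neg (by omega)] at a1; omega
  have hd := hq.decrease
  refine ⟨hd.nonneg, fun c => ?_, Or.inr ⟨q-1, ?_⟩⟩
  · rw [ht_insert m2, ht_erase_insert n1 n2]
    have := hq.le c; have := hq.lt c
    split_ifs <;> omega
  · rw [ht_insert m2, ht_erase_insert n1 n2, if_neg (by omega), if_neg (by omega), n3]; ring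

lemma Low1.square (h1 : Low1 M K U) (h2 : Low2 N K V) (h : IsMax U.2.1 U.2.2 N) :
    ∃ Y, Low2 N U Y ∧ Low1 (M+1) V Y := by
  obtain ⟨p, hp, rfl⟩ := h1; obtain ⟨q, hq, rfl⟩ := h2
  obtain ⟨K1, K2, K3⟩ := K
  have hle := fun c => h.le c
  dsimp only at *
  obtain ⟨m1, m2, m3⟩ := hp.mem
  obtain ⟨n1, n2, n3⟩ := hq.mem
  have hpq : q < p := by
    by_contra hcon
    have a1 := hle q; have a2 := hq.eq
    rw [ht_insert m2, if_pos (by omega)] at a1; omega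
  refine ⟨(K1.erase p, (insert p K2).erase q, insert q K3), ⟨q, ⟨hq.pos, hle, ?_, fun c hc => ?_⟩, rfl⟩,
    p, ⟨by have := hp.pos; omega, fun c => ?_, ?_, fun c hc => ?_⟩, ?_⟩ <;> dsimp only
  · rw [ht_insert m2, if_neg (by omega), hq.eq, add_zero]
  · rw [ht_insert m2, if_neg (by omega), add_zero]; exact hq.lt c hc
  · rw [ht_erase n1]; have := hp.le c; split_ifs <;> omega
  · rw [ht_erase n1, if_pos (by omega), hp.eq]
  · rw [ht_erase n1]; have := hp.lt c hc; split_ifs <;> omega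
  · refine Prod.ext rfl (Prod.ext ?_ rfl)
    ext c; simp only [mem_insert, mem_erase]; grind

lemma Low2.square (h1 : Low1 M K U) (h2 : Low2 N K V) (h : IsMax V.1 V.2.1 M) :
    ∃ Y, Low1 M V Y ∧ Low2 (N+1) U Y := by
  obtain ⟨p, hp, rfl⟩ := h1; obtain ⟨q, hq, rfl⟩ := h2
  obtain ⟨K1, K2, K3⟩ := K
  have hle := fun c => h.le c
  dsimp only at *
  obtain ⟨m1, m2, m3⟩ := hp.mem
  obtain ⟨n1, n2, n3⟩ := hq.mem
  have hpq : p < q := by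
    by_contra hcon
    have a1 := hle p; have a2 := hp.eq; have : p ≠ q := by rintro rfl; exact m2 n1
    rw [ht_erase n1, if_pos (by omega)] at a1; omega
  refine ⟨(K1.erase p, insert p (K2.erase q), insert q K3), ⟨p, ⟨hp.pos, hle, ?_, fun c hc => ?_⟩, rfl⟩,
    q, ⟨by have := hq.pos; omega, fun c => ?_, ?_, fun c hc => ?_⟩, ?_⟩ <;> dsimp only
  · rw [ht_erase n1, if_neg (by omega), hp.eq, add_zero]
  · rw [ht_erase n1, if_neg (by omega), add_zero]; exact hp.lt c hc
  · rw [ht_insert m2]; have := hq.le c; split_ifs <;> omega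
  · rw [ht_insert m2, if_pos (by omega), hq.eq]
  · rw [ht_insert m2]; have := hq.lt c hc; split_ifs <;> omega
  · refine Prod.ext rfl (Prod.ext ?_ rfl)
    ext c; simp only [mem_insert, mem_erase]; grind

/-- A recognition principle for a lowering, with its effect on the two excess functions. -/
lemma exists_low1 {p : ℤ} (hM : 0 < M) (h : ∀ c, ht K.1 K.2.1 c ≤ M ∧ (c < p → ht K.1 K.2.1 c < M))
    (hp : ht K.1 K.2.1 p = M) : ∃ U : Tri, Low1 M K U ∧ U = (K.1.erase p, insert p K.2.1, K.2.2) ∧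
      (∀ c, ht U.1 U.2.1 c = ht K.1 K.2.1 c-if p ≤ c then 2 else 0) ∧
      ∀ c, ht U.2.1 U.2.2 c = ht K.2.1 K.2.2 c+if p ≤ c then 1 else 0 := by
  have hf : FirstMax K.1 K.2.1 M p := ⟨hM, fun c => (h c).1, hp, fun c => (h c).2⟩
  exact ⟨_, ⟨p, hf, rfl⟩, rfl, ht_erase_insert hf.mem.1 hf.mem.2.1, ht_insert hf.mem.2.1⟩

lemma exists_low2 {p : ℤ} (hM : 0 < M) (h : ∀ c, ht K.2.1 K.2.2 c ≤ M ∧ (c < p → ht K.2.1 K.2.2 c < M))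
    (hp : ht K.2.1 K.2.2 p = M) : ∃ U : Tri, Low2 M K U ∧ U = (K.1, K.2.1.erase p, insert p K.2.2) ∧
      (∀ c, ht U.1 U.2.1 c = ht K.1 K.2.1 c+if p ≤ c then 1 else 0) ∧
      ∀ c, ht U.2.1 U.2.2 c = ht K.2.1 K.2.2 c-if p ≤ c then 2 else 0 := by
  have hf : FirstMax K.2.1 K.2.2 M p := ⟨hM, fun c => (h c).1, hp, fun c => (h c).2⟩
  exact ⟨_, ⟨p, hf, rfl⟩, rfl, ht_erase hf.mem.1, ht_erase_insert hf.mem.1 hf.mem.2.1⟩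

/-- The places of the lowerings in an octagon. -/
lemma exists_places {f g : ℤ → ℤ} {p q : ℤ} (hne : p ≠ q) (hf : ∀ c, f c ≤ M ∧ (c < p → f c < M))
    (hg : ∀ c, g c ≤ N ∧ (c < q → g c < N)) (p0 : f p = M) (q0 : g q = N) (p3 : f (p-1) = M-1)
    (q3 : g (q-1) = N-1) (e1 : ∃ c, p ≤ c ∧ g c = N) (e2 : ∃ c, q ≤ c ∧ f c = M) : ∃ p' q' p1 p2 q1 q2,
      ((p < q ∧ q ≤ p' ∧ p ≤ q' ∧ q' < q ∧ p1 = p' ∧ p2 = p ∧ q1 = q ∧ q2 = q' ∧ f p' = M ∧ g q' = N-1 ∧ f p1 = M ∧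
        f p2 = M ∧ g q1 = N ∧ g q2 = N-1) ∨
      (q < p ∧ q ≤ p' ∧ p ≤ q' ∧ p' < p ∧ p1 = p ∧ p2 = p' ∧ q1 = q' ∧ q2 = q ∧ f p' = M-1 ∧ g q' = N ∧ f p1 = M ∧
        f p2 = M-1 ∧ g q1 = N ∧ g q2 = N)) ∧
      ∀ c, (q ≤ c → c < p' → f c < f p') ∧ (p ≤ c → c < q' → g c < g q') := by
  rcases lt_or_gt_of_ne hne with hlt | hlt
  · obtain ⟨p', r1, r2, r3⟩ := exists_first q e2
    obtain ⟨q', s1, s2, s3⟩ := exists_first (P := fun c => g c = N-1) p ⟨q-1, by omega, q3⟩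
    have := s3 (q-1); have : q' < q := by omega
    refine ⟨p', q', p', p, q, q', Or.inl (by omega), fun c => ?_⟩
    have := hf c; have := hg c; have := r3 c; have := s3 c; omega
  · obtain ⟨q', r1, r2, r3⟩ := exists_first p e1
    obtain ⟨p', s1, s2, s3⟩ := exists_first (P := fun c => f c = M-1) q ⟨p-1, by omega, p3⟩
    have := s3 (p-1); have : p' < p := by omega
    refine ⟨p', q', p, p', q', q, Or.inr (by omega), fun c => ?_⟩
    have := hf c; have := hg c; have := r3 c; have := s3 c; omega

lemma Low1.octagon (h1 : Low1 M K U) (h2 : Low2 N K V) (h : IsMax U.2.1 U.2.2 (N+1))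
    (h' : IsMax V.1 V.2.1 (M+1)) :
    ∃ A B C D Y, Low2 (N+1) U A ∧ Low2 N A B ∧ Low1 M B Y ∧
      Low1 (M+1) V C ∧ Low1 M C D ∧ Low2 N D Y := by
  obtain ⟨p, hp, eU⟩ := h1; obtain ⟨q, hq, eV⟩ := h2
  have hM := hp.pos; have hN := hq.pos; have hf := fun c => And.intro (hp.le c) (hp.lt c)
  have hg := fun c => And.intro (hq.le c) (hq.lt c)
  obtain ⟨U, -, rfl, u1, u2⟩ := exists_low1 hM hf hp.eq
  obtain ⟨V, -, rfl, v1, v2⟩ := exists_low2 hN hg hq.eq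
  rw [← eU] at u1 u2
  rw [← eV] at v1 v2
  have y1 := hp.mem; have z1 := hq.mem
  obtain ⟨p', q', p1, p2, q1, q2, hc, F⟩ := exists_places (by rintro rfl; exact y1.2.1 z1.1) hf hg hp.eq hq.eq y1.2.2 z1.2.2
    (by
      rcases h.eq with h | ⟨c, hc⟩
      · omega
      · rw [u2] at hc
        exact ⟨c, by have := hg c; split_ifs at hc <;> omega⟩)
    (by
      rcases h'.eq with h | ⟨c, hc⟩
      · omega
      · rw [v1] at hc
        exact ⟨c, by have := hf c; split_ifs at hc <;> omega⟩)
  replace F := fun c => And.intro (F c) (And.intro (hf c) (hg c))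
  obtain ⟨A, x1, eA, a1, a2⟩ := exists_low2 (K := U) (M := N+1) (p := q1) (by omega)
    (fun c => by have := F c; rw [u2]; split_ifs <;> omega) (by rw [u2]; split_ifs <;> omega)
  obtain ⟨B, x2, eB, b1, b2⟩ := exists_low2 (K := A) (M := N) (p := q2) (by omega)
    (fun c => by have := F c; rw [a2, u2]; split_ifs <;> omega) (by rw [a2, u2]; split_ifs <;> omega)
  obtain ⟨Y, x3, eY, -⟩ := exists_low1 (K := B) (M := M) (p := p') (by omega)
    (fun c => by have := F c; rw [b1, a1, u1]; split_ifs <;> omega) (by rw [b1, a1, u1]; split_ifs <;> omega)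
  obtain ⟨C, x4, eC, c1, c2⟩ := exists_low1 (K := V) (M := M+1) (p := p1) (by omega)
    (fun c => by have := F c; rw [v1]; split_ifs <;> omega) (by rw [v1]; split_ifs <;> omega)
  obtain ⟨D, x5, eD, d1, d2⟩ := exists_low1 (K := C) (M := M) (p := p2) (by omega)
    (fun c => by have := F c; rw [c1, v1]; split_ifs <;> omega) (by rw [c1, v1]; split_ifs <;> omega)
  obtain ⟨Z, x6, eZ, -⟩ := exists_low2 (K := D) (M := N) (p := q') (by omega)
    (fun c => by have := F c; rw [d2, c2, v2]; split_ifs <;> omega) (by rw [d2, c2, v2]; split_ifs <;> omega)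
  refine ⟨A, B, C, D, Y, x1, x2, x3, x4, x5, ?_⟩
  convert x6 using 1
  subst eA eB eC eD eY eZ eU eV
  refine Prod.ext ?_ (Prod.ext ?_ ?_) <;> ext c <;> simp only [mem_insert, mem_erase] <;> grind

end

/-! #### The chart of three layers -/

/-- The chart of three layers: vertical strips `X.1`, `X.2.1`, `X.2.2` followed by horizontal strips
`K.1`, `K.2.1`, `K.2.2`. -/
def Chart3 (V1 H1 V2 H2 V3 H3 : Finset ℤ) (X K : Tri) : Prop :=
  ∃ L1 Y2 L2 M1 Y3 Z3 g₁ g₂ g3, Doubled V1 H1 X.1 L1 ∧ Doubled V2 H2 Y2 L2 ∧ Doubled V3 H3 Y3 K.2.2 ∧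
    Rot L1 Y2 X.2.1 M1 g₁ ∧ Rot L2 Y3 Z3 K.2.1 g₂ ∧ Rot M1 Z3 X.2.2 K.1 g3

/-- The reflection of a triple. -/
def reflTri (X : Tri) : Tri := (refl X.1, refl X.2.1, refl X.2.2)

lemma reflTri_injective : Function.Injective reflTri := by
  rintro ⟨a, b, c⟩ ⟨a', b', c'⟩ h; simp only [reflTri, Prod.mk.injEq] at h
  obtain ⟨h1, h2, h3⟩ := h
  rw [refl_injective h1, refl_injective h2, refl_injective h3]

section
variable {σ0 σ1 σ2 σ3 : ℤ → ℤ} {V1 H1 V2 H2 V3 H3 V1' H1' V2' H2' V3' H3' : Finset ℤ} {X K X' K' : Tri}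

lemma Chart3.exists (L1 : Layer σ0 σ1 V1 H1) (L2 : Layer σ1 σ2 V2 H2) (L3 : Layer σ2 σ3 V3 H3) :
    ∃ X K, Chart3 V1 H1 V2 H2 V3 H3 X K := by
  obtain ⟨X1, M1, d1⟩ := Doubled.exists L1.disj
  obtain ⟨Y2, M2, d2⟩ := Doubled.exists L2.disj
  obtain ⟨Y3, K3, d3⟩ := Doubled.exists L3.disj
  obtain ⟨_, a1, b1⟩ := d1.strips L1
  obtain ⟨_, a2, b2⟩ := d2.strips L2
  obtain ⟨_, a3, b3⟩ := d3.strips L3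
  obtain ⟨α, X2, N1, s1⟩ := exists_switch b1 a2
  obtain ⟨β, Z3, K2, s2⟩ := exists_switch b2 a3
  obtain ⟨g₁, r₁⟩ := s1.rot
  obtain ⟨g₂, r₂⟩ := s2.rot
  obtain ⟨τ, X3, K1, s3⟩ := exists_switch s1.hH' s2.hV'
  obtain ⟨g3, r3⟩ := s3.rot
  exact ⟨(X1, X2, X3), (K1, K2, K3), M1, Y2, M2, N1, Y3, Z3, g₁, g₂, g3, d1, d2, d3, r₁, r₂, r3⟩

lemma Chart3.unique (h : Chart3 V1 H1 V2 H2 V3 H3 X K) (h' : Chart3 V1 H1 V2 H2 V3 H3 X' K') :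
    X = X' ∧ K = K' := by
  obtain ⟨L1, Y2, L2, M1, Y3, Z3, g₁, g₂, g3, d1, d2, d3, r₁, r₂, r3⟩ := h
  obtain ⟨L1', Y2', L2', M1', Y3', Z3', g1', g2', g3', d1', d2', d3', r1', r2', r3'⟩ := h'
  obtain ⟨e1, rfl⟩ := d1.unique d1'
  obtain ⟨rfl, rfl⟩ := d2.unique d2'
  obtain ⟨rfl, e2⟩ := d3.unique d3'
  obtain ⟨e3, rfl⟩ := r₁.unique r1'
  obtain ⟨rfl, e4⟩ := r₂.unique r2'
  obtain ⟨e5, e6⟩ := r3.unique r3'; exact ⟨Prod.ext e1 (Prod.ext e3 e5), Prod.ext e6 (Prod.ext e4 e2)⟩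

/-- A chart determines the layers. -/
lemma Chart3.injective (h : Chart3 V1 H1 V2 H2 V3 H3 X K) (h' : Chart3 V1' H1' V2' H2' V3' H3' X K)
    (n1 : ∀ c ∈ V1 ∪ H1 ∪ V2 ∪ H2 ∪ V3 ∪ H3, 0 ≤ c) (n2 : ∀ c ∈ V1' ∪ H1' ∪ V2' ∪ H2' ∪ V3' ∪ H3', 0 ≤ c) :
    V1 = V1' ∧ H1 = H1' ∧ V2 = V2' ∧ H2 = H2' ∧ V3 = V3' ∧ H3 = H3' := by
  obtain ⟨L1, Y2, L2, M1, Y3, Z3, g₁, g₂, g3, d1, d2, d3, r₁, r₂, r3⟩ := h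
  obtain ⟨L1', Y2', L2', M1', Y3', Z3', g1', g2', g3', d1', d2', d3', r1', r2', r3'⟩ := h'
  obtain ⟨rfl, rfl⟩ := r3.unique_symm r3'
  obtain ⟨rfl, rfl⟩ := r₁.unique_symm r1'
  obtain ⟨rfl, rfl⟩ := r₂.unique_symm r2'
  have e1 := d1.right (fun c hc => n1 c (by simp [hc])) (fun c hc => n1 c (by simp [hc]))
  have e2 := d2.right (fun c hc => n1 c (by simp [hc])) (fun c hc => n1 c (by simp [hc]))
  have e3 := d3.right (fun c hc => n1 c (by simp [hc])) (fun c hc => n1 c (by simp [hc]))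
  have f1 := d1'.right (fun c hc => n2 c (by simp [hc])) (fun c hc => n2 c (by simp [hc]))
  have f2 := d2'.right (fun c hc => n2 c (by simp [hc])) (fun c hc => n2 c (by simp [hc]))
  have f3 := d3'.right (fun c hc => n2 c (by simp [hc])) (fun c hc => n2 c (by simp [hc]))
  exact ⟨e1.1.trans f1.1.symm, e1.2.trans f1.2.symm, e2.1.trans f2.1.symm, e2.2.trans f2.2.symm,
    e3.1.trans f3.1.symm, e3.2.trans f3.2.symm⟩

lemma IsMax.zero_iff {A B : Finset ℤ} : IsMax A B 0 ↔ ∀ c, ht A B c ≤ 0 :=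
  ⟨fun h => h.le, fun h => ⟨le_rfl, h, Or.inl rfl⟩⟩

variable {σ1' σ2' : ℤ → ℤ} {W1 W2 : Finset ℤ} {M p : ℤ}

lemma Chart3.low1 (L1 : Layer σ0 σ1 V1 H1) (L2 : Layer σ1 σ2 V2 H2) (L3 : Layer σ2 σ3 V3 H3)
    (w : Word V1 H1 V2 H2 W1 W2) (L1' : Layer σ0 σ1' V1' H1') (L2' : Layer σ1' σ2' V2' H2')
    (w' : Word V1' H1' V2' H2' (W1.erase p) (insert p W2)) (hf : FirstMax W1 W2 M p)
    (h : Chart3 V1 H1 V2 H2 V3 H3 X K) :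
    ∃ X' K', Chart3 V1' H1' V2' H2' V3 H3 X' K' ∧ Low1 M K K' ∧ Low1 M (reflTri X) (reflTri X') := by
  obtain ⟨M1, Y2, M2, N1, Y3, Z3, g₁, g₂, g3, d1, d2, d3, r₁, r₂, r3⟩ := h
  obtain ⟨_, a1, b1⟩ := d1.strips L1
  obtain ⟨_, a2, b2⟩ := d2.strips L2
  obtain ⟨_, a3, b3⟩ := d3.strips L3
  have s1 := r₁.strips b1 a2; have s2 := r₂.strips b2 a3; have s3 := r3.strips s1.hH' s2.hV'
  obtain ⟨q, r, k1, k2, Y2', M1', g1', e1, e2, e3⟩ :=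
    Chart.lowering L1 L2 w L1' L2' w' hf ⟨Y2, M1, g₁, d1, d2, r₁⟩
  obtain ⟨s, Z3', _, _, l1, S⟩ := Slide.lowering ⟨s2, s3⟩ k2
  obtain ⟨g2', r2'⟩ := S.outer.rot
  obtain ⟨g3', r3'⟩ := S.inner.rot
  refine ⟨(X.1.erase (-1-q), insert (-1-q) X.2.1, X.2.2), (K.1.erase s, insert s K.2.1, K.2.2),
    ⟨M1', Y2', _, _, Y3, Z3', g1', g2', g3', e1, e2, d3, e3, r2', r3'⟩, ⟨s, l1, rfl⟩, ⟨q, k1, ?_⟩⟩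
  simp only [reflTri, refl_erase, refl_insert, sub_sub_cancel]

lemma Chart3.zero1 (L1 : Layer σ0 σ1 V1 H1) (L2 : Layer σ1 σ2 V2 H2) (L3 : Layer σ2 σ3 V3 H3)
    (w : Word V1 H1 V2 H2 W1 W2) (hm : IsMax W1 W2 0) (h : Chart3 V1 H1 V2 H2 V3 H3 X K) :
    IsMax K.1 K.2.1 0 ∧ IsMax (reflTri X).1 (reflTri X).2.1 0 := by
  obtain ⟨M1, Y2, M2, N1, Y3, Z3, g₁, g₂, g3, d1, d2, d3, r₁, r₂, r3⟩ := h
  obtain ⟨_, a1, b1⟩ := d1.strips L1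
  obtain ⟨_, a2, b2⟩ := d2.strips L2
  obtain ⟨_, a3, b3⟩ := d3.strips L3
  have s1 := r₁.strips b1 a2; have s2 := r₂.strips b2 a3; have s3 := r3.strips s1.hH' s2.hV'
  obtain ⟨k1, k2⟩ := Chart.ht_le L1 L2 w ⟨Y2, M1, g₁, d1, d2, r₁⟩ hm.le
  exact ⟨IsMax.zero_iff.2 fun c => Slide.ht_le_of_le ⟨s2, s3⟩ r₂ r3 k2 c, IsMax.zero_iff.2 k1⟩

lemma Chart3.low2 (L1 : Layer σ0 σ1 V1 H1) (L2 : Layer σ1 σ2 V2 H2) (L3 : Layer σ2 σ3 V3 H3)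
    (w : Word V2 H2 V3 H3 W1 W2) (L2' : Layer σ1 σ1' V2' H2') (L3' : Layer σ1' σ2' V3' H3')
    (w' : Word V2' H2' V3' H3' (W1.erase p) (insert p W2)) (hf : FirstMax W1 W2 M p)
    (h : Chart3 V1 H1 V2 H2 V3 H3 X K) :
    ∃ X' K', Chart3 V1 H1 V2' H2' V3' H3' X' K' ∧ Low2 M K K' ∧ Low2 M (reflTri X) (reflTri X') := by
  obtain ⟨M1, Y2, M2, N1, Y3, Z3, g₁, g₂, g3, d1, d2, d3, r₁, r₂, r3⟩ := h
  obtain ⟨_, a1, b1⟩ := d1.strips L1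
  obtain ⟨_, a2, b2⟩ := d2.strips L2
  obtain ⟨_, a3, b3⟩ := d3.strips L3
  have s1 := r₁.strips b1 a2; have s2 := r₂.strips b2 a3; have s3 := r3.strips s1.hH' s2.hV'
  obtain ⟨q, r, k1, k2, Y3', M2', g2', e1, e2, e3⟩ :=
    Chart.lowering L2 L3 w L2' L3' w' hf ⟨Y3, M2, g₂, d2, d3, r₂⟩
  obtain ⟨s, U, _, _, l1, S⟩ := Slide.lifting ⟨s3.refl, s1.refl⟩ k1
  obtain ⟨g3', r3'⟩ := S.outer.rot
  obtain ⟨g1', r1'⟩ := S.inner.rot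
  have t3 := r3'.refl; have t1 := r1'.refl; simp only [refl_refl, refl_erase, refl_insert] at t1 t3
  refine ⟨(X.1, X.2.1.erase (-1-s), insert (-1-s) X.2.2), (K.1, K.2.1.erase r, insert r K.2.2),
    ⟨M1, _, M2', _, Y3', _, _, g2', _, d1, e1, e2, t1, e3, t3⟩, ⟨r, k2, rfl⟩, ⟨s, l1, ?_⟩⟩
  simp only [reflTri, refl_erase, refl_insert, sub_sub_cancel]

lemma Chart3.zero2 (L1 : Layer σ0 σ1 V1 H1) (L2 : Layer σ1 σ2 V2 H2) (L3 : Layer σ2 σ3 V3 H3)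
    (w : Word V2 H2 V3 H3 W1 W2) (hm : IsMax W1 W2 0) (h : Chart3 V1 H1 V2 H2 V3 H3 X K) :
    IsMax K.2.1 K.2.2 0 ∧ IsMax (reflTri X).2.1 (reflTri X).2.2 0 := by
  obtain ⟨M1, Y2, M2, N1, Y3, Z3, g₁, g₂, g3, d1, d2, d3, r₁, r₂, r3⟩ := h
  obtain ⟨_, a1, b1⟩ := d1.strips L1
  obtain ⟨_, a2, b2⟩ := d2.strips L2
  obtain ⟨_, a3, b3⟩ := d3.strips L3
  have s1 := r₁.strips b1 a2; have s2 := r₂.strips b2 a3; have s3 := r3.strips s1.hH' s2.hV'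
  obtain ⟨k1, k2⟩ := Chart.ht_le L2 L3 w ⟨Y3, M2, g₂, d2, d3, r₂⟩ hm.le
  refine ⟨IsMax.zero_iff.2 k2, IsMax.zero_iff.2 ?_⟩
  rcases exists_firstMax_or (reflTri X).2.1 (reflTri X).2.2 with h | ⟨M', p', h⟩
  · exact h
  · obtain ⟨s, _, _, _, l1, -⟩ := Slide.lowering ⟨s3.refl, s1.refl⟩ h
    have := k1 s; have := l1.eq; have := l1.pos; omega

end

end Strip

/-! ### A criterion for regularity -/

namespace ColoredDigraph

variable {V : Type*} (G : ColoredDigraph V)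

/-- A string statistic counts the edges after a vertex. -/
lemma eps_eq {i : ℕ} (ep : V → ℤ) (h0 : ∀ x, 0 ≤ ep x) (h1 : ∀ x y, G.edge i x y → ep y = ep x-1)
    (h2 : ∀ x, 0 < ep x → ∃ y, G.edge i x y) (x : V) : (G.eps i x : ℤ) = ep x := by
  have hle : ∀ d x y, G.Path i d x y → (d : ℤ) ≤ ep x := by
    intro d
    induction d with
    | zero => intro x y _; simpa using h0 x
    | succ d ih =>
      rintro x y ⟨z, hz, hp⟩
      have := ih z y hp; have := h1 x z hz
      push_cast; omega
  have hex : ∀ d : ℕ, ∀ x, ep x = d → ∃ y, G.Path i d x y := by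
    intro d
    induction d with
    | zero => intro x _; exact ⟨x, rfl⟩
    | succ d ih =>
      intro x hx
      push_cast at hx
      obtain ⟨z, hz⟩ := h2 x (by omega)
      obtain ⟨y, hy⟩ := ih z (by have := h1 x z hz; omega); exact ⟨y, z, hz, hy⟩
  have : G.eps i x = (ep x).toNat := by
    unfold eps
    refine IsGreatest.csSup_eq ⟨?_, ?_⟩
    · exact hex _ x (by have := h0 x; omega)
    · rintro d ⟨y, hy⟩
      have := hle d x y hy; omega
  have := h0 x; omega

lemma Path.snoc {i : ℕ} : ∀ {d : ℕ} {x y z : V}, G.Path i d x y → G.edge i y z → G.Path i (d+1) x z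
  | 0, _, _, z, h, h' => ⟨z, h ▸ h', rfl⟩
  | _+1, _, _, _, ⟨w, hw, hp⟩, h' => ⟨w, hw, Path.snoc hp h'⟩

/-- A string statistic counts the edges before a vertex. -/
lemma delta_eq {i : ℕ} (de : V → ℤ) (h0 : ∀ x, 0 ≤ de x) (h1 : ∀ x y, G.edge i x y → de y = de x+1)
    (h2 : ∀ x, 0 < de x → ∃ y, G.edge i y x) (x : V) : (G.delta i x : ℤ) = de x := by
  have hle : ∀ d x y, G.Path i d y x → (d : ℤ) ≤ de x := by
    intro d x y h
    have : de x = de y+d := by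
      induction d generalizing y with
      | zero => cases h; simp
      | succ d ih =>
        obtain ⟨z, hz, hp⟩ := h
        have := ih z hp; have := h1 y z hz
        push_cast; omega
    have := h0 y; omega
  have hex : ∀ d : ℕ, ∀ x, de x = d → ∃ y, G.Path i d y x := by
    intro d
    induction d with
    | zero => intro x _; exact ⟨x, rfl⟩
    | succ d ih =>
      intro x hx
      push_cast at hx
      obtain ⟨z, hz⟩ := h2 x (by omega)
      obtain ⟨y, hy⟩ := ih z (by have := h1 z x hz; omega); exact ⟨y, Path.snoc G hy hz⟩
  have : G.delta i x = (de x).toNat := by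
    unfold delta
    refine IsGreatest.csSup_eq ⟨?_, ?_⟩
    · exact hex _ x (by have := h0 x; omega)
    · rintro d ⟨y, hy⟩
      have := hle d x y hy; omega
  have := h0 x; omega

/-- The properties of the edges of one colour and of its string statistics. -/
structure Strings (R : V → V → Prop) (ep de : V → ℤ) : Prop where
  ep_nonneg : ∀ x, 0 ≤ ep x
  de_nonneg : ∀ x, 0 ≤ de x
  ep_edge : ∀ {x y}, R x y → ep y = ep x-1
  de_edge : ∀ {x y}, R x y → de y = de x+1
  exists_down : ∀ {x}, 0 < ep x → ∃ y, R x y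
  exists_up : ∀ {x}, 0 < de x → ∃ y, R y x
  func : ∀ {x y z}, R x y → R x z → y = z
  inj : ∀ {x y z}, R y x → R z x → y = z

/-- How the edges of a colour `R` interact with an adjacent colour `S`. -/
structure Near (R S : V → V → Prop) (eR eS dS : V → ℤ) : Prop where
  mono : ∀ {x u}, R x u → eS u = eS x ∨ eS u = eS x+1
  weight : ∀ {x u}, R x u → dS u = dS x+(eS u-eS x)-1
  square : ∀ {x u v}, R x u → S x v → eS u = eS x → ∃ y, S u y ∧ R v y ∧ eR v = eR x+1
  gap : ∀ {x u a}, R x u → eS u = eS x+1 → S u a → eR a = eR u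

/-- The octagon relation of two adjacent colours. -/
def Octagon (R S : V → V → Prop) (eR eS : V → ℤ) : Prop :=
  ∀ {x u v}, R x u → S x v → eS u = eS x+1 → eR v = eR x+1 →
    ∃ y a b c d, (S u a ∧ S a b ∧ R b y) ∧ (R v c ∧ R c d ∧ S d y)

lemma Octagon.symm {R S : V → V → Prop} {eR eS : V → ℤ} (h : Octagon R S eR eS) : Octagon S R eS eR :=
  fun h1 h2 h3 h4 => by
    obtain ⟨y, a, b, c, d, k1, k2⟩ := h h2 h1 h4 h3; exact ⟨y, c, d, a, b, k2, k1⟩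

/-- How the edges of a colour `R` interact with a distant colour `S`. -/
structure Far (R S : V → V → Prop) (eS dS : V → ℤ) : Prop where
  ep : ∀ {x u}, R x u → eS u = eS x
  de : ∀ {x u}, R x u → dS u = dS x
  square : ∀ {x u v}, R x u → S x v → ∃ y, S u y ∧ R v y

section
variable {R S : V → V → Prop} {eR dR eS dS : V → ℤ} {x u v : V}

lemma Near.square_down (hR : Strings R eR dR) (h : Near R S eR eS dS)
    (h' : Near S R eS eR dR) (hu : R x u) (hv : S x v) (he : eS u = eS x) :
    ∃ y, R v y ∧ S u y ∧ dR y = dR u := by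
  obtain ⟨y, h1, h2, h3⟩ := h.square hu hv he
  refine ⟨y, h2, h1, ?_⟩
  have := h'.weight h1; have := hR.ep_edge h2; have := hR.ep_edge hu; omega

lemma Near.square_up (hR : Strings R eR dR) (hS : Strings S eS dS) (h : Near R S eR eS dS)
    (h' : Near S R eS eR dR) (hu : R u x) (hv : S v x) (he : dS x = dS u) :
    ∃ y, R y v ∧ S y u ∧ eR y = eR u := by
  have e1 : eS x = eS u+1 := by have := h.weight hu; omega
  have := hS.de_edge hv; have := hS.de_nonneg v
  obtain ⟨y, hy⟩ := hS.exists_up (x := u) (by omega)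
  have e2 : eR u = eR y := by
    rcases h'.mono hy with e | e
    · exact e
    · have := h'.gap hy e hu; omega
  have := hR.ep_edge hu; have := hR.ep_nonneg x
  obtain ⟨w, hw⟩ := hR.exists_down (x := y) (by omega)
  obtain ⟨z, k1, k2, -⟩ := h'.square hy hw e2
  obtain rfl := hR.func k1 hu
  obtain rfl := hS.inj k2 hv; exact ⟨y, hw, hy, e2.symm⟩

lemma Near.octagon_down (hR : Strings R eR dR) (hS : Strings S eS dS) (h : Near R S eR eS dS)
    (h' : Near S R eS eR dR) (ho : Octagon R S eR eS) (hu : R x u) (hv : S x v) (e1 : eS u = eS x+1)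
    (e2 : eR v = eR x+1) :
    ∃ y a b c d, (S u a ∧ S a b ∧ R b y) ∧ (R v c ∧ R c d ∧ S d y) ∧ dS y = dS b-1 ∧ dR y = dR d-1 := by
  obtain ⟨y, a, b, c, d, ⟨k1, k2, k3⟩, k4, k5, k6⟩ := ho hu hv e1 e2
  refine ⟨y, a, b, c, d, ⟨k1, k2, k3⟩, ⟨k4, k5, k6⟩, ?_⟩
  have := hS.ep_edge k1; have := hS.ep_edge k2; have := hR.ep_edge k3
  have := hR.ep_edge k4; have := hR.ep_edge k5; have := hS.ep_edge k6; have := hR.ep_edge hu; have := hS.ep_edge hv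
  have g1 := h.gap hu e1 k1; have g2 := h'.gap hv e2 k4; have := h.weight k3; have := h'.weight k6
  have := h.mono k3; have := h'.mono k6; have := h.mono k5; have := h'.mono k2; omega

lemma Near.octagon_up (hR : Strings R eR dR) (hS : Strings S eS dS) (h : Near R S eR eS dS)
    (h' : Near S R eS eR dR) (ho : Octagon R S eR eS) (hu : R u x) (hv : S v x) (e1 : dS x = dS u-1)
    (e2 : dR x = dR v-1) :
    ∃ y a b c d, (S a u ∧ S b a ∧ R y b) ∧ (R c v ∧ R d c ∧ S y d) ∧ eS b = eS y+1 ∧ eR d = eR y+1 := by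
  have f1 : eS x = eS u := by have := h.weight hu; omega
  have f2 : eR x = eR v := by have := h'.weight hv; omega
  have u1 := hS.de_edge hv; have u2 := hS.de_nonneg v; have u3 := hR.ep_edge hu; have u4 := hS.ep_edge hv
  have u5 := hR.ep_nonneg x
  obtain ⟨a, ha⟩ := hS.exists_up (x := u) (by omega)
  have a1 := hS.de_edge ha; have a2 := hS.ep_edge ha
  obtain ⟨b, hb⟩ := hS.exists_up (x := a) (by omega)
  have b1 := hS.ep_edge hb; have b0 := hS.ep_nonneg u
  have f3 : eR u = eR a+1 := by
    rcases h'.mono ha with e | e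
    · obtain ⟨w, hw⟩ := hR.exists_down (x := a) (by omega)
      obtain ⟨z, k1, k2, k3⟩ := h'.square ha hw e
      obtain rfl := hR.func k1 hu
      obtain rfl := hS.inj k2 hv; omega
    · exact e
  have f4 : eR a = eR b := by
    rcases h'.mono hb with e | e
    · exact e
    · have := hR.ep_nonneg b
      obtain ⟨w, hw⟩ := hR.exists_down (x := a) (by omega)
      have k := h'.gap hb e hw
      obtain ⟨z, k1, k2, k3⟩ := h.square hw ha k
      obtain rfl := hR.func k2 hu
      obtain rfl := hS.inj k1 hv
      have := hR.ep_edge hw; omega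
  have := h'.weight hb; have := hR.de_nonneg a
  obtain ⟨y, hy⟩ := hR.exists_up (x := b) (by omega)
  have y1 := hR.ep_edge hy
  have f5 : eS b = eS y+1 := by
    rcases h.mono hy with e | e
    · obtain ⟨z, hz⟩ := hS.exists_down (x := y) (by omega)
      obtain ⟨t, k1, k2, k3⟩ := h.square hy hz e
      obtain rfl := hS.func k1 hb
      have := hR.ep_edge k2; omega
    · exact e
  obtain ⟨z, hz⟩ := hS.exists_down (x := y) (by omega)
  have z1 := hS.ep_edge hz
  have f6 : eR z = eR y+1 := by
    rcases h'.mono hz with e | e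
    · obtain ⟨t, k1, k2, k3⟩ := h'.square hz hy e
      obtain rfl := hS.func k2 hb
      have := h.gap k1 (by omega) ha; omega
    · exact e
  obtain ⟨Y, A, B, C, D, ⟨k1, k2, k3⟩, k4, k5, k6⟩ := ho hy hz f5 f6
  obtain rfl := hS.func k1 hb
  obtain rfl := hS.func k2 ha
  obtain rfl := hR.func k3 hu
  obtain rfl := hS.inj k6 hv; exact ⟨y, A, b, C, z, ⟨ha, hb, hy⟩, ⟨k5, k4, hz⟩, f5, f6⟩

lemma Far.square_up (hR : Strings R eR dR) (hS : Strings S eS dS) (h : Far R S eS dS)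
    (h' : Far S R eR dR) (hu : R u x) (hv : S v x) : ∃ y, R y v ∧ S y u := by
  have := hS.de_edge hv; have := hS.de_nonneg v; have := h.de hu
  obtain ⟨y, hy⟩ := hS.exists_up (x := u) (by omega)
  have := hR.ep_edge hu; have := hR.ep_nonneg x; have := h'.ep hy
  obtain ⟨w, hw⟩ := hR.exists_down (x := y) (by omega)
  obtain ⟨z, k1, k2⟩ := h.square hw hy
  obtain rfl := hR.func k2 hu
  obtain rfl := hS.inj k1 hv; exact ⟨y, hw, hy⟩

end

lemma Strings.stats {G : ColoredDigraph V} {i : ℕ} {ep de : V → ℤ} (h : Strings (G.edge i) ep de) (x : V) :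
    (G.eps i x : ℤ) = ep x ∧ (G.delta i x : ℤ) = de x :=
  ⟨G.eps_eq ep h.ep_nonneg (fun _ _ => h.ep_edge) (fun _ => h.exists_down) x,
    G.delta_eq de h.de_nonneg (fun _ _ => h.de_edge) (fun _ => h.exists_up) x⟩

lemma Strings.changes {G : ColoredDigraph V} {i : ℕ} {ep de : V → ℤ} (h : Strings (G.edge i) ep de) (u x : V) :
    G.dDelta i u x = de x-de u ∧ G.dEps i u x = ep u-ep x := by
  unfold dDelta dEps
  rw [(h.stats u).1, (h.stats x).1, (h.stats u).2, (h.stats x).2]; exact ⟨rfl, rfl⟩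

lemma Strings.of_not_mem {G : ColoredDigraph V} {i : ℕ} (h : i ∉ G.colors) :
    Strings (G.edge i) (fun _ => 0) fun _ => 0 :=
  ⟨fun _ => le_rfl, fun _ => le_rfl, fun e => (h (G.color_mem e)).elim, fun e => (h (G.color_mem e)).elim,
    fun e => (lt_irrefl _ e).elim, fun e => (lt_irrefl _ e).elim, fun e => (h (G.color_mem e)).elim,
    fun e => (h (G.color_mem e)).elim⟩

/-- A graph is regular if its strings have suitable statistics. -/
lemma isRegular_of_strings (ep de : ℕ → V → ℤ)
    (hs : ∀ i ∈ G.colors, Strings (G.edge i) (ep i) (de i))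
    (hn : ∀ i ∈ G.colors, i+1 ∈ G.colors → Near (G.edge i) (G.edge (i+1)) (ep i) (ep (i+1)) (de (i+1)) ∧
      Near (G.edge (i+1)) (G.edge i) (ep (i+1)) (ep i) (de i) ∧
      Octagon (G.edge i) (G.edge (i+1)) (ep i) (ep (i+1)))
    (hf : ∀ i ∈ G.colors, ∀ j ∈ G.colors, i+1 < j → Far (G.edge i) (G.edge j) (ep j) (de j) ∧
      Far (G.edge j) (G.edge i) (ep i) (de i)) : G.IsRegular := by
  have Δ : ∀ {i}, i ∈ G.colors → ∀ u x, G.dDelta i u x = de i x-de i u := fun hi u x => ((hs _ hi).changes u x).1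
  have E : ∀ {i}, i ∈ G.colors → ∀ u x, G.dEps i u x = ep i u-ep i x := fun hi u x => ((hs _ hi).changes u x).2
  have hcases : ∀ i ∈ G.colors, ∀ j ∈ G.colors, j = i ∨
      ((j = i+1 ∨ i = j+1) ∧ Near (G.edge i) (G.edge j) (ep i) (ep j) (de j) ∧
        Near (G.edge j) (G.edge i) (ep j) (ep i) (de i) ∧ Octagon (G.edge i) (G.edge j) (ep i) (ep j)) ∨
      ((i+1 < j ∨ j+1 < i) ∧ Far (G.edge i) (G.edge j) (ep j) (de j) ∧
        Far (G.edge j) (G.edge i) (ep i) (de i)) := by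
    intro i hi j hj
    obtain h | rfl | h | rfl | h : j = i ∨ j = i+1 ∨ i+1 < j ∨ i = j+1 ∨ j+1 < i := by omega
    · exact Or.inl h
    · exact Or.inr (Or.inl ⟨Or.inl rfl, hn i hi hj⟩)
    · exact Or.inr (Or.inr ⟨Or.inl h, hf i hi j hj h⟩)
    · obtain ⟨a, b, c⟩ := hn j hj hi; exact Or.inr (Or.inl ⟨Or.inr rfl, b, a, Octagon.symm c⟩)
    · exact Or.inr (Or.inr ⟨Or.inr h, (hf j hj i hi h).symm⟩)
  have descent : ∀ (f : V → ℤ) (s : ℕ → V), (∀ x, 0 ≤ f x) → ¬ ∀ k, f (s (k+1)) = f (s k)-1 := fun f s h0 h => by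
    have key : ∀ k : ℕ, f (s k) = f (s 0)-k := fun k => by
      induction k with
      | zero => simp
      | succ k ih => rw [h, ih]; push_cast; ring
    have := key ((f (s 0)).toNat+1); have := h0 (s ((f (s 0)).toNat+1)); omega
  refine ⟨fun i hi ⟨s, h⟩ => descent _ s (hs i hi).ep_nonneg fun k => (hs i hi).ep_edge (h k),
    fun i hi ⟨s, h⟩ => descent _ s (hs i hi).de_nonneg fun k => by rw [(hs i hi).de_edge (h k)]; ring,
    fun i hi _ _ _ => (hs i hi).inj, fun i hi _ _ _ => (hs i hi).func, ?_, ?_, ?_, ?_, ?_, ?_⟩ <;>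
  intro i hi j hj <;> simp only [Δ hi, Δ hj, E hi, E hj]
  · intro x u h
    rcases hcases i hi j hj with rfl | ⟨k, a, b, c⟩ | ⟨k, a, b⟩
    · rw [if_pos rfl, (hs j hj).ep_edge h, (hs j hj).de_edge h]; ring
    · rw [if_neg (by omega), if_pos k, a.weight h]; ring
    · rw [if_neg (by omega), if_neg (by omega), a.ep h, a.de h]; ring
  · intro hne x u h
    rcases hcases i hi j hj with rfl | ⟨k, a, b, c⟩ | ⟨k, a, b⟩
    · exact absurd rfl hne
    · have := a.weight h; have := a.mono h; omega
    · rw [a.ep h, a.de h, sub_self, sub_self]; exact ⟨le_rfl, le_rfl⟩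
  · intro x u v hu hv h
    rcases hcases i hi j hj with rfl | ⟨k, a, b, c⟩ | ⟨k, a, b⟩
    · have := (hs j hj).de_edge hu; omega
    · obtain ⟨y, h1, h2, h3⟩ := Near.square_up (hs i hi) (hs j hj) a b hu hv (by omega)
      exact ⟨y, h1, h2, by omega⟩
    · obtain ⟨y, h1, h2⟩ := Far.square_up (hs i hi) (hs j hj) a b hu hv
      exact ⟨y, h1, h2, by have := b.ep h2; omega⟩
  · intro x u v hu hv h
    rcases hcases i hi j hj with rfl | ⟨k, a, b, c⟩ | ⟨k, a, b⟩
    · have := (hs j hj).ep_edge hu; omega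
    · obtain ⟨y, h1, h2, h3⟩ := Near.square_down (hs i hi) a b hu hv (by omega)
      exact ⟨y, h1, h2, by omega⟩
    · obtain ⟨y, h1, h2⟩ := a.square hu hv; exact ⟨y, h2, h1, by have := b.de h1; omega⟩
  · intro x u v hu hv h h'
    rcases hcases i hi j hj with rfl | ⟨k, a, b, c⟩ | ⟨k, a, b⟩
    · have := (hs j hj).de_edge hu; omega
    · obtain ⟨y, p, q, r, s, h1, h2, h3, h4⟩ :=
        Near.octagon_up (hs i hi) (hs j hj) a b c hu hv (by omega) (by omega)
      exact ⟨y, p, q, r, s, h1, h2, by omega, by omega⟩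
    · have := a.de hu; omega
  · intro x u v hu hv h h'
    rcases hcases i hi j hj with rfl | ⟨k, a, b, c⟩ | ⟨k, a, b⟩
    · have := (hs j hj).ep_edge hu; omega
    · obtain ⟨y, p, q, r, s, h1, h2, h3, h4⟩ :=
        Near.octagon_down (hs i hi) (hs j hj) a b c hu hv (by omega) (by omega)
      exact ⟨y, p, q, r, s, h1, h2, by omega, by omega⟩
    · have := a.ep hu; omega

end ColoredDigraph

namespace Strip

/-! #### The set of words -/

/-- Reversal of strips. -/
lemma IsStrip.reverse {t : ℤ} {σ τ : ℤ → ℤ} {X : Finset ℤ} (h : IsStrip t σ τ X) :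
    IsStrip t (fun s => τ (-s)) (fun s => σ (-s)) (Strip.refl X) := by
  refine ⟨fun c => h.site2 _, fun c => h.site1 _, fun c => ?_, fun c h1 h2 => ?_⟩
  · have := h.move (-c)
    rw [ind_refl, ind_refl, show -1-c = -c-1 by ring, show -1-(c-1) = -c by ring]
    omega
  · rw [mem_refl, show -1-c = -c-1 by ring] at h1
    rw [mem_refl, show -1-(c-1) = -c by ring] at h2
    have a := h.cond (-c) h2 h1; have := h.move (-c)
    rw [ind_of_mem h1, ind_of_mem h2] at this
    show τ (-c) = t; omega

/-- The sequence of strips of a word and of its reflection. -/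
def Chain (s₀ s₆ : ℤ → ℤ) (W1 W2 : Finset ℤ) : Prop :=
  ∃ s1 s2 s3 s4 s5, IsStrip 0 s₀ s1 (W1.filter (· < 0)) ∧ IsStrip 0 s1 s2 (W2.filter (· < 0)) ∧
    IsStrip 1 s2 s3 (refl W1) ∧ IsStrip 1 s3 s4 (refl W2) ∧
    IsStrip 0 s4 s5 (W1.filter (0 ≤ ·)) ∧ IsStrip 0 s5 s₆ (W2.filter (0 ≤ ·))

lemma refl_filter_neg (W : Finset ℤ) : refl (W.filter (· < 0)) = (refl W).filter (0 ≤ ·) := by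
  ext c; simp only [mem_refl, mem_filter]; constructor <;> rintro ⟨a, b⟩ <;> exact ⟨a, by omega⟩

lemma refl_filter_nonneg (W : Finset ℤ) : refl (W.filter (0 ≤ ·)) = (refl W).filter (· < 0) := by
  ext c; simp only [mem_refl, mem_filter]; constructor <;> rintro ⟨a, b⟩ <;> exact ⟨a, by omega⟩

lemma cnt_refl (X : Finset ℤ) (c : ℤ) : cnt (refl X) c = X.card-cnt X (-2-c) := by
  have h1 : (refl X).filter (· ≤ c) = refl (X.filter (fun x => ¬ x ≤ -2-c)) := by
    ext x; simp only [mem_refl, mem_filter]; constructor <;> rintro ⟨a, b⟩ <;> exact ⟨a, by omega⟩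
  have h2 := X.card_filter_add_card_filter_not (fun x => x ≤ -2-c)
  have h3 : ∀ Y : Finset ℤ, (refl Y).card = Y.card := fun Y =>
    Finset.card_image_of_injective _ fun a b h => by simpa using h
  unfold cnt
  rw [h1, h3]
  push_cast [← h2]; ring

lemma ht_refl (W1 W2 : Finset ℤ) (c : ℤ) :
    ht (refl W2) (refl W1) c = ht W1 W2 (-2-c)-(W1.card-W2.card) := by
  unfold ht; rw [cnt_refl, cnt_refl]; ring

section
variable {s₀ s₆ : ℤ → ℤ} {W1 W2 : Finset ℤ} {M D p : ℤ}

lemma Chain.reverse (h : Chain s₀ s₆ W1 W2) :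
    Chain (fun s => s₆ (-s)) (fun s => s₀ (-s)) (refl W2) (refl W1) := by
  obtain ⟨s1, s2, s3, s4, s5, h1, h2, h3, h4, h5, h6⟩ := h
  refine ⟨fun s => s5 (-s), fun s => s4 (-s), fun s => s3 (-s), fun s => s2 (-s), fun s => s1 (-s),
    ?_, ?_, ?_, ?_, ?_, ?_⟩
  · rw [← refl_filter_nonneg]; exact h6.reverse
  · rw [← refl_filter_nonneg]; exact h5.reverse
  · exact h4.reverse
  · exact h3.reverse
  · rw [← refl_filter_neg]; exact h2.reverse
  · rw [← refl_filter_neg]; exact h1.reverse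

lemma Chain.pair (h : Chain s₀ s₆ W1 W2) : Pair W1 W2 := by
  obtain ⟨s1, s2, s3, s4, s5, h1, h2, h3, h4, h5, h6⟩ := h
  exact pair_of_strips (by simpa using h3.refl) (by simpa using h4.refl)

/-- Lowering preserves the validity of the strips of a word. -/
lemma Chain.lower (h : Chain s₀ s₆ W1 W2) (hf : FirstMax W1 W2 M p) :
    Chain s₀ s₆ (W1.erase p) (insert p W2) := by
  obtain ⟨s1, s2, s3, s4, s5, h1, h2, h3, h4, h5, h6⟩ := h
  have k : ∃ α, IsStrip 1 s2 α (refl (W1.erase p)) ∧ IsStrip 1 α s4 (refl (insert p W2)) := by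
    obtain ⟨a, b⟩ := hf.strips (by simpa using h3.refl) (by simpa using h4.refl)
    exact ⟨_, by simpa using a.refl, by simpa using b.refl⟩
  obtain ⟨α, k1, k2⟩ := k
  rcases lt_or_ge p 0 with hp | hp
  · have hfA : FirstMax (W1.filter (· < 0)) (W2.filter (· < 0)) M p :=
      ⟨hf.pos, ht_neg_le fun c _ => hf.le c, by rw [← ht_split_of_neg _ _ hp]; exact hf.eq,
        fun c hc => by rw [← ht_split_of_neg _ _ (by omega)]; exact hf.lt c hc⟩
    obtain ⟨a, b⟩ := hfA.strips h1 h2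
    refine ⟨_, _, _, _, _, (?_ : IsStrip 0 _ (after s₀ ((W1.filter (· < 0)).erase p)) _),
      (?_ : IsStrip 0 _ s2 _), k1, k2, (?_ : IsStrip 0 _ s5 _), ?_⟩
    · convert a using 1; ext c; simp only [mem_filter, mem_erase]; tauto
    · convert b using 1; ext c; simp only [mem_filter, mem_insert]; grind
    · convert h5 using 1; ext c; simp only [mem_filter, mem_erase]; grind
    · convert h6 using 1; ext c; simp only [mem_filter, mem_insert]; grind
  · have e : ∀ c, 0 ≤ c → ht (W1.filter (0 ≤ ·)) (W2.filter (0 ≤ ·)) c = ht W1 W2 c-ht W1 W2 (-1) := by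
      intro c hc
      have e1 := cnt_split W1 c; have e2 := cnt_split W2 c
      have e3 := cnt_neg_of_nonneg W1 (c := c) (by omega); have e4 := cnt_neg_of_nonneg W2 (c := c) (by omega)
      have e5 := ht_split_of_neg W1 W2 (c := -1) (by norm_num)
      have e6 := cnt_neg_of_nonneg W1 (c := -1) le_rfl; have e7 := cnt_neg_of_nonneg W2 (c := -1) le_rfl
      rw [e5]
      unfold ht; omega
    have e' : ∀ c, c < 0 → ht (W1.filter (0 ≤ ·)) (W2.filter (0 ≤ ·)) c = 0 := by
      intro c hc
      unfold ht
      rw [cnt_eq_zero fun x hx => by have := (mem_filter.1 hx).2; omega,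
        cnt_eq_zero fun x hx => by have := (mem_filter.1 hx).2; omega]
      rfl
    have hfA : FirstMax (W1.filter (0 ≤ ·)) (W2.filter (0 ≤ ·)) (M-ht W1 W2 (-1)) p := by
      have l := hf.lt (-1) (by omega)
      refine ⟨by omega, fun c => ?_, by rw [e p hp, hf.eq], fun c hc => ?_⟩
      · rcases lt_or_ge c 0 with h | h
        · rw [e' c h]; omega
        · rw [e c h]; have := hf.le c; omega
      · rcases lt_or_ge c 0 with h | h
        · rw [e' c h]; omega
        · rw [e c h]; have := hf.lt c hc; omega
    obtain ⟨a, b⟩ := hfA.strips h5 h6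
    refine ⟨_, _, _, _, _, (?_ : IsStrip 0 _ s1 _), (?_ : IsStrip 0 _ s2 _), k1, k2,
      (?_ : IsStrip 0 _ (after s4 ((W1.filter (0 ≤ ·)).erase p)) _), ?_⟩
    · convert h1 using 1; ext c; simp only [mem_filter, mem_erase]; grind
    · convert h2 using 1; ext c; simp only [mem_filter, mem_insert]; grind
    · convert a using 1; ext c; simp only [mem_filter, mem_erase]; tauto
    · convert b using 1; ext c; simp only [mem_filter, mem_insert]; grind

/-- Raising preserves the validity of the strips of a word. -/
lemma Chain.raise (h : Chain s₀ s₆ W1 W2) (hf : FirstMax (refl W2) (refl W1) D p) :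
    Chain s₀ s₆ (insert (-1-p) W1) (W2.erase (-1-p)) := by
  have := (h.reverse.lower hf).reverse
  simpa [refl_insert, refl_erase] using this

lemma FirstMax.raise (hf : FirstMax (refl W2) (refl W1) D p) (hM : IsMax W1 W2 M) :
    FirstMax (insert (-1-p) W1) (W2.erase (-1-p)) (M+1) (-1-p) ∧ D = M-(W1.card-W2.card) := by
  obtain ⟨m1, m2, m3⟩ := hf.mem
  rw [mem_refl] at m1 m2
  have f1 := hf.eq
  rw [ht_refl] at f1 m3
  rw [show -2-(p-1) = -1-p by ring] at m3
  have le : ∀ c, ht W1 W2 c ≤ ht W1 W2 (-2-p) := fun c => by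
    have := hf.le (-2-c); rw [ht_refl, show -2-(-2-c) = c by ring] at this; omega
  have lt : ∀ c, -2-p < c → ht W1 W2 c < ht W1 W2 (-2-p) := fun c hc => by
    have := hf.lt (-2-c) (by omega); rw [ht_refl, show -2-(-2-c) = c by ring] at this; omega
  have hm : ht W1 W2 (-2-p) = M := by
    apply le_antisymm (hM.le _)
    rcases hM.eq with h | ⟨c, hc⟩
    · obtain ⟨b, hb⟩ := ht_eq_zero_of_lower W1 W2
      have := hb b le_rfl; have := le b; omega
    · rw [← hc]; exact le c
  have hh : ∀ c, ht (insert (-1-p) W1) (W2.erase (-1-p)) c = ht W1 W2 c+if -1-p ≤ c then 2 else 0 := by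
    intro c
    unfold ht; rw [cnt_erase _ _ _ m1, cnt_insert _ _ _ m2]; split_ifs <;> ring
  refine ⟨⟨by have := hM.nonneg; omega, fun c => ?_, ?_, fun c hc => ?_⟩, by omega⟩
  · rw [hh]; have := le c; have := lt c; split_ifs <;> omega
  · rw [hh, if_pos le_rfl]; omega
  · rw [hh, if_neg (by omega)]; have := le c; omega

end

/-- The words of pairs of layers: conditions near the origin single out one of the two presentations
of the diagonal cell. -/
structure Canon (σ σ' : ℤ → ℤ) (W1 W2 : Finset ℤ) : Prop where
  chain : Chain (glue σ 0 σ) (glue σ' 0 σ') W1 W2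
  mark : -1 ∈ W1 → 0 ∈ W2
  step : -1 ∈ W2 → 1 ∈ W1
  turn : 0 ∈ W1 ∨ -1 ∈ W1 → -2 ∉ W2

section
variable {σ σ' : ℤ → ℤ} {W1 W2 : Finset ℤ} {M D p : ℤ}

lemma Chain.origin (h : Chain (glue σ 0 σ) (glue σ' 0 σ') W1 W2) :
    ¬ (-1 ∈ W1 ∧ -1 ∈ W2) ∧ ¬ (-1 ∈ W2 ∧ 0 ∈ W1) ∧ ¬ (0 ∈ W1 ∧ 0 ∈ W2) := by
  obtain ⟨s1, s2, s3, s4, s5, h1, h2, h3, h4, h5, h6⟩ := h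
  have a1 := h1.move 0; have a2 := h2.move 0; have a3 := h3.move 0
  have a4 := h4.move 0
  have b1 := h2.site2 0; have b2 := h3.site2 0; have b3 := h4.site2 0; have c0 : glue σ 0 σ 0 = 0 := by simp [glue]
  rw [c0] at a1
  unfold ind at *; simp only [mem_refl, mem_filter] at *
  norm_num at *
  refine ⟨?_, ?_, ?_⟩ <;> grind

/-- If the diagonal cell is presented as a marked one, then `1` carries the smaller value. -/
lemma Canon.one_mem (h : Canon σ σ' W1 W2) (h1 : -1 ∈ W1) : 1 ∈ W1 := by
  have m := h.mark h1; have t := h.turn (Or.inr h1)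
  obtain ⟨s1, s2, s3, s4, s5, -, -, k3, k4, k5, k6⟩ := h.chain
  have a3 := k3.at 1; have a4 := k4.at 1; have a5 := k5.at 1; have a6 := k6.at 1
  unfold StripAt ind at *; simp only [mem_refl, mem_filter] at *
  norm_num at *; grind

lemma Canon.lower (h : Canon σ σ' W1 W2) (hf : FirstMax W1 W2 M p) :
    Canon σ σ' (W1.erase p) (insert p W2) := by
  obtain ⟨o1, o2, o3⟩ := h.chain.origin
  have P := h.chain.pair
  obtain ⟨m1, m2, m3⟩ := hf.mem
  have nm := P.not_mem_succ hf.le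
  refine ⟨h.chain.lower hf, fun k => ?_, fun k => ?_, fun k k' => ?_⟩
  · exact mem_insert_of_mem (h.mark (mem_of_mem_erase k))
  · rcases mem_insert.1 k with rfl | k1
    · exact mem_erase.2 ⟨by norm_num, h.one_mem m1⟩
    · refine mem_erase.2 ⟨?_, h.step k1⟩
      rintro rfl
      have a := ht_step W1 W2 0
      norm_num at a m3
      have b : ind W1 0 = 0 := ind_of_not_mem fun h => o2 ⟨k1, h⟩; have c := hf.lt (-1) (by norm_num)
      have d := P.not_mem_of_lt hf (-1) (by norm_num)
      have e : ind W2 0 = 0 ∨ ind W2 0 = 1 := by unfold ind; split_ifs <;> simp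
      grind
  · have k1 : 0 ∈ W1 ∨ -1 ∈ W1 := k.imp mem_of_mem_erase mem_of_mem_erase
    rcases mem_insert.1 k' with rfl | k'
    · have a := nm (-2) hf.eq
      norm_num at a
      have b := ht_step W1 W2 (-1)
      norm_num at b
      rw [hf.eq, ind_of_not_mem a] at b
      have c : ind W2 (-1) = 0 := ind_of_not_mem fun h => o2 ⟨h, by tauto⟩; have d := nm (-1) (by omega)
      norm_num at d; tauto
    · exact h.turn k1 k'

lemma Canon.raise (h : Canon σ σ' W1 W2) (hf : FirstMax (refl W2) (refl W1) D p) :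
    Canon σ σ' (insert (-1-p) W1) (W2.erase (-1-p)) := by
  obtain ⟨o1, o2, o3⟩ := h.chain.origin
  have P := h.chain.reverse.pair
  obtain ⟨m1, m2, m3⟩ := hf.mem
  have nm := P.not_mem_succ hf.le; have nl := P.not_mem_of_lt hf; have s0 := ht_step (refl W2) (refl W1) 0
  have s1 := ht_step (refl W2) (refl W1) (-1)
  rw [ind_refl, ind_refl] at s0 s1
  norm_num at s0 s1
  rw [mem_refl] at m1 m2
  refine ⟨h.chain.raise hf, fun k => ?_, fun k => ?_, fun k k' => ?_⟩
  · rcases mem_insert.1 k with k1 | k1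
    · obtain rfl : p = 0 := by omega
      norm_num at m1 m2 m3 ⊢
      by_contra hc
      have a := h.step m1; have b : ind W1 0 = 0 := ind_of_not_mem fun h => o2 ⟨m1, h⟩
      rw [m3, b, ind_of_not_mem hc] at s1
      have := nl (-2) (by norm_num) (by omega)
      rw [mem_refl] at this
      norm_num at this; exact this a
    · refine mem_erase.2 ⟨?_, h.mark k1⟩
      intro h0
      obtain rfl : p = -1 := by omega
      norm_num at m1 m2
      have a := h.one_mem k1
      rw [hf.eq, ind_of_mem m1, ind_of_not_mem m2] at s1
      have := nl (-2) (by norm_num) (by omega)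
      rw [mem_refl] at this
      norm_num at this; exact this a
  · exact mem_insert_of_mem (h.step (mem_of_mem_erase k))
  · have k2 := mem_of_mem_erase k'
    by_cases k1 : 0 ∈ W1 ∨ -1 ∈ W1
    · exact h.turn k1 k2
    · push Not at k1
      simp only [mem_insert, k1, or_false] at k
      rcases k with k | k
      · obtain rfl : p = -1 := by omega
        have a := nm (-1) hf.eq
        norm_num at a
        rw [hf.eq, ind_of_not_mem a, ind_of_not_mem k1.2] at s0
        have b := nm 0 (by omega)
        norm_num at b; exact b k2
      · obtain rfl : p = 0 := by omega
        have a := nm 0 hf.eq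
        norm_num at a; exact a k2

end

/-! #### Words and layers -/

section
variable {t : ℤ} {σ τ σ' τ' a b c : ℤ → ℤ} {X v V h k : Finset ℤ}

lemma HalfStrip.congr_left (hX : HalfStrip t σ τ X) (he : ∀ c, 1 ≤ c → σ c = σ' c) :
    HalfStrip t σ' τ X :=
  ⟨hX.nonneg, fun c hc => by
    obtain ⟨h1, h2, h3, h4⟩ := hX.stripAt c hc
    rw [he c hc] at h1 h3 h4
    exact ⟨h1, h2, h3, h4⟩⟩

/-- The part of a strip on the right of the origin. -/
lemma IsStrip.half (hX : IsStrip t σ τ X) : HalfStrip t σ τ (X.filter (0 ≤ ·)) := by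
  refine ⟨fun c hc => (mem_filter.1 hc).2, fun c hc => ?_⟩
  obtain ⟨h1, h2, h3, h4⟩ := hX.at c
  unfold StripAt ind at *; simp only [mem_filter]; grind

lemma HalfStrip.disj (hv : HalfStrip 1 σ a v) (hh : HalfStrip 0 a τ h) (c : ℤ) (h1 : c ∈ v) : c ∉ h := by
  intro h2
  have := hv.nonneg c h1; have e1 := hv.stripAt (c+1) (by omega); have e2 := hh.stripAt (c+1) (by omega)
  unfold StripAt at e1 e2
  rw [add_sub_cancel_right] at e1 e2
  unfold ind at *; grind

/-- The strips of a word on the right of the origin. -/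
structure HalfChain (σ τ a b c : ℤ → ℤ) (v V h k : Finset ℤ) : Prop where
  fst : HalfStrip 1 σ a v
  snd : HalfStrip 1 a b V
  thd : HalfStrip 0 b c h
  fth : HalfStrip 0 c τ k

lemma refl_refl_union (v h : Finset ℤ) : refl (refl v ∪ h) = refl h ∪ v := by
  rw [refl_union, refl_refl, union_comm]

lemma HalfChain.chain (H : HalfChain σ τ a b c v V h k) (o1 : ¬ (0 ∈ v ∧ 0 ∈ V)) (o2 : ¬ (0 ∈ V ∧ 0 ∈ h))
    (o3 : ¬ (0 ∈ h ∧ 0 ∈ k)) : Chain (glue σ 0 σ) (glue τ 0 τ) (refl v ∪ h) (refl V ∪ k) := by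
  obtain ⟨h1, h2, h3, h4⟩ := H
  obtain ⟨f1, f2⟩ := filter_neg_union h1.nonneg h3.nonneg
  obtain ⟨f3, f4⟩ := filter_neg_union h2.nonneg h4.nonneg
  have e : ∀ X : Finset ℤ, refl X ∪ ∅ = refl X := fun X => Finset.union_empty _
  have e' : ∀ X : Finset ℤ, refl ∅ ∪ X = X := fun X => by simp [refl]
  have u : ¬ (0 ∈ v ∧ 0 ∈ V) → ¬ (0 ∈ V ∧ 0 ∈ h) → ¬ (0 ∈ h ∧ 0 ∈ k) →
      (ind v 0+ind V 0 = 0 ∨ ind v 0+ind V 0 = 1) ∧ (ind V 0+ind h 0 = 0 ∨ ind V 0+ind h 0 = 1) ∧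
      (ind h 0+ind k 0 = 0 ∨ ind h 0+ind k 0 = 1) := by unfold ind; grind
  obtain ⟨u1, u2, u3⟩ := u o1 o2 o3
  refine ⟨glue a (ind v 0) σ, glue b (ind v 0+ind V 0) σ, glue c (ind V 0+ind h 0) a,
    glue τ (ind h 0+ind k 0) b, glue τ (ind k 0) c, ?_, ?_, ?_, ?_, ?_, ?_⟩
  · rw [f1, ← e]
    exact glue_strip (t := 0) (by simpa using h1) (halfStrip_empty h1.site1) (by simp) (ind_zero_or _ _)
      (by simp [ind]) (by simp)
  · rw [f3, ← e]
    exact glue_strip (t := 0) (by simpa using h2) (halfStrip_empty h1.site1) (ind_zero_or _ _) u1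
      (by simp [ind]) (by simp)
  · rw [refl_refl_union]
    exact glue_strip (t := 1) (by simpa using h3) h1 u1 u2 (by ring) (by unfold ind; grind)
  · rw [refl_refl_union]
    exact glue_strip (t := 1) (by simpa using h4) h2 u2 u3 (by ring) (by unfold ind; grind)
  · rw [f2]
    have := glue_strip (t := 0) (halfStrip_empty (by simpa using h4.site2)) h3 u3 (ind_zero_or k 0)
      (by simp [ind]) (by simp)
    rwa [e'] at this
  · rw [f4]
    have := glue_strip (t := 0) (halfStrip_empty (by simpa using h4.site2)) h4 (ind_zero_or k 0) (Or.inl rfl)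
      (by simp [ind]) (by simp)
    rwa [e'] at this

/-- Marking the diagonal cell. -/
lemma HalfChain.mark (H : HalfChain σ τ a b c v V h k) (h1 : 0 ∈ h) (h2 : 0 ∉ v) (h3 : 0 ∉ V) (h4 : 1 ∉ V) :
    ∃ a' b', HalfChain σ τ a' b' c (insert 0 v) V (h.erase 0) k := by
  obtain ⟨k1, k2, k3, k4⟩ := H
  refine ⟨after σ (insert 0 v), after (after σ (insert 0 v)) V, ⟨?_, fun x hx => ?_⟩, ⟨k2.nonneg, fun x hx => ?_⟩,
    ⟨fun x hx => k3.nonneg x (mem_of_mem_erase hx), fun x hx => ?_⟩, k4⟩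
  · intro x hx
    rcases mem_insert.1 hx with rfl | hx
    · rfl
    · exact k1.nonneg x hx
  all_goals
    have a1 := k1.stripAt x hx; have a2 := k2.stripAt x hx; have a3 := k3.stripAt x hx
    unfold StripAt after ind at *; simp only [mem_insert, mem_erase]
    grind

/-- Unmarking the diagonal cell. -/
lemma HalfChain.unmark (H : HalfChain σ τ a b c v V h k) (h1 : 0 ∈ v) (h2 : 0 ∉ h) (h3 : 0 ∉ V) (h4 : 1 ∉ V) :
    ∃ a' b', HalfChain σ τ a' b' c (v.erase 0) V (insert 0 h) k := by
  obtain ⟨k1, k2, k3, k4⟩ := H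
  refine ⟨after σ (v.erase 0), after (after σ (v.erase 0)) V,
    ⟨fun x hx => k1.nonneg x (mem_of_mem_erase hx), fun x hx => ?_⟩, ⟨k2.nonneg, fun x hx => ?_⟩,
    ⟨?_, fun x hx => ?_⟩, k4⟩
  rotate_left 2
  · intro x hx
    rcases mem_insert.1 hx with rfl | hx
    · rfl
    · exact k3.nonneg x hx
  all_goals
    have a1 := k1.stripAt x hx; have a2 := k2.stripAt x hx; have a3 := k3.stripAt x hx
    unfold StripAt after ind at *; simp only [mem_insert, mem_erase]
    grind

lemma StripAt.refl (hX : StripAt t σ τ X c0) :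
    StripAt (1-t) (reflSite σ) (reflSite τ) (Strip.refl X) (-c0) := by
  obtain ⟨h1, h2, h3, h4⟩ := hX
  unfold StripAt reflSite
  rw [ind_refl, ind_refl, mem_refl, mem_refl, neg_neg, show -1 - -c0 = c0-1 by ring,
    show -1-(-c0-1) = c0 by ring]
  exact ⟨by omega, by omega, by omega, fun k1 k2 => by have := h4 k2 k1; omega⟩

lemma Rot.halfStrips_symm {σ0 σ2 : ℤ → ℤ} {H V V' H' : Finset ℤ} {g : ℤ → Prop} (hr : Rot H V V' H' g)
    (hV : HalfStrip 1 σ0 τ V') (hH : HalfStrip 0 τ σ2 H') :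
    HalfStrip 0 σ0 (after σ0 H) H ∧ HalfStrip 1 (after σ0 H) σ2 V := by
  have key : ∀ c, 1 ≤ c → StripAt 0 σ0 (after σ0 H) H c ∧ StripAt 1 (after σ0 H) σ2 V c := by
    intro c hc
    have a1 := (hV.stripAt c hc).refl; have a2 := (hH.stripAt c hc).refl
    norm_num at a1 a2
    obtain ⟨b1, b2⟩ := hr.refl.stripAt a1 a2
    have e : reflSite (after (reflSite σ0) (Strip.refl H)) = after σ0 H := by
      funext s; simp only [reflSite, after, ind_refl, neg_neg]
      rw [show -1 - -s = s-1 by ring, show -1-(-s-1) = s by ring]; ring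
    have c1 := b1.refl; have c2 := b2.refl
    rw [e] at c1 c2
    norm_num at c1 c2; exact ⟨c1, c2⟩
  have nn : ∀ c, c ∈ H ∨ c ∈ V → 0 ≤ c := fun c hc => by
    rcases (hr.union c).1 hc with h | h; exacts [hV.nonneg c h, hH.nonneg c h]
  exact ⟨⟨fun c hc => nn c (Or.inl hc), fun c hc => (key c hc).1⟩,
    ⟨fun c hc => nn c (Or.inr hc), fun c hc => (key c hc).2⟩⟩

end

section
variable {σ0 σ1 σ2 : ℤ → ℤ} {V1 H1 V2 H2 W1 W2 : Finset ℤ}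

lemma Word.exists (L1 : Layer σ0 σ1 V1 H1) (L2 : Layer σ1 σ2 V2 H2) : ∃ W1 W2, Word V1 H1 V2 H2 W1 W2 := by
  have hd : ∀ c, c ∈ H1 → c ∉ V2 := fun c h1 h2 => by
    have n := L1.hH.nonneg c h1; have : c ≠ 0 := fun h => L2.zero (h ▸ h2)
    exact disjoint_of_stripAt (L1.hH.stripAt c (by omega)) (L2.hV.stripAt c (by omega)) h1 h2
  obtain ⟨V, H, g, r⟩ := exists_rot hd
  by_cases h : 0 ∈ H ∧ 0 ∈ H2
  exacts [⟨_, _, V, H, g, r, rfl, Or.inr ⟨h, rfl⟩⟩, ⟨_, _, V, H, g, r, rfl, Or.inl ⟨h, rfl⟩⟩]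

lemma Word.unique {W1' W2' : Finset ℤ} (w : Word V1 H1 V2 H2 W1 W2) (w' : Word V1 H1 V2 H2 W1' W2') :
    W1 = W1' ∧ W2 = W2' := by
  obtain ⟨V, H, g, r, rfl, h⟩ := w
  obtain ⟨V', H', g', r', rfl, h'⟩ := w'
  obtain ⟨rfl, rfl⟩ := r.unique r'
  rcases h with ⟨h, rfl⟩ | ⟨h, rfl⟩ <;> rcases h' with ⟨h', rfl⟩ | ⟨h', rfl⟩ <;> first | exact ⟨rfl, rfl⟩ | exact absurd h' h | exact absurd h h'

lemma Word.canon (L1 : Layer σ0 σ1 V1 H1) (L2 : Layer σ1 σ2 V2 H2) (w : Word V1 H1 V2 H2 W1 W2) :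
    Canon σ0 σ2 W1 W2 := by
  obtain ⟨V, H, g, r, rfl, h⟩ := w
  obtain ⟨k1, k2⟩ := r.halfStrips L1.hH L2.hV
  have C : HalfChain σ0 σ2 _ _ _ V1 V H H2 := ⟨L1.hV, k1, k2, L2.hH⟩
  have nV := k1.nonneg; have nH := k2.nonneg; have nV1 := L1.hV.nonneg; have nH2 := L2.hH.nonneg
  have z1 := L1.zero; have z2 := L2.zero; have d := r.disj' 0; have u0 := r.union 0; have u1 := r.union 1
  have sh := r.shift 0; have la := r.last 0; have fi := r.first 0
  have neg1 : -1 ∉ V ∧ -1 ∉ H ∧ -1 ∉ V1 ∧ -1 ∉ H2 :=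
    ⟨fun h => by have := nV _ h; omega, fun h => by have := nH _ h; omega,
      fun h => by have := nV1 _ h; omega, fun h => by have := nH2 _ h; omega⟩
  have neg2 : -2 ∉ H2 ∧ -2 ∉ H := ⟨fun h => by have := nH2 _ h; omega, fun h => by have := nH _ h; omega⟩
  have um := r.union (-1); have nV0 : ∀ c, -1-c ∈ V → c < 0 := fun c h => by have := nV _ h; omega
  norm_num at sh la fi
  have f1 : 0 ∈ V → 1 ∈ H := by clear * - neg1 um u0 u1 sh la fi d z2; grind
  have f2 : 0 ∈ H → 1 ∉ V := by clear * - neg1 um u0 u1 sh la fi d z2 r; have := r.disj' 1; grind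
  have e : (-1 : ℤ) - -2 = 1 := by norm_num
  clear * - h C neg1 neg2 f1 f2 d z1 z2 nV1 nH nV nH2 e
  rcases h with ⟨h, rfl⟩ | ⟨⟨h, h'⟩, rfl⟩
  · refine ⟨C.chain (by tauto) (by tauto) (by tauto), ?_, ?_, ?_⟩ <;>
      simp only [mem_union, mem_refl] <;> norm_num <;> tauto
  · have e1 : 1 ∉ V := f2 h
    obtain ⟨a, b, C'⟩ := C.mark h z1 (by tauto) e1
    refine ⟨C'.chain (by tauto) (by tauto) (by simp), ?_, ?_, ?_⟩ <;>
      simp only [mem_union, mem_refl, mem_insert, mem_erase] <;> norm_num <;> tauto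

lemma Canon.exists_layers (C : Canon σ0 σ2 W1 W2) :
    ∃ σ V1 H1 V2 H2, Layer σ0 σ V1 H1 ∧ Layer σ σ2 V2 H2 ∧ Word V1 H1 V2 H2 W1 W2 := by
  obtain ⟨o1, o2, o3⟩ := C.chain.origin
  have m := C.mark; have s := C.step; have t := C.turn
  obtain ⟨s1, s2, s3, s4, s5, h1, h2, h3, h4, h5, h6⟩ := C.chain
  have e0 : ∀ c, 1 ≤ c → s2 c = σ0 c := by
    intro c hc
    rw [h2.move, h1.move]
    unfold ind; simp only [mem_filter]
    rw [if_neg (by omega), if_neg (by omega), if_neg (by omega), if_neg (by omega)]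
    unfold glue; rw [if_pos (by omega)]; ring
  have e6 : ∀ c, 1 ≤ c → glue σ2 0 σ2 c = σ2 c := fun c hc => by unfold glue; rw [if_pos (by omega)]
  have hc : HalfChain σ0 σ2 s3 s4 s5 ((refl W1).filter (0 ≤ ·)) ((refl W2).filter (0 ≤ ·))
      (W1.filter (0 ≤ ·)) (W2.filter (0 ≤ ·)) :=
    ⟨h3.half.congr_left e0, h4.half, by simpa [Finset.filter_filter] using h5.half,
      by simpa [Finset.filter_filter] using h6.half.congr e6⟩
  have key : ∃ V1 H a b, 0 ∉ V1 ∧ (0 ∈ H ↔ (0 ∈ W1 ∨ -1 ∈ W1)) ∧ (1 ∈ H ↔ 1 ∈ W1) ∧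
      HalfChain σ0 σ2 a b s5 V1 ((refl W2).filter (0 ≤ ·)) H (W2.filter (0 ≤ ·)) ∧
      ((¬ (0 ∈ H ∧ 0 ∈ W2.filter (0 ≤ ·)) ∧ W1 = refl V1 ∪ H) ∨
        ((0 ∈ H ∧ 0 ∈ W2.filter (0 ≤ ·)) ∧ W1 = refl (insert 0 V1) ∪ H.erase 0)) := by
    by_cases hm : -1 ∈ W1
    · obtain ⟨a, b, hc'⟩ := hc.unmark (by simpa using hm) (by simp only [mem_filter]; tauto)
        (by simp; tauto) (by simp; tauto)
      refine ⟨_, _, a, b, by simp, by simp [hm], by simp, hc', Or.inr ⟨by simp; tauto, ?_⟩⟩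
      ext c; simp only [mem_union, mem_refl, mem_insert, mem_erase, mem_filter]
      have : -1-(-1-c) = c := by ring
      rw [this]
      rcases eq_or_ne c (-1) with rfl | h
      · simp [hm]
      · grind
    · refine ⟨_, _, s3, s4, by simpa using hm, by simp [hm], by simp, hc, Or.inl ⟨by simp; tauto, ?_⟩⟩
      ext c; simp only [mem_union, mem_refl, mem_filter]
      have : -1-(-1-c) = c := by ring
      rw [this]; grind
  obtain ⟨V1, H, a, b, z1, z2, z3, hc', hw⟩ := key
  have hd := hc'.snd.disj hc'.thd
  obtain ⟨V', H', g, hr⟩ := exists_rot (H := refl ((refl W2).filter (0 ≤ ·))) (V := refl H)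
    (fun c => by simpa using hd (-1-c))
  have r := hr.refl
  rw [refl_refl, refl_refl] at r
  set H1 := refl V'
  set V2 := refl H'
  obtain ⟨k1, k2⟩ := r.halfStrips_symm hc'.snd hc'.thd
  have zV : 0 ∉ V2 := by
    intro hz
    have u0 := r.union 0; have u1 := r.union 1; have um := r.union (-1)
    have sh := r.shift 0; have d0 := r.disj 0; have d0' := r.disj' 0; have d1 := hd 1
    have la := r.last 0; have fi := r.first 0
    simp only [mem_filter, mem_refl] at u0 u1 um sh d0' d1 fi
    have n1 : -1 ∉ H := fun h => by have := hc'.thd.nonneg _ h; omega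
    norm_num at sh la fi u0 u1 um d0' d1; grind
  refine ⟨after (after σ0 V1) H1, V1, H1, V2, W2.filter (0 ≤ ·), ⟨?_, ?_, z1, ?_⟩, ⟨?_, ?_, zV, ?_⟩,
    (refl W2).filter (0 ≤ ·), H, _, r, ?_, hw⟩
  · exact hc'.fst.congr hc'.fst.eq_after
  · exact (k1.congr_left hc'.fst.eq_after).congr fun c hc => by
      rw [after, after, hc'.fst.eq_after c hc]
  · exact hc'.fst.disj k1
  · exact (k2.congr_left fun c hc => by rw [after, after, hc'.fst.eq_after c hc]).congr fun c hc => by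
      rw [k2.eq_after c hc, after, after, after, after, hc'.fst.eq_after c hc]
  · exact hc'.fth.congr_left fun c hc => by
      rw [k2.eq_after c hc, after, after, after, after, hc'.fst.eq_after c hc]
  · exact k2.disj hc'.fth
  · ext c; simp only [mem_union, mem_refl, mem_filter]
    have : -1-(-1-c) = c := by ring
    rw [this]; grind

/-- Every word with a positive maximal excess can be lowered. -/
lemma Word.exists_lower (L1 : Layer σ0 σ1 V1 H1) (L2 : Layer σ1 σ2 V2 H2) (w : Word V1 H1 V2 H2 W1 W2)
    {M p : ℤ} (hf : FirstMax W1 W2 M p) : ∃ σ V1' H1' V2' H2', Layer σ0 σ V1' H1' ∧ Layer σ σ2 V2' H2' ∧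
      Word V1' H1' V2' H2' (W1.erase p) (insert p W2) :=
  ((w.canon L1 L2).lower hf).exists_layers

/-- Every word with a positive final deficiency can be raised. -/
lemma Word.exists_raise (L1 : Layer σ0 σ1 V1 H1) (L2 : Layer σ1 σ2 V2 H2) (w : Word V1 H1 V2 H2 W1 W2)
    {M : ℤ} (hM : IsMax W1 W2 M) (hd : 0 < M-(W1.card-W2.card)) :
    ∃ q σ V1' H1' V2' H2' W1' W2', Layer σ0 σ V1' H1' ∧ Layer σ σ2 V2' H2' ∧
      Word V1' H1' V2' H2' W1' W2' ∧ FirstMax W1' W2' (M+1) q ∧ W1 = W1'.erase q ∧ W2 = insert q W2' := by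
  rcases exists_firstMax_or (refl W2) (refl W1) with h | ⟨D, p, h⟩
  · exfalso
    have hle : ∀ c, ht W1 W2 c ≤ W1.card-W2.card := fun c => by
      have := h (-2-c); rw [ht_refl, show -2-(-2-c) = c by ring] at this; omega
    rcases hM.eq with h0 | ⟨c, hc⟩
    · obtain ⟨b, hb⟩ := ht_eq_zero_of_lower W1 W2
      have := hb b le_rfl; have := hle b; omega
    · have := hle c; omega
  · obtain ⟨k1, k2⟩ := h.raise hM
    obtain ⟨σ, V1', H1', V2', H2', l1, l2, l3⟩ := ((w.canon L1 L2).raise h).exists_layers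
    obtain ⟨m1, m2, m3⟩ := h.mem
    rw [mem_refl] at m1 m2
    exact ⟨_, σ, V1', H1', V2', H2', _, _, l1, l2, l3, k1, (Finset.erase_insert m2).symm,
      (Finset.insert_erase m1).symm⟩

end

/-! #### Modifications of a switched pair -/

section
variable {H V V' H' : Finset ℤ} {g : ℤ → Prop} {p q e : ℤ}

/-- The predicate `g` is constant on an interval of the run. -/
lemma Rot.g_const (r : Rot H V V' H' g) {x y : ℤ} (hxy : x ≤ y) (h : ∀ d, x ≤ d → d ≤ y → d ∈ H ∨ d ∈ V) :
    g x ↔ g y := by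
  obtain ⟨n, hn⟩ : ∃ n : ℕ, y = x+n := ⟨(y-x).toNat, by omega⟩
  induction n generalizing y with
  | zero => simp at hn; rw [hn]
  | succ n ih =>
    push_cast at hn
    have := ih (y := x+n) (by omega) (fun d h1 h2 => h d h1 (by omega)) rfl
    rw [this, hn, ← add_assoc]
    exact r.const _ (h _ (by omega) (by omega)) (h _ (by omega) (by omega))

lemma Rot.erase_last (r : Rot H V V' H' g) (h1 : p ∈ H) (h2 : p ∈ H') (h3 : ¬ (p+1 ∈ H ∨ p+1 ∈ V)) :
    Rot (H.erase p) V V' (H'.erase p) g := by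
  have hg := (r.last p (Or.inl h1) h3).1 h1
  constructor <;> intro c <;> simp only [mem_erase]
  · have := r.disj c; tauto
  · have := r.disj' c; tauto
  · have := r.union c; have := r.disj c; have := r.disj' c; have := r.disj p; have := r.disj' p; grind
  · have := r.const c; tauto
  · have := r.shift c; have := r.disj p; grind
  · have := r.last c; have := r.shift c; have := r.const c; have := r.disj p; grind
  · have := r.first c; have := r.disj p; grind

lemma Rot.erase_of_true (r : Rot H V V' H' g) (hpe : p < e) (h1 : p ∈ V) (h2 : p ∈ H')
    (h : ∀ d, p ≤ d → d ≤ e → d ∈ H ∨ d ∈ V) (h3 : e ∈ H) (h4 : ¬ (e+1 ∈ H ∨ e+1 ∈ V)) :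
    Rot (H.erase e) (insert e (V.erase p)) V' (H'.erase p) (fun c => g c ∧ ¬ (p < c ∧ c ≤ e)) := by
  have hge := (r.last e (Or.inl h3) h4).1 h3
  have hg : ∀ d, p ≤ d → d ≤ e → g d := fun d a b =>
    (r.g_const b fun d' a' b' => h d' (by omega) b').2 hge
  constructor <;> intro c <;> simp only [mem_erase, mem_insert]
  · have := r.disj c; grind
  · have := r.disj' c; grind
  · have := r.union c; have := r.disj c; have := r.disj' c; have := r.disj p; have := r.disj' p; grind
  · have := r.const c; have := h c; have := h (c+1); have := r.disj p; grind
  · have := r.shift c; have := r.disj e; have := r.disj p; grind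
  · have := r.last c; have := r.shift c; have := r.disj p; have := r.disj c; have := r.const c
    have := hg c; have := hg p; have := h (c+1); have := h c; grind
  · have := r.first c; have := r.shift (c-1); have := h c; have := h (c-1); have := r.disj p; grind

lemma Rot.erase_first (r : Rot H V V' H' g) (hpe : p < e) (h1 : p ∈ H) (h2 : p ∈ H')
    (h : ∀ d, p ≤ d → d ≤ e → d ∈ H ∨ d ∈ V) (h3 : e ∈ H) (h4 : ¬ (e+1 ∈ H ∨ e+1 ∈ V))
    (h5 : ¬ (p-1 ∈ H ∨ p-1 ∈ V)) :
    Rot (H.erase e) (insert e V) (insert p V') (H'.erase p) (fun c => g c ∧ ¬ (p ≤ c ∧ c ≤ e)) := by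
  constructor <;> intro c <;> simp only [mem_erase, mem_insert]
  · have := r.disj c; grind
  · have := r.disj' c; grind
  · have := r.union c; grind
  · have := r.const c; have := h c; have := h (c+1); grind
  · have := r.shift c; grind
  · have := r.last c; have := h (c+1); have := r.disj c; grind
  · have := r.first c; have := h c; have := h (c-1); grind

lemma Rot.erase_of_false (r : Rot H V V' H' g) (h1 : p-1 ∈ H) (h2 : p ∈ V) (h3 : p ∈ H') (hg : ¬ g p) :
    Rot (H.erase (p-1)) (insert (p-1) (V.erase p)) V' (H'.erase p) g := by
  have d2 := r.disj p; have d3 := r.disj' p; have c1 := r.const (p-1)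
  rw [sub_add_cancel] at c1
  constructor <;> intro c <;> simp only [mem_erase, mem_insert]
  · have := r.disj c; grind
  · have := r.disj' c; grind
  · have := r.union c; grind
  · have := r.const c; grind
  · have := r.shift c; grind
  · have := r.last c; grind
  · have := r.first c; have := r.shift p; have := r.const p; grind

lemma Rot.insert_of_true (r : Rot H V V' H' g) (h1 : ¬ (q ∈ H ∨ q ∈ V)) (h2 : q-1 ∈ H) (hg : g (q-1))
    (h3 : q+1 ∈ H ∨ q+1 ∈ V → q+1 ∈ H') :
    Rot (insert q (H.erase (q-1))) (insert (q-1) V) (insert q V') H' (fun c => g c ∨ c = q) := by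
  have u := r.union q; have f := r.first (q+1)
  rw [add_sub_cancel_right] at f
  constructor <;> intro c <;> simp only [mem_erase, mem_insert]
  · have := r.disj c; grind
  · have := r.disj' c; grind
  · have := r.union c; grind
  · have := r.const c; grind
  · have := r.shift c; grind
  · have := r.last c; grind
  · have := r.first c; grind

lemma Rot.insert_last (r : Rot H V V' H' g) (h1 : ¬ (q ∈ H ∨ q ∈ V)) (h2 : ¬ (q+1 ∈ H ∨ q+1 ∈ V))
    (h3 : q-1 ∉ H) : Rot H (insert q V) (insert q V') H' (fun c => g c ∧ c ≠ q) := by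
  have u := r.union q; have l := r.last (q-1)
  rw [sub_add_cancel] at l
  constructor <;> intro c <;> simp only [mem_insert]
  · have := r.disj c; grind
  · have := r.disj' c; grind
  · have := r.union c; grind
  · have := r.const c; grind
  · have := r.shift c; grind
  · have := r.last c; grind
  · have := r.first c; grind

lemma Rot.insert_first (r : Rot H V V' H' g) (hqe : q < e) (h1 : ¬ (q ∈ H ∨ q ∈ V)) (h2 : q-1 ∉ H)
    (h : ∀ d, q < d → d ≤ e → d ∈ H ∨ d ∈ V) (h3 : e ∈ H) (h4 : ¬ (e+1 ∈ H ∨ e+1 ∈ V)) :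
    Rot (insert q (H.erase e)) (insert e V) (insert q V') H' (fun c => g c ∧ ¬ (q ≤ c ∧ c ≤ e)) := by
  have u := r.union q; have l := r.last (q-1)
  rw [sub_add_cancel] at l
  have hge := (r.last e (Or.inl h3) h4).1 h3
  have hg1 : g (q+1) := (r.g_const (by omega) fun d' a' b' => h d' (by omega) b').2 hge
  have f := r.first (q+1) (h _ (by omega) (by omega)) (by rwa [add_sub_cancel_right])
  constructor <;> intro c <;> simp only [mem_erase, mem_insert]
  · have := r.disj c; grind
  · have := r.disj' c; grind
  · have := r.union c; grind
  · have := r.const c; have := h c; have := h (c+1); grind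
  · have := r.shift c; grind
  · have := r.last c; have := h (c+1); have := r.disj c; grind
  · have := r.first c; have := h c; have := h (c-1); grind

end

/-! #### The active cell -/

lemma cnt_refl_union_nonneg {X Y : Finset ℤ} (hX : ∀ c ∈ X, 0 ≤ c) (hY : ∀ c ∈ Y, 0 ≤ c) {c : ℤ} (hc : 0 ≤ c) :
    cnt (refl X ∪ Y) c = X.card+cnt Y c := by
  rw [cnt_union fun d h h' => by rw [mem_refl] at h; have := hX _ h; have := hY _ h'; omega, cnt_refl,
    cnt_eq_zero (X := X) fun x hx => by have := hX x hx; omega]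
  ring

lemma cnt_refl_union_neg {X Y : Finset ℤ} (hX : ∀ c ∈ X, 0 ≤ c) (hY : ∀ c ∈ Y, 0 ≤ c) {c : ℤ} (hc : c < 0) :
    cnt (refl X ∪ Y) c = X.card-cnt X (-2-c) := by
  rw [cnt_union fun d h h' => by rw [mem_refl] at h; have := hX _ h; have := hY _ h'; omega, cnt_refl,
    cnt_eq_zero (X := Y) fun x hx => by have := hY x hx; omega]
  ring

/-- The place `x` of the cell to which the lowering operator applies, in the word formed by the layers
themselves: the first one with the maximal excess `M` among those that are not followed by another
cell of the smaller value. -/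
structure Active (V1 H1 V2 H2 : Finset ℤ) (M x : ℤ) : Prop where
  mem : x ∈ refl V1 ∪ H1
  good : x+1 ∉ refl V1 ∪ H1
  eq : ht (refl V1 ∪ H1) (refl V2 ∪ H2) x = M
  le : ∀ y ∈ refl V1 ∪ H1, y+1 ∉ refl V1 ∪ H1 → ht (refl V1 ∪ H1) (refl V2 ∪ H2) y ≤ M
  lt : ∀ y ∈ refl V1 ∪ H1, y+1 ∉ refl V1 ∪ H1 → y < x → ht (refl V1 ∪ H1) (refl V2 ∪ H2) y < M
  diag : ¬ (x = -2 ∧ 0 ∈ H1 ∧ 0 ∈ H2)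
  side : x < 0 → -1-x ∉ V2

/-- The effect of the lowering operator on the layers, if `x` is the place of the active cell. -/
inductive Move (V1 H1 V2 H2 : Finset ℤ) : ℤ → Finset ℤ → Finset ℤ → Finset ℤ → Finset ℤ → Prop
  | east (x : ℤ) (h1 : x ∈ H1) (h2 : x+1 ∈ V2) :
      Move V1 H1 V2 H2 x V1 (H1.erase x) (insert x (V2.erase (x+1))) (insert (x+1) H2)
  | turn (x : ℤ) (h1 : x ∈ H1) (h2 : x+1 ∉ V2) (h3 : x-1 ∉ V2) (h4 : x-1 ∉ H2) :
      Move V1 H1 V2 H2 x V1 (H1.erase x) V2 (insert x H2)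
  | ribbon (x p : ℤ) (h1 : x ∈ H1) (h2 : x+1 ∉ V2) (h3 : p < x)
      (h4 : ∀ d, p ≤ d → d < x → d ∈ V2 ∨ d ∈ H2) (h5 : p-1 ∉ V2) (h6 : p-1 ∉ H2) :
      Move V1 H1 V2 H2 x V1 (H1.erase x) (insert x (V2.erase p)) (insert p H2)
  | north (q : ℤ) (h1 : q ∈ V1) (h2 : q-1 ∈ H1) :
      Move V1 H1 V2 H2 (-1-q) (V1.erase q) (insert q (H1.erase (q-1))) (insert (q-1) V2) H2
  | mark (q : ℤ) (h1 : q ∈ V1) (h2 : q-1 ∉ H1) (h3 : q+1 ∉ H1) (h4 : q+1 ∉ V2) :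
      Move V1 H1 V2 H2 (-1-q) (V1.erase q) H1 (insert q V2) H2
  | south (q e : ℤ) (h1 : q ∈ V1) (h2 : q-1 ∉ H1) (h3 : q < e) (h4 : q+1 ∈ H1 ∨ q+1 ∈ V2)
      (h5 : ∀ d, q < d → d ≤ e → d ∈ V1 ∨ d ∈ H1)
      (h6 : ∀ d, q < d → d < e → d ∈ H1 → d+1 ∈ H1 ∨ d+1 ∈ V2) (h7 : e ∈ H1) (h8 : e+1 ∉ H1)
      (h9 : e+1 ∉ V2) :
      Move V1 H1 V2 H2 (-1-q) (V1.erase q) (insert q (H1.erase e)) (insert e V2) H2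

section
variable {σ0 σ1 σ2 : ℤ → ℤ} {V1 H1 V2 H2 V1' H1' V2' H2' W1 W2 V H : Finset ℤ} {g : ℤ → Prop} {M p x : ℤ}

/-- The two shapes of the first part of a word. -/
def Front (V1 H H2 W1 : Finset ℤ) : Prop :=
  (¬ (0 ∈ H ∧ 0 ∈ H2) ∧ W1 = refl V1 ∪ H) ∨ ((0 ∈ H ∧ 0 ∈ H2) ∧ W1 = refl (insert 0 V1) ∪ H.erase 0)

lemma Front.mem_pos (h : Front V1 H H2 W1) (hV : ∀ c ∈ V1, 0 ≤ c) {c : ℤ} (hc : 1 ≤ c) : c ∈ W1 ↔ c ∈ H := by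
  have := hV (-1-c)
  rcases h with ⟨-, rfl⟩ | ⟨-, rfl⟩ <;> simp only [mem_union, mem_refl, mem_insert, mem_erase] <;>
    grind

lemma Front.mem_neg (h : Front V1 H H2 W1) (hH : ∀ c ∈ H, 0 ≤ c) {c : ℤ} (hc : 1 ≤ c) :
    -1-c ∈ W1 ↔ c ∈ V1 := by
  have := hH (-1-c)
  rcases h with ⟨-, rfl⟩ | ⟨-, rfl⟩ <;> simp only [mem_union, mem_refl, mem_insert, mem_erase,
    sub_sub_cancel] <;> grind

lemma Front.mem_zero (h : Front V1 H H2 W1) (hV : ∀ c ∈ V1, 0 ≤ c) :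
    0 ∈ W1 ↔ 0 ∈ H ∧ 0 ∉ H2 := by
  have := hV (-1)
  rcases h with ⟨h, rfl⟩ | ⟨h, rfl⟩ <;> simp only [mem_union, mem_refl, mem_insert, mem_erase] <;>
    grind

lemma Front.mem_neg_one (h : Front V1 H H2 W1) (hH : ∀ c ∈ H, 0 ≤ c) (hz : 0 ∉ V1) :
    -1 ∈ W1 ↔ 0 ∈ H ∧ 0 ∈ H2 := by
  have := hH (-1)
  rcases h with ⟨h, rfl⟩ | ⟨h, rfl⟩ <;> simp only [mem_union, mem_refl, mem_insert, mem_erase] <;>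
    norm_num <;> tauto

lemma Front.cnt_nonneg (h : Front V1 H H2 W1) (hV : ∀ c ∈ V1, 0 ≤ c) (hH : ∀ c ∈ H, 0 ≤ c) (hz : 0 ∉ V1)
    {c : ℤ} (hc : 0 ≤ c) : cnt W1 c = V1.card+cnt H c := by
  rcases h with ⟨-, rfl⟩ | ⟨⟨h, -⟩, rfl⟩
  · exact cnt_refl_union_nonneg hV hH hc
  · rw [cnt_refl_union_nonneg (by simpa using hV) (fun c hc => hH c (mem_of_mem_erase hc)) hc,
      cnt_erase _ _ _ h, if_pos hc, card_insert_of_notMem hz]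
    push_cast; ring

lemma Front.cnt_neg (h : Front V1 H H2 W1) (hV : ∀ c ∈ V1, 0 ≤ c) (hH : ∀ c ∈ H, 0 ≤ c) (hz : 0 ∉ V1)
    {s : ℤ} (hs : 1 ≤ s) : cnt W1 (-1-s) = V1.card-cnt V1 (s-1) := by
  have e : -2-(-1-s) = s-1 := by ring
  rcases h with ⟨-, rfl⟩ | ⟨⟨h, -⟩, rfl⟩
  · rw [cnt_refl_union_neg hV hH (by omega), e]
  · rw [cnt_refl_union_neg (by simpa using hV) (fun c hc => hH c (mem_of_mem_erase hc)) (by omega), e,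
      cnt_insert _ _ _ hz, if_pos (by omega), card_insert_of_notMem hz]
    push_cast; ring

lemma Front.lower_nonneg (h : Front V1 H H2 W1) (hV : ∀ c ∈ V1, 0 ≤ c) (hp : 0 ≤ p)
    (h1 : p ∈ W1) : Front V1 (H.erase p) (insert p H2) (W1.erase p) := by
  rcases h with ⟨h, rfl⟩ | ⟨h, rfl⟩
  · refine Or.inl ⟨by simp only [mem_erase, mem_insert]; grind, ?_⟩
    ext c; have := hV (-1-c); simp only [mem_erase, mem_union, mem_refl]; grind
  · have h0 : p ≠ 0 := by
      rintro rfl; simp only [mem_union, mem_refl, mem_insert, mem_erase] at h1; grind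
    refine Or.inr ⟨by simp only [mem_erase, mem_insert]; grind, ?_⟩
    ext c; have := hV (-1-c); simp only [mem_erase, mem_union, mem_refl, mem_insert]; grind

lemma Front.lower_neg (h : Front V1 H H2 W1) (hH : ∀ c ∈ H, 0 ≤ c) {q : ℤ} (hq : 1 ≤ q) :
    Front (V1.erase q) H H2 (W1.erase (-1-q)) := by
  rcases h with ⟨h, rfl⟩ | ⟨h, rfl⟩
  · refine Or.inl ⟨h, ?_⟩
    ext c; have := hH (-1-c); simp only [mem_erase, mem_union, mem_refl]; grind
  · refine Or.inr ⟨h, ?_⟩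
    ext c; have := hH (-1-c); simp only [mem_erase, mem_union, mem_refl, mem_insert]; grind

lemma insert_refl_union (p : ℤ) (V K : Finset ℤ) : insert p (refl V ∪ K) = refl V ∪ insert p K := by
  ext c; simp only [mem_insert, mem_union, mem_refl]; tauto

lemma insert_refl_union' (q : ℤ) (V K : Finset ℤ) : insert (-1-q) (refl V ∪ K) = refl (insert q V) ∪ K := by
  ext c; simp only [mem_insert, mem_union, mem_refl]; grind

open Classical in
/-- The excess functions of the word and of the layers themselves. -/
lemma word_ht (L1 : Layer σ0 σ1 V1 H1) (L2 : Layer σ1 σ2 V2 H2) (r : Rot H1 V2 V H g)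
    (f : Front V1 H H2 W1) :
    (∀ c, 0 ≤ c → ht W1 (refl V ∪ H2) c = ht (refl V1 ∪ H1) (refl V2 ∪ H2) c +
      if c ∈ H1 ∨ c ∈ V2 then (if g c then 1 else 0)-ind H1 c else 0) ∧
    (∀ s, 1 ≤ s → ht W1 (refl V ∪ H2) (-1-s) = ht (refl V1 ∪ H1) (refl V2 ∪ H2) (-1-s) -
      if s-1 ∈ H1 ∨ s-1 ∈ V2 then (if g (s-1) then 1 else 0)-ind H1 (s-1) else 0) := by
  obtain ⟨k1, k2⟩ := r.halfStrips L1.hH L2.hV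
  have nV := k1.nonneg; have nH := k2.nonneg; have nV1 := L1.hV.nonneg; have nH1 := L1.hH.nonneg
  have nV2 := L2.hV.nonneg; have nH2 := L2.hH.nonneg
  have hu : ∀ c, cnt V c = cnt V2 c+cnt H1 c-cnt H c := by
    intro c
    have e : V ∪ H = H1 ∪ V2 := by
      ext x; have := r.union x; simp only [mem_union]; tauto
    have := cnt_union r.disj' c; have := cnt_union r.disj c
    rw [e] at *; omega
  have hcard : (V.card : ℤ) = V2.card := by
    have e : V ∪ H = H1 ∪ V2 := by
      ext x; have := r.union x; simp only [mem_union]; tauto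
    have a := card_union_of_disjoint (Finset.disjoint_left.2 fun c h h' => r.disj' c h h')
    have b := card_union_of_disjoint (Finset.disjoint_left.2 fun c h h' => r.disj c h h'); have := r.card
    rw [e] at a; omega
  constructor
  · intro c hc
    unfold ht
    rw [f.cnt_nonneg nV1 nH L1.zero hc, cnt_refl_union_nonneg nV nH2 hc, cnt_refl_union_nonneg nV1 nH1 hc,
      cnt_refl_union_nonneg nV2 nH2 hc, r.cnt_eq, hcard]
    ring
  · intro s hs
    unfold ht
    have e : -2-(-1-s) = s-1 := by ring
    rw [f.cnt_neg nV1 nH L1.zero hs, cnt_refl_union_neg nV nH2 (by omega), cnt_refl_union_neg nV1 nH1 (by omega),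
      cnt_refl_union_neg nV2 nH2 (by omega), e, hu, r.cnt_eq, hcard]
    ring

open Classical in
/-- The excess of the layers at cells that are not followed by a cell of the same value. -/
lemma word_ht_of_good (L1 : Layer σ0 σ1 V1 H1) (L2 : Layer σ1 σ2 V2 H2) (r : Rot H1 V2 V H g)
    (f : Front V1 H H2 W1) {y : ℤ} (hy : y ∈ refl V1 ∪ H1) (hy' : y+1 ∉ refl V1 ∪ H1) :
    (y < 0 → y ≤ -2 ∧ ht (refl V1 ∪ H1) (refl V2 ∪ H2) y ≤ ht W1 (refl V ∪ H2) y) ∧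
    (0 ≤ y → y ∈ H1 ∧ (g y → ht (refl V1 ∪ H1) (refl V2 ∪ H2) y = ht W1 (refl V ∪ H2) y) ∧
      (¬ g y → ht (refl V1 ∪ H1) (refl V2 ∪ H2) y = ht W1 (refl V ∪ H2) (y+1) ∧ y+1 ∈ V2)) := by
  obtain ⟨e1, e2⟩ := word_ht L1 L2 r f
  rw [mem_union, mem_refl] at hy hy'
  push Not at hy'
  obtain ⟨hy1, hy2⟩ := hy'
  constructor
  · intro hlt
    have h1 : -1-y ∈ V1 := hy.resolve_right fun h => by have := L1.hH.nonneg y h; omega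
    have h0 : -1-y ≠ 0 := fun h => L1.zero (h ▸ h1); have := e2 (-1-y) (by omega)
    rw [show -1-(-1-y) = y by ring] at this
    have a1 := L1.hV.stripAt (-1-y) (by omega); have a2 := L1.hH.stripAt (-1-y) (by omega)
    have a3 := L2.hV.stripAt (-1-y) (by omega)
    rw [show -1-(y+1) = -1-y-1 by ring] at hy1
    have la := r.last (-1-y-1)
    rw [sub_add_cancel] at la
    have key : (if -1-y-1 ∈ H1 ∨ -1-y-1 ∈ V2 then (if g (-1-y-1) then 1 else 0) -
        ind H1 (-1-y-1) else 0) ≤ (0 : ℤ) := by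
      have := r.disj (-1-y-1)
      unfold StripAt after ind at *; grind
    exact ⟨by omega, by linarith⟩
  · intro hge
    have h1 : y ∈ H1 := hy.resolve_left fun h => by have := L1.hV.nonneg _ h; omega
    refine ⟨h1, fun hg => ?_, fun hg => ?_⟩
    · rw [e1 y hge, if_pos (Or.inl h1), if_pos hg, ind_of_mem h1]; ring
    · have h2 : y+1 ∈ V2 := by
        by_contra hcon; exact hg ((r.last y (Or.inl h1) (by tauto)).1 h1)
      refine ⟨?_, h2⟩
      have h3 := L2.disj _ h2
      rw [e1 (y+1) (by omega), if_pos (Or.inr h2), if_neg (fun h => hg ((r.const y (Or.inl h1) (Or.inr h2)).2 h)),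
        ind_of_not_mem hy2, ht_succ, ind_of_not_mem, ind_of_not_mem]
      · ring
      · rw [mem_union, mem_refl]; rintro (h | h)
        · have := L2.hV.nonneg _ h; omega
        · exact h3 h
      · rw [mem_union, mem_refl]; tauto

/-- Along a run that follows a place of maximal excess, the excess stays maximal up to the values of
the second horizontal strip. -/
lemma word_walk (L2 : Layer σ1 σ2 V2 H2) (r : Rot H1 V2 V H g) (f : Front V1 H H2 W1)
    (hV1 : ∀ c ∈ V1, 0 ≤ c) (hV : ∀ c ∈ V, 0 ≤ c) (nm : ∀ c, ht W1 (refl V ∪ H2) c = M → c+1 ∉ W1)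
    {a e : ℤ} (ha : 0 ≤ a)
    (hrun : ∀ d, a ≤ d → d ≤ e → d ∈ H1 ∨ d ∈ V2) (h : ht W1 (refl V ∪ H2) a = M-ind H2 a) (d : ℤ)
    (had : a ≤ d) (hde : d ≤ e) :
    ht W1 (refl V ∪ H2) d = M-ind H2 d ∧ (d < e → d ∈ H1 → d ∈ H2) := by
  have key : ∀ d, a ≤ d → d < e → ht W1 (refl V ∪ H2) d = M-ind H2 d → (d ∈ H1 → d ∈ H2) ∧
      ht W1 (refl V ∪ H2) (d+1) = M-ind H2 (d+1) := by
    intro d h1 h2 h3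
    have sh := r.shift d (hrun d h1 h2.le) (hrun (d+1) (by omega) (by omega))
    have m1 := f.mem_pos hV1 (c := d+1) (by omega)
    have m2 : d+1 ∈ refl V ∪ H2 ↔ d+1 ∈ H2 := by
      have := hV (-1-(d+1)); rw [mem_union, mem_refl]; grind
    have n := nm d; have s := ht_succ W1 (refl V ∪ H2) d; have di := L2.disj d
    unfold ind at *; grind
  obtain ⟨n, hn⟩ : ∃ n : ℕ, d = a+n := ⟨(d-a).toNat, by omega⟩
  have base : ht W1 (refl V ∪ H2) d = M-ind H2 d := by
    induction n generalizing d with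
    | zero => simp at hn; rw [hn]; exact h
    | succ n ih =>
      push_cast at hn
      have := ih (a+n) (by omega) (by omega) rfl
      rw [hn, ← add_assoc]; exact (key _ (by omega) (by omega) this).2
  exact ⟨base, fun h1 h2 => (key d had h1 base).1 h2⟩

lemma exists_union_run_end (A B : Finset ℤ) {p : ℤ} (h : p ∈ A ∨ p ∈ B) :
    ∃ e, p ≤ e ∧ (∀ d, p ≤ d → d ≤ e → d ∈ A ∨ d ∈ B) ∧ ¬ (e+1 ∈ A ∨ e+1 ∈ B) := by
  obtain ⟨b, hb⟩ := exists_upper (A ∪ B)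
  have hp := hb p (by simpa using h)
  obtain ⟨e, h1, h2, h3⟩ := exists_first (P := fun c => ¬ (c+1 ∈ A ∨ c+1 ∈ B)) p
    ⟨b, hp.le, fun h => by have := hb (b+1) (by simpa using h); omega⟩
  refine ⟨e, h1, fun d a b => ?_, h2⟩
  by_cases hd : d = p
  · rwa [hd]
  · have := h3 (d-1) (by omega) (by omega)
    rw [not_not, sub_add_cancel] at this; exact this

/-- The active cell, if the flipped content belongs to a run that ends with the smaller value. -/
lemma active_of_run (L1 : Layer σ0 σ1 V1 H1) (L2 : Layer σ1 σ2 V2 H2) (r : Rot H1 V2 V H g)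
    (f : Front V1 H H2 W1) (hf : FirstMax W1 (refl V ∪ H2) M p) (nm : ∀ c, ht W1 (refl V ∪ H2) c = M → c+1 ∉ W1)
    {a : ℤ} (ha : 0 ≤ a) (hap : a = p ∨ (p = -1 ∧ a = 0)) (hC : a ∈ H1 ∨ a ∈ V2) (hg : g a)
    (h : ht W1 (refl V ∪ H2) a = M-ind H2 a) :
    ∃ e, a ≤ e ∧ (∀ d, a ≤ d → d ≤ e → d ∈ H1 ∨ d ∈ V2) ∧ ¬ (e+1 ∈ H1 ∨ e+1 ∈ V2) ∧ e ∈ H1 ∧ e ∉ H2 ∧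
      (∀ d, a ≤ d → d < e → d ∈ V2 ∨ d ∈ H2) ∧ Active V1 H1 V2 H2 M e := by
  have nV := (r.halfStrips L1.hH L2.hV).1.nonneg
  obtain ⟨e, h1, h2, h3⟩ := exists_union_run_end _ _ hC
  have ge : ∀ d, a ≤ d → d ≤ e → g d := fun d i j => by
    rwa [← r.g_const i fun x a b => h2 x a (b.trans j)]
  have he : e ∈ H1 := (r.last e (h2 e h1 le_rfl) h3).2 (ge e h1 le_rfl)
  have he2 : e ∉ H2 := by
    have b1 := L1.hH.stripAt (e+1) (by omega); have b2 := L2.hV.stripAt (e+1) (by omega)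
    have b3 := L2.hH.stripAt (e+1) (by omega); have b4 := r.disj e he
    unfold StripAt after at b1 b2 b3
    rw [add_sub_cancel_right] at b1 b2 b3
    clear * - b1 b2 b3 b4 he h3
    unfold ind at *; grind
  have w := word_walk L2 r f L1.hV.nonneg nV nm ha h2 h
  have good := fun y (h : y ∈ refl V1 ∪ H1) (h' : y+1 ∉ refl V1 ∪ H1) => word_ht_of_good L1 L2 r f h h'
  have ge1 : e+1 ∉ refl V1 ∪ H1 := by
    rw [mem_union, mem_refl]; rintro (h | h)
    · have := L1.hV.nonneg _ h; omega
    · exact h3 (Or.inl h)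
  refine ⟨e, h1, h2, h3, he, he2, fun d i j => ?_, ?_⟩
  · rcases h2 d i j.le with k | k; exacts [Or.inr ((w d i j.le).2 j k), Or.inl k]
  refine ⟨mem_union_right _ he, ge1, ?_, fun y m m' => ?_, fun y m m' hy => ?_, by omega, fun h => absurd h (by omega)⟩
  · rw [((good e (mem_union_right _ he) ge1).2 (by omega)).2.1 (ge e h1 le_rfl), (w e h1 le_rfl).1,
      ind_of_not_mem he2]; ring
  · obtain ⟨k1, k2⟩ := good y m m'
    rcases lt_or_ge y 0 with hy | hy
    · exact (k1 hy).2.trans (hf.le y)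
    · obtain ⟨_, k3, k4⟩ := k2 hy
      by_cases gy : g y
      · rw [k3 gy]; exact hf.le y
      · rw [(k4 gy).1]; exact hf.le _
  · obtain ⟨k1, k2⟩ := good y m m'
    rcases lt_or_ge y 0 with hy0 | hy0
    · obtain ⟨k3, k4⟩ := k1 hy0; exact k4.trans_lt (hf.lt y (by omega))
    · obtain ⟨k0, k3, k4⟩ := k2 hy0
      rcases lt_or_ge y a with hya | hya
      · have hlt : a = p := by omega
        by_cases gy : g y
        · rw [k3 gy]; exact hf.lt y (by omega)
        · obtain ⟨k5, k6⟩ := k4 gy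
          rw [k5]
          refine hf.lt _ (lt_of_le_of_ne (by omega) fun hcon => gy ?_)
          rw [r.const y (Or.inl k0) (Or.inr k6), hcon, ← hlt]; exact hg
      · obtain ⟨w1, w2⟩ := w y hya hy.le
        rw [k3 (ge y hya hy.le), w1, ind_of_mem (w2 hy k0)]; omega

lemma word_good_le (L1 : Layer σ0 σ1 V1 H1) (L2 : Layer σ1 σ2 V2 H2) (r : Rot H1 V2 V H g)
    (f : Front V1 H H2 W1) (hM : ∀ c, ht W1 (refl V ∪ H2) c ≤ M) (y : ℤ) (m : y ∈ refl V1 ∪ H1)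
    (m' : y+1 ∉ refl V1 ∪ H1) : ht (refl V1 ∪ H1) (refl V2 ∪ H2) y ≤ M := by
  obtain ⟨k1, k2⟩ := word_ht_of_good L1 L2 r f m m'
  rcases lt_or_ge y 0 with hy | hy
  · exact (k1 hy).2.trans (hM y)
  · obtain ⟨_, k3, k4⟩ := k2 hy
    by_cases gy : g y
    · rw [k3 gy]; exact hM y
    · rw [(k4 gy).1]; exact hM _

/-- Along a run that precedes a place of maximal excess in the reflected order, the cells of the
second vertical strip are cells of the first one. -/
lemma reflected_walk (r : Rot H1 V2 V H g) (f : Front V1 H H2 W1) (nH : ∀ c ∈ H, 0 ≤ c) (nH2 : ∀ c ∈ H2, 0 ≤ c)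
    (hd1 : ∀ c ∈ V1, c ∉ H1) (nl : ∀ c < p, ht W1 (refl V ∪ H2) c = M-1 → c ∉ refl V ∪ H2) {a e : ℤ}
    (ha : 1 ≤ a) (hap : -1-a < p) (hrun : ∀ d, a ≤ d → d ≤ e → d ∈ H1 ∨ d ∈ V2) (he : e ∈ H1)
    (h : ht W1 (refl V ∪ H2) (-1-a) = M-1-ind V a) (d : ℤ) (had : a ≤ d) (hde : d ≤ e) :
    d ∈ V1 ∨ d ∈ H1 := by
  have key : ∀ d, a ≤ d → d < e → ht W1 (refl V ∪ H2) (-1-d) = M-1-ind V d → (d ∈ V1 ∨ d ∈ H1) ∧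
      ht W1 (refl V ∪ H2) (-1-(d+1)) = M-1-ind V (d+1) := by
    intro d h1 h2 h3
    have mV : ∀ c, 0 ≤ c → (-1-c ∈ refl V ∪ H2 ↔ c ∈ V) := fun c hc => by
      have := nH2 (-1-c); rw [mem_union, mem_refl, sub_sub_cancel]; grind
    have c0 := hrun d h1 h2.le; have c1 := hrun (d+1) (by omega) (by omega); have s := ht_step W1 (refl V ∪ H2) (-1-d)
    rw [show -1-d-1 = -1-(d+1) by ring] at s
    have z1 := f.mem_neg nH (c := d) (by omega); have z2 := mV d (by omega); have z3 := mV (d+1) (by omega)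
    have shd := r.shift d c0 c1; have dd1 := r.disj' (d+1); have ud1 := r.union (d+1); have di := hd1 d
    have nn := nl (-1-(d+1)) (by omega)
    clear * - s z1 z2 z3 shd dd1 ud1 di nn c0 c1 h3
    unfold ind at *; grind
  have walk : ∀ n : ℕ, a+n ≤ e → ht W1 (refl V ∪ H2) (-1-(a+n)) = M-1-ind V (a+n) := by
    intro n
    induction n with
    | zero => simpa using fun _ => h
    | succ n ih =>
      intro hn
      push_cast at hn ⊢
      rw [← add_assoc]; exact (key _ (by omega) (by omega) (ih (by omega))).2
  rcases eq_or_lt_of_le hde with rfl | hlt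
  · exact Or.inr he
  · refine (key d had hlt ?_).1
    have := walk (d-a).toNat (by omega); rwa [show a+((d-a).toNat : ℤ) = d by omega] at this

/-- The lowering of words at a reflected content. -/
lemma link_of_neg (L1 : Layer σ0 σ1 V1 H1) (L2 : Layer σ1 σ2 V2 H2) (r : Rot H1 V2 V H g)
    (f : Front V1 H H2 W1) (pr : Pair W1 (refl V ∪ H2)) (hf : FirstMax W1 (refl V ∪ H2) M p) (hp : p ≤ -2) :
    ∃ x V1' H1' V2' H2', Active V1 H1 V2 H2 M x ∧ Move V1 H1 V2 H2 x V1' H1' V2' H2' ∧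
      Word V1' H1' V2' H2' (W1.erase p) (insert p (refl V ∪ H2)) := by
  obtain ⟨k1, k2⟩ := r.halfStrips L1.hH L2.hV
  have nH := k2.nonneg; have nH1 := L1.hH.nonneg
  have nV2 := L2.hV.nonneg; have nH2 := L2.hH.nonneg; have nm := pr.not_mem_succ hf.le; have nl := pr.not_mem_of_lt hf
  obtain ⟨m1, m2, m3⟩ := hf.mem
  have nl' := nl (p-1) (by omega) m3
  have good := fun y (h : y ∈ refl V1 ∪ H1) (h' : y+1 ∉ refl V1 ∪ H1) => word_ht_of_good L1 L2 r f h h'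
  have mV : ∀ c, 0 ≤ c → (-1-c ∈ refl V ∪ H2 ↔ c ∈ V) := fun c hc => by
    have := nH2 (-1-c); rw [mem_union, mem_refl, sub_sub_cancel]; grind
  have un : ∀ c, (c ∈ H1 ∨ c ∈ V2) ↔ (c ∈ V ∨ c ∈ H) := r.union; have hle := word_good_le L1 L2 r f hf.le
  obtain ⟨q, rfl⟩ : ∃ q, p = -1-q := ⟨-1-p, by ring⟩
  have hq : 1 ≤ q := by omega
  have qV₁ := (f.mem_neg nH hq).1 m1; have qV : q ∉ V := fun h => m2 ((mV q (by omega)).2 h)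
  have qV1 : q+1 ∉ V := fun h => nl' (by
    have := (mV (q+1) (by omega)).2 h; rwa [show -1-(q+1) = -1-q-1 by ring] at this)
  have nm1 := nm _ hf.eq
  rw [show -1-q+1 = -1-(q-1) by ring] at nm1
  have qV1' : q-1 ∉ V1 := fun h => by
    rcases eq_or_lt_of_le hq with h1 | h1
    · exact L1.zero (by rwa [← h1] at h)
    · exact nm1 ((f.mem_neg nH (by omega)).2 h)
  have qd := L1.disj q qV₁; have s1 := L1.hV.stripAt q hq; have s1' := L1.hV.stripAt (q+1) (by omega)
  have s2 := L1.hH.stripAt q hq; have s2' := L1.hH.stripAt (q+1) (by omega); have s3 := L2.hV.stripAt q hq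
  have s3' := L2.hV.stripAt (q+1) (by omega); have t1 := k1.stripAt (q+1) (by omega); have t0 := k1.stripAt q hq
  have u0 := un q; have u1 := un (q+1); have sh := r.shift q; have fr := r.first (q+1)
  unfold StripAt after at s1' s2' s3' t1
  rw [add_sub_cancel_right] at fr s1' s2' s3' t1
  have qC : ¬ (q ∈ H1 ∨ q ∈ V2) := by
    have x1 := r.disj q; have x2 := r.disj' q; have x3 := r.disj' (q+1)
    clear * - qV₁ qV qV1 qd s1 s1' s2 s2' s3 s3' t1 t0 u0 u1 qV1' sh x1 x2 x3
    unfold StripAt after ind at *; grind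
  have la := r.last (q-1)
  rw [sub_add_cancel] at la
  have gx : -1-q ∈ refl V1 ∪ H1 := mem_union_left _ (by rw [mem_refl, sub_sub_cancel]; exact qV₁)
  have gx' : -1-q+1 ∉ refl V1 ∪ H1 := by
    rw [mem_union, mem_refl, show -1-(-1-q+1) = q-1 by ring]
    rintro (h | h)
    · exact qV1' h
    · have := nH1 _ h; omega
  have e2 := (word_ht L1 L2 r f).2 q hq
  have hx : ht (refl V1 ∪ H1) (refl V2 ∪ H2) (-1-q) = M := by
    rw [hf.eq] at e2
    rw [e2]
    by_cases hc : q-1 ∈ H1 ∨ q-1 ∈ V2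
    · have := la hc qC
      rw [if_pos hc]
      by_cases h1 : q-1 ∈ H1
      · rw [if_pos (this.1 h1), ind_of_mem h1]; ring
      · rw [if_neg (fun h => h1 (this.2 h)), ind_of_not_mem h1]; ring
    · rw [if_neg hc]; ring
  have act : Active V1 H1 V2 H2 M (-1-q) := by
    refine ⟨gx, gx', hx, hle, fun y m m' hy => ?_, ?_, fun _ h => ?_⟩
    · exact ((good y m m').1 (by omega)).2.trans_lt (hf.lt y hy)
    · rintro ⟨h1, h2, h3⟩
      obtain rfl : q = 1 := by omega
      rw [sub_self] at la nm1
      have g0 := (la (Or.inl h2) qC).1 h2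
      have hz := (r.first 0 (Or.inl h2) (by
        have := nH1 (-1); have := nV2 (-1); norm_num; grind)).2 g0
      exact nm1 ((f.mem_neg_one nH L1.zero).2 ⟨hz, h3⟩ : -1 ∈ W1)
    · rw [sub_sub_cancel] at h; exact qC (Or.inr h)
  have front := f.lower_neg nH hq
  by_cases h1 : q-1 ∈ H1
  · exact ⟨_, _, _, _, _, act, Move.north q qV₁ h1, insert q V, H, _,
      r.insert_of_true qC h1 ((la (Or.inl h1) qC).1 h1) (fun h => by
        rcases u1.1 h with h | h
        · exact absurd h qV1
        · exact h), insert_refl_union' _ _ _, front⟩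
  by_cases h2 : q+1 ∈ H1 ∨ q+1 ∈ V2
  · have hH1 : q+1 ∈ H := (u1.1 h2).resolve_left qV1; have hg : g (q+1) := (fr h2 qC).1 hH1
    obtain ⟨e, i1, i2, i3⟩ := exists_union_run_end _ _ h2
    have ge : ∀ d, q+1 ≤ d → d ≤ e → g d := fun d i j => by
      rwa [← r.g_const i fun x a b => i2 x a (b.trans j)]
    have he : e ∈ H1 := (r.last e (i2 e i1 le_rfl) i3).2 (ge e i1 le_rfl)
    have base : ht W1 (refl V ∪ H2) (-1-(q+1)) = M-1-ind V (q+1) := by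
      rw [show -1-(q+1) = -1-q-1 by ring, m3, ind_of_not_mem qV1]; ring
    have walk' := reflected_walk r f nH nH2 L1.disj nl (a := q+1) (e := e) (by omega) (by omega)
      (fun d a b => i2 d a b) he base
    refine ⟨_, _, _, _, _, act, Move.south q e qV₁ h1 (by omega) h2 (fun d a b => walk' d (by omega) b)
      (fun d a b _ => i2 (d+1) (by omega) (by omega)) he (fun h => i3 (Or.inl h))
      (fun h => i3 (Or.inr h)), insert q V, H, _,
      r.insert_first (by omega) qC h1 (fun d a b => i2 d (by omega) b) he i3, insert_refl_union' _ _ _, front⟩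
  · exact ⟨_, _, _, _, _, act, Move.mark q qV₁ h1 (fun h => h2 (Or.inl h)) (fun h => h2 (Or.inr h)), insert q V, H, _,
      r.insert_last qC h2 h1, insert_refl_union' _ _ _, front⟩

/-- The lowering of words is the lowering operator on the layers. -/
lemma Word.link (L1 : Layer σ0 σ1 V1 H1) (L2 : Layer σ1 σ2 V2 H2) (w : Word V1 H1 V2 H2 W1 W2)
    (hf : FirstMax W1 W2 M p) :
    ∃ x V1' H1' V2' H2', Active V1 H1 V2 H2 M x ∧ Move V1 H1 V2 H2 x V1' H1' V2' H2' ∧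
      Word V1' H1' V2' H2' (W1.erase p) (insert p W2) := by
  have pr := (w.canon L1 L2).chain.pair
  obtain ⟨V, H, g, r, rfl, f⟩ := w
  change Front V1 H H2 W1 at f
  obtain ⟨k1, k2⟩ := r.halfStrips L1.hH L2.hV
  have nV := k1.nonneg; have nH := k2.nonneg; have nV1 := L1.hV.nonneg; have nH1 := L1.hH.nonneg
  have nV2 := L2.hV.nonneg; have nH2 := L2.hH.nonneg; have nm := pr.not_mem_succ hf.le; have nl := pr.not_mem_of_lt hf
  obtain ⟨m1, m2, m3⟩ := hf.mem
  have nl' := nl (p-1) (by omega) m3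
  have good := fun y (h : y ∈ refl V1 ∪ H1) (h' : y+1 ∉ refl V1 ∪ H1) => word_ht_of_good L1 L2 r f h h'
  have mH2 : ∀ c, 0 ≤ c → (c ∈ refl V ∪ H2 ↔ c ∈ H2) := fun c hc => by
    have := nV (-1-c); rw [mem_union, mem_refl]; grind
  have un : ∀ c, (c ∈ H1 ∨ c ∈ V2) ↔ (c ∈ V ∨ c ∈ H) := r.union; have hle := word_good_le L1 L2 r f hf.le
  rcases le_or_gt 0 p with hp | hp
  · have hpH : p ∈ H := by
      rcases eq_or_lt_of_le hp with h0 | h0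
      · have := f.mem_zero nV1; rw [← h0] at m1; rw [← h0]; exact (this.1 m1).1
      · exact (f.mem_pos nV1 (by omega)).1 m1
    have hpC : p ∈ H1 ∨ p ∈ V2 := (un p).2 (Or.inr hpH); have hpH2 : p ∉ H2 := fun h => m2 ((mH2 p hp).2 h)
    have front := f.lower_nonneg nV1 hp m1; have prev : p-1 ∉ H2 := fun h => nl' ((mH2 (p-1) (nH2 _ h)).2 h)
    by_cases hg : g p
    · obtain ⟨e, h1, h2, h3, h4, h5, h6, h7⟩ := active_of_run L1 L2 r f hf nm hp (Or.inl rfl) hpC hg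
        (by rw [hf.eq, ind_of_not_mem hpH2]; ring)
      have hp1 : p-1 ∉ V2 := fun h => by
        have sh := r.shift (p-1) (Or.inr h) (by rwa [sub_add_cancel])
        rw [sub_add_cancel] at sh; exact r.disj _ (sh.1 hpH) h
      rcases eq_or_lt_of_le h1 with rfl | hlt
      · refine ⟨p, _, _, _, _, h7, Move.turn p h4 (fun h => h3 (Or.inr h)) hp1 prev, V, H.erase p, g,
          r.erase_last h4 hpH h3, insert_refl_union _ _ _, front⟩
      · have hpV : p ∈ V2 := (h6 p le_rfl hlt).resolve_right hpH2
        exact ⟨e, _, _, _, _, h7, Move.ribbon e p h4 (fun h => h3 (Or.inr h)) hlt h6 hp1 prev, V, H.erase p, _,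
          r.erase_of_true hlt hpV hpH h2 h4 h3, insert_refl_union _ _ _, front⟩
    · have hpC' : p-1 ∈ H1 ∨ p-1 ∈ V2 := by
        by_contra hcon; exact hg ((r.first p hpC hcon).1 hpH)
      have sh := r.shift (p-1) hpC' (by rwa [sub_add_cancel])
      rw [sub_add_cancel] at sh
      have hp1 := sh.1 hpH
      have hpV : p ∈ V2 := by
        by_contra hcon
        have hp2 := hpC.resolve_right hcon
        have h3 : p+1 ∈ H1 ∨ p+1 ∈ V2 := by
          by_contra h3; exact hg ((r.last p hpC h3).1 hp2)
        exact nm p hf.eq ((f.mem_pos nV1 (by omega)).2 ((r.shift p hpC h3).2 hp2))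
      have hp2 : p ∉ H1 := fun h => r.disj _ h hpV; have pn := nH1 _ hp1
      have g1 : p-1+1 ∉ refl V1 ∪ H1 := by
        rw [sub_add_cancel, mem_union, mem_refl]; rintro (h | h)
        · have := nV1 _ h; omega
        · exact hp2 h
      have g0 : p-1 ∈ refl V1 ∪ H1 := mem_union_right _ hp1
      have hg' : ¬ g (p-1) := fun h => hg (by
        have := r.const (p-1) hpC' (by rwa [sub_add_cancel]); rw [sub_add_cancel] at this; exact this.1 h)
      have act : Active V1 H1 V2 H2 M (p-1) := by
        refine ⟨g0, g1, ?_, hle, fun y m m' hy => ?_, by omega, fun h => absurd h (by omega)⟩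
        · rw [(((good _ g0 g1).2 pn).2.2 hg').1, sub_add_cancel, hf.eq]
        · obtain ⟨k1, k2⟩ := good y m m'
          rcases lt_or_ge y 0 with hy0 | hy0
          · exact (k1 hy0).2.trans_lt (hf.lt y (by omega))
          · obtain ⟨_, k3, k4⟩ := k2 hy0
            by_cases gy : g y
            · rw [k3 gy]; exact hf.lt y (by omega)
            · rw [(k4 gy).1]; exact hf.lt _ (by omega)
      have mv := Move.east (V1 := V1) (H2 := H2) (p-1) hp1 (by rwa [sub_add_cancel])
      rw [sub_add_cancel] at mv
      exact ⟨p-1, _, _, _, _, act, mv, V, H.erase p, g, r.erase_of_false hp1 hpV hpH hg,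
        insert_refl_union _ _ _, front⟩
  rcases eq_or_ne p (-1) with rfl | hne
  · obtain ⟨a1, a2⟩ := (f.mem_neg_one nH L1.zero).1 m1
    have a3 : 0 ∈ H1 ∨ 0 ∈ V2 := (un 0).2 (Or.inr a1); have a4 := a3.resolve_right L2.zero
    have n1 : ∀ X : Finset ℤ, (∀ c ∈ X, 0 ≤ c) → (-1 : ℤ) ∉ X := fun X h h' => by have := h _ h'; omega
    have hg : g 0 := (r.first 0 a3 (by have := n1 _ nH1; have := n1 _ nV2; norm_num; tauto)).1 a1
    have h0 : ht W1 (refl V ∪ H2) 0 = M-ind H2 0 := by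
      have s := ht_succ W1 (refl V ∪ H2) (-1)
      rw [hf.eq, show (-1 : ℤ)+1 = 0 by norm_num, ind_of_mem ((mH2 0 le_rfl).2 a2),
        ind_of_not_mem (X := W1) (by rw [f.mem_zero nV1]; tauto)] at s
      rw [s, ind_of_mem a2]; ring
    obtain ⟨e, h1, h2, h3, h4, h5, h6, h7⟩ := active_of_run L1 L2 r f hf nm le_rfl (Or.inr ⟨rfl, rfl⟩) a3 hg h0
    have hlt : 0 < e := lt_of_le_of_ne h1 fun h => h5 (h ▸ a2)
    have mv := Move.ribbon (V1 := V1) e 0 h4 (fun h => h3 (Or.inr h)) hlt h6 (by have := n1 _ nV2; norm_num; tauto)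
      (by have := n1 _ nH2; norm_num; tauto)
    rw [Finset.erase_eq_of_notMem L2.zero, Finset.insert_eq_of_mem a2] at mv
    refine ⟨e, _, _, _, _, h7, mv, insert 0 V, H.erase 0, _, r.erase_first hlt a4 a1 h2 h4 h3
      (by have := n1 _ nH1; have := n1 _ nV2; norm_num; tauto), insert_refl_union' 0 _ _, Or.inl ⟨by simp, ?_⟩⟩
    rcases f with ⟨f, rfl⟩ | ⟨f, rfl⟩
    · exact absurd ⟨a1, a2⟩ f
    · have z := L1.zero
      ext c; have := nH (-1); have := nH c; simp only [mem_erase, mem_union, mem_refl, mem_insert]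
      grind
  exact link_of_neg L1 L2 r f pr hf (by omega)

/-- The excess at the places not followed by another cell of the same value is at most that of the word. -/
lemma Word.good_le (L1 : Layer σ0 σ1 V1 H1) (L2 : Layer σ1 σ2 V2 H2) (w : Word V1 H1 V2 H2 W1 W2)
    (hM : IsMax W1 W2 M) {y : ℤ} (m : y ∈ refl V1 ∪ H1) (m' : y+1 ∉ refl V1 ∪ H1) :
    ht (refl V1 ∪ H1) (refl V2 ∪ H2) y ≤ M := by
  obtain ⟨V, H, g, r, rfl, f⟩ := w; exact word_good_le L1 L2 r f hM.le y m m'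

/-- A word determines the layers. -/
lemma Word.injective (w : Word V1 H1 V2 H2 W1 W2) (w' : Word V1' H1' V2' H2' W1 W2)
    (n : ∀ c ∈ V1 ∪ H1 ∪ V2 ∪ H2, 0 ≤ c) (n' : ∀ c ∈ V1' ∪ H1' ∪ V2' ∪ H2', 0 ≤ c)
    (z : 0 ∉ V1) (z' : 0 ∉ V1') : V1 = V1' ∧ H1 = H1' ∧ V2 = V2' ∧ H2 = H2' := by
  simp only [mem_union] at n n'
  obtain ⟨V, H, g, r, rfl, f⟩ := w
  obtain ⟨V', H', g', r', e, f'⟩ := w'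
  change Front V1 H H2 W1 at f
  change Front V1' H' H2' W1 at f'
  obtain ⟨a1, a2⟩ := r.nonneg.1 ⟨fun c hc => n c (by tauto), fun c hc => n c (by tauto)⟩
  obtain ⟨b1, b2⟩ := r'.nonneg.1 ⟨fun c hc => n' c (by tauto), fun c hc => n' c (by tauto)⟩
  have c1 := filter_neg_union a1 (fun c hc => n c (Or.inr hc) : ∀ c ∈ H2, 0 ≤ c)
  have c2 := filter_neg_union b1 (fun c hc => n' c (Or.inr hc) : ∀ c ∈ H2', 0 ≤ c)
  rw [e] at c1
  have eV : V = V' := refl_injective (c1.1.symm.trans c2.1); have eH : H2 = H2' := c1.2.symm.trans c2.2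
  have nV1 : ∀ c ∈ V1, 0 ≤ c := fun c hc => n c (by tauto); have nV1' : ∀ c ∈ V1', 0 ≤ c := fun c hc => n' c (by tauto)
  have eV1 : V1 = V1' := by
    ext c
    rcases lt_trichotomy c 0 with hc | rfl | hc
    · exact ⟨fun h => absurd (nV1 c h) (by omega), fun h => absurd (nV1' c h) (by omega)⟩
    · exact ⟨fun h => absurd h z, fun h => absurd h z'⟩
    · rw [← f.mem_neg a2 (by omega), f'.mem_neg b2 (by omega)]
  have eHH : H = H' := by
    ext c
    rcases lt_trichotomy c 0 with hc | rfl | hc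
    · exact ⟨fun h => absurd (a2 c h) (by omega), fun h => absurd (b2 c h) (by omega)⟩
    · have := f.mem_neg_one a2 z; have := f.mem_zero nV1; have := f'.mem_neg_one b2 z'; have := f'.mem_zero nV1'
      subst eH; tauto
    · rw [← f.mem_pos nV1 (by omega), f'.mem_pos nV1' (by omega)]
  subst eV eHH
  obtain ⟨e1, e2⟩ := r.unique_symm r'; exact ⟨eV1, e1, e2, eH⟩

lemma Layer.nonneg2 (L1 : Layer σ0 σ1 V1 H1) (L2 : Layer σ1 σ2 V2 H2) : ∀ c ∈ V1 ∪ H1 ∪ V2 ∪ H2, 0 ≤ c := by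
  intro c hc; simp only [mem_union] at hc
  rcases hc with ((h | h) | h) | h
  exacts [L1.hV.nonneg c h, L1.hH.nonneg c h, L2.hV.nonneg c h, L2.hH.nonneg c h]

lemma Move.nonneg (h : Move V1 H1 V2 H2 x V1' H1' V2' H2') (n : ∀ c ∈ V1 ∪ H1 ∪ V2 ∪ H2, 0 ≤ c) :
    (∀ c ∈ V1' ∪ H1' ∪ V2' ∪ H2', 0 ≤ c) ∧ V1' ⊆ V1 := by
  simp only [mem_union] at n
  have n1 : ∀ c ∈ V1, 0 ≤ c := fun c h => n c (by tauto); have n2 : ∀ c ∈ H1, 0 ≤ c := fun c h => n c (by tauto)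
  have n3 : ∀ c ∈ V2, 0 ≤ c := fun c h => n c (by tauto); have n4 : ∀ c ∈ H2, 0 ≤ c := fun c h => n c (by tauto)
  clear n; simp only [mem_union]
  rcases h with ⟨_, h1, h2⟩ | ⟨_, h1, h2, h3, h4⟩ | ⟨_, p, h1, h2, h3, h4, h5, h6⟩ | ⟨q, h1, h2⟩ | ⟨q, h1, h2, h3, h4⟩ |
    ⟨q, e, h1, h2, h3, h4, h5, h6, h7, h8, h9⟩
  · exact ⟨by grind, by grind⟩
  · exact ⟨by grind, by grind⟩
  · have := h4 p le_rfl h3; exact ⟨by grind, by grind⟩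
  · exact ⟨by grind, by grind⟩
  · exact ⟨by grind, by grind⟩
  · exact ⟨by grind, by grind⟩

/-- The lowering operator on a pair of layers. -/
lemma Word.step (L1 : Layer σ0 σ1 V1 H1) (L2 : Layer σ1 σ2 V2 H2) (w : Word V1 H1 V2 H2 W1 W2)
    (hf : FirstMax W1 W2 M p) :
    ∃ x σ V1' H1' V2' H2', Active V1 H1 V2 H2 M x ∧ Move V1 H1 V2 H2 x V1' H1' V2' H2' ∧
      Layer σ0 σ V1' H1' ∧ Layer σ σ2 V2' H2' ∧ Word V1' H1' V2' H2' (W1.erase p) (insert p W2) := by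
  obtain ⟨x, A, B, C, D, h1, h2, h3⟩ := w.link L1 L2 hf
  obtain ⟨σ, A', B', C', D', k1, k2, k3⟩ := w.exists_lower L1 L2 hf
  obtain ⟨n1, n2⟩ := h2.nonneg (L1.nonneg2 L2)
  obtain ⟨rfl, rfl, rfl, rfl⟩ := h3.injective k3 n1 (k1.nonneg2 k2) (fun h => L1.zero (n2 h)) k1.zero
  exact ⟨x, σ, _, _, _, _, h1, h2, k1, k2, h3⟩

end

end Strip

namespace Shifted

open Strip (ind HalfStrip Layer StripAt after ind_of_mem ind_of_not_mem refl cnt ht mem_refl Move)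

/-! #### Letters and shapes -/

/-- The rank of a letter in the order `0' < 0 < 1' < 1 < ⋯`. -/
def rank (a : Letter) : ℕ := 2*a.val+if (ofLex a).2 then 1 else 0

@[simp] lemma rank_mk (k : ℕ) : rank (mk k) = 2*k := by simp [rank, mk, Letter.val]
@[simp] lemma rank_un (k : ℕ) : rank (un k) = 2*k+1 := by simp [rank, un, Letter.val]
@[simp] lemma val_mk (k : ℕ) : (mk k).val = k := rfl
@[simp] lemma val_un (k : ℕ) : (un k).val = k := rfl

lemma letter_cases (a : Letter) : a = mk a.val ∨ a = un a.val := by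
  rcases a with ⟨k, _ | _⟩; exacts [Or.inl rfl, Or.inr rfl]

lemma rank_bounds (a : Letter) : 2*a.val ≤ rank a ∧ rank a ≤ 2*a.val+1 := by
  unfold rank; split <;> omega

lemma le_iff_rank {a b : Letter} : a ≤ b ↔ rank a ≤ rank b := by
  rw [Prod.Lex.le_iff]
  unfold rank Letter.val
  generalize (ofLex a).1 = k
  generalize (ofLex a).2 = u
  generalize (ofLex b).1 = l
  generalize (ofLex b).2 = v
  cases u <;> cases v <;> simp <;> omega

lemma rank_injective {a b : Letter} (h : rank a = rank b) : a = b :=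
  le_antisymm (le_iff_rank.2 h.le) (le_iff_rank.2 h.ge)

lemma lt_iff_rank {a b : Letter} : a < b ↔ rank a < rank b := by
  rw [← not_le, le_iff_rank, not_le]

lemma StrictPartition.mem_of_le (γ : StrictPartition) {r c r' c' : ℕ} (h : (r, c) ∈ γ.diagram) (hr : r' ≤ r)
    (hc : c' ≤ c) (h' : r' ≤ c') : (r', c') ∈ γ.diagram := by
  have key : ∀ d r, r+d ≤ c → (r+d, c) ∈ γ.diagram → (r, c) ∈ γ.diagram := by
    intro d
    induction d with
    | zero => exact fun r _ h => h
    | succ d ih =>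
      intro r hle h
      refine ih r (by omega) ?_; simp only [diagram, Set.mem_ofPred_eq] at h ⊢
      refine ⟨by omega, ?_⟩
      have hl : r+d+1 < γ.parts.length := by
        by_contra hcon
        rw [← add_assoc, List.getD_eq_default _ _ (by omega)] at h; omega
      have := List.pairwise_iff_getElem.1 γ.strict (r+d) (r+d+1) (by omega) hl (by omega)
      rw [← add_assoc, List.getD_eq_getElem _ _ hl] at h
      rw [List.getD_eq_getElem _ _ (by omega)]; omega
  have h1 := h.1; have := key (r-r') r' (by simp only at h1; omega) (by rwa [show r'+(r-r') = r by omega])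
  exact ⟨h', lt_of_le_of_lt hc this.2⟩

lemma StrictPartition.lt_size (γ : StrictPartition) {r c : ℕ} (h : (r, c) ∈ γ.diagram) : r ≤ c ∧ c < γ.size := by
  refine ⟨h.1, ?_⟩
  have := (γ.mem_of_le h (Nat.zero_le r) le_rfl (Nat.zero_le c)).2; simp only [zero_add] at this
  have e : γ.parts.getD 0 0 = γ.parts.headD 0 := by cases γ.parts <;> rfl
  unfold size; omega

/-! #### Counting letters on diagonals -/

open Classical in
/-- The number of letters of rank at most `m` on the diagonal of content `c`. -/
noncomputable def num (γ : StrictPartition) (T : Filling) (m : ℕ) (c : ℤ) : ℤ :=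
  ((Finset.range γ.size).filter fun d => ∃ a, T (d, d+c.toNat) = some a ∧ rank a ≤ m).card

open Classical in
/-- The contents of the cells with the letter of rank `m`. -/
noncomputable def lay (γ : StrictPartition) (T : Filling) (m : ℕ) : Finset ℤ :=
  ((Finset.range γ.size).filter fun c => ∃ d a, T (d, d+c) = some a ∧ rank a = m).image (↑)

/-- The site occupation of the boundary of the letters of rank at most `m`. -/
noncomputable def site (γ : StrictPartition) (T : Filling) (m : ℕ) (s : ℤ) : ℤ :=
  num γ T m (s-1)-num γ T m s

lemma mem_iff_lt_card {S : Finset ℕ} (h : ∀ a ∈ S, ∀ b < a, b ∈ S) (d : ℕ) : d ∈ S ↔ d < S.card := by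
  constructor
  · intro hd
    have : Finset.range (d+1) ⊆ S := fun b hb => by
      rcases (Nat.lt_succ_iff_lt_or_eq.1 (Finset.mem_range.1 hb)) with h1 | rfl
      exacts [h d hd b h1, hd]
    simpa using Finset.card_le_card this
  · intro hd
    by_contra hcon
    have : S ⊆ Finset.range d := fun b hb => by
      rw [Finset.mem_range]; by_contra h1
      rcases eq_or_lt_of_le (not_lt.1 h1) with rfl | h2; exacts [hcon hb, hcon (h b hb d h2)]
    have := Finset.card_le_card this
    rw [Finset.card_range] at this; omega

section
variable {γ : StrictPartition} {n : ℕ∞} {S T : Filling} {i j k m r c r' c' : ℕ} {a b : Letter} {q q' : ℕ × ℕ} {M x p y : ℤ}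
  {V1 H1 V2 H2 V1' H1' V2' H2' : Finset ℤ}

lemma num_nonneg (γ : StrictPartition) (T : Filling) (m : ℕ) (c : ℤ) : 0 ≤ num γ T m c := by
  unfold num; positivity

lemma IsSSHT.lt_size (hT : IsSSHT γ n T) (h : T (r, c) = some a) : r ≤ c ∧ c < γ.size :=
  γ.lt_size ((hT.shape _).1 (by rw [h]; rfl))

lemma IsSSHT.exists_le (hT : IsSSHT γ n T) (h : T (r, c) = some a) (hr : r' ≤ r) (hc : c' ≤ c) (h' : r' ≤ c') :
    ∃ b, T (r', c') = some b ∧ rank b ≤ rank a := by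
  have m1 := (hT.shape _).1 (show (T (r, c)).isSome by rw [h]; rfl)
  obtain ⟨e, he⟩ := Option.isSome_iff_exists.1 ((hT.shape _).2 (γ.mem_of_le m1 hr le_rfl (h'.trans hc)))
  obtain ⟨b, hb⟩ := Option.isSome_iff_exists.1 ((hT.shape _).2 (γ.mem_of_le m1 hr hc h'))
  have h1 : e ≤ a := by
    rcases eq_or_lt_of_le hr with rfl | hlt
    · rw [h] at he; exact (Option.some.inj he).ge
    · exact hT.col_weak _ _ _ _ _ hlt he h
  have h2 : b ≤ e := by
    rcases eq_or_lt_of_le hc with rfl | hlt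
    · rw [hb] at he; exact (Option.some.inj he).le
    · exact hT.row_weak _ _ _ _ _ hlt hb he
  exact ⟨b, hb, le_iff_rank.1 (h2.trans h1)⟩

lemma IsSSHT.val_lt (hT : IsSSHT γ n T) (h : T (r, c) = some a) (h' : T (r', c') = some b) (hr : r < r')
    (hc : c'+r = c+r') : a.val < b.val := by
  have hb := hT.lt_size h
  obtain ⟨e, he, he'⟩ := hT.exists_le h' (r' := r+1) (c' := c+1) (by omega) (by omega) (by omega)
  obtain ⟨f, hf, hf'⟩ := hT.exists_le he (r' := r) (c' := c+1) (by omega) (by omega) (by omega)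
  obtain ⟨f2, hf2, hf2'⟩ := hT.exists_le hf (r' := r) (c' := c) (by omega) (by omega) (by omega)
  rw [h] at hf2
  obtain rfl := Option.some.inj hf2
  by_contra hcon
  have := rank_bounds a; have := rank_bounds b; have := rank_bounds e; have := rank_bounds f
  rcases letter_cases f with h1 | h1
  · have h2 : a = Shifted.mk f.val := rank_injective (by rw [h1, rank_mk] at hf2'; rw [rank_mk]; omega)
    rw [h2] at h; rw [h1] at hf
    have := hT.row_marked _ _ _ _ h hf; omega
  · have h2 : e = un f.val := rank_injective (by rw [h1, rank_un] at hf'; rw [rank_un]; omega)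
    rw [h2] at he; rw [h1] at hf
    have := hT.col_unmarked _ _ _ _ hf he; omega

lemma IsSSHT.lt_num (hT : IsSSHT γ n T) (h : r ≤ c) :
    (∃ a, T (r, c) = some a ∧ rank a ≤ m) ↔ (r : ℤ) < num γ T m (c-r) := by
  obtain ⟨x, rfl⟩ := Nat.exists_eq_add_of_le h
  unfold num
  rw [show ((r+x : ℕ) : ℤ)-r = x by push_cast; ring, Int.toNat_natCast, Nat.cast_lt, ← mem_iff_lt_card]
  · rw [mem_filter, Finset.mem_range]
    refine ⟨fun h => ⟨?_, h⟩, fun h => h.2⟩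
    obtain ⟨a, ha, -⟩ := h
    have := hT.lt_size ha; omega
  · simp only [mem_filter, Finset.mem_range]
    rintro a ⟨h1, e, he, he'⟩ b hb
    obtain ⟨f, hf, hf'⟩ := hT.exists_le he (r' := b) (c' := b+x) (by omega) (by omega) (by omega)
    exact ⟨by omega, f, hf, hf'.trans he'⟩

lemma num_mono (γ : StrictPartition) (T : Filling) {m m' : ℕ} (h : m ≤ m') (c : ℤ) : num γ T m c ≤ num γ T m' c := by
  unfold num
  refine Nat.cast_le.2 (Finset.card_le_card fun d hd => ?_); simp only [mem_filter] at hd ⊢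
  obtain ⟨h0, a, h1, h2⟩ := hd; exact ⟨h0, a, h1, h2.trans h⟩

lemma IsSSHT.mem_lay (hT : IsSSHT γ n T) {x : ℤ} :
    x ∈ lay γ T m ↔ ∃ r c a, T (r, c) = some a ∧ rank a = m ∧ x = (c : ℤ)-r := by
  unfold lay; simp only [Finset.mem_image, mem_filter, Finset.mem_range]
  constructor
  · rintro ⟨c, ⟨-, d, a, h1, h2⟩, rfl⟩; exact ⟨d, d+c, a, h1, h2, by push_cast; ring⟩
  · rintro ⟨r, c, a, h1, h2, rfl⟩
    have := hT.lt_size h1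
    exact ⟨c-r, ⟨by omega, r, a, by rwa [show r+(c-r) = c by omega], h2⟩, by omega⟩

lemma IsSSHT.lay_nonneg (hT : IsSSHT γ n T) : ∀ x ∈ lay γ T m, 0 ≤ x := by
  intro x hx
  obtain ⟨r, c, a, h, -, rfl⟩ := hT.mem_lay.1 hx
  have := hT.lt_size h; omega

lemma IsSSHT.num_of_mem (hT : IsSSHT γ n T) (h : T (r, c) = some a) :
    num γ T (2*a.val+1) (c-r) = r+1 ∧ (∀ m, 2*a.val = m+1 → num γ T m (c-r) = r) := by
  have hb := hT.lt_size h; have rb := rank_bounds a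
  constructor
  · have h1 : (r : ℤ) < num γ T (2*a.val+1) (c-r) := (hT.lt_num hb.1).1 (Exists.intro a ⟨h, rb.2⟩)
    by_contra hcon
    have h2 := (hT.lt_num (r := r+1) (c := c+1) (by omega) (m := 2*a.val+1)).2
      (by push_cast; rw [show (c : ℤ)+1-(r+1) = c-r by ring]; omega)
    obtain ⟨b, hb, hb'⟩ := h2
    have := hT.val_lt h hb (by omega) (by omega); have := rank_bounds b; omega
  · intro m hm
    have h1 : ¬ (r : ℤ) < num γ T m (c-r) := fun h1 => by
      obtain ⟨b, hb, hb'⟩ := (hT.lt_num hb.1).2 h1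
      rw [h] at hb; obtain rfl := Option.some.inj hb; omega
    by_contra hcon
    have h0 := num_nonneg γ T m (c-r)
    obtain ⟨d, hd⟩ := Int.eq_ofNat_of_zero_le h0
    obtain ⟨e, he, he'⟩ := hT.exists_le h (r' := d) (c' := d+(c-r)) (by omega) (by omega) (by omega)
    have h2 := (hT.lt_num (r := d) (c := d+(c-r)) (by omega) (m := m)).1 ⟨e, he, by
      have := hT.val_lt he h (by omega) (by omega)
      have := rank_bounds e; omega⟩
    rw [show ((d+(c-r) : ℕ) : ℤ)-d = c-r by omega] at h2; omega

lemma IsSSHT.num_succ (hT : IsSSHT γ n T) (m : ℕ) {x : ℤ} (hx : 0 ≤ x) :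
    num γ T (m+1) x = num γ T m x+ind (lay γ T (m+1)) x := by
  by_cases h : x ∈ lay γ T (m+1)
  · rw [ind_of_mem h]
    obtain ⟨r, c, a, h1, h2, rfl⟩ := hT.mem_lay.1 h
    have hb := hT.lt_size h1; have k1 := (hT.lt_num hb.1 (m := m+1)).1 ⟨a, h1, h2.le⟩
    have k2 : ¬ (r : ℤ) < num γ T m (c-r) := fun h3 => by
      obtain ⟨b, hb, hb'⟩ := (hT.lt_num hb.1).2 h3
      rw [h1] at hb; obtain rfl := Option.some.inj hb; omega
    obtain ⟨k3, k4⟩ := hT.num_of_mem h1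
    have rb := rank_bounds a; have k5 := num_mono γ T (show m+1 ≤ 2*a.val+1 by omega) (c-r)
    rcases Nat.lt_or_ge m (2*a.val) with hm | hm
    · have := k4 m (by omega); omega
    · have k6 := k4 (m-1)
      rcases Nat.eq_zero_or_pos a.val with hv | hv
      · have := (hT.entries _ _ h1).1; omega
      · have := k6 (by omega); have := num_mono γ T (show m-1 ≤ m by omega) (c-r); omega
  · rw [ind_of_not_mem h, add_zero]
    refine le_antisymm ?_ (num_mono γ T (Nat.le_succ m) x)
    by_contra hcon
    obtain ⟨d, hd⟩ := Int.eq_ofNat_of_zero_le (num_nonneg γ T m x)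
    obtain ⟨y, rfl⟩ := Int.eq_ofNat_of_zero_le hx
    have e : ((d+y : ℕ) : ℤ)-d = y := by push_cast; ring
    obtain ⟨a, h1, h2⟩ := (hT.lt_num (r := d) (c := d+y) (by omega) (m := m+1)).2
      (by rw [e]; omega)
    refine h (hT.mem_lay.2 ⟨d, d+y, a, h1, ?_, e.symm⟩)
    by_contra h3
    have := (hT.lt_num (r := d) (c := d+y) (by omega) (m := m)).1 ⟨a, h1, by omega⟩
    rw [e] at this; omega

/-- The interlacing conditions that characterize tableaux. -/
structure Interlacing (N : ℕ → ℤ → ℤ) : Prop where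
  zero : ∀ x, N 0 x = 0
  mono : ∀ m x, 0 ≤ x → N m x ≤ N (m+1) x
  vert : ∀ k s, 1 ≤ s → N (2*k+2) s ≤ N (2*k+1) (s-1)
  horiz : ∀ k s, 1 ≤ s → N (2*k+1) (s-1) ≤ N (2*k) s+1
  diag : ∀ k, N (2*k+2) 0 = N (2*k+1) 0

lemma IsSSHT.interlacing (hT : IsSSHT γ n T) : Interlacing (num γ T) := by
  refine ⟨fun x => ?_, fun m x _ => num_mono γ T (Nat.le_succ m) x, fun k s hs => ?_, fun k s hs => ?_, fun k => ?_⟩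
  · unfold num
    rw [Nat.cast_eq_zero, Finset.card_eq_zero, Finset.filter_eq_empty_iff]
    rintro d - ⟨a, h1, h2⟩
    have := (hT.entries _ _ h1).1; have := rank_bounds a; omega
  · by_contra hcon
    obtain ⟨d, hd⟩ := Int.eq_ofNat_of_zero_le (num_nonneg γ T (2*k+1) (s-1))
    obtain ⟨y, rfl⟩ := Int.eq_ofNat_of_zero_le (show 0 ≤ s by omega)
    obtain ⟨a, h1, h2⟩ := (hT.lt_num (r := d) (c := d+y) (by omega) (m := 2*k+2)).2
      (by rw [show ((d+y : ℕ) : ℤ)-d = y by push_cast; ring]; omega)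
    obtain ⟨b, h3, h4⟩ := hT.exists_le h1 (r' := d) (c' := d+y-1) (by omega) (by omega) (by omega)
    have h5 : ¬ rank b ≤ 2*k+1 := fun h5 => by
      have := (hT.lt_num (r := d) (c := d+y-1) (by omega)).1 ⟨b, h3, h5⟩
      rw [show ((d+y-1 : ℕ) : ℤ)-d = y-1 by omega] at this; omega
    have e1 : a = Shifted.mk (k+1) := rank_injective (by rw [rank_mk]; omega)
    have e2 : b = Shifted.mk (k+1) := rank_injective (by rw [rank_mk]; omega)
    rw [e1] at h1; rw [e2] at h3
    have := hT.row_marked _ _ _ _ h1 h3; omega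
  · by_contra hcon
    obtain ⟨d, hd⟩ := Int.eq_ofNat_of_zero_le (num_nonneg γ T (2*k) s)
    obtain ⟨y, rfl⟩ := Int.eq_ofNat_of_zero_le (show 0 ≤ s by omega)
    obtain ⟨a, h1, h2⟩ := (hT.lt_num (r := d+1) (c := d+y) (by omega) (m := 2*k+1)).2
      (by rw [show ((d+y : ℕ) : ℤ)-(d+1 : ℕ) = y-1 by push_cast; ring]; omega)
    obtain ⟨b, h3, h4⟩ := hT.exists_le h1 (r' := d) (c' := d+y) (by omega) (by omega) (by omega)
    have h5 : ¬ rank b ≤ 2*k := fun h5 => by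
      have := (hT.lt_num (r := d) (c := d+y) (by omega)).1 ⟨b, h3, h5⟩
      rw [show ((d+y : ℕ) : ℤ)-d = y by push_cast; ring] at this; omega
    have e1 : a = un k := rank_injective (by rw [rank_un]; omega)
    have e2 : b = un k := rank_injective (by rw [rank_un]; omega)
    rw [e1] at h1; rw [e2] at h3
    have := hT.col_unmarked _ _ _ _ h1 h3; omega
  · refine le_antisymm ?_ (num_mono γ T (by omega) 0)
    by_contra hcon
    obtain ⟨d, hd⟩ := Int.eq_ofNat_of_zero_le (num_nonneg γ T (2*k+1) 0)
    obtain ⟨a, h1, h2⟩ := (hT.lt_num (r := d) (c := d) le_rfl (m := 2*k+2)).2 (by rw [sub_self]; omega)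
    have h5 : ¬ rank a ≤ 2*k+1 := fun h5 => by
      have := (hT.lt_num (r := d) (c := d) le_rfl).1 ⟨a, h1, h5⟩
      rw [sub_self] at this; omega
    have e1 : a = Shifted.mk (k+1) := rank_injective (by rw [rank_mk]; omega)
    rw [e1] at h1; exact hT.diag_unmarked _ _ h1

/-- A filling with interlacing diagonals is a tableau. -/
lemma isSSHT_of_interlacing {N : ℕ → ℤ → ℤ} (hN : Interlacing N)
    (shape : ∀ q, (T q).isSome ↔ q ∈ γ.diagram)
    (entries : ∀ q a, T q = some a → 1 ≤ a.val ∧ (a.val : ℕ∞) ≤ n)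
    (hlt : ∀ r c m, r ≤ c → ((∃ a, T (r, c) = some a ∧ rank a ≤ m) ↔ (r : ℤ) < N m (c-r))) : IsSSHT γ n T := by
  have le : ∀ {r c a}, T (r, c) = some a → r ≤ c := fun {r c a} h =>
    ((shape (r, c)).1 (by rw [h]; rfl)).1
  have up : ∀ {r c a}, T (r, c) = some a → (r : ℤ) < N (rank a) (c-r) := fun h => (hlt _ _ _ (le h)).1 ⟨_, h, le_rfl⟩
  have lo : ∀ {r c a m}, T (r, c) = some a → m < rank a → N m (c-r) ≤ r := fun {r c a m} h hm => by
    by_contra hcon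
    obtain ⟨b, h1, h2⟩ := (hlt r c m (le h)).2 (by omega)
    rw [h] at h1; obtain rfl := Option.some.inj h1; omega
  have site : ∀ m s, 1 ≤ s → N m s ≤ N m (s-1) ∧ N m (s-1) ≤ N m s+1 := by
    intro m s hs
    obtain ⟨k, rfl | rfl⟩ : ∃ k, m = 2*k ∨ m = 2*k+1 := ⟨m / 2, by omega⟩
    · refine ⟨?_, (hN.mono (2*k) (s-1) (by omega)).trans (hN.horiz k s hs)⟩
      cases k with
      | zero => rw [mul_zero, hN.zero, hN.zero]
      | succ k => exact (hN.vert k s hs).trans (hN.mono (2*k+1) (s-1) (by omega))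
    · exact ⟨(hN.mono _ s (by omega)).trans (hN.vert k s hs),
        (hN.horiz k s hs).trans (by have := hN.mono (2*k) s (by omega); omega)⟩
  have site' : ∀ m (t : ℕ) x, 0 ≤ x → N m (x+t) ≤ N m x ∧ N m x ≤ N m (x+t)+t := by
    intro m t x hx
    induction t with
    | zero => simp
    | succ t ih =>
      have := site m (x+t+1) (by omega)
      rw [add_sub_cancel_right] at this
      push_cast
      rw [← add_assoc]; omega
  have anti : ∀ m x y, 0 ≤ x → x ≤ y → N m y ≤ N m x ∧ N m x ≤ N m y+(y-x) := by
    intro m x y hx hy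
    have := site' m (y-x).toNat x hx
    rwa [show x+((y-x).toNat : ℤ) = y by omega, show ((y-x).toNat : ℤ) = y-x by omega] at this
  refine ⟨shape, entries, fun r c d a b hcd h1 h2 => ?_, fun r s c a b hrs h1 h2 => ?_, fun r s c k h1 h2 => ?_,
    fun r c d k h1 h2 => ?_, fun r k h => ?_⟩
  · rw [le_iff_rank]
    by_contra hcon
    have := le h1; have := up h2; have := lo h1 (not_le.1 hcon)
    have := anti (rank b) (c-r) (d-r) (by omega) (by omega); omega
  · rw [le_iff_rank]
    by_contra hcon
    have := le h2; have := up h2; have := lo h1 (not_le.1 hcon)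
    have := anti (rank b) (c-s) (c-r) (by omega) (by omega); omega
  · have key : ∀ r s, r < s → T (r, c) = some (un k) → T (s, c) = some (un k) → False := by
      intro r s hrs h1 h2
      have := le h2; have a1 := up h2; have a2 := lo h1 (m := 2*k) (by rw [rank_un]; omega)
      have a3 := anti (2*k) (c-s+1) (c-r) (by omega) (by omega); have a4 := hN.horiz k (c-s+1) (by omega)
      rw [rank_un] at a1
      rw [add_sub_cancel_right] at a4; omega
    rcases lt_trichotomy r s with h | h | h
    exacts [(key r s h h1 h2).elim, h, (key s r h h2 h1).elim]
  · have key : ∀ c d, c < d → T (r, c) = some (mk k) → T (r, d) = some (mk k) → False := by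
      intro c d hcd h1 h2
      have := le h1; have hk := (entries _ _ h1).1
      rw [val_mk] at hk
      obtain ⟨k, rfl⟩ := Nat.exists_eq_add_of_le' hk
      have a1 := up h2; have a2 := lo h1 (m := 2*k+1) (by rw [rank_mk]; omega)
      have a3 := anti (2*k+1) (c-r) (d-r-1) (by omega) (by omega); have a4 := hN.vert k (d-r) (by omega)
      rw [rank_mk, show 2*(k+1) = 2*k+2 by ring] at a1; omega
    rcases lt_trichotomy c d with h | h | h
    exacts [(key c d h h1 h2).elim, h, (key d c h h2 h1).elim]
  · have hk := (entries _ _ h).1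
    rw [val_mk] at hk
    obtain ⟨k, rfl⟩ := Nat.exists_eq_add_of_le' hk
    have a1 := up h; have a2 := lo h (m := 2*k+1) (by rw [rank_mk]; omega)
    have a3 := hN.diag k
    rw [rank_mk, show 2*(k+1) = 2*k+2 by ring] at a1
    rw [sub_self] at a1 a2; omega

lemma Interlacing.monotone {N : ℕ → ℤ → ℤ} (hN : Interlacing N) {m m' : ℕ} (h : m ≤ m') {x : ℤ} (hx : 0 ≤ x) :
    N m x ≤ N m' x :=
  monotone_nat_of_le_succ (f := fun m => N m x) (fun m => hN.mono m x hx) h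

/-- The letters of one value form a layer. -/
lemma IsSSHT.layer (hT : IsSSHT γ n T) (k : ℕ) :
    Layer (site γ T (2*k+1)) (site γ T (2*k+3)) (lay γ T (2*k+2)) (lay γ T (2*k+3)) := by
  have I := hT.interlacing; have e1 : ∀ x : ℤ, 0 ≤ x → _ := fun x hx => hT.num_succ (2*k+1) hx
  have e2 : ∀ x : ℤ, 0 ≤ x → _ := fun x hx => hT.num_succ (2*k+2) hx
  have site : ∀ k s, 1 ≤ s → num γ T (2*k+1) s ≤ num γ T (2*k+1) (s-1) ∧
      num γ T (2*k+1) (s-1) ≤ num γ T (2*k+1) s+1 := fun k s hs =>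
    ⟨(I.mono _ s (by omega)).trans (I.vert k s hs),
        (I.horiz k s hs).trans (by have := I.mono (2*k) s (by omega); omega)⟩
  have key : ∀ s, 1 ≤ s → StripAt 1 (Shifted.site γ T (2*k+1)) (after (Shifted.site γ T (2*k+1)) (lay γ T (2*k+2)))
      (lay γ T (2*k+2)) s ∧ StripAt 0 (after (Shifted.site γ T (2*k+1)) (lay γ T (2*k+2)))
        (Shifted.site γ T (2*k+3)) (lay γ T (2*k+3)) s := by
    intro s hs
    have a1 := e1 s (by omega); have a2 := e1 (s-1) (by omega)
    have a3 := e2 s (by omega); have a4 := e2 (s-1) (by omega); have a5 := site k s hs; have a6 := site (k+1) s hs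
    have a7 := I.vert k s hs; have a8 := I.horiz (k+1) s hs
    rw [show 2*(k+1)+1 = 2*k+3 by ring] at a6 a8
    rw [show 2*(k+1) = 2*k+2 by ring] at a8; simp only [Nat.add_assoc, Nat.reduceAdd] at a1 a2 a3 a4
    clear * - a1 a2 a3 a4 a5 a6 a7 a8
    unfold StripAt after Shifted.site ind at *
    constructor
    · refine ⟨by omega, by grind, rfl, fun h h' => by grind⟩
    · refine ⟨by grind, by omega, by grind, fun h h' => by grind⟩
  refine ⟨⟨hT.lay_nonneg, fun s hs => (key s hs).1⟩, ⟨hT.lay_nonneg, fun s hs => (key s hs).2⟩, fun h => ?_, fun x h h' => ?_⟩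
  · have a1 := e1 0 le_rfl
    rw [ind_of_mem h, I.diag k] at a1; omega
  · have hx := hT.lay_nonneg x h; have a1 := e1 x hx; have a3 := e2 x hx
    have a7 := I.vert k (x+1) (by omega); have a8 := I.horiz (k+1) (x+1) (by omega)
    rw [show 2*(k+1)+1 = 2*k+3 by ring, show 2*(k+1) = 2*k+2 by ring] at a8
    rw [ind_of_mem h] at a1; rw [ind_of_mem h'] at a3
    simp only [Nat.add_assoc, Nat.reduceAdd, add_sub_cancel_right] at *; omega

lemma num_eq_of_lay (hS : IsSSHT γ n S) (hT : IsSSHT γ n T) {m : ℕ} (h : ∀ l ≤ m, lay γ S l = lay γ T l) {x : ℤ}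
    (hx : 0 ≤ x) : num γ S m x = num γ T m x := by
  induction m with
  | zero => rw [hS.interlacing.zero, hT.interlacing.zero]
  | succ m ih => rw [hS.num_succ m hx, hT.num_succ m hx, ih fun l hl => h l (by omega), h _ le_rfl]

/-- A tableau is determined by its layers. -/
lemma IsSSHT.ext_lay (hS : IsSSHT γ n S) (hT : IsSSHT γ n T) (h : ∀ m, lay γ S m = lay γ T m) : S = T := by
  have key : ∀ {S T : Filling}, IsSSHT γ n S → IsSSHT γ n T → (∀ m, lay γ S m = lay γ T m) → ∀ {r c a},
      S (r, c) = some a → ∃ b, T (r, c) = some b ∧ rank b ≤ rank a := by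
    intro S T hS hT h r c a ha
    have hb := (hS.lt_size ha).1
    rw [hT.lt_num hb, ← num_eq_of_lay hS hT (fun l _ => h l) (by omega), ← hS.lt_num hb]
    exact ⟨a, ha, le_rfl⟩
  funext ⟨r, c⟩
  cases hq : S (r, c) with
  | none =>
    cases hq' : T (r, c) with
    | none => rfl
    | some b => obtain ⟨a, ha, -⟩ := key hT hS (fun m => (h m).symm) hq'; rw [hq] at ha; cases ha
  | some a =>
    obtain ⟨b, hb, h1⟩ := key hS hT h hq
    obtain ⟨a', ha', h2⟩ := key hT hS (fun m => (h m).symm) hb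
    rw [hq] at ha'
    obtain rfl := Option.some.inj ha'
    rw [hb, rank_injective (le_antisymm h2 h1)]

lemma exists_of_interlacing (hT : IsSSHT γ n T) (hj : (j+2 : ℕ) ≤ n) {N : ℕ → ℤ → ℤ} (hN : Interlacing N)
    (heq : ∀ m, m ≤ 2*j+1 ∨ 2*j+5 ≤ m → ∀ x, N m x = num γ T m x) :
    ∃ S, IsSSHT γ n S ∧ ∀ m x, 0 ≤ x → num γ S m x = N m x := by
  classical
  let S : Filling := fun q =>
    if q.1 ≤ q.2 ∧ N (2*j+1) (q.2-q.1) ≤ q.1 ∧ (q.1 : ℤ) < N (2*j+5) (q.2-q.1) then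
      some (if (q.1 : ℤ) < N (2*j+2) (q.2-q.1) then mk (j+1) else
        if (q.1 : ℤ) < N (2*j+3) (q.2-q.1) then un (j+1) else
        if (q.1 : ℤ) < N (2*j+4) (q.2-q.1) then mk (j+2) else un (j+2))
    else T q
  have hlt : ∀ r c m, r ≤ c → ((∃ a, S (r, c) = some a ∧ rank a ≤ m) ↔ (r : ℤ) < N m (c-r)) := by
    intro r c m h
    have hx : (0 : ℤ) ≤ c-r := by omega
    have m1 := hN.mono (2*j+1) _ hx; have m2 := hN.mono (2*j+2) _ hx
    have m3 := hN.mono (2*j+3) _ hx; have m4 := hN.mono (2*j+4) _ hx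
    simp only [Nat.add_assoc, Nat.reduceAdd] at m1 m2 m3 m4
    by_cases hb : r ≤ c ∧ N (2*j+1) (c-r) ≤ r ∧ (r : ℤ) < N (2*j+5) (c-r)
    · have : S (r, c) = some _ := if_pos hb
      rw [this]; simp only [Option.some.injEq, exists_eq_left']
      have c1 : m ≤ 2*j+1 → N m (c-r) ≤ N (2*j+1) (c-r) := fun h => hN.monotone h hx
      have c2 : 2*j+5 ≤ m → N (2*j+5) (c-r) ≤ N m (c-r) := fun h => hN.monotone h hx
      obtain h | rfl | rfl | rfl | h : m ≤ 2*j+1 ∨ m = 2*j+2 ∨ m = 2*j+3 ∨ m = 2*j+4 ∨ 2*j+5 ≤ m := by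
        omega
      all_goals split_ifs <;> simp only [rank_mk, rank_un] <;> omega
    · have : S (r, c) = T (r, c) := if_neg hb
      rw [this, hT.lt_num h]
      by_cases hm : m ≤ 2*j+1 ∨ 2*j+5 ≤ m
      · rw [heq m hm]
      · have k1 := num_mono γ T (show 2*j+1 ≤ m by omega) (c-r)
        have k2 := num_mono γ T (show m ≤ 2*j+5 by omega) (c-r)
        rw [← heq (2*j+1) (by omega)] at k1
        rw [← heq (2*j+5) (by omega)] at k2
        have k3 := hN.monotone (show 2*j+1 ≤ m by omega) hx; have k4 := hN.monotone (show m ≤ 2*j+5 by omega) hx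
        omega
  have hS : IsSSHT γ n S := by
    refine isSSHT_of_interlacing hN (fun ⟨r, c⟩ => ?_) (fun ⟨r, c⟩ a ha => ?_) hlt
    · rw [← hT.shape]
      by_cases hb : r ≤ c ∧ N (2*j+1) (c-r) ≤ r ∧ (r : ℤ) < N (2*j+5) (c-r)
      · have e : S (r, c) = some _ := if_pos hb
        rw [heq _ (by omega), heq _ (by omega)] at hb
        obtain ⟨b, h1, -⟩ := (hT.lt_num hb.1).2 hb.2.2
        rw [e, h1]; simp
      · have : S (r, c) = T (r, c) := if_neg hb
        rw [this]
    · by_cases hb : r ≤ c ∧ N (2*j+1) (c-r) ≤ r ∧ (r : ℤ) < N (2*j+5) (c-r)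
      · have e : S (r, c) = some _ := if_pos hb
        rw [e] at ha
        have h1 : (j+1 : ℕ) ≤ n := le_trans (by exact_mod_cast (by omega : j+1 ≤ j+2)) hj
        rw [← Option.some.inj ha]
        split_ifs <;> simp only [val_mk, val_un] <;> exact ⟨by omega, by assumption⟩
      · have : S (r, c) = T (r, c) := if_neg hb
        rw [this] at ha; exact hT.entries _ _ ha
  refine ⟨S, hS, fun m x hx => ?_⟩
  obtain ⟨y, rfl⟩ := Int.eq_ofNat_of_zero_le hx
  have h1 : ∀ r : ℕ, (r : ℤ) < num γ S m y ↔ (r : ℤ) < N m y := fun r => by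
    have a := hS.lt_num (r := r) (c := r+y) (m := m) (by omega); have b := hlt r (r+y) m (by omega)
    rw [show ((r+y : ℕ) : ℤ)-r = y by push_cast; ring] at a b
    rw [← a, b]
  have h2 := num_nonneg γ S m y; have h3 : 0 ≤ N m y := by rw [← hN.zero y]; exact hN.monotone (Nat.zero_le m) hx
  have h4 := h1 (num γ S m y).toNat; have h5 := h1 (N m y).toNat; omega

lemma num_eq_zero (hT : IsSSHT γ n T) (m : ℕ) {x : ℤ} (hx : γ.size ≤ x) : num γ T m x = 0 := by
  obtain ⟨y, rfl⟩ := Int.eq_ofNat_of_zero_le (show 0 ≤ x by omega)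
  have := num_nonneg γ T m y
  by_contra hcon
  obtain ⟨a, h, -⟩ := (hT.lt_num (r := 0) (c := y) (m := m) (Nat.zero_le _)).2 (by push_cast; rw [sub_zero]; omega)
  have := hT.lt_size h; omega

/-- The counts after the replacement of two consecutive layers. -/
def replaced (M : ℕ → ℤ → ℤ) (j : ℕ) (V1 H1 V2 : Finset ℤ) (m : ℕ) (x : ℤ) : ℤ :=
  if m ≤ 2*j+1 ∨ 2*j+5 ≤ m then M m x else
    if m = 2*j+2 then M (2*j+1) x+ind V1 x else if m = 2*j+3 then M (2*j+1) x+ind V1 x+ind H1 x else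
      M (2*j+1) x+ind V1 x+ind H1 x+ind V2 x

lemma replaced_eq (M : ℕ → ℤ → ℤ) (j : ℕ) (V1 H1 V2 : Finset ℤ) :
    (∀ m, m ≤ 2*j+1 ∨ 2*j+5 ≤ m → ∀ x, replaced M j V1 H1 V2 m x = M m x) ∧
    (∀ x, replaced M j V1 H1 V2 (2*j+2) x = M (2*j+1) x+ind V1 x) ∧
    (∀ x, replaced M j V1 H1 V2 (2*j+3) x = M (2*j+1) x+ind V1 x+ind H1 x) ∧
    (∀ x, replaced M j V1 H1 V2 (2*j+4) x = M (2*j+1) x+ind V1 x+ind H1 x+ind V2 x) := by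
  unfold replaced
  refine ⟨fun m h x => if_pos h, fun x => ?_, fun x => ?_, fun x => ?_⟩
  · rw [if_neg (by omega)]; simp
  · rw [if_neg (by omega), if_neg (by omega)]; simp
  · rw [if_neg (by omega), if_neg (by omega), if_neg (by omega)]

lemma Interlacing.replaced {N : ℕ → ℤ → ℤ} (I : Interlacing N) {σ : ℤ → ℤ} {V1 H1 V2 H2 : Finset ℤ}
    (L1 : Layer (fun s => N (2*j+1) (s-1)-N (2*j+1) s) σ V1 H1)
    (L2 : Layer σ (fun s => N (2*j+5) (s-1)-N (2*j+5) s) V2 H2)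
    (tot : ∀ x, 0 ≤ x → N (2*j+5) x = N (2*j+1) x+ind V1 x+ind H1 x+ind V2 x+ind H2 x) :
    Interlacing (replaced N j V1 H1 V2) := by
  obtain ⟨n0, n2, n3, n4⟩ := replaced_eq N j V1 H1 V2
  have n1 := n0 (2*j+1) (Or.inl le_rfl); have n5 := n0 (2*j+5) (Or.inr le_rfl)
  have pos : ∀ (X : Finset ℤ) x, 0 ≤ ind X x := fun X x => by unfold ind; split_ifs <;> omega
  refine ⟨fun x => ?_, fun m x hx => ?_, fun k s hs => ?_, fun k s hs => ?_, fun k => ?_⟩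
  · rw [n0 0 (by omega)]; exact I.zero x
  · have p1 := pos V1 x; have p2 := pos H1 x; have p3 := pos V2 x; have p4 := pos H2 x; have t := tot x hx
    obtain h | rfl | rfl | rfl | rfl | h : m+1 ≤ 2*j+1 ∨ m = 2*j+1 ∨ m = 2*j+2 ∨ m = 2*j+3 ∨
      m = 2*j+4 ∨ 2*j+5 ≤ m := by omega
    · rw [n0 _ (by omega), n0 _ (by omega)]; exact I.mono m x hx
    · rw [n1, n2]; omega
    · rw [n2, n3]; omega
    · rw [n3, n4]; omega
    · rw [n4, n5]; omega
    · rw [n0 _ (by omega), n0 _ (by omega)]; exact I.mono m x hx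
  · have a1 := L1.hV.stripAt s hs; have a2 := L1.hH.stripAt s hs; have a3 := L2.hV.stripAt s hs
    obtain h | rfl | rfl | h : k < j ∨ k = j ∨ k = j+1 ∨ j+2 ≤ k := by omega
    · rw [n0 _ (by omega), n0 _ (by omega)]; exact I.vert k s hs
    · rw [n2, n1]; clear * - a1; unfold StripAt after ind at *; grind
    · rw [show 2*(j+1)+2 = 2*j+4 by ring, show 2*(j+1)+1 = 2*j+3 by ring, n4, n3]
      clear * - a2 a3; unfold StripAt after ind at *; grind
    · rw [n0 _ (by omega), n0 _ (by omega)]; exact I.vert k s hs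
  · have a2 := L1.hH.stripAt s hs; have a3 := L2.hV.stripAt s hs; have a4 := L2.hH.stripAt s hs
    have t := tot (s-1) (by omega)
    obtain h | rfl | rfl | h : k ≤ j ∨ k = j+1 ∨ k = j+2 ∨ j+3 ≤ k := by omega
    · rw [n0 _ (by omega), n0 _ (by omega)]; exact I.horiz k s hs
    · rw [show 2*(j+1)+1 = 2*j+3 by ring, show 2*(j+1) = 2*j+2 by ring, n3, n2]
      clear * - a2; unfold StripAt after ind at *; grind
    · rw [show 2*(j+2)+1 = 2*j+5 by ring, show 2*(j+2) = 2*j+4 by ring, n5, n4, t]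
      clear * - a2 a3 a4; unfold StripAt after ind at *; grind
    · rw [n0 _ (by omega), n0 _ (by omega)]; exact I.horiz k s hs
  · obtain h | rfl | rfl | h : k < j ∨ k = j ∨ k = j+1 ∨ j+2 ≤ k := by omega
    · rw [n0 _ (by omega), n0 _ (by omega)]; exact I.diag k
    · rw [n2, n1, ind_of_not_mem L1.zero, add_zero]
    · rw [show 2*(j+1)+2 = 2*j+4 by ring, show 2*(j+1)+1 = 2*j+3 by ring, n4, n3,
        ind_of_not_mem L2.zero, add_zero]
    · rw [n0 _ (by omega), n0 _ (by omega)]; exact I.diag k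

/-- Replacement of two consecutive layers. -/
lemma exists_of_layers (hT : IsSSHT γ n T) (hj : (j+2 : ℕ) ≤ n) {σ : ℤ → ℤ} {V1 H1 V2 H2 : Finset ℤ}
    (L1 : Layer (site γ T (2*j+1)) σ V1 H1) (L2 : Layer σ (site γ T (2*j+5)) V2 H2) :
    ∃ S, IsSSHT γ n S ∧ lay γ S (2*j+2) = V1 ∧ lay γ S (2*j+3) = H1 ∧ lay γ S (2*j+4) = V2 ∧
      lay γ S (2*j+5) = H2 ∧ (∀ m, m ≤ 2*j+1 ∨ 2*j+6 ≤ m → lay γ S m = lay γ T m) ∧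
      ∀ m x, m ≤ 2*j+1 ∨ 2*j+5 ≤ m → 0 ≤ x → num γ S m x = num γ T m x := by
  have I := hT.interlacing; have s2 := fun s hs => L1.hH.stripAt s hs; have s4 := fun s hs => L2.hH.stripAt s hs
  unfold StripAt after site at s2 s4
  have tot : ∀ x, 0 ≤ x → num γ T (2*j+5) x = num γ T (2*j+1) x+ind V1 x+ind H1 x+ind V2 x+ind H2 x := by
    obtain ⟨b, hb⟩ := Strip.exists_upper (V1 ∪ H1 ∪ V2 ∪ H2)
    have far : ∀ x, b ≤ x → γ.size ≤ x → num γ T (2*j+5) x = num γ T (2*j+1) x+ind V1 x+ind H1 x+ind V2 x+ind H2 x := by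
      intro x h1 h2
      have := hb x; simp only [mem_union] at this
      rw [num_eq_zero hT _ h2, num_eq_zero hT _ h2, ind_of_not_mem (by grind), ind_of_not_mem (by grind),
        ind_of_not_mem (by grind), ind_of_not_mem (by grind)]
      rfl
    have down : ∀ (t : ℕ) x, 0 ≤ x → (num γ T (2*j+5) (x+t) = num γ T (2*j+1) (x+t)+ind V1 (x+t)+ind H1 (x+t)+ind V2 (x+t)+ind H2 (x+t)) →
        num γ T (2*j+5) x = num γ T (2*j+1) x+ind V1 x+ind H1 x+ind V2 x+ind H2 x := by
      intro t
      induction t with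
      | zero => simp
      | succ t ih =>
        intro x hx h
        refine ih x hx ?_
        push_cast at h
        rw [← add_assoc] at h
        have a2 := (s2 (x+t+1) (by omega)).2.2.1; have a4 := (s4 (x+t+1) (by omega)).2.2.1
        rw [add_sub_cancel_right] at a2 a4; omega
    intro x hx
    refine down (max (b-x) (γ.size-x)).toNat x hx (far _ ?_ ?_)
    · have := le_max_left (b-x) (γ.size-x); omega
    · have := le_max_right (b-x) (γ.size-x); omega
  obtain ⟨n0, n2, n3, n4⟩ := replaced_eq (num γ T) j V1 H1 V2
  have n1 := n0 (2*j+1) (Or.inl le_rfl); have n5 := n0 (2*j+5) (Or.inr le_rfl)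
  obtain ⟨S, hS, hSN⟩ := exists_of_interlacing hT hj (I.replaced L1 L2 tot) n0
  have ext : ∀ m (X : Finset ℤ), (∀ x ∈ X, 0 ≤ x) → (∀ x, 0 ≤ x → ind X x = replaced (num γ T) j V1 H1 V2 (m+1) x-replaced (num γ T) j V1 H1 V2 m x) → lay γ S (m+1) = X := by
    intro m X hX h
    ext x
    by_cases hx : 0 ≤ x
    · have a := hS.num_succ m hx
      rw [hSN _ _ hx, hSN _ _ hx] at a
      have b := h x hx
      unfold ind at a b; grind
    · exact ⟨fun h => absurd (hS.lay_nonneg x h) hx, fun h => absurd (hX x h) hx⟩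
  refine ⟨S, hS, ext (2*j+1) _ L1.hV.nonneg fun x _ => ?_, ext (2*j+2) _ L1.hH.nonneg fun x _ => ?_,
    ext (2*j+3) _ L2.hV.nonneg fun x _ => ?_, ext (2*j+4) _ L2.hH.nonneg fun x hx => ?_, fun m hm => ?_,
    fun m x hm hx => by rw [hSN m x hx, n0 m hm]⟩
  · rw [n1, n2]; ring
  · rw [n2, n3]; ring
  · rw [n3, n4]; ring
  · rw [n4, n5, tot x hx]; ring
  · cases m with
    | zero =>
      have : ∀ {T : Filling}, IsSSHT γ n T → lay γ T 0 = ∅ := fun {T} hT => by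
        rw [Finset.eq_empty_iff_forall_notMem]
        intro x hx
        obtain ⟨r, c, a, h, h0, -⟩ := hT.mem_lay.1 hx
        have := (hT.entries _ _ h).1; have := rank_bounds a; omega
      rw [this hS, this hT]
    | succ m =>
      refine ext m _ hT.lay_nonneg fun x hx => ?_
      rw [n0 _ (by omega), n0 _ (by omega), hT.num_succ m hx]; ring

/-! #### The reading order -/

/-- The index of the hook in which a cell is read. -/
def hook (T : Filling) (q : ℕ × ℕ) : ℕ := if isMarked T q then q.2 else q.1

/-- The place of a cell within its hook. -/
def place (γ : StrictPartition) (T : Filling) (q : ℕ × ℕ) : ℕ := if isMarked T q then q.1 else γ.size+q.2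

/-- The cell `q` is read before the cell `q'`. -/
def Before (γ : StrictPartition) (T : Filling) (q q' : ℕ × ℕ) : Prop :=
  hook T q' < hook T q ∨ hook T q = hook T q' ∧ place γ T q < place γ T q'

/-- The place of a cell in the word formed by the layers. -/
def position (T : Filling) (q : ℕ × ℕ) : ℤ := if isMarked T q then -1-(q.2-q.1 : ℤ) else q.2-q.1

lemma of_mk (γ : StrictPartition) {k : ℕ} (h : T (r, c) = some (mk k)) :
    hook T (r, c) = c ∧ place γ T (r, c) = r ∧ position T (r, c) = -1-(c-r : ℤ) := by
  have : isMarked T (r, c) = true := by simp [isMarked, h, mk]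
  simp [hook, place, position, this]

lemma of_un (γ : StrictPartition) {k : ℕ} (h : T (r, c) = some (un k)) :
    hook T (r, c) = r ∧ place γ T (r, c) = γ.size+c ∧ position T (r, c) = (c-r : ℤ) := by
  have : isMarked T (r, c) = false := by simp [isMarked, h, un]
  simp [hook, place, position, this]

lemma pairwise_readingCells (γ : StrictPartition) (T : Filling) : (readingCells γ T).Pairwise (Before γ T) := by
  have marked : ∀ {i} {q : ℕ × ℕ}, q ∈ ((List.range γ.size).map fun r => (r, i)).filter (isMarked T) →
      hook T q = i ∧ place γ T q < γ.size := by
    intro i q h; simp only [List.mem_filter, List.mem_map, List.mem_range] at h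
    obtain ⟨⟨r, hr, rfl⟩, h⟩ := h; simp only [hook, place, h, if_true]; exact ⟨trivial, hr⟩
  have unmarked : ∀ {i} {q : ℕ × ℕ}, q ∈ ((List.range γ.size).map fun c => (i, c)).filter (isUnmarked T) →
      hook T q = i ∧ γ.size ≤ place γ T q := by
    intro i q h; simp only [List.mem_filter, List.mem_map, List.mem_range] at h
    obtain ⟨⟨c, hc, rfl⟩, h⟩ := h
    have h2 : isMarked T (i, c) = false := by
      unfold isUnmarked at h; unfold isMarked
      cases hT : T (i, c) with
      | none => rfl
      | some a => rw [hT] at h; simp at h ⊢; exact h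
    simp [hook, place, h2]
  have pw : ∀ {P : ℕ × ℕ → Bool} {f : ℕ → ℕ × ℕ}, (∀ x y, x < y → P (f x) → P (f y) → Before γ T (f x) (f y)) →
      (((List.range γ.size).map f).filter P).Pairwise (Before γ T) := by
    intro P f h
    rw [List.pairwise_filter, List.pairwise_map]
    exact List.pairwise_lt_range.imp fun hxy h1 h2 => h _ _ hxy h1 h2
  unfold readingCells
  rw [List.pairwise_flatMap]
  refine ⟨fun i _ => List.pairwise_append.2 ⟨pw fun x y hxy h1 h2 => ?_, pw fun x y hxy h1 h2 => ?_, fun q hq q' hq' => ?_⟩, ?_⟩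
  · simp [Before, hook, place, h1, h2, hxy]
  · have e : ∀ x, isUnmarked T (i, x) = true → isMarked T (i, x) = false := fun x h => by
      unfold isUnmarked at h; unfold isMarked
      cases hT : T (i, x) with
      | none => rfl
      | some a => rw [hT] at h; simp at h ⊢; exact h
    simp [Before, hook, place, e x h1, e y h2, hxy]
  · have h1 := marked hq; have h2 := unmarked hq'; exact Or.inr ⟨by omega, by omega⟩
  · rw [List.pairwise_reverse]
    refine List.pairwise_lt_range.imp fun {x y} hxy q hq q' hq' => Or.inl ?_
    have e : ∀ {i q}, q ∈ (((List.range γ.size).map fun r => (r, i)).filter (isMarked T) ++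
        ((List.range γ.size).map fun c => (i, c)).filter (isUnmarked T)) → hook T q = i := fun h =>
      (List.mem_append.1 h).elim (fun h => (marked h).1) fun h => (unmarked h).1
    rw [e hq, e hq']; exact hxy

lemma IsSSHT.mem_readingCells (hT : IsSSHT γ n T) : (r, c) ∈ readingCells γ T ↔ ∃ a, T (r, c) = some a := by
  unfold readingCells
  simp only [List.mem_flatMap, List.mem_reverse, List.mem_range, List.mem_append, List.mem_filter, List.mem_map]
  constructor
  · rintro ⟨i, -, ⟨-, h⟩ | ⟨-, h⟩⟩
    · unfold isMarked at h
      cases hT : T (r, c) with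
      | none => rw [hT] at h; cases h
      | some a => exact ⟨a, rfl⟩
    · unfold isUnmarked at h
      cases hT : T (r, c) with
      | none => rw [hT] at h; cases h
      | some a => exact ⟨a, rfl⟩
  · rintro ⟨a, h⟩
    have := hT.lt_size h
    rcases letter_cases a with e | e
    · exact ⟨c, by omega, Or.inl ⟨⟨r, by omega, rfl⟩, by rw [e] at h; simp [isMarked, h, Shifted.mk]⟩⟩
    · exact ⟨r, by omega, Or.inr ⟨⟨c, by omega, rfl⟩, by rw [e] at h; simp [isUnmarked, h, un]⟩⟩

/-- The value in a cell, `0` if there is none. -/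
def value (T : Filling) (q : ℕ × ℕ) : ℕ := ((T q).map Letter.val).getD 0

open Classical in
/-- The excess of the value `i` over the value `i + 1` in the part of the reading word up to `q`. -/
noncomputable def excess (γ : StrictPartition) (T : Filling) (i : ℕ) (q : ℕ × ℕ) : ℤ :=
  ((readingCells γ T).countP fun q' => decide (value T q' = i ∧ (q' = q ∨ Before γ T q' q)) : ℤ) -
    (readingCells γ T).countP fun q' => decide (value T q' = i+1 ∧ (q' = q ∨ Before γ T q' q))

lemma Before.asymm (h : Before γ T q q') : ¬ Before γ T q' q := by
  unfold Before at *; omega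

lemma Before.irrefl (q : ℕ × ℕ) : ¬ Before γ T q q := by
  unfold Before at *; omega

lemma mIndex_eq_excess {p : ℕ} (hp : p < (readingCells γ T).length) :
    mIndex i (readingWord γ T) (p+1) = excess γ T i (readingCells γ T)[p] := by
  classical
  have key : ∀ k, ((readingWord γ T).take (p+1)).count k = (readingCells γ T).countP fun q' =>
      decide (value T q' = k ∧ (q' = (readingCells γ T)[p] ∨ Before γ T q' (readingCells γ T)[p])) := by
    intro k
    unfold readingWord
    have pw := pairwise_readingCells γ T
    generalize readingCells γ T = L at *
    rw [← List.map_take, List.count_eq_countP, List.countP_map]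
    generalize he : L[p] = q0
    have split := List.countP_append (p := fun q' => decide (value T q' = k ∧ (q' = q0 ∨ Before γ T q' q0)))
      (l₁ := L.take (p+1)) (l₂ := L.drop (p+1))
    rw [List.take_append_drop] at split
    rw [split]
    subst he
    have h2 : (L.drop (p+1)).countP (fun q' => decide (value T q' = k ∧ (q' = L[p] ∨ Before γ T q' L[p]))) = 0 := by
      rw [List.countP_eq_zero]
      intro q hq
      rw [decide_eq_true_eq]
      obtain ⟨m, hm, rfl⟩ := List.getElem_of_mem hq
      rw [List.getElem_drop]
      have := List.pairwise_iff_getElem.1 pw p (p+1+m) hp (by rw [List.length_drop] at hm; omega) (by omega)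
      rintro ⟨-, h | h⟩
      · rw [h] at this; exact Before.irrefl _ this
      · exact this.asymm h
    rw [h2, add_zero]
    refine List.countP_congr fun q hq => ?_; simp only [Function.comp, beq_iff_eq, decide_eq_true_eq]
    refine ⟨fun h => ⟨h, ?_⟩, fun h => h.1⟩
    obtain ⟨m, hm, rfl⟩ := List.getElem_of_mem hq
    rw [List.length_take] at hm
    rw [List.getElem_take]
    rcases eq_or_lt_of_le (show m ≤ p by omega) with rfl | hlt
    exacts [Or.inl rfl, Or.inr (List.pairwise_iff_getElem.1 pw m p (by omega) hp hlt)]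
  unfold mIndex excess
  rw [key, key]

/-- The excess is attained at cells with the smaller value. -/
lemma mIndex_le (p : ℕ) (hp : p ≤ (readingCells γ T).length) :
    mIndex i (readingWord γ T) p ≤ 0 ∨ ∃ p', ∃ h : p' < (readingCells γ T).length, p' < p ∧
      value T (readingCells γ T)[p'] = i ∧ mIndex i (readingWord γ T) p ≤ excess γ T i (readingCells γ T)[p'] := by
  induction p with
  | zero => exact Or.inl (by simp [mIndex])
  | succ p ih =>
    by_cases hv : value T (readingCells γ T)[p] = i
    · exact Or.inr ⟨p, hp, by omega, hv, (mIndex_eq_excess hp).le⟩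
    · have hle : mIndex i (readingWord γ T) (p+1) ≤ mIndex i (readingWord γ T) p := by
        unfold mIndex
        have hl : p < (readingWord γ T).length := by unfold readingWord; simpa using hp
        rw [List.take_succ_eq_append_getElem hl, List.count_append, List.count_append]
        have : (readingWord γ T)[p] = value T (readingCells γ T)[p] := by
          simp [readingWord, value]
        have h0 : [(readingWord γ T)[p]].count i = 0 := by
          rw [List.count_eq_zero, List.mem_singleton, this]; exact fun h => hv h.symm
        rw [h0]; push_cast; omega
      rcases ih (by omega) with h | ⟨p', h1, h2, h3, h4⟩
      exacts [Or.inl (hle.trans h), Or.inr ⟨p', h1, by omega, h3, hle.trans h4⟩]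

lemma length_readingWord (γ : StrictPartition) (T : Filling) : (readingWord γ T).length = (readingCells γ T).length := by
  simp [readingWord]

lemma mMax_le_zero (h : ∀ q ∈ readingCells γ T, value T q = i → excess γ T i q ≤ 0) :
    mMax i (readingWord γ T) ≤ 0 := by
  unfold mMax
  rw [Finset.sup'_le_iff]
  intro p hp
  rw [Finset.mem_range, length_readingWord] at hp
  rcases mIndex_le (γ := γ) (T := T) (i := i) p (by omega) with h1 | ⟨p', h1, -, h3, h4⟩
  exacts [h1, h4.trans (h _ (List.getElem_mem h1) h3)]

lemma activeCell_eq (hq : q ∈ readingCells γ T) (hp : 0 < excess γ T i q)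
    (hle : ∀ q' ∈ readingCells γ T, value T q' = i → excess γ T i q' ≤ excess γ T i q)
    (hlt : ∀ q' ∈ readingCells γ T, value T q' = i → Before γ T q' q → excess γ T i q' < excess γ T i q) :
    activeCell γ i T = some q := by
  obtain ⟨p, hpl, rfl⟩ := List.getElem_of_mem hq
  have h1 := mIndex_eq_excess (i := i) hpl
  have hM : mMax i (readingWord γ T) = excess γ T i (readingCells γ T)[p] := by
    unfold mMax
    refine le_antisymm (Finset.sup'_le _ _ fun p' hp' => ?_) ?_
    · rw [Finset.mem_range, length_readingWord] at hp'
      rcases mIndex_le (γ := γ) (T := T) (i := i) p' (by omega) with h1 | ⟨p'', h1, -, h3, h4⟩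
      exacts [h1.trans hp.le, h4.trans (hle _ (List.getElem_mem h1) h3)]
    · rw [← h1]; exact Finset.le_sup' _ (Finset.mem_range.2 (by rw [length_readingWord]; omega))
  unfold activeCell; simp only
  rw [if_neg (by rw [hM]; omega)]
  have hf : ((List.range ((readingWord γ T).length+1)).find? fun p => mIndex i (readingWord γ T) p == mMax i (readingWord γ T)) =
      some (p+1) := by
    rw [List.find?_range_eq_some]
    refine ⟨by simp [h1, hM], List.mem_range.2 (by rw [length_readingWord]; omega), fun p' hp' => ?_⟩
    simp only [Bool.not_eq_true', beq_eq_false_iff_ne, ne_eq]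
    rw [hM]
    rcases mIndex_le (γ := γ) (T := T) (i := i) p' (by omega) with h1 | ⟨p'', h1, h2, h3, h4⟩
    · omega
    · have := hlt _ (List.getElem_mem h1) h3
        (List.pairwise_iff_getElem.1 (pairwise_readingCells γ T) p'' p h1 hpl (by omega))
      omega
  rw [hf]; simp [hpl]

/-- The places of the cells of value `k` in the word formed by the layers. -/
noncomputable def naive (γ : StrictPartition) (T : Filling) (k : ℕ) : Finset ℤ :=
  refl (lay γ T (2*k)) ∪ lay γ T (2*k+1)

lemma IsSSHT.sw_lt (hT : IsSSHT γ n T) (h : T (r, c) = some a) (h' : T (r', c') = some b) (hr : r < r')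
    (hc : c < c') : a.val < b.val := by
  have := hT.lt_size h
  obtain ⟨e, h1, h2⟩ := hT.exists_le h' (r' := r+1) (c' := c+1) (by omega) (by omega) (by omega)
  have := hT.val_lt h h1 (by omega) (by omega); have := rank_bounds b; have := rank_bounds e; omega

lemma IsSSHT.mem_naive (hT : IsSSHT γ n T) :
    x ∈ naive γ T i ↔ ∃ q a, T q = some a ∧ a.val = i ∧ position T q = x := by
  unfold naive
  rw [mem_union, mem_refl, hT.mem_lay, hT.mem_lay]
  constructor
  · rintro (⟨r, c, a, h1, h2, h3⟩ | ⟨r, c, a, h1, h2, h3⟩)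
    · obtain rfl : a = Shifted.mk i := rank_injective (by rw [h2, rank_mk])
      exact ⟨_, _, h1, rfl, by rw [(of_mk γ h1).2.2]; omega⟩
    · obtain rfl : a = un i := rank_injective (by rw [h2, rank_un])
      exact ⟨_, _, h1, rfl, by rw [(of_un γ h1).2.2]; omega⟩
  · rintro ⟨⟨r, c⟩, a, h1, rfl, h3⟩
    rcases letter_cases a with e | e
    · rw [e] at h1
      rw [(of_mk γ h1).2.2] at h3; exact Or.inl ⟨r, c, _, h1, rank_mk _, by omega⟩
    · rw [e] at h1
      rw [(of_un γ h1).2.2] at h3; exact Or.inr ⟨r, c, _, h1, rank_un _, by omega⟩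

lemma IsSSHT.before_of_position_lt (hT : IsSSHT γ n T) (h : T q = some a) (h' : T q' = some b)
    (hv : a.val = b.val) (hp : position T q < position T q') : Before γ T q q' := by
  obtain ⟨r, c⟩ := q
  obtain ⟨r', c'⟩ := q'
  have s := hT.lt_size h; have s' := hT.lt_size h'
  have g1 : ¬ (r < r' ∧ c < c') := fun g => by have := hT.sw_lt h h' g.1 g.2; omega
  have g2 : ¬ (r' < r ∧ c' < c) := fun g => by have := hT.sw_lt h' h g.1 g.2; omega
  unfold Before
  rcases letter_cases a with e | e <;> rcases letter_cases b with e' | e' <;> rw [e] at h <;> rw [e'] at h'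
  · obtain ⟨h1, h2, h3⟩ := of_mk γ h; obtain ⟨k1, k2, k3⟩ := of_mk γ h'
    rw [h1, h2, k1, k2]; rw [h3, k3] at hp; omega
  · obtain ⟨h1, h2, h3⟩ := of_mk γ h; obtain ⟨k1, k2, k3⟩ := of_un γ h'
    rw [h1, h2, k1, k2]; rw [h3, k3] at hp; omega
  · obtain ⟨h1, h2, h3⟩ := of_un γ h; obtain ⟨k1, k2, k3⟩ := of_mk γ h'
    rw [h1, h2, k1, k2]; rw [h3, k3] at hp; omega
  · obtain ⟨h1, h2, h3⟩ := of_un γ h; obtain ⟨k1, k2, k3⟩ := of_un γ h'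
    rw [h1, h2, k1, k2]; rw [h3, k3] at hp; omega

lemma IsSSHT.position_inj (hT : IsSSHT γ n T) (h : T q = some a) (h' : T q' = some b)
    (hv : a.val = b.val) (hp : position T q = position T q') : q = q' := by
  obtain ⟨r, c⟩ := q
  obtain ⟨r', c'⟩ := q'
  have s := hT.lt_size h; have s' := hT.lt_size h'
  have g1 : ¬ (r < r' ∧ c < c') := fun g => by have := hT.sw_lt h h' g.1 g.2; omega
  have g2 : ¬ (r' < r ∧ c' < c) := fun g => by have := hT.sw_lt h' h g.1 g.2; omega
  have : r = r' ∧ c = c' := by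
    rcases letter_cases a with e | e <;> rcases letter_cases b with e' | e' <;> rw [e] at h <;> rw [e'] at h'
    · rw [(of_mk γ h).2.2, (of_mk γ h').2.2] at hp; omega
    · rw [(of_mk γ h).2.2, (of_un γ h').2.2] at hp; omega
    · rw [(of_un γ h).2.2, (of_mk γ h').2.2] at hp; omega
    · rw [(of_un γ h).2.2, (of_un γ h').2.2] at hp; omega
  rw [this.1, this.2]

lemma IsSSHT.not_sw (hT : IsSSHT γ n T) (h : T (r, c) = some a) (h' : T (r', c') = some b)
    (hr : rank a < rank b) : ¬ (r' ≤ r ∧ c' ≤ c) := fun g => by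
  obtain ⟨e, h1, h2⟩ := hT.exists_le h g.1 g.2 (hT.lt_size h').1
  rw [h'] at h1
  obtain rfl := Option.some.inj h1; omega

lemma IsSSHT.before_of_position_le (hT : IsSSHT γ n T) (h : T q = some a) (h' : T q' = some b)
    (hv : a.val+1 = b.val) (hp : position T q' ≤ position T q) : Before γ T q' q := by
  obtain ⟨r, c⟩ := q
  obtain ⟨r', c'⟩ := q'
  have s := hT.lt_size h; have s' := hT.lt_size h'; have ra := rank_bounds a; have rb := rank_bounds b
  have g := hT.not_sw h h' (by omega)
  unfold Before
  rcases letter_cases a with e | e <;> rcases letter_cases b with e' | e' <;> rw [e] at h <;> rw [e'] at h'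
  · obtain ⟨h1, h2, h3⟩ := of_mk γ h; obtain ⟨k1, k2, k3⟩ := of_mk γ h'
    rw [h1, h2, k1, k2]; rw [h3, k3] at hp; omega
  · obtain ⟨h1, h2, h3⟩ := of_mk γ h; obtain ⟨k1, k2, k3⟩ := of_un γ h'
    rw [h1, h2, k1, k2]; rw [h3, k3] at hp; omega
  · obtain ⟨h1, h2, h3⟩ := of_un γ h; obtain ⟨k1, k2, k3⟩ := of_mk γ h'
    rw [h1, h2, k1, k2]; rw [h3, k3] at hp; omega
  · obtain ⟨h1, h2, h3⟩ := of_un γ h; obtain ⟨k1, k2, k3⟩ := of_un γ h'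
    rw [h1, h2, k1, k2]; rw [h3, k3] at hp; omega

lemma IsSSHT.position_le_of_before (hT : IsSSHT γ n T) (h : T q = some a) (h' : T q' = some b)
    (hv : a.val+1 = b.val) (good : position T q+1 ∉ naive γ T a.val)
    (side : position T q < 0 → -1-position T q ∉ lay γ T (2*b.val))
    (diag : ¬ (position T q = -2 ∧ 0 ∈ lay γ T (2*a.val+1) ∧ 0 ∈ lay γ T (2*b.val+1)))
    (hp : Before γ T q' q) : position T q' ≤ position T q := by
  obtain ⟨r, c⟩ := q
  obtain ⟨r', c'⟩ := q'
  by_contra hlt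
  have s := hT.lt_size h; have s' := hT.lt_size h'; have ra := rank_bounds a; have rb := rank_bounds b
  unfold Before at hp
  rw [hT.mem_naive] at good
  rcases letter_cases a with e | e <;> rcases letter_cases b with e' | e' <;> rw [e] at h <;> rw [e'] at h'
  · obtain ⟨h1, h2, h3⟩ := of_mk γ h; obtain ⟨k1, k2, k3⟩ := of_mk γ h'
    rw [h1, h2, k1, k2] at hp; rw [h3, k3] at hlt
    have hne : r ≠ c := fun hrc => hT.diag_unmarked _ _ (hrc ▸ h)
    obtain ⟨f, f1, f2⟩ := hT.exists_le h' (r' := r+1) (c' := c) (by omega) (by omega) (by omega)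
    have f4 := hT.sw_lt f1 h' (by omega) (by omega)
    have f5 : f ≠ Shifted.mk a.val := fun hf => good ⟨_, _, f1, by rw [hf]; rfl, by
      rw [hf] at f1; rw [h3, (of_mk γ f1).2.2]; push_cast; ring⟩
    have f6 := rank_bounds f
    obtain ⟨e2, g1, g2⟩ := hT.exists_le h' (r' := r+1) (c' := c+1) (by omega) (by omega) (by omega)
    have g3 := hT.val_lt h g1 (by omega) (by omega)
    rw [val_mk] at g3
    have g4 := rank_bounds e2
    rw [rank_mk] at g2
    refine side (by rw [h3]; omega) (hT.mem_lay.2 ⟨_, _, e2, g1, by omega, by rw [h3]; push_cast; ring⟩)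
  · obtain ⟨h1, h2, h3⟩ := of_mk γ h; obtain ⟨k1, k2, k3⟩ := of_un γ h'
    rw [h1, h2, k1, k2] at hp; rw [h3, k3] at hlt
    have hne : r ≠ c := fun hrc => hT.diag_unmarked _ _ (hrc ▸ h)
    obtain ⟨f, f1, f2⟩ := hT.exists_le h' (r' := c) (c' := c) (by omega) (by omega) (by omega)
    obtain ⟨e2, g1, g2⟩ := hT.exists_le h' (r' := c+1) (c' := c+1) (by omega) (by omega) (by omega)
    have g3 := hT.val_lt f1 g1 (by omega) (by omega)
    obtain ⟨a2, g4, g5⟩ := hT.exists_le f1 (r' := r) (c' := c) (by omega) le_rfl (by omega)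
    rw [h] at g4; obtain rfl := Option.some.inj g4
    rw [rank_mk] at g5; rw [rank_un] at g2
    have rf := rank_bounds f; have re := rank_bounds e2
    have hf : f = un a.val := by
      rcases letter_cases f with hf | hf
      · rw [hf] at f1; exact absurd f1 (hT.diag_unmarked _ _)
      · rw [hf, show f.val = a.val by omega]
    have he : e2 = un b.val := by
      rcases letter_cases e2 with hf | hf
      · rw [hf] at g1; exact absurd g1 (hT.diag_unmarked _ _)
      · rw [hf, show e2.val = b.val by omega]
    have d1 : 0 ∈ lay γ T (2*a.val+1) := hT.mem_lay.2 ⟨_, _, _, f1, by rw [hf, rank_un], by ring⟩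
    have d2 : 0 ∈ lay γ T (2*b.val+1) := hT.mem_lay.2 ⟨_, _, _, g1, by rw [he, rank_un], by ring⟩
    have hc2 : c ≠ r+1 := fun hc => diag ⟨by rw [h3]; omega, d1, d2⟩
    obtain ⟨k, l1, l2⟩ := hT.exists_le f1 (r' := r+1) (c' := c) (by omega) le_rfl (by omega)
    obtain ⟨a2, l3, l4⟩ := hT.exists_le l1 (r' := r) (c' := c) (by omega) le_rfl (by omega)
    rw [h] at l3; obtain rfl := Option.some.inj l3
    rw [rank_mk] at l4; rw [hf, rank_un] at l2
    rcases letter_cases k with hk | hk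
    · refine good ⟨_, _, l1, ?_, ?_⟩
      · have := rank_bounds k; omega
      · rw [hk] at l1; rw [h3, (of_mk γ l1).2.2]; push_cast; ring
    · have := rank_bounds k
      rw [hk, show k.val = a.val by omega] at l1; rw [hf] at f1
      have := hT.col_unmarked _ _ _ _ l1 f1; omega
  · obtain ⟨h1, h2, h3⟩ := of_un γ h; obtain ⟨k1, k2, k3⟩ := of_mk γ h'
    rw [h3, k3] at hlt; omega
  · obtain ⟨h1, h2, h3⟩ := of_un γ h; obtain ⟨k1, k2, k3⟩ := of_un γ h'
    rw [h1, h2, k1, k2] at hp; rw [h3, k3] at hlt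
    obtain ⟨f, f1, f2⟩ := hT.exists_le h' (r' := r) (c' := c+1) (by omega) (by omega) (by omega)
    have f4 := hT.sw_lt f1 h' (by omega) (by omega)
    obtain ⟨a2, l3, l4⟩ := hT.exists_le f1 (r' := r) (c' := c) le_rfl (by omega) (by omega)
    rw [h] at l3; obtain rfl := Option.some.inj l3
    rw [rank_un] at l4; rw [val_un] at f4
    have rf := rank_bounds f; have hf : f = un a.val := rank_injective (by rw [rank_un]; omega)
    rw [hf] at f1; exact good ⟨_, _, f1, rfl, by rw [h3, (of_un γ f1).2.2]; push_cast; ring⟩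

lemma IsSSHT.before_next (hT : IsSSHT γ n T) (h : T q = some a) {q1 : ℕ × ℕ} (h₁ : T q1 = some b) (hv : a.val = b.val)
    (hp : position T q1 = position T q+1) {e : Letter} (h' : T q' = some e) (he : e.val ≠ a.val)
    (hb : Before γ T q' q1) : Before γ T q' q := by
  obtain ⟨r, c⟩ := q
  obtain ⟨r₁, c1⟩ := q1
  obtain ⟨r', c'⟩ := q'
  have s := hT.lt_size h; have s' := hT.lt_size h'; have s1 := hT.lt_size h₁
  have ne : ¬ (r' = r ∧ c' = c) := by
    rintro ⟨rfl, rfl⟩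
    rw [h] at h'; exact he (by rw [Option.some.inj h'])
  have g1 : ¬ (r < r₁ ∧ c < c1) := fun g => by have := hT.sw_lt h h₁ g.1 g.2; omega
  have g2 : ¬ (r₁ < r ∧ c1 < c) := fun g => by have := hT.sw_lt h₁ h g.1 g.2; omega
  unfold Before at *
  rcases letter_cases a with e1 | e1 <;> rcases letter_cases b with e2 | e2 <;> rw [e1] at h <;> rw [e2] at h₁
  · obtain ⟨h1, h2, h3⟩ := of_mk γ h; obtain ⟨k1, k2, k3⟩ := of_mk γ h₁
    rw [h3, k3] at hp; rw [k1, k2] at hb; rw [h1, h2]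
    have : c1 = c ∧ r₁ = r+1 := by
      have key : c1 = c := by
        by_contra hc
        have hr : r₁ = r := by omega
        subst hr
        rw [← hv] at h₁; exact hc (hT.row_marked _ _ _ _ h₁ h)
      omega
    rcases letter_cases e with e' | e' <;> rw [e'] at h'
    · obtain ⟨l1, l2, l3⟩ := of_mk γ h'; rw [l1, l2] at hb ⊢; omega
    · obtain ⟨l1, l2, l3⟩ := of_un γ h'; rw [l1, l2] at hb ⊢; omega
  · obtain ⟨h1, h2, h3⟩ := of_mk γ h; obtain ⟨k1, k2, k3⟩ := of_un γ h₁
    have hne : r ≠ c := fun hrc => hT.diag_unmarked _ _ (hrc ▸ h)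
    rw [h3, k3] at hp; omega
  · obtain ⟨h1, h2, h3⟩ := of_un γ h; obtain ⟨k1, k2, k3⟩ := of_mk γ h₁
    rw [h3, k3] at hp; omega
  · obtain ⟨h1, h2, h3⟩ := of_un γ h; obtain ⟨k1, k2, k3⟩ := of_un γ h₁
    rw [h3, k3] at hp; rw [k1, k2] at hb; rw [h1, h2]
    have : c1 = c+1 ∧ r₁ = r := by
      have key : r₁ = r := by
        by_contra hc
        have hr : c1 = c := by omega
        subst hr
        rw [← hv] at h₁; exact hc (hT.col_unmarked _ _ _ _ h₁ h)
      omega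
    rcases letter_cases e with e' | e' <;> rw [e'] at h'
    · obtain ⟨l1, l2, l3⟩ := of_mk γ h'; rw [l1, l2] at hb ⊢; omega
    · obtain ⟨l1, l2, l3⟩ := of_un γ h'; rw [l1, l2] at hb ⊢; omega

lemma countP_eq_card (P : ℕ × ℕ → Bool) :
    (readingCells γ T).countP P = ((readingCells γ T).toFinset.filter fun q => P q = true).card := by
  have nd : (readingCells γ T).Nodup :=
    (pairwise_readingCells γ T).imp fun {q q'} (h : Before γ T q q') (e : q = q') => by rw [e] at h; exact Before.irrefl q' h
  rw [List.countP_eq_length_filter, ← List.toFinset_card_of_nodup (nd.filter _), List.toFinset_filter]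

lemma value_of (h : T q = some a) : value T q = a.val := by simp [value, h]

lemma IsSSHT.of_value (hT : IsSSHT γ n T) (hq : q ∈ readingCells γ T) (hv : value T q = i) :
    ∃ a, T q = some a ∧ a.val = i := by
  obtain ⟨r, c⟩ := q
  obtain ⟨a, ha⟩ := hT.mem_readingCells.1 hq; exact ⟨a, ha, by rw [← hv, value_of ha]⟩

lemma IsSSHT.mem_reading (hT : IsSSHT γ n T) (h : T q = some a) : q ∈ readingCells γ T := by
  obtain ⟨r, c⟩ := q; exact hT.mem_readingCells.2 ⟨a, h⟩

/-- The number of cells of value `k` that are read up to a cell, in terms of positions. -/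
lemma IsSSHT.card_before (hT : IsSSHT γ n T) {k : ℕ} {p : ℕ × ℕ → Prop} (P : ℕ × ℕ → Bool)
    (hP : ∀ q, P q = true ↔ value T q = k ∧ p q) (s : Finset ℤ)
    (h : ∀ q a, T q = some a → a.val = k → (p q ↔ position T q ∈ s)) (hs : s ⊆ naive γ T k) :
    (readingCells γ T).countP P = s.card := by
  rw [countP_eq_card]
  refine Finset.card_bij (fun q _ => position T q) (fun q hq => ?_) (fun q hq q' hq' e => ?_) (fun y hy => ?_)
  · simp only [mem_filter, List.mem_toFinset, hP] at hq
    obtain ⟨a, h1, h2⟩ := hT.of_value hq.1 hq.2.1; exact (h q a h1 h2).1 hq.2.2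
  · simp only [mem_filter, List.mem_toFinset, hP] at hq hq'
    obtain ⟨a, h1, h2⟩ := hT.of_value hq.1 hq.2.1
    obtain ⟨b, h3, h4⟩ := hT.of_value hq'.1 hq'.2.1; exact hT.position_inj h1 h3 (h2.trans h4.symm) e
  · obtain ⟨q, a, h1, h2, h3⟩ := hT.mem_naive.1 (hs hy)
    refine ⟨q, ?_, h3⟩; simp only [mem_filter, List.mem_toFinset, hP]
    exact ⟨hT.mem_reading h1, by rw [value_of h1, h2], (h q a h1 h2).2 (h3 ▸ hy)⟩

open Classical in
lemma IsSSHT.count_eq (hT : IsSSHT γ n T) (h : T q = some a) :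
    ((readingCells γ T).countP fun q' => decide (value T q' = a.val ∧ (q' = q ∨ Before γ T q' q)) : ℤ) =
      cnt (naive γ T a.val) (position T q) := by
  unfold cnt
  rw [Nat.cast_inj]
  refine hT.card_before _ (fun _ => decide_eq_true_iff) _ (fun q' b h1 h2 => ?_) (Finset.filter_subset _ _)
  rw [mem_filter, and_iff_right (hT.mem_naive.2 ⟨q', b, h1, h2, rfl⟩)]
  constructor
  · rintro (rfl | hb)
    · exact le_rfl
    · by_contra hlt; exact hb.asymm (hT.before_of_position_lt h h1 h2.symm (not_le.1 hlt))
  · intro hle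
    rcases eq_or_lt_of_le hle with he | hlt
    exacts [Or.inl (hT.position_inj h1 h h2 he), Or.inr (hT.before_of_position_lt h1 h h2 hlt)]

lemma IsSSHT.excess_le (hT : IsSSHT γ n T) (h : T q = some a) :
    excess γ T a.val q ≤ ht (naive γ T a.val) (naive γ T (a.val+1)) (position T q) := by
  classical
  unfold excess ht
  have h1 := hT.count_eq h
  have h2 := hT.card_before (fun q' => decide (value T q' = a.val+1 ∧ position T q' ≤ position T q))
    (fun _ => decide_eq_true_iff) ((naive γ T (a.val+1)).filter (· ≤ position T q))
    (fun q' b h1 h2 => by rw [mem_filter, and_iff_right (hT.mem_naive.2 ⟨q', b, h1, h2, rfl⟩)])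
    (Finset.filter_subset _ _)
  have h3 : (readingCells γ T).countP (fun q' => decide (value T q' = a.val+1 ∧ position T q' ≤ position T q)) ≤
      (readingCells γ T).countP fun q' => decide (value T q' = a.val+1 ∧ (q' = q ∨ Before γ T q' q)) := by
    refine List.countP_mono_left fun q' hq' hp => ?_
    rw [decide_eq_true_eq] at hp ⊢
    obtain ⟨b, k1, k2⟩ := hT.of_value hq' hp.1
    exact ⟨hp.1, Or.inr (hT.before_of_position_le h k1 k2.symm hp.2)⟩
  rw [h2] at h3
  rw [h1]
  unfold cnt; omega

lemma IsSSHT.excess_eq (hT : IsSSHT γ n T) (h : T q = some a) (good : position T q+1 ∉ naive γ T a.val)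
    (side : position T q < 0 → -1-position T q ∉ lay γ T (2*(a.val+1)))
    (diag : ¬ (position T q = -2 ∧ 0 ∈ lay γ T (2*a.val+1) ∧ 0 ∈ lay γ T (2*(a.val+1)+1))) :
    excess γ T a.val q = ht (naive γ T a.val) (naive γ T (a.val+1)) (position T q) := by
  classical
  unfold excess ht
  rw [hT.count_eq h]
  have h2 := hT.card_before (fun q' => decide (value T q' = a.val+1 ∧ (q' = q ∨ Before γ T q' q)))
    (fun _ => decide_eq_true_iff) ((naive γ T (a.val+1)).filter (· ≤ position T q))
    (fun q' b h1 h2 => by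
      rw [mem_filter, and_iff_right (hT.mem_naive.2 ⟨q', b, h1, h2, rfl⟩)]
      constructor
      · rintro (rfl | hb)
        exacts [le_rfl, hT.position_le_of_before h h1 h2.symm good (by rwa [h2]) (by rwa [h2]) hb]
      · exact fun hle => Or.inr (hT.before_of_position_le h h1 h2.symm hle))
    (Finset.filter_subset _ _)
  rw [h2]; rfl

lemma IsSSHT.excess_next (hT : IsSSHT γ n T) (h : T q = some a) {q1 : ℕ × ℕ} (h1 : T q1 = some b)
    (hv : a.val = b.val) (hp : position T q1 = position T q+1) :
    excess γ T a.val q+1 ≤ excess γ T a.val q1 := by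
  classical
  have c1 := hT.count_eq h; have c2 := hT.count_eq h1
  rw [← hv, hp, Strip.cnt_succ, Strip.ind_of_mem (hT.mem_naive.2 ⟨q1, b, h1, hv.symm, hp⟩)] at c2
  unfold excess
  have h3 : (readingCells γ T).countP (fun q' => decide (value T q' = a.val+1 ∧ (q' = q1 ∨ Before γ T q' q1))) ≤
      (readingCells γ T).countP fun q' => decide (value T q' = a.val+1 ∧ (q' = q ∨ Before γ T q' q)) := by
    refine List.countP_mono_left fun q' hq' hp' => ?_
    rw [decide_eq_true_eq] at hp' ⊢
    obtain ⟨e, k1, k2⟩ := hT.of_value hq' hp'.1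
    refine ⟨hp'.1, Or.inr ?_⟩
    rcases hp'.2 with rfl | hb
    · rw [h1] at k1; rw [← Option.some.inj k1] at k2; omega
    · exact hT.before_next h h1 hv hp k1 (by omega) hb
  omega

lemma IsSSHT.excess_le_of_good (hT : IsSSHT γ n T)
    (hM : ∀ y ∈ naive γ T i, y+1 ∉ naive γ T i → ht (naive γ T i) (naive γ T (i+1)) y ≤ M) (h : T q = some a)
    (ha : a.val = i) : excess γ T i q ≤ M ∧ (position T q+1 ∈ naive γ T i → excess γ T i q < M) := by
  obtain ⟨B, hB⟩ := Strip.exists_upper (naive γ T i)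
  have key : ∀ t : ℕ, ∀ q a, T q = some a → a.val = i → B-position T q ≤ t →
      excess γ T i q ≤ M ∧ (position T q+1 ∈ naive γ T i → excess γ T i q < M) := by
    intro t
    induction t with
    | zero =>
      intro q a h1 h2 h3
      have := hB _ (hT.mem_naive.2 ⟨q, a, h1, h2, rfl⟩)
      push_cast at h3; omega
    | succ t ih =>
      intro q a h1 h2 h3
      by_cases hg : position T q+1 ∈ naive γ T i
      · obtain ⟨q1, b, k1, k2, k3⟩ := hT.mem_naive.1 hg
        have := (ih q1 b k1 k2 (by push_cast at h3; omega)).1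
        have h5 := hT.excess_next h1 k1 (h2.trans k2.symm) k3
        rw [h2] at h5; exact ⟨by omega, fun _ => by omega⟩
      · have h5 := hT.excess_le h1
        rw [h2] at h5
        exact ⟨h5.trans (hM _ (hT.mem_naive.2 ⟨q, a, h1, h2, rfl⟩) hg), fun h => absurd h hg⟩
  exact key (B-position T q).toNat q a h ha (by omega)

lemma IsSSHT.mMax_le_zero (hT : IsSSHT γ n T)
    (hM : ∀ y ∈ naive γ T i, y+1 ∉ naive γ T i → ht (naive γ T i) (naive γ T (i+1)) y ≤ 0) :
    mMax i (readingWord γ T) ≤ 0 := by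
  refine Shifted.mMax_le_zero fun q hq hv => ?_
  obtain ⟨a, h1, h2⟩ := hT.of_value hq hv; exact (hT.excess_le_of_good hM h1 h2).1

/-- The active cell, in terms of positions. -/
lemma IsSSHT.activeCell_of_active (hT : IsSSHT γ n T)
    (hA : Strip.Active (lay γ T (2*i)) (lay γ T (2*i+1)) (lay γ T (2*(i+1))) (lay γ T (2*(i+1)+1)) M x)
    (hM : 0 < M) : ∃ q a, T q = some a ∧ a.val = i ∧ position T q = x ∧ activeCell γ i T = some q := by
  obtain ⟨q, a, h1, rfl, h3⟩ := hT.mem_naive.1 hA.mem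
  refine ⟨q, a, h1, rfl, h3, ?_⟩
  have e := hT.excess_eq h1 (by rw [h3]; exact hA.good) (by rw [h3]; exact hA.side) (by rw [h3]; exact hA.diag)
  have e2 : ht (naive γ T a.val) (naive γ T (a.val+1)) (position T q) = M := by rw [h3]; exact hA.eq
  rw [e2] at e
  refine activeCell_eq (hT.mem_reading h1) (by omega) (fun q' hq' hv => ?_) (fun q' hq' hv hb => ?_)
  · obtain ⟨b, k1, k2⟩ := hT.of_value hq' hv
    rw [e]; exact (hT.excess_le_of_good hA.le k1 k2).1
  · obtain ⟨b, k1, k2⟩ := hT.of_value hq' hv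
    rw [e]
    by_cases hg : position T q'+1 ∈ naive γ T a.val
    · exact (hT.excess_le_of_good hA.le k1 k2).2 hg
    · have h5 := hT.excess_le k1
      rw [k2] at h5
      refine h5.trans_lt (hA.lt _ (hT.mem_naive.2 ⟨q', b, k1, k2, rfl⟩) hg ?_)
      rw [← h3]
      by_contra hle
      rcases eq_or_lt_of_le (not_lt.1 hle) with h | h
      · exact Before.irrefl q' (by have e := hT.position_inj h1 k1 k2.symm h; rwa [e] at hb)
      · exact hb.asymm (hT.before_of_position_lt h1 k1 k2.symm h)

/-! #### The rules of the lowering operator -/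

lemma IsSSHT.at_of (hT : IsSSHT γ n T) (h : r ≤ c) {m : ℕ} (hm : rank a = m+1) (hn : num γ T m (c-r) = r)
    (hl : (c : ℤ)-r ∈ lay γ T (m+1)) : T (r, c) = some a := by
  have h1 := hT.num_succ m (show (0 : ℤ) ≤ c-r by omega)
  rw [ind_of_mem hl] at h1
  obtain ⟨b, hb, hb'⟩ := (hT.lt_num h (m := m+1)).2 (by omega)
  have h2 : ¬ rank b ≤ m := fun h2 => by
    have : (r : ℤ) < num γ T m (c-r) := (hT.lt_num h).1 (Exists.intro b ⟨hb, h2⟩); omega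
  rw [hb, rank_injective (show rank b = rank a by omega)]

lemma IsSSHT.num_at (hT : IsSSHT γ n T) (h : T (r, c) = some a) {m : ℕ} (hm : rank a = m+1) :
    num γ T m (c-r) = r ∧ num γ T (m+1) (c-r) = r+1 ∧ (c : ℤ)-r ∈ lay γ T (m+1) := by
  have hb := (hT.lt_size h).1; have hl : (c : ℤ)-r ∈ lay γ T (m+1) := hT.mem_lay.2 ⟨r, c, a, h, hm, rfl⟩
  have h1 := hT.num_succ m (show (0 : ℤ) ≤ c-r by omega)
  rw [ind_of_mem hl] at h1
  have h2 : ¬ (r : ℤ) < num γ T m (c-r) := fun h2 => by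
    obtain ⟨b, hb, hb'⟩ := (hT.lt_num hb).2 h2
    rw [h] at hb; obtain rfl := Option.some.inj hb; omega
  have h3 : (r : ℤ) < num γ T (m+1) (c-r) := (hT.lt_num hb).1 (Exists.intro a ⟨h, hm.le⟩)
  exact ⟨by omega, by omega, hl⟩

lemma IsSSHT.cell_unique (hT : IsSSHT γ n T) (h : T (r, c) = some a) (h' : T (r', c') = some b) (hv : a.val = b.val)
    (hx : (c : ℤ)-r = c'-r') : r = r' ∧ c = c' := by
  have g1 : ¬ (r < r' ∧ c < c') := fun g => by have := hT.sw_lt h h' g.1 g.2; omega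
  have g2 : ¬ (r' < r ∧ c' < c) := fun g => by have := hT.sw_lt h' h g.1 g.2; omega
  omega

lemma IsSSHT.neighbour (hT : IsSSHT γ n T) (h : T (r, c) = some a) (h' : T (r', c') = some b) (hv : a.val = b.val)
    (hx : (c' : ℤ)-r' = c-r-1) : (r' = r+1 ∧ c' = c) ∨ (r' = r ∧ c'+1 = c) := by
  have g1 : ¬ (r < r' ∧ c < c') := fun g => by have := hT.sw_lt h h' g.1 g.2; omega
  have g2 : ¬ (r' < r ∧ c' < c) := fun g => by have := hT.sw_lt h' h g.1 g.2; omega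
  omega

/-- The contents of the cells of value `k`. -/
def InLay (γ : StrictPartition) (T : Filling) (k : ℕ) (x : ℤ) : Prop := x ∈ lay γ T (2*k) ∨ x ∈ lay γ T (2*k+1)

lemma IsSSHT.inLay_iff (hT : IsSSHT γ n T) :
    InLay γ T k x ↔ ∃ r c a, T (r, c) = some a ∧ a.val = k ∧ x = (c : ℤ)-r := by
  unfold InLay
  rw [hT.mem_lay, hT.mem_lay]
  constructor
  · rintro (⟨r, c, a, h1, h2, h3⟩ | ⟨r, c, a, h1, h2, h3⟩)
    · exact ⟨r, c, a, h1, by have := rank_bounds a; omega, h3⟩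
    · exact ⟨r, c, a, h1, by have := rank_bounds a; omega, h3⟩
  · rintro ⟨r, c, a, h1, h2, h3⟩
    have := rank_bounds a
    rcases (show rank a = 2*k ∨ rank a = 2*k+1 by omega) with h | h
    exacts [Or.inl ⟨r, c, a, h1, h, h3⟩, Or.inr ⟨r, c, a, h1, h, h3⟩]

lemma hasVal_iff : hasVal k T q = true ↔ ∃ a, T q = some a ∧ a.val = k := by
  unfold hasVal
  cases T q <;> simp

lemma IsSSHT.stepNW_of_mem (hT : IsSSHT γ n T) (h : T (r, c) = some a) (hv : a.val = k)
    (hm : InLay γ T k ((c : ℤ)-r-1)) : ∃ r' c' b, stepNW k T (r, c) = (r', c') ∧ T (r', c') = some b ∧ b.val = k ∧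
      (c' : ℤ)-r' = c-r-1 := by
  obtain ⟨r', c', b, h1, h2, h3⟩ := hT.inLay_iff.1 hm
  refine ⟨r', c', b, ?_, h1, h2, h3.symm⟩
  rcases hT.neighbour h h1 (hv.trans h2.symm) h3.symm with ⟨rfl, rfl⟩ | ⟨rfl, rfl⟩
  · unfold stepNW
    rw [if_pos (hasVal_iff.2 ⟨b, h1, h2⟩)]
  · unfold stepNW
    have h4 : ¬ hasVal k T (r'+1, c'+1) = true := fun h4 => by
      obtain ⟨e, h5, h6⟩ := hasVal_iff.1 h4
      have := hT.cell_unique h5 h1 (h6.trans h2.symm) (by push_cast; ring); omega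
    simp only
    rw [if_neg h4, if_pos ⟨by omega, by rw [Nat.add_sub_cancel]; exact hasVal_iff.2 ⟨b, h1, h2⟩⟩, Nat.add_sub_cancel]

lemma IsSSHT.stepNW_of_not_mem (hT : IsSSHT γ n T) (hm : ¬ InLay γ T k ((c : ℤ)-r-1)) :
    stepNW k T (r, c) = (r, c) := by
  rw [hT.inLay_iff] at hm
  unfold stepNW
  rw [if_neg, if_neg]
  · rintro ⟨h0, h⟩
    obtain ⟨e, h5, h6⟩ := hasVal_iff.1 h; exact hm ⟨_, _, e, h5, h6, by simp only at h0 ⊢; omega⟩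
  · intro h
    obtain ⟨e, h5, h6⟩ := hasVal_iff.1 h; exact hm ⟨_, _, e, h5, h6, by push_cast; ring⟩

lemma IsSSHT.stepSE_of_mem (hT : IsSSHT γ n T) (h : T (r, c) = some a) (hv : a.val = k)
    (hm : InLay γ T k ((c : ℤ)-r+1)) : ∃ r' c' b, stepSE k T (r, c) = (r', c') ∧ T (r', c') = some b ∧ b.val = k ∧
      (c' : ℤ)-r' = c-r+1 := by
  obtain ⟨r', c', b, h1, h2, h3⟩ := hT.inLay_iff.1 hm
  refine ⟨r', c', b, ?_, h1, h2, h3.symm⟩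
  rcases hT.neighbour h1 h (h2.trans hv.symm) (by omega) with ⟨rfl, rfl⟩ | ⟨rfl, rfl⟩
  · unfold stepSE
    have h4 : ¬ hasVal k T (r'+1, c+1) = true := fun h4 => by
      obtain ⟨e, h5, h6⟩ := hasVal_iff.1 h4
      have := hT.cell_unique h5 h1 (h6.trans h2.symm) (by push_cast; ring); omega
    simp only
    rw [if_neg h4, if_pos ⟨by omega, by rw [Nat.add_sub_cancel]; exact hasVal_iff.2 ⟨b, h1, h2⟩⟩, Nat.add_sub_cancel]
  · unfold stepSE
    rw [if_pos (hasVal_iff.2 ⟨b, h1, h2⟩)]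

/-- The end of the ribbon in the northwest direction. -/
lemma IsSSHT.endNW_spec (hT : IsSSHT γ n T) (h : T (r, c) = some a) (hv : a.val = k) (hp : p ≤ (c : ℤ)-r)
    (hrun : ∀ d, p ≤ d → d ≤ (c : ℤ)-r → InLay γ T k d) (hend : ¬ InLay γ T k (p-1)) :
    ∃ r' c' b, endNW γ k T (r, c) = (r', c') ∧ T (r', c') = some b ∧ b.val = k ∧ (c' : ℤ)-r' = p := by
  have key : ∀ (t r c : ℕ) a, T (r, c) = some a → a.val = k → p ≤ (c : ℤ)-r → (c : ℤ)-r ≤ p+t →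
      (∀ d, p ≤ d → d ≤ (c : ℤ)-r → InLay γ T k d) →
      ∃ r' c' b, (stepNW k T)^[t] (r, c) = (r', c') ∧ T (r', c') = some b ∧ b.val = k ∧ (c' : ℤ)-r' = p := by
    intro t
    induction t with
    | zero => exact fun r c a h hv h1 h2 _ => ⟨r, c, a, rfl, h, hv, by push_cast at h2; omega⟩
    | succ t ih =>
      intro r c a h hv h1 h2 hrun
      rw [Function.iterate_succ_apply]
      rcases eq_or_lt_of_le h1 with he | hlt
      · rw [hT.stepNW_of_not_mem (by rwa [← he])]; exact ih r c a h hv h1 (by omega) hrun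
      · obtain ⟨r', c', b, h3, h4, h5, h6⟩ := hT.stepNW_of_mem h hv (hrun _ (by omega) (by omega))
        rw [h3]
        exact ih r' c' b h4 h5 (by omega) (by push_cast at h2; omega) fun d h7 h8 => hrun d h7 (by omega)
  refine key (2*γ.size) r c a h hv hp ?_ hrun
  have := hT.lt_size h
  obtain ⟨r', c', b, h4, -, h6⟩ := hT.inLay_iff.1 (hrun p le_rfl hp)
  have := hT.lt_size h4
  push_cast; omega

/-- The first suitable cell on the ribbon in the southeast direction. -/
lemma IsSSHT.firstSE_spec (hT : IsSSHT γ n T) (h : T (r, c) = some a) (hv : a.val = i) {e : ℤ} (he : (c : ℤ)-r ≤ e)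
    (hrun : ∀ d, (c : ℤ)-r ≤ d → d ≤ e → InLay γ T i d)
    (hno : ∀ r' c' : ℕ, (c : ℤ)-r ≤ c'-r' → (c' : ℤ)-r' < e → T (r', c') = some (un i) →
      T (r', c'+1) = some (un i) ∨ T (r', c'+1) = some (Shifted.mk (i+1)))
    (hyes : ∀ r' c' : ℕ, (c' : ℤ)-r' = e → ∀ b, T (r', c') = some b → b.val = i → T (r', c') = some (un i) ∧
      T (r', c'+1) ≠ some (un i) ∧ T (r', c'+1) ≠ some (Shifted.mk (i+1))) :
    ∃ r' c', firstSE γ i T (r, c) = some (r', c') ∧ T (r', c') = some (un i) ∧ (c' : ℤ)-r' = e := by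
  have key : ∀ t : ℕ, (c : ℤ)-r+t ≤ e →
      ∃ r' c' b, (stepSE i T)^[t] (r, c) = (r', c') ∧ T (r', c') = some b ∧ b.val = i ∧ (c' : ℤ)-r' = c-r+t := by
    intro t
    induction t with
    | zero => exact fun _ => ⟨r, c, a, rfl, h, hv, by simp⟩
    | succ t ih =>
      intro ht
      push_cast at ht
      obtain ⟨r', c', b, h1, h2, h3, h4⟩ := ih (by omega)
      rw [Function.iterate_succ_apply', h1]
      obtain ⟨r₂, c2, b2, k1, k2, k3, k4⟩ := hT.stepSE_of_mem h2 h3 (hrun _ (by omega) (by omega))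
      exact ⟨r₂, c2, b2, k1, k2, k3, by push_cast; omega⟩
  obtain ⟨t0, rfl⟩ : ∃ t : ℕ, e = c-r+t := ⟨(e-(c-r)).toNat, by omega⟩
  obtain ⟨r', c', b, h1, h2, h3, h4⟩ := key t0 le_rfl
  obtain ⟨y1, y2, y3⟩ := hyes r' c' h4 b h2 h3
  refine ⟨r', c', ?_, y1, h4⟩
  unfold firstSE
  rw [List.find?_map]
  have hb := hT.lt_size h2; have hc := hT.lt_size h
  rw [show ((List.range (2*γ.size)).find? _) = some t0 from ?_]
  · rw [Option.map_some, h1]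
  · rw [List.find?_range_eq_some]
    refine ⟨?_, List.mem_range.2 (by omega), fun t ht => ?_⟩
    · simp only [Function.comp, h1, decide_eq_true_eq]; exact ⟨y1, y2, y3⟩
    · obtain ⟨r₂, c2, b2, k1, k2, k3, k4⟩ := key t (by omega)
      simp only [Function.comp, k1, Bool.not_eq_true', decide_eq_false_iff_not]
      rintro ⟨m1, m2, m3⟩
      rcases hno r₂ c2 (by omega) (by omega) m1 with h | h; exacts [m2 h, m3 h]

/-- The data for comparing a tableau with one in which two consecutive layers are changed. -/
structure Changed (γ : StrictPartition) (n : ℕ∞) (j : ℕ) (T S : Filling) : Prop where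
  left : IsSSHT γ n T
  right : IsSSHT γ n S
  lay_eq : ∀ m, m ≤ 2*j+1 ∨ 2*j+6 ≤ m → lay γ S m = lay γ T m
  num_eq : ∀ m x, m ≤ 2*j+1 ∨ 2*j+5 ≤ m → 0 ≤ x → num γ S m x = num γ T m x

lemma Changed.fst (h : Changed γ n j T S) (hT : T (r, c) = some a) (ha : a.val = j+1) (hb : b.val = j+1)
    (hx : (c : ℤ)-r ∈ lay γ S (rank b)) : S (r, c) = some b := by
  have hrc := (h.left.lt_size hT).1; have h1 := (h.left.num_of_mem hT).2 (2*j+1) (by omega)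
  rw [← h.num_eq _ _ (by omega) (by omega)] at h1
  rcases letter_cases b with e | e
  · have hr : rank b = 2*j+1+1 := by rw [e, rank_mk]; omega
    rw [hr] at hx; exact h.right.at_of hrc hr h1 hx
  · have hr : rank b = 2*j+2+1 := by rw [e, rank_un]; omega
    rw [hr] at hx
    refine h.right.at_of hrc hr ?_ hx
    rw [h.right.num_succ (2*j+1) (by omega), h1,
      ind_of_not_mem fun h' => (h.right.layer j).disj _ h' hx, add_zero]

lemma Changed.snd (h : Changed γ n j T S) (hT : T (r, c) = some a) (ha : a.val = j+2) (hb : b.val = j+2)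
    (hx : (c : ℤ)-r ∈ lay γ S (rank b)) : S (r, c) = some b := by
  have hrc := (h.left.lt_size hT).1; have h1 := (h.left.num_of_mem hT).1
  rw [ha, show 2*(j+2)+1 = 2*j+5 by ring, ← h.num_eq _ _ (by omega) (by omega)] at h1
  have n1 := h.right.num_succ (2*j+4) (show (0 : ℤ) ≤ c-r by omega)
  have n2 := h.right.num_succ (2*j+3) (show (0 : ℤ) ≤ c-r by omega)
  rcases letter_cases b with e | e
  · have hr : rank b = 2*j+3+1 := by rw [e, rank_mk]; omega
    rw [hr] at hx
    refine h.right.at_of hrc hr ?_ hx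
    have hd : (c : ℤ)-r ∉ lay γ S (2*j+4+1) := fun h' => (h.right.layer (j+1)).disj _ hx h'
    rw [ind_of_not_mem hd] at n1
    rw [ind_of_mem hx] at n2; simp only [Nat.add_assoc, Nat.reduceAdd] at n1 n2; omega
  · have hr : rank b = 2*j+4+1 := by rw [e, rank_un]; omega
    rw [hr] at hx
    refine h.right.at_of hrc hr ?_ hx
    rw [ind_of_mem hx] at n1; simp only [Nat.add_assoc, Nat.reduceAdd] at n1; omega

lemma Changed.up (h : Changed γ n j T S) (hT : T (r, c) = some a) (ha : a.val = j+1) (hb : b.val = j+2)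
    (h1 : (c : ℤ)-r ∉ lay γ S (2*j+2)) (h2 : (c : ℤ)-r ∉ lay γ S (2*j+3))
    (hx : (c : ℤ)-r ∈ lay γ S (rank b)) : S (r, c) = some b := by
  have hrc := (h.left.lt_size hT).1; have h3 := (h.left.num_of_mem hT).2 (2*j+1) (by omega)
  rw [← h.num_eq _ _ (by omega) (by omega)] at h3
  have n1 := h.right.num_succ (2*j+1) (show (0 : ℤ) ≤ c-r by omega)
  have n2 := h.right.num_succ (2*j+2) (show (0 : ℤ) ≤ c-r by omega)
  have n3 := h.right.num_succ (2*j+3) (show (0 : ℤ) ≤ c-r by omega)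
  rw [ind_of_not_mem h1] at n1
  rw [ind_of_not_mem h2] at n2; simp only [Nat.add_assoc, Nat.reduceAdd] at n1 n2 n3
  rcases letter_cases b with e | e
  · have hr : rank b = 2*j+3+1 := by rw [e, rank_mk]; omega
    rw [hr] at hx; exact h.right.at_of hrc hr (by omega) hx
  · have hr : rank b = 2*j+4+1 := by rw [e, rank_un]; omega
    rw [hr] at hx
    refine h.right.at_of hrc hr ?_ hx
    have hd : (c : ℤ)-r ∉ lay γ S (2*j+4) := fun h' => (h.right.layer (j+1)).disj _ h' hx
    rw [ind_of_not_mem hd] at n3; omega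

lemma Changed.keep (h : Changed γ n j T S) (hT : T (r, c) = some a) (hx : (c : ℤ)-r ∈ lay γ S (rank a)) :
    S (r, c) = some a := by
  by_cases h1 : a.val = j+1
  · exact h.fst hT h1 h1 hx
  by_cases h2 : a.val = j+2
  · exact h.snd hT h2 h2 hx
  have hrc := (h.left.lt_size hT).1; have rb := rank_bounds a; have h0 := (h.left.entries _ _ hT).1
  obtain ⟨m, hm⟩ : ∃ m, rank a = m+1 := ⟨rank a-1, by omega⟩
  rw [hm] at hx
  refine h.right.at_of hrc hm ?_ hx
  rw [h.num_eq m _ (by omega) (by omega)]; exact (h.left.num_at hT hm).1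

/-- Comparison with a filling in which two cells are changed. -/
lemma Changed.update2 (h : Changed γ n j T S) {a1 a2 b1 b2 : Letter} (t1 : T (r, c) = some a1)
    (t2 : T (r', c') = some a2) (s1 : S (r, c) = some b1) (s2 : S (r', c') = some b2)
    (hk : ∀ m d, 2*j+2 ≤ m → m ≤ 2*j+5 → d ∈ lay γ T m →
      d ∈ lay γ S m ∨ (rank a1 = m ∧ d = (c : ℤ)-r) ∨ (rank a2 = m ∧ d = (c' : ℤ)-r')) :
    Function.update (Function.update T (r, c) (some b1)) (r', c') (some b2) = S := by
  funext ⟨x, y⟩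
  by_cases e2 : (x, y) = (r', c')
  · rw [e2, Function.update_self, s2]
  rw [Function.update_of_ne e2]
  by_cases e1 : (x, y) = (r, c)
  · rw [e1, Function.update_self, s1]
  rw [Function.update_of_ne e1]
  cases hT : T (x, y) with
  | none =>
    have h1 : ¬ (S (x, y)).isSome := by rw [h.right.shape, ← h.left.shape, hT]; simp
    simpa using (Option.not_isSome_iff_eq_none.1 h1).symm
  | some a =>
    have hm := h.left.mem_lay.2 ⟨x, y, a, hT, rfl, rfl⟩
    refine (h.keep hT ?_).symm
    by_cases hr : 2*j+2 ≤ rank a ∧ rank a ≤ 2*j+5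
    · rcases hk _ _ hr.1 hr.2 hm with h' | ⟨h', e⟩ | ⟨h', e⟩
      · exact h'
      · obtain ⟨rfl, rfl⟩ := h.left.cell_unique hT t1 (by rw [rank_injective h']) e
        exact absurd rfl e1
      · obtain ⟨rfl, rfl⟩ := h.left.cell_unique hT t2 (by rw [rank_injective h']) e
        exact absurd rfl e2
    · rwa [h.lay_eq _ (by omega)]

lemma IsSSHT.east_of (hT : IsSSHT γ n T) (h : T (r, c) = some (un i)) (h1 : (c : ℤ)-r+1 ∉ lay γ T (2*i+1))
    (h2 : (c : ℤ)-r+1 ∈ lay γ T (2*i+2)) : T (r, c+1) = some (Shifted.mk (i+1)) := by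
  have hrc := (hT.lt_size h).1
  obtain ⟨k1, k2, -⟩ := hT.num_at h (m := 2*i) (rank_un i)
  have e : ((c+1 : ℕ) : ℤ)-r = c-r+1 := by push_cast; ring
  refine hT.at_of (by omega) (m := 2*i+1) (by rw [rank_mk]; ring) ?_ (by rw [e]; exact h2)
  rw [e]
  have n1 := hT.num_succ (2*i) (show (0 : ℤ) ≤ c-r+1 by omega)
  have n2 := hT.num_succ (2*i+1) (show (0 : ℤ) ≤ c-r+1 by omega)
  rw [ind_of_not_mem h1] at n1
  rw [ind_of_mem h2] at n2
  have i1 := hT.interlacing.horiz i (c-r+1) (by omega); have i2 := hT.interlacing.vert i (c-r+1) (by omega)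
  rw [add_sub_cancel_right] at i1 i2; simp only [Nat.add_assoc, Nat.reduceAdd] at n1 n2; omega

lemma IsSSHT.north_of_un (hT : IsSSHT γ n T) (h : T (r, c) = some (un i)) (hrc : r+1 ≤ c) :
    (∃ a, T (r+1, c) = some a ∧ rank a ≤ 2*i+3) ↔ InLay γ T (i+1) (c-r-1) := by
  obtain ⟨k1, k2, -⟩ := hT.num_at h (m := 2*i) (rank_un i)
  have e : (c : ℤ)-((r+1 : ℕ) : ℤ) = c-r-1 := by push_cast; ring
  rw [hT.lt_num hrc, e]
  have n2 := hT.num_succ (2*i+1) (show (0 : ℤ) ≤ c-r-1 by omega)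
  have n3 := hT.num_succ (2*i+2) (show (0 : ℤ) ≤ c-r-1 by omega)
  have i1 := hT.interlacing.horiz i (c-r) (by omega); have i2 := hT.interlacing.vert i (c-r) (by omega)
  have i3 := hT.interlacing.mono (2*i+1) (c-r) (by omega)
  unfold InLay
  rw [show 2*(i+1) = 2*i+2 by ring]; simp only [Nat.add_assoc, Nat.reduceAdd] at n2 n3 i3 ⊢
  have v2 : 0 ≤ ind (lay γ T (2*i+2)) (c-r-1) := by unfold ind; split_ifs <;> omega
  have v3 : 0 ≤ ind (lay γ T (2*i+3)) (c-r-1) := by unfold ind; split_ifs <;> omega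
  constructor
  · intro hlt
    by_contra hcon
    rw [not_or] at hcon
    rw [ind_of_not_mem hcon.1] at n2
    rw [ind_of_not_mem hcon.2] at n3
    push_cast at hlt; omega
  · rintro (h | h)
    · rw [ind_of_mem h] at n2; push_cast; omega
    · rw [ind_of_mem h] at n3; push_cast; omega

lemma IsSSHT.east_of_mk (hT : IsSSHT γ n T) (h : T (r, c) = some (Shifted.mk (j+1))) :
    (∃ a, T (r, c+1) = some a ∧ rank a ≤ 2*j+4) ↔
      (c : ℤ)-r+1 ∈ lay γ T (2*j+3) ∨ (c : ℤ)-r+1 ∈ lay γ T (2*j+4) := by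
  have hrc := (hT.lt_size h).1
  obtain ⟨k1, k2, -⟩ := hT.num_at h (m := 2*j+1) (by rw [rank_mk]; ring)
  have e : ((c+1 : ℕ) : ℤ)-r = c-r+1 := by push_cast; ring
  rw [hT.lt_num (by omega), e]
  have n2 := hT.num_succ (2*j+2) (show (0 : ℤ) ≤ c-r+1 by omega)
  have n3 := hT.num_succ (2*j+3) (show (0 : ℤ) ≤ c-r+1 by omega)
  have i1 := hT.interlacing.vert j (c-r+1) (by omega); have i2 := hT.interlacing.horiz (j+1) (c-r+1) (by omega)
  have i3 := hT.interlacing.mono (2*j+2) (c-r) (by omega)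
  rw [show 2*(j+1) = 2*j+2 by ring] at i2
  rw [add_sub_cancel_right] at i1 i2; simp only [Nat.add_assoc, Nat.reduceAdd] at n2 n3 i2 i3 k2
  have v2 : 0 ≤ ind (lay γ T (2*j+3)) (c-r+1) := by unfold ind; split_ifs <;> omega
  have v3 : 0 ≤ ind (lay γ T (2*j+4)) (c-r+1) := by unfold ind; split_ifs <;> omega
  constructor
  · intro hlt
    by_contra hcon
    rw [not_or] at hcon
    rw [ind_of_not_mem hcon.1] at n2
    rw [ind_of_not_mem hcon.2] at n3; omega
  · rintro (h | h)
    · rw [ind_of_mem h] at n2; omega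
    · rw [ind_of_mem h] at n3; omega

lemma IsSSHT.lay_of (hT : IsSSHT γ n T) (h : T (r, c) = some a) {m : ℕ} (hm : rank a = m) : (c : ℤ)-r ∈ lay γ T m :=
  hT.mem_lay.2 ⟨r, c, a, h, hm, rfl⟩

lemma mk_lt_iff {z : Letter} : mk k < z ↔ ¬ rank z ≤ 2*k := by
  rw [lt_iff_rank, rank_mk, not_le]

lemma un_lt_iff {z : Letter} : un k < z ↔ ¬ rank z ≤ 2*k+1 := by
  rw [lt_iff_rank, rank_un, not_le]

/-- The rules of the lowering operator, in terms of the layers. -/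
lemma lowerPos_of_move (h : Changed γ n j T S)
    (hA : Strip.Active (lay γ T (2*j+2)) (lay γ T (2*j+3)) (lay γ T (2*j+4)) (lay γ T (2*j+5)) M x)
    (hM : 0 < M)
    (hm : Move (lay γ T (2*j+2)) (lay γ T (2*j+3)) (lay γ T (2*j+4)) (lay γ T (2*j+5)) x
      (lay γ S (2*j+2)) (lay γ S (2*j+3)) (lay γ S (2*j+4)) (lay γ S (2*j+5))) :
    lowerPos γ (j+1) T = some S := by
  obtain ⟨⟨r, c⟩, a, ha, h2, hx, hq⟩ := h.left.activeCell_of_active (i := j+1) hA hM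
  have hT := h.left; have hrc := (hT.lt_size ha).1; have hun : rank (un (j+1)) = 2*j+3 := by rw [rank_un]; ring
  have hmk : rank (mk (j+1)) = 2*j+2 := by rw [rank_mk]; ring
  have hun2 : rank (un (j+2)) = 2*j+5 := by rw [rank_un]; ring
  have hmk2 : rank (mk (j+2)) = 2*j+4 := by rw [rank_mk]; ring
  have hcell : (a = un (j+1) ∧ x = (c : ℤ)-r) ∨ (a = mk (j+1) ∧ x = -1-((c : ℤ)-r)) := by
    rcases letter_cases a with e | e <;> rw [h2] at e <;> subst e
    exacts [Or.inr ⟨rfl, by rw [← hx, (of_mk γ ha).2.2]⟩, Or.inl ⟨rfl, by rw [← hx, (of_un γ ha).2.2]⟩]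
  have hg : (c : ℤ)-r+1 ∈ lay γ T (2*j+3) → x ≠ c-r := fun h' e => hA.good (e ▸ mem_union_right _ h')
  have hl := (hT.layer j).disj
  have of_mem : x ∈ lay γ T (2*j+3) → a = un (j+1) ∧ x = (c : ℤ)-r := fun h' =>
    hcell.resolve_right fun e => by have := hT.lay_nonneg x h'; omega
  have of_neg : ∀ q ∈ lay γ T (2*j+2), x = -1-q → a = mk (j+1) ∧ x = -1-((c : ℤ)-r) := fun q h' e' =>
    hcell.resolve_left fun e => by have := hT.lay_nonneg q h'; omega
  have cell : ∀ d ∈ lay γ T (2*j+3), ∃ r c : ℕ, T (r, c) = some (un (j+1)) ∧ d = (c : ℤ)-r := fun d hd => by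
    obtain ⟨r, c, a, k1, k2, k3⟩ := hT.mem_lay.1 hd
    obtain rfl : a = un (j+1) := rank_injective (by omega); exact ⟨r, c, k1, k3⟩
  have east : ∀ {r c a m}, T (r, c+1) = some a → rank a = m → (c : ℤ)-r+1 ∈ lay γ T m := fun h' hr => by
    simpa [add_sub_right_comm] using hT.lay_of h' hr
  have north : T (r+1, c) = some (un (j+1)) → (c : ℤ)-r-1 ∈ lay γ T (2*j+3) := fun h' => by
    simpa [sub_sub] using hT.lay_of h' hun
  have layers : ∀ {m}, 2*j+2 ≤ m → m ≤ 2*j+5 → m = 2*j+2 ∨ m = 2*j+3 ∨ m = 2*j+4 ∨ m = 2*j+5 := by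
    omega
  unfold lowerPos
  rw [hq, Option.bind_some]
  generalize f1 : lay γ S (2*j+2) = V1', f2 : lay γ S (2*j+3) = H1', f3 : lay γ S (2*j+4) = V2',
    f4 : lay γ S (2*j+5) = H2' at hm
  cases hm with
  | east x h1 h2 =>
    obtain ⟨rfl, rfl⟩ := of_mem h1
    have h3 := hT.east_of ha (fun h' => hg h' rfl) h2; simp only [if_pos ha, if_pos h3]
    congr 1
    refine h.update2 ha h3 (h.up ha rfl rfl (by rw [f1]; exact fun h' => hl _ h' h1) (by simp [f2]) (by simp [hmk2, f3]))
      (h.snd h3 rfl rfl (by rw [hun2, f4, Nat.cast_succ, add_sub_right_comm]; simp)) fun m d m1 m2 hd => ?_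
    rcases layers m1 m2 with rfl | rfl | rfl | rfl <;> simp only [f1, f2, f3, f4] <;> grind
  | turn x h1 h2 h3 h4 =>
    obtain ⟨rfl, rfl⟩ := of_mem h1
    rw [if_pos ha, if_neg fun h' => h2 (east h' hmk2), if_pos]
    · congr 1
      have s1 : S (r, c) = some (un (j+2)) :=
        h.up ha rfl rfl (by rw [f1]; exact fun h' => hl _ h' h1) (by simp [f2]) (by simp [hun2, f4])
      have := h.update2 ha ha s1 s1 fun m d m1 m2 hd => by
        rcases layers m1 m2 with rfl | rfl | rfl | rfl <;> simp only [f1, f2, f3, f4] <;> grind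
      rwa [Function.update_idem] at this
    · rw [Option.all_eq_true]
      intro y hy
      rw [decide_eq_true_eq, un_lt_iff]
      exact fun hr => ((hT.north_of_un ha (hT.lt_size hy).1).1 ⟨y, hy, by omega⟩).elim h3 h4
  | ribbon x p h1 h2 h3 h4 h5 h6 =>
    obtain ⟨rfl, rfl⟩ := of_mem h1
    have hp : 0 ≤ p := (h4 p le_rfl h3).elim (hT.lay_nonneg p) (hT.lay_nonneg p)
    obtain ⟨y, hy, hyr⟩ := (hT.north_of_un ha (by omega)).2 (h4 _ (by omega) (by omega))
    have hyv : y.val = j+2 := by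
      have l1 := le_iff_rank.1 (hT.col_weak r (r+1) c _ _ (by omega) ha hy)
      have l2 : rank y ≠ rank (un (j+1)) := fun h' => by
        have := hT.col_unmarked _ _ _ _ ha (rank_injective h' ▸ hy); omega
      have := rank_bounds y; omega
    rw [if_pos ha, if_neg fun h' => h2 (east h' hmk2), if_neg]
    · obtain ⟨r', c', b, g1, g2, g3, g4⟩ := hT.endNW_spec (p := p) hy hyv (by push_cast; omega)
        (fun d d1 d2 => h4 d d1 (by push_cast at d2; omega)) fun h' => h'.elim h5 h6
      rw [g1]
      congr 1
      have hb := rank_bounds b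
      have := h.update2 (b1 := un (j+2)) (b2 := mk (j+2)) g2 ha (h.snd g2 g3 rfl (by simp [hun2, f4, g4]))
        (h.up ha rfl rfl (by rw [f1]; exact fun h' => hl _ h' h1) (by simp [f2]) (by simp [hmk2, f3])) fun m d m1 m2 hd => by
          have hp' : rank b = 2*j+5 → p ∉ lay γ T (2*j+4) := fun e h' =>
            (hT.layer (j+1)).disj _ h' (g4 ▸ hT.lay_of g2 e)
          rcases layers m1 m2 with rfl | rfl | rfl | rfl <;> simp only [f1, f2, f3, f4] <;> grind
      rw [← this]
      unfold unmark
      rw [g2, Option.map_some, g3]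
    · rw [hy, Option.all_some, decide_eq_true_eq, un_lt_iff]; exact fun h' => h' (by omega)
  | north q h1 h2 =>
    obtain ⟨rfl, e⟩ := of_neg q h1 rfl
    obtain rfl : q = (c : ℤ)-r := by omega
    obtain ⟨r', c', k1, k3⟩ := cell _ h2
    have h3 : T (r+1, c) = some (un (j+1)) := by
      rcases hT.neighbour ha k1 rfl k3.symm with ⟨rfl, rfl⟩ | ⟨rfl, rfl⟩
      exacts [k1, absurd ⟨le_rfl, Nat.le_succ _⟩ (hT.not_sw ha k1 (by omega))]
    have e0 : (c : ℤ)-(r+1 : ℕ) = c-r-1 := by push_cast; ring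
    rw [ha, if_neg (by simp [mk, un]), if_pos rfl, if_pos h3]
    congr 1
    refine h.update2 ha h3 (h.fst ha rfl rfl (by simp [hun, f2])) (h.up h3 rfl rfl ?_ ?_ (by rw [hmk2, f3, e0]; simp))
      fun m d m1 m2 hd => ?_
    · rw [f1, e0]; exact fun h' => hl _ (mem_of_mem_erase h') h2
    · rw [f2, e0]; simp
    · rw [e0]
      rcases layers m1 m2 with rfl | rfl | rfl | rfl <;> simp only [f1, f2, f3, f4] <;> grind
  | mark q h1 h2 h3 h4 =>
    obtain ⟨rfl, e⟩ := of_neg q h1 rfl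
    obtain rfl : q = (c : ℤ)-r := by omega
    rw [ha, if_neg (by simp [mk, un]), if_pos rfl, if_neg fun h' => h2 (north h'), if_pos]
    · congr 1
      have s1 : S (r, c) = some (mk (j+2)) :=
        h.up ha rfl rfl (by simp [f1]) (by rw [f2]; exact hl _ h1) (by simp [hmk2, f3])
      have := h.update2 ha ha s1 s1 fun m d m1 m2 hd => by
        rcases layers m1 m2 with rfl | rfl | rfl | rfl <;> simp only [f1, f2, f3, f4] <;> grind
      rwa [Function.update_idem] at this
    · rw [Option.all_eq_true]
      intro z hz
      rw [decide_eq_true_eq, mk_lt_iff]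
      exact fun hr => ((hT.east_of_mk ha).1 ⟨z, hz, by omega⟩).elim h3 h4
  | south q e h1 h2 h3 h4 h5 h6 h7 h8 h9 =>
    obtain ⟨rfl, e0⟩ := of_neg q h1 rfl
    obtain rfl : q = (c : ℤ)-r := by omega
    obtain ⟨z, hz, hzr⟩ := (hT.east_of_mk ha).2 h4
    obtain ⟨r', c', g1, g2, g3⟩ := hT.firstSE_spec (i := j+1) ha rfl h3.le (fun d d1 d2 => by
        rcases eq_or_lt_of_le d1 with rfl | hlt
        exacts [Or.inl h1, h5 d hlt d2]) (fun r' c' d1 d2 hT1 => by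
        have hd := hT.lay_of hT1 hun; have hlt : (c : ℤ)-r < c'-r' := lt_of_le_of_ne d1 fun h' => hl _ h1 (h' ▸ hd)
        by_cases hH : (c' : ℤ)-r'+1 ∈ lay γ T (2*j+3)
        · obtain ⟨r₂, c₂, k1, k2⟩ := cell _ hH
          rcases hT.neighbour k1 hT1 rfl (by omega) with ⟨rfl, rfl⟩ | ⟨rfl, rfl⟩
          · have := hT.col_unmarked _ _ _ _ k1 hT1; omega
          · exact Or.inl k1
        · exact Or.inr (hT.east_of hT1 hH ((h6 _ hlt d2 hd).resolve_left hH)))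
      (fun r' c' d1 b hb hbv => by
        obtain ⟨r₂, c₂, k1, k2⟩ := cell _ h7
        obtain ⟨rfl, rfl⟩ := hT.cell_unique hb k1 hbv (by omega)
        exact ⟨k1, fun h' => h8 (d1 ▸ east h' hun), fun h' => h9 (d1 ▸ east h' hmk2)⟩)
    rw [ha, if_neg (by simp [mk, un]), if_pos rfl, if_neg fun h' => h2 (north h'), if_neg, g1, Option.map_some]
    · congr 1
      refine h.update2 ha g2 (h.fst ha rfl rfl (by simp [hun, f2])) (h.up g2 rfl rfl ?_ ?_ (by simp [hmk2, f3, g3]))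
        fun m d m1 m2 hd => ?_
      · rw [f1, g3]; exact fun h' => hl _ (mem_of_mem_erase h') h7
      · rw [f2, g3]; simp [h3.ne']
      · rcases layers m1 m2 with rfl | rfl | rfl | rfl <;> simp only [f1, f2, f3, f4] <;> grind
    · rw [hz, Option.all_some, decide_eq_true_eq, mk_lt_iff]; exact fun h' => h' (by omega)

end

end Shifted

namespace Strip

section
variable {σ0 σ1 σ2 : ℤ → ℤ} {V1 H1 V2 H2 W1 W2 A B : Finset ℤ} {M D p : ℤ}

lemma card_refl (X : Finset ℤ) : (refl X).card = X.card :=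
  Finset.card_image_of_injective _ fun a b h => by simpa using h

lemma Word.card (n : ∀ c ∈ V1 ∪ H1 ∪ V2 ∪ H2, 0 ≤ c) (z : 0 ∉ V1) (w : Word V1 H1 V2 H2 W1 W2) :
    W1.card = V1.card+H1.card ∧ W2.card = V2.card+H2.card := by
  obtain ⟨V, H, g, r, rfl, h⟩ := w
  have c1 := r.card; have e : H ∪ V = H1 ∪ V2 := by ext c; have := r.union c; simp only [mem_union]; tauto
  have c2 := congrArg Finset.card e
  rw [card_union_of_disjoint (Finset.disjoint_left.2 fun c h h' => by have := r.disj' c; tauto),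
    card_union_of_disjoint (Finset.disjoint_left.2 fun c h h' => by have := r.disj c; tauto)] at c2
  simp only [mem_union] at n
  have nHV : ∀ c ∈ H ∪ V, 0 ≤ c := fun c hc => n c (by rw [e, mem_union] at hc; tauto)
  have dj : ∀ X Y : Finset ℤ, (∀ c ∈ X, 0 ≤ c) → (∀ c ∈ Y, 0 ≤ c) → (refl X ∪ Y).card = X.card+Y.card := by
    intro X Y hX hY
    rw [card_union_of_disjoint, card_refl]
    rw [Finset.disjoint_left]
    intro c h h'
    rw [mem_refl] at h
    have := hX _ h; have := hY _ h'; omega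
  have nH : ∀ c ∈ H, 0 ≤ c := fun c hc => nHV c (mem_union_left _ hc)
  rw [dj V H2 (fun c hc => nHV c (mem_union_right _ hc)) fun c hc => n c (by tauto)]
  refine ⟨?_, by omega⟩
  rcases h with ⟨-, rfl⟩ | ⟨⟨h0, -⟩, rfl⟩
  · rw [dj V1 H (fun c hc => n c (by tauto)) nH, c1]
  · rw [dj _ _ _ fun c hc => nH c (mem_of_mem_erase hc), card_insert_of_notMem z,
      Finset.card_erase_of_mem h0, ← c1]
    · have := Finset.card_pos.2 ⟨0, h0⟩; omega
    · intro c hc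
      rcases mem_insert.1 hc with rfl | hc; exacts [le_rfl, n c (by tauto)]

lemma IsMax.card_sub_le (h : IsMax A B M) : (A.card : ℤ)-B.card ≤ M := by
  obtain ⟨b, hb⟩ := exists_upper (A ∪ B)
  have := h.le b
  unfold ht at this
  rwa [cnt_eq_card fun x hx => (hb x (mem_union_left _ hx)).le,
    cnt_eq_card fun x hx => (hb x (mem_union_right _ hx)).le] at this

/-- The flipped place can be recovered after a flip. -/
lemma FirstMax.flip_injective {A B A' B' : Finset ℤ} {M M' p p' : ℤ} (h : FirstMax A B M p) (h' : FirstMax A' B' M' p')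
    (e : A.erase p = A'.erase p') (e' : insert p B = insert p' B') : A = A' ∧ B = B' := by
  obtain ⟨m1, m2, -⟩ := h.mem
  obtain ⟨m1', m2', -⟩ := h'.mem
  have hM : M-1 = M'-1 := (h.decrease.unique (by rw [e, e']; exact h'.decrease))
  have key : ∀ {A B : Finset ℤ} {p}, FirstMax A B M p → ∀ c,
      (p ≤ c → ht (A.erase p) (insert p B) c ≤ M-2) ∧ (c = p-1 → ht (A.erase p) (insert p B) c = M-1) := by
    intro A B p h c
    obtain ⟨m1, m2, m3⟩ := h.mem
    rw [ht_erase_insert m1 m2]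
    refine ⟨fun hc => ?_, fun hc => ?_⟩
    · rw [if_pos hc]; have := h.le c; omega
    · rw [if_neg (by omega), hc, m3]; ring
  obtain rfl : M = M' := by omega
  have : p = p' := by
    rcases lt_trichotomy p p' with hlt | heq | hlt
    · have a1 := (key h (p'-1)).1 (by omega); have a2 := (key h' (p'-1)).2 rfl
      rw [← e, ← e'] at a2; omega
    · exact heq
    · have a1 := (key h' (p-1)).1 (by omega); have a2 := (key h (p-1)).2 rfl
      rw [e, e'] at a2; omega
  subst this
  exact ⟨by rw [← Finset.insert_erase m1, e, Finset.insert_erase m1'],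
    by rw [← Finset.erase_insert m2, e', Finset.erase_insert m2']⟩

end

end Strip

namespace Shifted

open Strip ColoredDigraph

section
variable {γ : StrictPartition} {n : ℕ∞} {R S T U : Filling} {i j k : ℕ} {M D p x : ℤ} {W1 W2 : Finset ℤ}

/-! #### The edges of positive colour, in terms of words -/

/-- The word of the letters with the values `j + 1` and `j + 2`. -/
def WordOf (γ : StrictPartition) (T : Filling) (j : ℕ) (W1 W2 : Finset ℤ) : Prop :=
  Word (lay γ T (2*j+2)) (lay γ T (2*j+3)) (lay γ T (2*j+4)) (lay γ T (2*j+5)) W1 W2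

lemma num_neg (γ : StrictPartition) (T : Filling) (m : ℕ) (hx : x ≤ 0) : num γ T m x = num γ T m 0 := by
  unfold num; rw [Int.toNat_of_nonpos hx, Int.toNat_zero]

lemma Changed.site_eq (h : Changed γ n j T S) {m : ℕ} (hm : m ≤ 2*j+1 ∨ 2*j+5 ≤ m) :
    site γ S m = site γ T m := by
  have key : ∀ x, num γ S m x = num γ T m x := fun x => by
    rcases le_total 0 x with hx | hx
    · exact h.num_eq m x hm hx
    · rw [num_neg _ _ _ hx, num_neg _ _ _ hx, h.num_eq m 0 hm le_rfl]
  funext s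
  unfold site
  rw [key, key]

lemma Changed.symm (h : Changed γ n j T S) : Changed γ n j S T :=
  ⟨h.right, h.left, fun m hm => (h.lay_eq m hm).symm, fun m x hm hx => (h.num_eq m x hm hx).symm⟩

lemma Changed.trans (h : Changed γ n j T S) (h' : Changed γ n j S R) : Changed γ n j T R :=
  ⟨h.left, h'.right, fun m hm => (h'.lay_eq m hm).trans (h.lay_eq m hm),
    fun m x hm hx => (h'.num_eq m x hm hx).trans (h.num_eq m x hm hx)⟩

lemma IsSSHT.nonneg2 (hT : IsSSHT γ n T) (j : ℕ) :
    ∀ c ∈ lay γ T (2*j+2) ∪ lay γ T (2*j+3) ∪ lay γ T (2*j+4) ∪ lay γ T (2*j+5), 0 ≤ c :=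
  Layer.nonneg2 (hT.layer j) (hT.layer (j+1))

lemma IsSSHT.exists_word (hT : IsSSHT γ n T) (j : ℕ) : ∃ W1 W2, WordOf γ T j W1 W2 :=
  Word.exists (hT.layer j) (hT.layer (j+1))

/-- Two fillings that differ in two layers only agree if the words of these layers do. -/
lemma Changed.eq_of_word (h : Changed γ n j T S) (w : WordOf γ T j W1 W2) (w' : WordOf γ S j W1 W2) : T = S := by
  obtain ⟨e1, e2, e3, e4⟩ := Word.injective w w' (h.left.nonneg2 j) (h.right.nonneg2 j) (h.left.layer j).zero
    (h.right.layer j).zero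
  refine h.left.ext_lay h.right fun m => ?_
  obtain hm | rfl | rfl | rfl | rfl : (m ≤ 2*j+1 ∨ 2*j+6 ≤ m) ∨ m = 2*j+2 ∨ m = 2*j+3 ∨ m = 2*j+4 ∨
    m = 2*j+5 := by omega
  exacts [(h.lay_eq m hm).symm, e1, e2, e3, e4]

/-- The lowering operator flips one content of the word. -/
def Flip (γ : StrictPartition) (n : ℕ∞) (j : ℕ) (M : ℤ) (T S : Filling) : Prop :=
  Changed γ n j T S ∧ ∃ W1 W2 p, WordOf γ T j W1 W2 ∧ FirstMax W1 W2 M p ∧ WordOf γ S j (W1.erase p) (insert p W2)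

lemma IsSSHT.exists_flip (hT : IsSSHT γ n T) (hj : (j+2 : ℕ) ≤ n) (w : WordOf γ T j W1 W2)
    (hf : FirstMax W1 W2 M p) : ∃ S, Flip γ n j M T S ∧ lowerPos γ (j+1) T = some S := by
  obtain ⟨x, σ, A, B, C, D, hA, hm, L1, L2, w'⟩ := Word.step (hT.layer j) (hT.layer (j+1)) w hf
  obtain ⟨S, hS, rfl, rfl, rfl, rfl, e1, e2⟩ := exists_of_layers hT hj L1 L2
  have hc : Changed γ n j T S := ⟨hT, hS, e1, e2⟩
  exact ⟨S, ⟨hc, W1, W2, p, w, hf, w'⟩, lowerPos_of_move hc hA hf.pos hm⟩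

lemma lowerPos_eq_none (h : mMax i (readingWord γ T) ≤ 0) : lowerPos γ i T = none := by
  unfold lowerPos activeCell; simp only
  rw [if_pos h]; rfl

lemma IsSSHT.mMax_le_zero_of_word (hT : IsSSHT γ n T) (w : WordOf γ T j W1 W2) (h : ∀ c, ht W1 W2 c ≤ 0) :
    mMax (j+1) (readingWord γ T) ≤ 0 :=
  hT.mMax_le_zero fun _ m m' => Word.good_le (hT.layer j) (hT.layer (j+1)) w (IsMax.zero_iff.2 h) m m'

lemma IsSSHT.flip_iff (hT : IsSSHT γ n T) (hj : (j+2 : ℕ) ≤ n) :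
    lowerPos γ (j+1) T = some S ↔ ∃ M, Flip γ n j M T S := by
  obtain ⟨W1, W2, w⟩ := hT.exists_word j
  rcases Strip.exists_firstMax_or W1 W2 with h | ⟨M, p, hf⟩
  · rw [lowerPos_eq_none (hT.mMax_le_zero_of_word w h)]
    refine ⟨fun h => (by cases h), ?_⟩
    rintro ⟨M, -, W1', W2', p, w', hf, -⟩
    obtain ⟨rfl, rfl⟩ := w.unique w'
    have := h p; have := hf.eq; have := hf.pos; omega
  · obtain ⟨S0, h1, h2⟩ := hT.exists_flip hj w hf
    rw [h2]
    constructor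
    · intro h; cases h; exact ⟨M, h1⟩
    · rintro ⟨M', hc, W1', W2', p', w', hf', w1⟩
      obtain ⟨hc0, W3, W4, p3, w3, hf3, w2⟩ := h1
      obtain ⟨rfl, rfl⟩ := w'.unique w3
      obtain ⟨rfl, rfl⟩ := hf'.unique hf3
      rw [(hc0.symm.trans hc).eq_of_word w2 w1]

lemma exists_lowerPos_of_pos (hT : IsSSHT γ n T) (hj : (j+2 : ℕ) ≤ n)
    (h : 0 < mMax (j+1) (readingWord γ T)) : ∃ S, lowerPos γ (j+1) T = some S := by
  obtain ⟨W1, W2, w⟩ := hT.exists_word j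
  rcases Strip.exists_firstMax_or W1 W2 with h' | ⟨M, p, hf⟩
  · exact absurd (hT.mMax_le_zero_of_word w h') (not_le.2 h)
  · obtain ⟨S0, h1, h2⟩ := hT.exists_flip hj w hf; exact ⟨S0, h2⟩

/-- The number of letters of value `k + 1`. -/
noncomputable def weight (γ : StrictPartition) (T : Filling) (k : ℕ) : ℤ :=
  (lay γ T (2*k+2)).card+(lay γ T (2*k+3)).card

lemma IsSSHT.card_word (hT : IsSSHT γ n T) (w : WordOf γ T j W1 W2) :
    weight γ T j = W1.card ∧ weight γ T (j+1) = W2.card := by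
  obtain ⟨h1, h2⟩ := Word.card (hT.nonneg2 j) (hT.layer j).zero w
  unfold weight
  rw [h1, h2]
  push_cast; exact ⟨rfl, rfl⟩

lemma Flip.weight_eq (h : Flip γ n j M T S) (k : ℕ) :
    weight γ S k = weight γ T k+(if k = j+1 then 1 else 0)-if k = j then 1 else 0 := by
  obtain ⟨hc, W1, W2, p, w, hf, w'⟩ := h
  obtain ⟨a1, a2⟩ := hc.left.card_word w
  obtain ⟨b1, b2⟩ := hc.right.card_word w'
  obtain ⟨m1, m2, -⟩ := hf.mem
  rw [card_insert_of_notMem m2] at b2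
  rw [Finset.card_erase_of_mem m1] at b1
  have := Finset.card_pos.2 ⟨p, m1⟩
  by_cases h1 : k = j
  · subst h1; rw [if_neg (by omega), if_pos rfl]; omega
  by_cases h2 : k = j+1
  · subst h2; rw [if_pos rfl, if_neg (by omega)]; push_cast at b2; omega
  · rw [if_neg h1, if_neg h2]
    unfold weight
    rw [hc.lay_eq _ (by omega), hc.lay_eq _ (by omega)]; ring

/-- The maximal excess of the word. -/
def MaxOf (γ : StrictPartition) (T : Filling) (j : ℕ) (M : ℤ) : Prop := ∃ W1 W2, WordOf γ T j W1 W2 ∧ IsMax W1 W2 M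

lemma IsSSHT.exists_max (hT : IsSSHT γ n T) (j : ℕ) : ∃ M, MaxOf γ T j M := by
  obtain ⟨W1, W2, w⟩ := hT.exists_word j
  obtain ⟨M, hM⟩ := Strip.exists_isMax W1 W2; exact ⟨M, W1, W2, w, hM⟩

lemma MaxOf.unique {M' : ℤ} (h : MaxOf γ T j M) (h' : MaxOf γ T j M') : M = M' := by
  obtain ⟨W1, W2, w, hM⟩ := h
  obtain ⟨W1', W2', w', hM'⟩ := h'
  obtain ⟨rfl, rfl⟩ := w.unique w'; exact hM.unique hM'

lemma Flip.maxOf (h : Flip γ n j M T S) : 0 < M ∧ MaxOf γ T j M ∧ MaxOf γ S j (M-1) := by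
  obtain ⟨hc, W1, W2, p, w, hf, w'⟩ := h; exact ⟨hf.pos, ⟨_, _, w, hf.isMax⟩, ⟨_, _, w', hf.decrease⟩⟩

lemma MaxOf.exists_flip (h : MaxOf γ T j M) (hT : IsSSHT γ n T) (hj : (j+2 : ℕ) ≤ n) (hM : 0 < M) :
    ∃ S, Flip γ n j M T S := by
  obtain ⟨W1, W2, w, hM'⟩ := h
  obtain ⟨p, hf⟩ := hM'.firstMax hM
  obtain ⟨S, hS, -⟩ := hT.exists_flip hj w hf; exact ⟨S, hS⟩

lemma MaxOf.exists_raise (h : MaxOf γ T j M) (hT : IsSSHT γ n T) (hj : (j+2 : ℕ) ≤ n)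
    (hd : 0 < M-(weight γ T j-weight γ T (j+1))) : ∃ S, Flip γ n j (M+1) S T := by
  obtain ⟨W1, W2, w, hM⟩ := h
  obtain ⟨a1, a2⟩ := hT.card_word w
  rw [a1, a2] at hd
  obtain ⟨q, σ, A, B, C, D, W1', W2', L1, L2, w', hf, rfl, rfl⟩ :=
    Word.exists_raise (hT.layer j) (hT.layer (j+1)) w hM hd
  obtain ⟨S, hS, rfl, rfl, rfl, rfl, e1, e2⟩ := exists_of_layers hT hj L1 L2
  have hc : Changed γ n j T S := ⟨hT, hS, e1, e2⟩; exact ⟨S, hc.symm, W1', W2', q, w', hf, w⟩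

lemma Flip.injective {M' : ℤ} (h : Flip γ n j M S T) (h' : Flip γ n j M' R T) : S = R := by
  obtain ⟨hc, W1, W2, p, w, hf, w1⟩ := h
  obtain ⟨hc', W1', W2', p', w', hf', w1'⟩ := h'
  obtain ⟨e1, e2⟩ := w1.unique w1'
  obtain ⟨rfl, rfl⟩ := hf.flip_injective hf' e1 e2; exact (hc.trans hc'.symm).eq_of_word w w'

/-! #### The statistics -/

/-- The number of edges of colour `j + 1` after a tableau. -/
noncomputable def edgesAfter (j : ℕ) (x : SSHT γ n) : ℤ := (x.2.exists_max j).choose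

/-- The number of edges of colour `j + 1` before a tableau. -/
noncomputable def edgesBefore (j : ℕ) (x : SSHT γ n) : ℤ := edgesAfter j x-(weight γ x.1 j-weight γ x.1 (j+1))

/-- The edges of colour `j + 1`. -/
def Edge (j : ℕ) (x y : SSHT γ n) : Prop := lowerPos γ (j+1) x.1 = some y.1

variable {x y z u v : SSHT γ n}

lemma edgesAfter_spec (j : ℕ) (x : SSHT γ n) : MaxOf γ x.1 j (edgesAfter j x) := (x.2.exists_max j).choose_spec

lemma edgesAfter_eq (h : MaxOf γ x.1 j M) : edgesAfter j x = M := (edgesAfter_spec j x).unique h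

lemma edge_iff (hj : (j+2 : ℕ) ≤ n) : Edge j x y ↔ Flip γ n j (edgesAfter j x) x.1 y.1 := by
  unfold Edge
  rw [x.2.flip_iff hj]
  constructor
  · rintro ⟨M, h⟩; rwa [edgesAfter_eq h.maxOf.2.1]
  · exact fun h => ⟨_, h⟩

lemma strings (hj : (j+2 : ℕ) ≤ n) : Strings (Edge (γ := γ) (n := n) j) (edgesAfter j) (edgesBefore j) where
  ep_nonneg x := by obtain ⟨W1, W2, w, hM⟩ := edgesAfter_spec j x; exact hM.nonneg
  de_nonneg x := by
    obtain ⟨W1, W2, w, hM⟩ := edgesAfter_spec j x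
    obtain ⟨a1, a2⟩ := x.2.card_word w
    have := hM.card_sub_le
    unfold edgesBefore
    rw [a1, a2]; omega
  ep_edge h := edgesAfter_eq ((edge_iff hj).1 h).maxOf.2.2
  de_edge h := by
    have h' := (edge_iff hj).1 h
    unfold edgesBefore
    rw [edgesAfter_eq h'.maxOf.2.2, h'.weight_eq, h'.weight_eq, if_neg (by omega), if_pos rfl, if_pos rfl, if_neg (by omega)]
    ring
  exists_down {x} h := by
    obtain ⟨S, hS⟩ := (edgesAfter_spec j x).exists_flip x.2 hj h
    exact ⟨⟨S, hS.1.right⟩, (edge_iff hj).2 hS⟩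
  exists_up {x} h := by
    obtain ⟨S, hS⟩ := (edgesAfter_spec j x).exists_raise x.2 hj h
    exact ⟨⟨S, hS.1.left⟩, (edge_iff hj).2 (by rw [edgesAfter_eq (x := ⟨S, hS.1.left⟩) hS.maxOf.2.1]; exact hS)⟩
  func h h' := Subtype.ext (Option.some.inj (h.symm.trans h'))
  inj h h' := Subtype.ext (((edge_iff hj).1 h).injective ((edge_iff hj).1 h'))

end

end Shifted

namespace Strip

/-- Charts for the vertices of a graph, on which two adjacent colours act by lowering triples. -/
structure Charted {V : Type*} (R S : V → V → Prop) (eR eS : V → ℤ) (A : V → V → Prop) (K X : V → Tri) : Prop where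
  low1 : ∀ {x u}, R x u → Low1 (eR x) (K x) (K u) ∧ Low1 (eR x) (X x) (X u)
  low2 : ∀ {x v}, S x v → Low2 (eS x) (K x) (K v) ∧ Low2 (eS x) (X x) (X v)
  max1 : ∀ x, IsMax (K x).1 (K x).2.1 (eR x) ∧ IsMax (X x).1 (X x).2.1 (eR x)
  max2 : ∀ x, IsMax (K x).2.1 (K x).2.2 (eS x) ∧ IsMax (X x).2.1 (X x).2.2 (eS x)
  equiv : Equivalence A
  sub1 : ∀ {x u}, R x u → A x u
  sub2 : ∀ {x v}, S x v → A x v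
  ext : ∀ {x y}, A x y → K x = K y → X x = X y → x = y

open ColoredDigraph

section
variable {V : Type*} {R S : V → V → Prop} {eR dR eS dS : V → ℤ} {A : V → V → Prop} {K X : V → Tri} {x u v a : V}
  {M N : ℤ} {Y Z : Tri}

lemma Low1.pos (h : Low1 M Y Z) : 0 < M := by obtain ⟨p, h, -⟩ := h; exact h.pos

lemma Low2.pos (h : Low2 M Y Z) : 0 < M := by obtain ⟨p, h, -⟩ := h; exact h.pos

lemma Charted.down1 (hc : Charted R S eR eS A K X) (hR : Strings R eR dR) (h : Low1 M (K x) Y)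
    (h' : Low1 M (X x) Z) : eR x = M ∧ ∃ u, R x u ∧ K u = Y ∧ X u = Z := by
  have e := (hc.max1 x).1.unique h.isMax
  obtain ⟨u, hu⟩ := hR.exists_down (x := x) (by rw [e]; exact h.pos)
  exact ⟨e, u, hu, (hc.low1 hu).1.unique h, (hc.low1 hu).2.unique h'⟩

lemma Charted.down2 (hc : Charted R S eR eS A K X) (hS : Strings S eS dS) (h : Low2 M (K x) Y)
    (h' : Low2 M (X x) Z) : eS x = M ∧ ∃ u, S x u ∧ K u = Y ∧ X u = Z := by
  have e := (hc.max2 x).1.unique h.isMax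
  obtain ⟨u, hu⟩ := hS.exists_down (x := x) (by rw [e]; exact h.pos)
  exact ⟨e, u, hu, (hc.low2 hu).1.unique h, (hc.low2 hu).2.unique h'⟩

lemma Charted.mono1 (hc : Charted R S eR eS A K X) (h : R x u) : eS u = eS x ∨ eS u = eS x+1 :=
  ((hc.low1 h).1.mono (hc.max2 x).1).imp (hc.max2 u).1.unique (hc.max2 u).1.unique

lemma Charted.mono2 (hc : Charted R S eR eS A K X) (h : S x v) : eR v = eR x ∨ eR v = eR x+1 :=
  ((hc.low2 h).1.mono (hc.max1 x).1).imp (hc.max1 v).1.unique (hc.max1 v).1.unique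

lemma Charted.gap1 (hc : Charted R S eR eS A K X) (h : R x u) (he : eS u = eS x+1) (ha : S u a) : eR a = eR u := by
  have h1 := (hc.low1 h).1; have h2 := (hc.low2 ha).1
  rw [he] at h2
  rw [(hc.max1 a).1.unique (h1.gap (hc.max2 x).1 h2), (hc.max1 u).1.unique h1.decrease]

lemma Charted.gap2 (hc : Charted R S eR eS A K X) (h : S x v) (he : eR v = eR x+1) (ha : R v a) : eS a = eS v := by
  have h1 := (hc.low2 h).1; have h2 := (hc.low1 ha).1
  rw [he] at h2
  rw [(hc.max2 a).1.unique (h1.gap (hc.max1 x).1 h2), (hc.max2 v).1.unique h1.decrease]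

lemma Charted.square1 (hc : Charted R S eR eS A K X) (hR : Strings R eR dR)
    (hS : Strings S eS dS) (hu : R x u) (hv : S x v) (he : eS u = eS x) :
    ∃ y, S u y ∧ R v y ∧ eR v = eR x+1 := by
  obtain ⟨Y, k1, k2⟩ := (hc.low1 hu).1.square (hc.low2 hv).1 (he ▸ (hc.max2 u).1)
  obtain ⟨Z, l1, l2⟩ := (hc.low1 hu).2.square (hc.low2 hv).2 (he ▸ (hc.max2 u).2)
  obtain ⟨-, y, hy, ey, ey'⟩ := hc.down2 hS k1 l1
  obtain ⟨e, y', hy', fy, fy'⟩ := hc.down1 hR k2 l2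
  have : y = y' := hc.ext (hc.equiv.trans (hc.equiv.symm (hc.equiv.trans (hc.sub1 hu) (hc.sub2 hy)))
    (hc.equiv.trans (hc.sub2 hv) (hc.sub1 hy'))) (ey.trans fy.symm) (ey'.trans fy'.symm)
  exact ⟨y, hy, this ▸ hy', e⟩

lemma Charted.square2 (hc : Charted R S eR eS A K X) (hR : Strings R eR dR)
    (hS : Strings S eS dS) (hv : S x v) (hu : R x u) (he : eR v = eR x) :
    ∃ y, R v y ∧ S u y ∧ eS u = eS x+1 := by
  obtain ⟨Y, k1, k2⟩ := Low2.square (hc.low1 hu).1 (hc.low2 hv).1 (he ▸ (hc.max1 v).1)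
  obtain ⟨Z, l1, l2⟩ := Low2.square (hc.low1 hu).2 (hc.low2 hv).2 (he ▸ (hc.max1 v).2)
  obtain ⟨-, y, hy, ey, ey'⟩ := hc.down1 hR k1 l1
  obtain ⟨e, y', hy', fy, fy'⟩ := hc.down2 hS k2 l2
  have : y = y' := hc.ext (hc.equiv.trans (hc.equiv.symm (hc.equiv.trans (hc.sub2 hv) (hc.sub1 hy)))
    (hc.equiv.trans (hc.sub1 hu) (hc.sub2 hy'))) (ey.trans fy.symm) (ey'.trans fy'.symm)
  exact ⟨y, hy, this ▸ hy', e⟩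

lemma Charted.octagon (hc : Charted R S eR eS A K X) (hR : Strings R eR dR)
    (hS : Strings S eS dS) : Octagon R S eR eS := by
  intro x u v hu hv e1 e2
  obtain ⟨A1, A2, A3, A4, A5, k1, k2, k3, k4, k5, k6⟩ := (hc.low1 hu).1.octagon (hc.low2 hv).1 (e1 ▸ (hc.max2 u).1)
    (e2 ▸ (hc.max1 v).1)
  obtain ⟨B1, B2, B3, B4, B5, l1, l2, l3, l4, l5, l6⟩ := (hc.low1 hu).2.octagon (hc.low2 hv).2 (e1 ▸ (hc.max2 u).2)
    (e2 ▸ (hc.max1 v).2)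
  obtain ⟨-, a, ha, rfl, rfl⟩ := hc.down2 hS k1 l1
  obtain ⟨-, b, hb, rfl, rfl⟩ := hc.down2 hS k2 l2
  obtain ⟨-, y, hy, rfl, rfl⟩ := hc.down1 hR k3 l3
  obtain ⟨-, c, hcc, rfl, rfl⟩ := hc.down1 hR k4 l4
  obtain ⟨-, d, hd, rfl, rfl⟩ := hc.down1 hR k5 l5
  obtain ⟨-, y', hy', fy, fy'⟩ := hc.down2 hS k6 l6
  have t := fun {x y z} => hc.equiv.trans (x := x) (y := y) (z := z)
  have : y' = y := hc.ext (t (hc.equiv.symm (t (hc.sub2 hv) (t (hc.sub1 hcc) (t (hc.sub1 hd) (hc.sub2 hy')))))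
    (t (hc.sub1 hu) (t (hc.sub2 ha) (t (hc.sub2 hb) (hc.sub1 hy))))) fy fy'
  exact ⟨y, a, b, c, d, ⟨ha, hb, hy⟩, hcc, hd, this ▸ hy'⟩

end

end Strip

namespace Shifted

open Strip ColoredDigraph

section
variable {γ : StrictPartition} {n : ℕ∞} {R S T U : Filling} {i j k : ℕ} {M D p : ℤ} {W1 W2 : Finset ℤ} {X K : Tri}
  {x y z u v : SSHT γ n}

/-- The chart of the letters with the values `j + 1`, `j + 2` and `j + 3`. -/
def ChartOf (γ : StrictPartition) (T : Filling) (j : ℕ) (X K : Tri) : Prop :=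
  Chart3 (lay γ T (2*j+2)) (lay γ T (2*j+3)) (lay γ T (2*j+4)) (lay γ T (2*j+5)) (lay γ T (2*j+6))
    (lay γ T (2*j+7)) X K

lemma IsSSHT.exists_chart (hT : IsSSHT γ n T) (j : ℕ) : ∃ P : Tri × Tri, ChartOf γ T j P.1 P.2 := by
  obtain ⟨X, K, h⟩ := Chart3.exists (hT.layer j) (hT.layer (j+1)) (hT.layer (j+2)); exact ⟨(X, K), h⟩

lemma IsSSHT.nonneg3 (hT : IsSSHT γ n T) (j : ℕ) : ∀ c ∈ lay γ T (2*j+2) ∪ lay γ T (2*j+3) ∪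
    lay γ T (2*j+4) ∪ lay γ T (2*j+5) ∪ lay γ T (2*j+6) ∪ lay γ T (2*j+7), 0 ≤ c := by
  intro c hc; simp only [mem_union] at hc
  rcases hc with ((((h | h) | h) | h) | h) | h <;> exact hT.lay_nonneg _ h

lemma Flip.chart1 (h : Flip γ n j M T S) (hK : ChartOf γ T j X K) :
    ∃ X' K', ChartOf γ S j X' K' ∧ Low1 M K K' ∧ Low1 M (reflTri X) (reflTri X') := by
  obtain ⟨hc, W1, W2, p, w, hf, w'⟩ := h
  have l1 := hc.right.layer j; have l2 := hc.right.layer (j+1)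
  rw [hc.site_eq (m := 2*j+1) (by omega)] at l1
  rw [hc.site_eq (m := 2*(j+1)+3) (by omega)] at l2
  obtain ⟨X', K', h1, h2, h3⟩ := Chart3.low1 (hc.left.layer j) (hc.left.layer (j+1)) (hc.left.layer (j+2)) w l1 l2 w' hf hK
  refine ⟨X', K', ?_, h2, h3⟩
  unfold ChartOf
  rw [hc.lay_eq (2*j+6) (by omega), hc.lay_eq (2*j+7) (by omega)]; exact h1

lemma Flip.chart2 (h : Flip γ n (j+1) M T S) (hK : ChartOf γ T j X K) :
    ∃ X' K', ChartOf γ S j X' K' ∧ Low2 M K K' ∧ Low2 M (reflTri X) (reflTri X') := by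
  obtain ⟨hc, W1, W2, p, w, hf, w'⟩ := h
  have l1 := hc.right.layer (j+1); have l2 := hc.right.layer (j+2)
  rw [hc.site_eq (m := 2*(j+1)+1) (by omega)] at l1
  rw [hc.site_eq (m := 2*(j+2)+3) (by omega)] at l2
  obtain ⟨X', K', h1, h2, h3⟩ := Chart3.low2 (hc.left.layer j) (hc.left.layer (j+1)) (hc.left.layer (j+2)) w l1 l2 w' hf hK
  refine ⟨X', K', ?_, h2, h3⟩
  unfold ChartOf
  rw [hc.lay_eq (2*j+2) (by omega), hc.lay_eq (2*j+3) (by omega)]; exact h1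

/-- The horizontal strips of the chart. -/
noncomputable def horizontal (j : ℕ) (x : SSHT γ n) : Tri := (x.2.exists_chart j).choose.2

/-- The reflected vertical strips of the chart. -/
noncomputable def vertical (j : ℕ) (x : SSHT γ n) : Tri := reflTri (x.2.exists_chart j).choose.1

lemma charted (hj : (j+3 : ℕ) ≤ n) : Charted (Edge (γ := γ) (n := n) j) (Edge (j+1)) (edgesAfter j)
    (edgesAfter (j+1)) (fun x y => ∀ m, m ≤ 2*j+1 ∨ 2*j+8 ≤ m → lay γ x.1 m = lay γ y.1 m)
    (horizontal j) (vertical j) := by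
  have hj1 : (j+2 : ℕ) ≤ n := le_trans (by exact_mod_cast (by omega : j+2 ≤ j+3)) hj
  have spec : ∀ x : SSHT γ n, ChartOf γ x.1 j (x.2.exists_chart j).choose.1 (horizontal j x) := fun x =>
    (x.2.exists_chart j).choose_spec
  have low1 : ∀ {x u : SSHT γ n}, Edge j x u → Low1 (edgesAfter j x) (horizontal j x) (horizontal j u) ∧
      Low1 (edgesAfter j x) (vertical j x) (vertical j u) := fun {x u} h => by
    obtain ⟨X', K', h1, h2, h3⟩ := ((edge_iff hj1).1 h).chart1 (spec x)
    obtain ⟨e1, e2⟩ := h1.unique (spec u)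
    rw [e1] at h3; rw [e2] at h2; exact ⟨h2, h3⟩
  have low2 : ∀ {x u : SSHT γ n}, Edge (j+1) x u → Low2 (edgesAfter (j+1) x) (horizontal j x) (horizontal j u) ∧
      Low2 (edgesAfter (j+1) x) (vertical j x) (vertical j u) := fun {x u} h => by
    obtain ⟨X', K', h1, h2, h3⟩ := ((edge_iff hj).1 h).chart2 (spec x)
    obtain ⟨e1, e2⟩ := h1.unique (spec u)
    rw [e1] at h3; rw [e2] at h2; exact ⟨h2, h3⟩
  refine ⟨low1, low2, fun x => ?_, fun x => ?_, ⟨fun x m _ => rfl, fun h m hm => (h m hm).symm,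
    fun h h' m hm => (h m hm).trans (h' m hm)⟩, fun h m hm => ?_, fun h m hm => ?_, fun {x y} h h1 h2 => ?_⟩
  · rcases eq_or_lt_of_le ((strings hj1).ep_nonneg x) with h0 | h0
    · obtain ⟨W1, W2, w, hM⟩ := edgesAfter_spec j x
      rw [← h0] at hM ⊢
      exact Chart3.zero1 (x.2.layer j) (x.2.layer (j+1)) (x.2.layer (j+2)) w hM (spec x)
    · obtain ⟨u, hu⟩ := (strings hj1).exists_down h0; exact ⟨(low1 hu).1.isMax, (low1 hu).2.isMax⟩
  · rcases eq_or_lt_of_le ((strings (j := j+1) hj).ep_nonneg x) with h0 | h0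
    · obtain ⟨W1, W2, w, hM⟩ := edgesAfter_spec (j+1) x
      rw [← h0] at hM ⊢
      exact Chart3.zero2 (x.2.layer j) (x.2.layer (j+1)) (x.2.layer (j+2)) w hM (spec x)
    · obtain ⟨u, hu⟩ := (strings (j := j+1) hj).exists_down h0
      exact ⟨(low2 hu).1.isMax, (low2 hu).2.isMax⟩
  · exact (((edge_iff hj1).1 h).1.lay_eq m (by omega)).symm
  · exact (((edge_iff hj).1 h).1.lay_eq m (by omega)).symm
  · have s1 := spec x; have s2 := spec y
    rw [h1, reflTri_injective h2] at s1
    obtain ⟨e1, e2, e3, e4, e5, e6⟩ := Chart3.injective s1 s2 (x.2.nonneg3 j) (y.2.nonneg3 j)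
    refine Subtype.ext (x.2.ext_lay y.2 fun m => ?_)
    obtain hm | rfl | rfl | rfl | rfl | rfl | rfl : (m ≤ 2*j+1 ∨ 2*j+8 ≤ m) ∨ m = 2*j+2 ∨ m = 2*j+3 ∨
      m = 2*j+4 ∨ m = 2*j+5 ∨ m = 2*j+6 ∨ m = 2*j+7 := by omega
    exacts [h m hm, e1, e2, e3, e4, e5, e6]

lemma near (hj : (j+3 : ℕ) ≤ n) :
    Near (Edge (γ := γ) (n := n) j) (Edge (j+1)) (edgesAfter j) (edgesAfter (j+1)) (edgesBefore (j+1)) ∧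
    Near (Edge (γ := γ) (n := n) (j+1)) (Edge j) (edgesAfter (j+1)) (edgesAfter j) (edgesBefore j) ∧
    Octagon (Edge (γ := γ) (n := n) j) (Edge (j+1)) (edgesAfter j) (edgesAfter (j+1)) := by
  have hj1 : (j+2 : ℕ) ≤ n := le_trans (by exact_mod_cast (by omega : j+2 ≤ j+3)) hj; have hc := charted (γ := γ) hj
  have s1 := strings (γ := γ) hj1; have s2 := strings (γ := γ) (j := j+1) hj
  refine ⟨⟨hc.mono1, fun {x u} h => ?_, hc.square1 s1 s2, hc.gap1⟩, ⟨hc.mono2, fun {x u} h => ?_, hc.square2 s1 s2, hc.gap2⟩,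
    hc.octagon s1 s2⟩
  · have h' := (edge_iff hj1).1 h
    unfold edgesBefore
    rw [h'.weight_eq, h'.weight_eq, if_pos rfl, if_neg (by omega), if_neg (by omega), if_neg (by omega)]
    ring
  · have h' := (edge_iff (j := j+1) hj).1 h
    unfold edgesBefore
    rw [h'.weight_eq, h'.weight_eq, if_neg (by omega), if_neg (by omega), if_neg (by omega), if_pos rfl]
    ring

/-- Tableaux that agree in two layers. -/
def Agree (γ : StrictPartition) (j : ℕ) (T S : Filling) : Prop :=
  ∀ m, 2*j+2 ≤ m → m ≤ 2*j+5 → lay γ S m = lay γ T m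

lemma Agree.wordOf (h : Agree γ j T S) : WordOf γ S j = WordOf γ T j := by
  unfold WordOf
  rw [h (2*j+2) (by omega) (by omega), h (2*j+3) (by omega) (by omega), h (2*j+4) (by omega) (by omega),
    h (2*j+5) (by omega) (by omega)]

lemma Agree.maxOf (h : Agree γ j T S) : MaxOf γ S j = MaxOf γ T j := by
  unfold MaxOf; rw [h.wordOf]

lemma Agree.flip {M' : ℤ} (h : Agree γ j T S) (hT : Flip γ n j M T U) (hS : Flip γ n j M' S R) : Agree γ j U R := by
  obtain ⟨hc, W1, W2, p, w, hf, w'⟩ := hT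
  obtain ⟨hc1, W3, W4, p1, w1, hf1, w1'⟩ := hS
  rw [h.wordOf] at w1
  obtain ⟨rfl, rfl⟩ := w.unique w1
  obtain ⟨rfl, rfl⟩ := hf.unique hf1
  obtain ⟨e1, e2, e3, e4⟩ := Word.injective w1' w' (hc1.right.nonneg2 j) (hc.right.nonneg2 j) (hc1.right.layer j).zero
    (hc.right.layer j).zero
  intro m h1 h2
  obtain rfl | rfl | rfl | rfl : m = 2*j+2 ∨ m = 2*j+3 ∨ m = 2*j+4 ∨ m = 2*j+5 := by omega
  exacts [e1, e2, e3, e4]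

lemma Agree.edgesAfter_eq (h : Agree γ j x.1 y.1) : edgesAfter j y = edgesAfter j x :=
  Shifted.edgesAfter_eq (by rw [h.maxOf]; exact edgesAfter_spec j x)

lemma Agree.edgesBefore_eq (h : Agree γ j x.1 y.1) : edgesBefore j y = edgesBefore j x := by
  unfold edgesBefore weight
  rw [h.edgesAfter_eq, h (2*j+2) (by omega) (by omega), h (2*j+3) (by omega) (by omega),
    h (2*(j+1)+2) (by omega) (by omega), h (2*(j+1)+3) (by omega) (by omega)]

lemma Changed.agree (h : Changed γ n j T S) (hk : k+1 < j ∨ j+1 < k) : Agree γ k T S :=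
  fun m h1 h2 => h.lay_eq m (by omega)

lemma far (hj : (j+2 : ℕ) ≤ n) (hk' : (k+2 : ℕ) ≤ n) (hk : k+1 < j ∨ j+1 < k) :
    Far (Edge (γ := γ) (n := n) j) (Edge k) (edgesAfter k) (edgesBefore k) := by
  refine ⟨fun h => (((edge_iff hj).1 h).1.agree hk).edgesAfter_eq, fun h => (((edge_iff hj).1 h).1.agree hk).edgesBefore_eq,
    fun {x u v} hu hv => ?_⟩
  have fu := (edge_iff hj).1 hu; have fv := (edge_iff hk').1 hv; have au := fu.1.agree hk
  have av := fv.1.agree (k := j) (by omega)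
  obtain ⟨y, hy⟩ := (strings (γ := γ) hk').exists_down (x := u) (by rw [au.edgesAfter_eq]; exact fv.maxOf.1)
  obtain ⟨y', hy'⟩ := (strings (γ := γ) hj).exists_down (x := v) (by rw [av.edgesAfter_eq]; exact fu.maxOf.1)
  have fy := (edge_iff hk').1 hy; have fy' := (edge_iff hj).1 hy'; have e1 := au.flip fv fy; have e2 := av.flip fu fy'
  have : y = y' := by
    refine Subtype.ext (y.2.ext_lay y'.2 fun m => ?_)
    by_cases h1 : 2*j+2 ≤ m ∧ m ≤ 2*j+5
    · rw [e2 m h1.1 h1.2, fy.1.lay_eq m (by omega)]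
    by_cases h2 : 2*k+2 ≤ m ∧ m ≤ 2*k+5
    · rw [e1 m h2.1 h2.2, fy'.1.lay_eq m (by omega)]
    rw [fy.1.lay_eq m (by omega), fu.1.lay_eq m (by omega), fy'.1.lay_eq m (by omega), fv.1.lay_eq m (by omega)]
  exact ⟨y, hy, this ▸ hy'⟩

lemma color_succ {i : ℕ} (hi : i ∈ (queerCrystal γ n).positivePart.colors) : ∃ j, i = j+1 ∧ (j+2 : ℕ) ≤ n := by
  obtain ⟨h1, h2⟩ := hi
  refine ⟨i-1, by omega, ?_⟩
  rw [show i-1+2 = i+1 by omega]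
  exact_mod_cast Order.add_one_le_of_lt (show (i : ℕ∞) < n from h1)

lemma positivePart_edge (hj : (j+2 : ℕ) ≤ n) : (queerCrystal γ n).positivePart.edge (j+1) = Edge j := by
  funext x y
  have h : ((j+1 : ℕ) : ℕ∞) < n := lt_of_lt_of_le (by exact_mod_cast (by omega : j+1 < j+2)) hj
  unfold positivePart queerCrystal lower Edge; simp [-Nat.cast_add, h]

lemma positivePart_isRegular : (queerCrystal γ n).positivePart.IsRegular := by
  refine isRegular_of_strings _ (fun i => edgesAfter (i-1)) (fun i => edgesBefore (i-1)) ?_ ?_ ?_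
  · intro i hi
    obtain ⟨j, rfl, hj⟩ := color_succ hi
    rw [positivePart_edge hj]; exact strings hj
  · intro i hi hi'
    obtain ⟨j, rfl, hj⟩ := color_succ hi
    obtain ⟨_, e, hj'⟩ := color_succ hi'
    obtain rfl := Nat.succ.inj e
    rw [positivePart_edge hj, positivePart_edge hj']; exact near hj'
  · intro i hi i' hi' hlt
    obtain ⟨j, rfl, hj⟩ := color_succ hi
    obtain ⟨k, rfl, hk⟩ := color_succ hi'
    rw [positivePart_edge hj, positivePart_edge hk]
    exact ⟨far hj hk (by omega), far hk hj (by omega)⟩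

end

end Shifted

namespace Strip

/-! #### The first two layers of a tableau -/

section
variable {σ0 σ1 σ2 σ τ : ℤ → ℤ} {V1 H1 V2 H2 V3 H3 W1 W2 X : Finset ℤ} {a v d b l p M c : ℤ}

lemma exists_Ico (hl : ∀ c ∈ X, l ≤ c) (h : ∀ c ∈ X, l < c → c-1 ∈ X) : ∃ b, 0 ≤ b ∧ X = Ico l (l+b) := by
  have down : ∀ (t : ℕ) c, c ∈ X → l ≤ c-t → c-t ∈ X := by
    intro t
    induction t with
    | zero => intro c hc _; simpa using hc
    | succ t ih =>
      intro c hc ht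
      push_cast at ht ⊢
      have := h _ (ih c hc (by omega)) (by omega); rwa [show c-(t+1 : ℤ) = c-t-1 by ring]
  rcases X.eq_empty_or_nonempty with rfl | hX
  · exact ⟨0, le_rfl, by simp⟩
  have hm := X.max'_mem hX; have hlm := hl _ hm
  refine ⟨X.max' hX+1-l, by omega, ?_⟩
  ext c
  rw [mem_Ico]
  constructor
  · intro hc
    have := X.le_max' c hc; exact ⟨hl c hc, by omega⟩
  · intro hc
    have := down (X.max' hX-c).toNat _ hm (by omega)
    rwa [show X.max' hX-((X.max' hX-c).toNat : ℤ) = c by omega] at this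

lemma cnt_Ico (l u c : ℤ) : cnt (Ico l u) c = max 0 (min u (c+1)-l) := by
  have : (Ico l u).filter (· ≤ c) = Ico l (min u (c+1)) := by
    ext x; simp only [mem_filter, mem_Ico]; omega
  unfold cnt
  rw [this, Int.card_Ico]; omega

lemma refl_Ico (l u : ℤ) : refl (Ico l u) = Ico (-u) (-l) := by
  ext c; rw [mem_refl, mem_Ico, mem_Ico]; omega

/-- A vertical strip that meets at most one particle. -/
lemma HalfStrip.eq_Ico (h : HalfStrip 1 σ τ X) (h0 : 0 ∉ X) (hσ : ∀ c, 1 ≤ c → σ c = ind {p} c) (hp : 0 ≤ p) :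
    ∃ v, 0 ≤ v ∧ v ≤ 1 ∧ (v = 1 → 1 ≤ p) ∧ X = Ico p (p+v) := by
  have key : ∀ c ∈ X, c = p ∧ 1 ≤ p := by
    intro c hc
    have h1 := h.nonneg c hc; have h2 : 1 ≤ c := by rcases eq_or_lt_of_le h1 with rfl | h3; exacts [absurd hc h0, h3]
    have h3 := h.stripAt c h2; have h4 := hσ c h2
    unfold StripAt ind at h3
    unfold ind at h4; grind
  by_cases hX : p ∈ X
  · refine ⟨1, by omega, by omega, fun _ => (key p hX).2, ?_⟩
    ext c; rw [mem_Ico]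
    exact ⟨fun hc => by have := key c hc; omega, fun hc => by rwa [show c = p by omega]⟩
  · refine ⟨0, le_rfl, by omega, by omega, ?_⟩
    ext c; rw [mem_Ico]; exact ⟨fun hc => absurd ((key c hc).1 ▸ hc) hX, fun hc => by omega⟩

lemma exists_config (L1 : Layer σ0 σ1 V1 H1) (L2 : Layer σ1 σ2 V2 H2) (hσ : ∀ c, 1 ≤ c → σ0 c = 0) :
    V1 = ∅ ∧ ∃ a v d b, 0 ≤ a ∧ 0 ≤ v ∧ v ≤ 1 ∧ 0 ≤ d ∧ 0 ≤ b ∧ (v = 1 → 1 ≤ a) ∧ (d = 0 ∨ d+1 ≤ a+v) ∧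
      H1 = Ico 0 a ∧ V2 = Ico a (a+v) ∧ H2 = Ico 0 d ∪ Ico (a+v) (a+v+b) ∧
      ∀ s, 1 ≤ s → σ2 s = ind {a+v+b} s+ind {d} s := by
  have hV1 : V1 = ∅ := by
    rw [Finset.eq_empty_iff_forall_notMem]
    intro c hc
    have h1 := L1.hV.nonneg c hc
    have h2 : 1 ≤ c := by rcases eq_or_lt_of_le h1 with rfl | h3; exacts [absurd hc L1.zero, h3]
    have h3 := L1.hV.stripAt c h2
    unfold StripAt ind at h3; grind
  subst hV1
  have a1 := L1.hH.stripAt; simp only [StripAt, Strip.after, ind, notMem_empty, if_false] at a1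
  obtain ⟨a, ha, rfl⟩ := exists_Ico (X := H1) (l := 0) L1.hH.nonneg fun c hc h1 => by
    have := a1 c (by omega); have := hσ c (by omega); grind
  have hσ1 : ∀ c, 1 ≤ c → σ1 c = ind {a} c := fun c hc => by
    have h1 := a1 c hc; have h2 := hσ c hc; simp only [mem_Ico] at h1
    unfold ind; simp only [mem_singleton]; grind
  obtain ⟨v, hv, hv', hva, rfl⟩ := L2.hV.eq_Ico L2.zero hσ1 ha
  have a2 := L2.hH.stripAt; simp only [StripAt, Strip.after, ind, mem_Ico] at a2
  simp only [ind, mem_singleton] at hσ1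
  have hp : 1 ≤ a+v → a+v-1 ∉ H2 := fun h => by
    have h1 := a2 (a+v) h; have h2 := hσ1 (a+v) h; grind
  have hc : ∀ c ∈ H2, 1 ≤ c → c ≠ a+v → c-1 ∈ H2 := fun c hc h h' => by
    have h1 := a2 c h; have h2 := hσ1 c h; grind
  obtain ⟨d, hd, ed⟩ := exists_Ico (X := H2.filter (· < a+v)) (l := 0)
    (fun c h => L2.hH.nonneg c (mem_filter.1 h).1) fun c h h' => by
      have := hc c; simp only [mem_filter] at h ⊢; grind
  obtain ⟨b, hb, eb⟩ := exists_Ico (X := H2.filter (a+v ≤ ·)) (l := a+v)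
    (fun c h => (mem_filter.1 h).2) fun c h h' => by
      have := hc c; simp only [mem_filter] at h ⊢; grind
  have eH : H2 = Ico 0 d ∪ Ico (a+v) (a+v+b) := by
    rw [zero_add] at ed; rw [← ed, ← eb]
    ext c; simp only [mem_union, mem_filter]; grind
  have hd' : d = 0 ∨ d+1 ≤ a+v := by
    by_contra hcon
    have h1 : d-1 ∈ H2.filter (· < a+v) := by rw [ed, mem_Ico]; omega
    rw [mem_filter] at h1
    have := hp (by omega)
    rw [show d-1 = a+v-1 by omega] at h1
    exact this h1.1
  refine ⟨rfl, a, v, d, b, ha, hv, hv', hd, hb, hva, hd', by rw [zero_add], rfl, eH, fun s hs => ?_⟩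
  have h1 := a2 s hs; have h2 := hσ1 s hs
  clear ed eb hc hp a2 hσ1 L2 L1 a1
  subst eH; simp only [mem_union, mem_Ico] at h1; simp only [ind, mem_singleton]; grind

lemma config_layers (ha : 0 ≤ a) (hv : 0 ≤ v) (hv' : v ≤ 1) (hb : 0 ≤ b) (hva : v = 1 → 1 ≤ a)
    (hd' : d = 0 ∨ d+1 ≤ a+v) (hσ : ∀ c, 1 ≤ c → σ0 c = 0) (h2 : ∀ s, 1 ≤ s → σ2 s = ind {a+v+b} s+ind {d} s) :
    ∃ σ, Layer σ0 σ ∅ (Ico 0 a) ∧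
      Layer σ σ2 (Ico a (a+v)) (Ico 0 d ∪ Ico (a+v) (a+v+b)) := by
  refine ⟨Strip.after σ0 (Ico 0 a), ⟨⟨by simp, fun c hc => ?_⟩, ⟨by simp; omega, fun c hc => ?_⟩, by simp, by simp⟩,
    ⟨⟨by simp; omega, fun c hc => ?_⟩, ⟨fun c hc => ?_, fun c hc => ?_⟩, by simp; omega, fun c hc hc' => ?_⟩⟩
  · have := hσ c hc; simp [StripAt, Strip.after, ind, this]
  · have := hσ c hc; simp only [StripAt, Strip.after, ind, mem_Ico, notMem_empty, if_false]; grind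
  · have := hσ c hc; simp only [StripAt, Strip.after, ind, mem_Ico]; grind
  · simp only [mem_union, mem_Ico] at hc; omega
  · have := hσ c hc; have := h2 c hc; simp only [ind, mem_singleton] at this
    simp only [StripAt, Strip.after, ind, mem_union, mem_Ico]
    clear h2 hσ
    split_ifs at * <;> omega
  · simp only [mem_union, mem_Ico] at hc hc'; omega

lemma rot_Ico (hl : l ≤ p) (hv : 0 ≤ v) (hv' : v ≤ 1) :
    Rot (Ico l p) (Ico p (p+v)) (Ico l (l+v)) (Ico (l+v) (p+v)) fun _ => v = 0 := by
  obtain rfl | rfl : v = 0 ∨ v = 1 := by omega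
  all_goals constructor <;> intro c <;> simp <;> omega

/-- The maximal excess of the word of the first two layers. -/
lemma exists_word_config (ha : 0 ≤ a) (hv : 0 ≤ v) (hv' : v ≤ 1) (hd : 0 ≤ d) (hb : 0 ≤ b) (hd' : d = 0 ∨ d+1 ≤ a+v) :
    ∃ W1 W2, Word ∅ (Ico 0 a) (Ico a (a+v)) (Ico 0 d ∪ Ico (a+v) (a+v+b)) W1 W2 ∧
      IsMax W1 W2 (max 0 (a-v-d)) := by
  have hW2 : ∀ c, cnt (refl (Ico 0 (0+v)) ∪ (Ico 0 d ∪ Ico (a+v) (a+v+b))) c =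
      max 0 (min 0 (c+1)+v)+(max 0 (min d (c+1))+max 0 (min (a+v+b) (c+1)-(a+v))) := by
    intro c
    rw [refl_Ico, cnt_union, cnt_union, cnt_Ico, cnt_Ico, cnt_Ico]
    · omega
    · intro c; simp only [mem_Ico]; omega
    · intro c; simp only [mem_union, mem_Ico]; omega
  by_cases h0 : 0 ∈ Ico (0+v) (a+v) ∧ 0 ∈ Ico 0 d ∪ Ico (a+v) (a+v+b)
  · refine ⟨_, _, ⟨_, _, _, rot_Ico ha hv hv', rfl, Or.inr ⟨h0, rfl⟩⟩, ?_⟩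
    have hW1 : ∀ c, cnt (refl (insert 0 ∅) ∪ (Ico (0+v) (a+v)).erase 0) c =
        max 0 (min 0 (c+1)+1)+max 0 (min (a+v) (c+1)-1) := by
      intro c
      have e1 : refl (insert 0 ∅) = Ico (-1) 0 := by
        ext c; rw [mem_refl, mem_Ico, mem_insert]; simp; omega
      have e2 : (Ico (0+v) (a+v)).erase 0 = Ico 1 (a+v) := by
        ext c; rw [mem_erase, mem_Ico, mem_Ico]; simp only [mem_union, mem_Ico] at h0; omega
      rw [e1, e2, cnt_union, cnt_Ico, cnt_Ico]
      · omega
      · intro c; simp only [mem_Ico]; omega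
    simp only [mem_union, mem_Ico] at h0
    refine ⟨by omega, fun c => by unfold ht; rw [hW1, hW2]; omega, ?_⟩
    exact Or.inr ⟨a+v-1, by unfold ht; rw [hW1, hW2]; omega⟩
  · refine ⟨_, _, ⟨_, _, _, rot_Ico ha hv hv', rfl, Or.inl ⟨h0, rfl⟩⟩, ?_⟩
    have e1 : refl ∅ ∪ Ico (0+v) (a+v) = Ico v (a+v) := by
      ext c; simp [mem_refl]
    rw [e1]; simp only [mem_union, mem_Ico] at h0
    refine ⟨by omega, fun c => by unfold ht; rw [cnt_Ico, hW2]; omega, ?_⟩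
    by_cases h : a-v-d ≤ 0
    · left; omega
    · exact Or.inr ⟨a+v-1, by unfold ht; rw [cnt_Ico, hW2]; omega⟩

/-! #### The effect of the queer lowering operator on the next word -/

/-- The content added by the queer lowering operator to the next word. -/
def zeroPlace (a : ℤ) (W2 : Finset ℤ) : ℤ := if 2 ≤ a then -a else if -2 ∈ W2 then 1 else if 0 ∈ W2 then -1 else 0

/-- The larger values of the next word after the queer lowering operator. -/
def zeroSet (a : ℤ) (W2 : Finset ℤ) : Finset ℤ := if a = 1 ∧ -2 ∈ W2 then insert (-1) (W2.erase (-2)) else W2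

lemma Word.insert_mark (m : ℤ) (w : Word V1 H1 V2 H2 W1 W2) : Word (insert m V1) H1 V2 H2 (insert (-1-m) W1) W2 := by
  obtain ⟨V, H, g, r, e, h⟩ := w
  refine ⟨V, H, g, r, e, h.imp (fun h => ⟨h.1, ?_⟩) fun h => ⟨h.1, ?_⟩⟩
  · rw [h.2, insert_refl_union']
  · rw [h.2, insert_refl_union', Finset.insert_comm]

/-- The word of the values `2` and `3`, if the values `1` and `2` have the shape of one row. -/
lemma word_row (hb : 0 ≤ b) (hv : 0 ≤ v) (hv' : v ≤ 1) (hH : ∀ c ∈ H3, 0 ≤ c)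
    (w : Word ∅ (Ico 1 (1+b)) (Ico (1+b) (1+b+v)) H3 W1 W2) :
    Word ∅ (Ico 0 (1+b)) (Ico (1+b) (1+b+v)) H3 (insert (zeroPlace 1 W2) W1) (zeroSet 1 W2) ∧
      (∀ p ∈ W1, zeroPlace 1 W2 < p ∧ 1 ≤ p) ∧ -1 ∉ W2 := by
  have w' : Word ∅ (Ico 1 (1+b)) (Ico (1+b) (1+b+v)) H3 (Ico (1+v) (1+b+v))
      (refl (Ico 1 (1+v)) ∪ H3) :=
    ⟨_, _, _, rot_Ico (by omega) hv hv', rfl, Or.inl ⟨by rw [mem_Ico]; omega, by ext c; simp [mem_refl]⟩⟩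
  obtain ⟨rfl, rfl⟩ := w.unique w'
  rw [← and_assoc]
  refine ⟨?_, fun h => by rw [mem_union, mem_refl, mem_Ico] at h; grind⟩
  obtain rfl | rfl : v = 0 ∨ v = 1 := by omega
  · have e : refl (Ico 1 (1+0)) ∪ H3 = H3 := by ext c; simp [mem_refl]
    rw [e]
    have h2 : (-2 : ℤ) ∉ H3 := by grind
    have z1 : zeroPlace 1 H3 = if 0 ∈ H3 then -1 else 0 := by unfold zeroPlace; rw [if_neg (by omega), if_neg h2]
    have z2 : zeroSet 1 H3 = H3 := if_neg (by tauto)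
    have e' : H3 = refl (Ico 0 (0+0)) ∪ H3 := by ext c; simp [mem_refl]
    refine ⟨⟨_, _, _, rot_Ico (by omega) le_rfl (by omega), z2.trans e', ?_⟩, fun p hp => ?_⟩
    · rw [z1]
      by_cases h : 0 ∈ H3
      · refine Or.inr ⟨⟨by rw [mem_Ico]; omega, h⟩, ?_⟩
        rw [if_pos h]
        ext c; simp only [mem_insert, mem_union, mem_refl, mem_erase, mem_Ico, notMem_empty]; grind
      · refine Or.inl ⟨fun h' => h h'.2, ?_⟩
        rw [if_neg h]
        ext c; simp only [mem_insert, mem_union, mem_refl, mem_Ico, notMem_empty]; grind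
    · rw [z1]; rw [mem_Ico] at hp; split_ifs <;> omega
  · have h2 : (-2 : ℤ) ∈ refl (Ico 1 (1+1)) ∪ H3 := by
      rw [mem_union, mem_refl, mem_Ico]; omega
    have z1 : zeroPlace 1 (refl (Ico 1 (1+1)) ∪ H3) = 1 := by unfold zeroPlace; rw [if_neg (by omega), if_pos h2]
    have z2 : zeroSet 1 (refl (Ico 1 (1+1)) ∪ H3) = refl (Ico 0 (0+1)) ∪ H3 := by
      unfold zeroSet
      rw [if_pos ⟨rfl, h2⟩]
      ext c; simp only [mem_insert, mem_union, mem_refl, mem_erase, mem_Ico]; grind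
    refine ⟨⟨_, _, _, rot_Ico (by omega) hv hv', z2, Or.inl ⟨by rw [mem_Ico]; omega, ?_⟩⟩, fun p hp => ?_⟩
    · rw [z1]
      ext c; simp only [mem_insert, mem_union, mem_refl, mem_Ico, notMem_empty]; grind
    · rw [z1]; rw [mem_Ico] at hp; omega

lemma ht_zero (hq : ∀ p ∈ W1, zeroPlace a W2 < p) (hn : -1 ∉ W2 ∨ a ≠ 1) (c : ℤ) :
    ht W1 W2 c ≤ ht (insert (zeroPlace a W2) W1) (zeroSet a W2) c ∧
    ht (insert (zeroPlace a W2) W1) (zeroSet a W2) c ≤ ht W1 W2 c+1 ∧ (zeroPlace a W2 ≤ c →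
    ht (insert (zeroPlace a W2) W1) (zeroSet a W2) c = ht W1 W2 c+1) := by
  have hq' : zeroPlace a W2 ∉ W1 := fun h => lt_irrefl _ (hq _ h)
  rw [ht_insert hq']
  by_cases h : a = 1 ∧ -2 ∈ W2
  · have e : zeroPlace a W2 = 1 := by unfold zeroPlace; rw [if_neg (by omega), if_pos h.2]
    have h' : (-1 : ℤ) ∉ W2.erase (-2) := fun h' => by have := mem_of_mem_erase h'; tauto
    unfold zeroSet ht
    rw [if_pos h, cnt_insert _ _ _ h', cnt_erase _ _ _ h.2, e]
    split_ifs <;> omega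
  · unfold zeroSet
    rw [if_neg h]
    split_ifs <;> omega

lemma FirstMax.zero (hq : ∀ p ∈ W1, zeroPlace a W2 < p) (hn : -1 ∉ W2 ∨ a ≠ 1) (h : FirstMax W1 W2 M p) :
    FirstMax (insert (zeroPlace a W2) W1) (zeroSet a W2) (M+1) p := by
  have k := ht_zero hq hn
  refine ⟨by have := h.pos; omega, fun c => ?_, ?_, fun c hc => ?_⟩
  · have := (k c).2.1; have := h.le c; omega
  · rw [(k p).2.2 (hq p h.mem.1).le, h.eq]
  · have := (k c).2.1; have := h.lt c hc; omega

lemma zero_insert (h2 : p ≠ -2) (h0 : p ≠ 0 ∨ 2 ≤ a) : zeroPlace a (insert p W2) = zeroPlace a W2 ∧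
    zeroSet a (insert p W2) = insert p (zeroSet a W2) := by
  unfold zeroPlace zeroSet; simp only [mem_insert]
  refine ⟨by grind, ?_⟩
  by_cases h : a = 1 ∧ -2 ∈ W2
  · rw [if_pos h, if_pos ⟨h.1, Or.inr h.2⟩, Finset.erase_insert_of_ne h2, Finset.insert_comm]
  · rw [if_neg h, if_neg (by grind)]

end

end Strip

namespace Shifted

open Strip ColoredDigraph

section
variable {γ : StrictPartition} {n : ℕ∞} {R S T U : Filling} {i j k r c : ℕ} {M p : ℤ} {W1 W2 : Finset ℤ}
  {x y z u w : SSHT γ n} {a v d b a' v' d' b' : ℤ}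

/-! #### The letters of value 1 and 2 -/

/-- The first row begins with `a` letters `1`, `v` letters `2'` and `b` letters `2`, and the second row
with `d` letters `2`, where a row of letters `2` alone is counted by `b`. -/
structure Config (γ : StrictPartition) (T : Filling) (a v d b : ℤ) : Prop where
  ha : 0 ≤ a
  hv : 0 ≤ v
  hv' : v ≤ 1
  hd : 0 ≤ d
  hb : 0 ≤ b
  hva : v = 1 → 1 ≤ a
  hd' : d = 0 ∨ d+1 ≤ a+v
  lay2 : lay γ T 2 = ∅
  lay3 : lay γ T 3 = Ico 0 a
  lay4 : lay γ T 4 = Ico a (a+v)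
  lay5 : lay γ T 5 = Ico 0 d ∪ Ico (a+v) (a+v+b)
  site5 : ∀ s, 1 ≤ s → site γ T 5 s = ind {a+v+b} s+ind {d} s

lemma IsSSHT.site_one (hT : IsSSHT γ n T) (s : ℤ) : site γ T 1 s = 0 := by
  have : ∀ x, num γ T 1 x = 0 := fun x => by
    unfold num
    rw [Nat.cast_eq_zero, Finset.card_eq_zero, Finset.filter_eq_empty_iff]
    rintro d - ⟨a, h1, h2⟩
    have := (hT.entries _ _ h1).1; have := rank_bounds a; omega
  unfold site; rw [this, this]; rfl

lemma IsSSHT.exists_config (hT : IsSSHT γ n T) : ∃ a v d b, Config γ T a v d b := by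
  obtain ⟨e1, a, v, d, b, h1, h2, h3, h4, h5, h6, h7, e2, e3, e4, e5⟩ :=
    Strip.exists_config (hT.layer 0) (hT.layer 1) fun c _ => hT.site_one c
  exact ⟨a, v, d, b, h1, h2, h3, h4, h5, h6, h7, e1, e2, e3, e4, e5⟩

lemma Config.weight (h : Config γ T a v d b) : weight γ T 0 = a ∧ weight γ T 1 = v+d+b := by
  obtain ⟨h1, h2, h3, h4, h5, h6, h7, e1, e2, e3, e4, -⟩ := h
  unfold Shifted.weight
  rw [show 2*0+2 = 2 from rfl, show 2*0+3 = 3 from rfl, show 2*1+2 = 4 from rfl, show 2*1+3 = 5 from rfl, e1, e2, e3, e4,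
    card_union_of_disjoint (Finset.disjoint_left.2 fun c h h' => by rw [mem_Ico] at h h'; omega)]
  push_cast; simp only [Int.card_Ico, Finset.card_empty]; omega

lemma Config.maxOf (h : Config γ T a v d b) : MaxOf γ T 0 (max 0 (a-v-d)) := by
  obtain ⟨W1, W2, w, hM⟩ := exists_word_config h.ha h.hv h.hv' h.hd h.hb h.hd'
  refine ⟨W1, W2, ?_, hM⟩
  have := h.lay2; have := h.lay3; have := h.lay4; have := h.lay5
  unfold WordOf; simp only [mul_zero, zero_add, *]

lemma Config.site_unique (h : Config γ T a v d b) (h' : Config γ S a' v' d' b') (e : site γ S 5 = site γ T 5) :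
    a'+v'+b' = a+v+b ∧ d' = d := by
  obtain ⟨h1, h2, h3, h4, h5, h6, h7, -, -, -, -, e1⟩ := h
  obtain ⟨k1, k2, k3, k4, k5, k6, k7, -, -, -, -, e2⟩ := h'
  rw [e] at e2
  have key : ∀ s, 1 ≤ s → ind {a+v+b} s+ind {d} s = ind {a'+v'+b'} s+ind {d'} s := fun s hs => by
    rw [← e1 s hs, e2 s hs]
  have q1 := key (a+v+b); have q2 := key d; have q3 := key (a'+v'+b'); have q4 := key d'
  simp only [ind, mem_singleton] at q1 q2 q3 q4
  clear key e1 e2 e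
  constructor <;> grind

lemma Config.unique (h : Config γ T a v d b) (h' : Config γ T a' v' d' b') : a' = a ∧ v' = v ∧ d' = d ∧ b' = b := by
  obtain ⟨e1, e2⟩ := h.site_unique h' rfl
  have e3 := h.weight.1.symm.trans h'.weight.1; have e4 := congrArg Finset.card (h.lay4.symm.trans h'.lay4)
  rw [Int.card_Ico, Int.card_Ico] at e4
  have := h.hv; have := h'.hv; omega

lemma Config.eq (h : Config γ T a v d b) (h' : Config γ S a v d b) (hc : Changed γ n 0 T S) : T = S := by
  refine hc.left.ext_lay hc.right fun m => ?_
  obtain hm | rfl | rfl | rfl | rfl : (m ≤ 2*0+1 ∨ 2*0+6 ≤ m) ∨ m = 2 ∨ m = 3 ∨ m = 4 ∨ m = 5 := by omega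
  · exact (hc.lay_eq m hm).symm
  · rw [h.lay2, h'.lay2]
  · rw [h.lay3, h'.lay3]
  · rw [h.lay4, h'.lay4]
  · rw [h.lay5, h'.lay5]

lemma Config.congr (h : Config γ T a v d b) (h1 : ∀ m, m ≤ 5 → lay γ S m = lay γ T m) (h2 : site γ S 5 = site γ T 5) :
    Config γ S a v d b :=
  ⟨h.ha, h.hv, h.hv', h.hd, h.hb, h.hva, h.hd', (h1 2 (by omega)).trans h.lay2, (h1 3 (by omega)).trans h.lay3,
    (h1 4 (by omega)).trans h.lay4, (h1 5 (by omega)).trans h.lay5, by rw [h2]; exact h.site5⟩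

lemma Config.exists (h : Config γ T a v d b) (hT : IsSSHT γ n T) (hn : 2 ≤ n) (ha : 0 ≤ a') (hv : 0 ≤ v') (hv' : v' ≤ 1)
    (hb : 0 ≤ b') (hva : v' = 1 → 1 ≤ a') (hd' : d = 0 ∨ d+1 ≤ a'+v') (he : a'+v'+b' = a+v+b) :
    ∃ S, Changed γ n 0 T S ∧ Config γ S a' v' d b' := by
  obtain ⟨σ, L1, L2⟩ := config_layers (σ0 := site γ T (2*0+1)) (σ2 := site γ T (2*0+5)) ha hv hv' hb hva hd'
    (fun c _ => hT.site_one c) (fun s hs => by rw [he]; exact h.site5 s hs)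
  obtain ⟨S, hS, e1, e2, e3, e4, e5, e6⟩ := exists_of_layers (j := 0) hT (by exact_mod_cast hn) L1 L2
  have hc : Changed γ n 0 T S := ⟨hT, hS, e5, e6⟩
  exact ⟨S, hc, ha, hv, hv', h.hd, hb, hva, hd', e1, e2, e3, e4, fun s hs => by
    rw [hc.site_eq (by omega), he]; exact h.site5 s hs⟩

/-! #### The queer lowering operator -/

lemma pairwise_boxCells (γ : StrictPartition) : (boxCells γ).Pairwise fun q q' => q'.2 ≤ q.2 := by
  unfold boxCells
  rw [List.pairwise_flatMap]
  constructor
  · intro c _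
    rw [List.pairwise_map]; exact List.pairwise_of_forall fun _ _ => le_rfl
  · rw [List.pairwise_reverse]
    refine List.pairwise_lt_range.imp fun {c c'} h q hq q' hq' => ?_
    rw [List.mem_map] at hq hq'
    obtain ⟨r, -, rfl⟩ := hq; obtain ⟨r', -, rfl⟩ := hq'; exact h.le

lemma IsSSHT.mem_boxCells (hT : IsSSHT γ n T) {e : Letter} (h : T (r, c) = some e) : (r, c) ∈ boxCells γ := by
  have := hT.lt_size h
  unfold boxCells
  rw [List.mem_flatMap]; exact ⟨c, by simp; omega, List.mem_map.2 ⟨r, by simp; omega, rfl⟩⟩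

lemma Config.cells (h : Config γ T a v d b) (hT : IsSSHT γ n T) :
    (∀ r c, T (r, c) = some (un 1) → r = 0 ∧ (c : ℤ) < a) ∧ (∀ c : ℕ, (c : ℤ) < a → T (0, c) = some (un 1)) := by
  have h3 := h.lay3
  have hu : ∀ r c, T (r, c) = some (un 1) → r = 0 := fun r c hr => by
    by_contra h0
    obtain ⟨e, h1, h2⟩ := hT.exists_le hr (r' := 0) (c' := c) (by omega) le_rfl (by omega)
    have := (hT.entries _ _ h1).1; have hb := rank_bounds e
    rw [rank_un] at h2
    rcases letter_cases e with he | he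
    · obtain ⟨e', k1, k2⟩ := hT.exists_le h1 (r' := 0) (c' := 0) le_rfl (by omega) le_rfl
      have := (hT.entries _ _ k1).1; have hb' := rank_bounds e'
      rw [he, rank_mk] at k2
      have : e' = Shifted.mk 1 := rank_injective (by rw [rank_mk]; omega)
      rw [this] at k1; exact hT.diag_unmarked _ _ k1
    · rw [show e.val = 1 by omega] at he
      rw [he] at h1; exact h0 (hT.col_unmarked _ _ _ _ hr h1)
  refine ⟨fun r c hr => ?_, fun c hc => ?_⟩
  · obtain rfl := hu r c hr
    have := hT.lay_of hr (rank_un 1)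
    rw [show 2*1+1 = 3 from rfl, h3, mem_Ico] at this; exact ⟨rfl, by push_cast at this; omega⟩
  · have : (c : ℤ) ∈ lay γ T 3 := by rw [h3, mem_Ico]; omega
    obtain ⟨r', c', e, k1, k2, k3⟩ := hT.mem_lay.1 this
    obtain rfl : e = un 1 := rank_injective (by rw [rank_un]; omega)
    obtain rfl := hu _ _ k1; rwa [show c = c' by push_cast at k3; omega]

lemma Config.lowerZero_eq_none (h : Config γ T a v d b) (hT : IsSSHT γ n T) (h' : v = 1 ∨ a = 0) : lowerZero γ T = none := by
  unfold lowerZero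
  split_ifs with hm
  · rfl
  rcases h' with rfl | rfl
  · refine absurd ?_ hm
    have : a ∈ lay γ T 4 := by rw [h.lay4, mem_Ico]; omega
    obtain ⟨r', c', e, k1, k2, k3⟩ := hT.mem_lay.1 this
    obtain rfl : e = Shifted.mk 2 := rank_injective (by rw [rank_mk]; omega)
    exact List.any_eq_true.2 ⟨_, hT.mem_boxCells k1, decide_eq_true k1⟩
  · rw [List.find?_eq_none.2, Option.map_none]
    intro q _ hq
    have := (h.cells hT).1 q.1 q.2 (of_decide_eq_true hq); omega

/-- The configuration after the queer lowering operator. -/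
def Lowered (γ : StrictPartition) (S : Filling) (a d b : ℤ) : Prop :=
  Config γ S (a-1) (if 2 ≤ a then 1 else 0) d (if 2 ≤ a then b else b+1)

lemma Config.lowerZero_eq (h : Config γ T a 0 d b) (ha : 1 ≤ a) (hc : Changed γ n 0 T S) (h' : Lowered γ S a d b) :
    lowerZero γ T = some S := by
  have hT := hc.left
  obtain ⟨m, rfl⟩ : ∃ m : ℕ, a = m+1 := ⟨(a-1).toNat, by omega⟩
  obtain ⟨c1, c2⟩ := h.cells hT
  have hm := c2 m (by omega)
  have hne : ¬ ((boxCells γ).any fun q => decide (T q = some (Shifted.mk 2))) = true := fun h' => by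
    obtain ⟨q, -, hq⟩ := List.any_eq_true.1 h'
    have := hT.lay_of (r := q.1) (c := q.2) (of_decide_eq_true hq) (rank_mk 2)
    rw [show 2*2 = 4 from rfl, h.lay4, mem_Ico] at this; omega
  have hf : (boxCells γ).find? (fun q => decide (T q = some (un 1))) = some (0, m) := by
    cases hf : (boxCells γ).find? (fun q => decide (T q = some (un 1))) with
    | none => exact absurd (decide_eq_true hm) (List.find?_eq_none.1 hf _ (hT.mem_boxCells hm))
    | some q =>
      obtain ⟨k1, as, bs, k2, k3⟩ := List.find?_eq_some_iff_append.1 hf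
      obtain ⟨k4, k5⟩ := c1 q.1 q.2 (of_decide_eq_true k1)
      have h1 := hT.mem_boxCells hm; have h2 := pairwise_boxCells γ
      rw [k2] at h1 h2
      rcases List.mem_append.1 h1 with h1 | h1
      · have := k3 _ h1; simp [hm] at this
      rcases List.mem_cons.1 h1 with h1 | h1
      · rw [h1]
      have := List.rel_of_pairwise_cons (List.pairwise_append.1 h2).2.1 h1; simp only at this
      exact congrArg some (Prod.ext k4 (by simp only; omega))
  unfold lowerZero
  rw [if_neg hne, hf, Option.map_some]
  congr 1
  have e2 := h'.lay2; have e3 := h'.lay3; have e4 := h'.lay4; have e5 := h'.lay5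
  have s1 : S (0, m) = some (if (0 : ℕ) = m then un 2 else Shifted.mk 2) := by
    refine hc.up hm rfl (by split_ifs <;> rfl) (by rw [show 2*0+2 = 2 from rfl, e2]; simp)
      (by rw [show 2*0+3 = 3 from rfl, e3]; simp) ?_
    by_cases h0 : 0 = m
    · rw [if_pos h0, rank_un, show 2*2+1 = 5 from rfl, e5]; simp only [mem_union, mem_Ico]
      have := h.hb
      split_ifs <;> push_cast <;> omega
    · rw [if_neg h0, rank_mk, show 2*2 = 4 from rfl, e4]; simp only [mem_Ico]
      split_ifs <;> push_cast <;> omega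
  have := hc.update2 hm hm s1 s1 fun k d k1 k2 hd => by
    have := h.hb
    obtain rfl | rfl | rfl | rfl : k = 2 ∨ k = 3 ∨ k = 4 ∨ k = 5 := by omega
    · rw [h.lay2] at hd; simp at hd
    · rw [h.lay3, mem_Ico] at hd
      rw [e3, mem_Ico]; have := rank_un 1; omega
    · rw [h.lay4, mem_Ico] at hd; omega
    · rw [h.lay5] at hd
      rw [e5]; simp only [mem_union, mem_Ico] at hd ⊢
      split_ifs <;> omega
  rwa [Function.update_idem] at this

lemma Config.exists_lowered (h : Config γ T a 0 d b) (hT : IsSSHT γ n T) (hn : 2 ≤ n) (ha : 1 ≤ a) :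
    ∃ S, Changed γ n 0 T S ∧ Lowered γ S a d b := by
  have := h.hb; have := h.hd'
  by_cases h2 : 2 ≤ a
  · unfold Lowered; simp only [if_pos h2]
    exact h.exists hT hn (by omega) (by omega) (by omega) (by omega) (by omega) (by omega) (by omega)
  · unfold Lowered; simp only [if_neg h2]
    exact h.exists hT hn (by omega) (by omega) (by omega) (by omega) (by omega) (by omega) (by omega)

/-- The edges of colour `0`. -/
def ZeroEdge (x y : SSHT γ n) : Prop := lowerZero γ x.1 = some y.1

lemma lowerZero_iff (hT : IsSSHT γ n T) (hn : 2 ≤ n) (h : Config γ T a v d b) :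
    lowerZero γ T = some S ↔ v = 0 ∧ 1 ≤ a ∧ Changed γ n 0 T S ∧ Lowered γ S a d b := by
  by_cases h' : v = 1 ∨ a = 0
  · rw [h.lowerZero_eq_none hT h']; exact ⟨fun h => (by cases h), fun h => by omega⟩
  have h1 := h.hv; have h2 := h.hv'; have h3 := h.ha
  obtain rfl : v = 0 := by omega
  have ha : 1 ≤ a := by omega
  refine ⟨fun e => ?_, fun e => h.lowerZero_eq ha e.2.2.1 e.2.2.2⟩
  obtain ⟨S', hc, hS⟩ := h.exists_lowered hT hn ha
  rw [h.lowerZero_eq ha hc hS] at e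
  cases e
  exact ⟨rfl, ha, hc, hS⟩

lemma ZeroEdge.exists (hn : 2 ≤ n) (h : ZeroEdge x y) : ∃ a d b, Config γ x.1 a 0 d b ∧ 1 ≤ a ∧ Changed γ n 0 x.1 y.1 ∧
    Lowered γ y.1 a d b := by
  obtain ⟨a, v, d, b, hx⟩ := x.2.exists_config
  obtain ⟨rfl, h1, h2, h3⟩ := (lowerZero_iff x.2 hn hx).1 h; exact ⟨a, d, b, hx, h1, h2, h3⟩

lemma ZeroEdge.two_le (h : ZeroEdge x y) : 2 ≤ n := by
  unfold ZeroEdge lowerZero at h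
  split_ifs at h
  obtain ⟨q, -, h2⟩ := Option.map_eq_some_iff.1 h
  have h3 : y.1 q = some (if q.1 = q.2 then un 2 else Shifted.mk 2) := by rw [← h2, Function.update_self]
  have := (y.2.entries _ _ h3).2
  split_ifs at this <;> exact_mod_cast this

lemma Config.stats (h : Config γ x.1 a v d b) :
    edgesAfter 0 x = max 0 (a-v-d) ∧ edgesBefore 0 x = max 0 (a-v-d)-(a-v-d-b) := by
  have h1 := edgesAfter_eq h.maxOf
  refine ⟨h1, ?_⟩
  unfold edgesBefore
  rw [h1, h.weight.1, h.weight.2]; ring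

/-! #### The strings of colour 0 -/

/-- The number of edges of colour `0` after a tableau. -/
noncomputable def zeroAfter (x : SSHT γ n) : ℤ := if lay γ x.1 4 = ∅ ∧ lay γ x.1 3 ≠ ∅ then 1 else 0

/-- The number of edges of colour `0` before a tableau. -/
noncomputable def zeroBefore (x : SSHT γ n) : ℤ :=
  if lay γ x.1 4 ≠ ∅ ∨ (lay γ x.1 3 = ∅ ∧ lay γ x.1 5 ≠ ∅) then 1 else 0

lemma Config.zero (h : Config γ x.1 a v d b) : zeroAfter x = (if v = 0 ∧ 1 ≤ a then 1 else 0) ∧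
    zeroBefore x = if v = 1 ∨ a = 0 ∧ 1 ≤ b then 1 else 0 := by
  obtain ⟨h1, h2, h3, h4, h5, h6, h7, e1, e2, e3, e4, -⟩ := h
  unfold zeroAfter zeroBefore
  rw [e2, e3, e4]; simp only [ne_eq, Finset.union_eq_empty, Finset.Ico_eq_empty_iff]
  constructor <;> congr 1 <;> rw [eq_iff_iff] <;> omega

lemma zeroStrings (hn : 2 ≤ n) : Strings (ZeroEdge (γ := γ) (n := n)) zeroAfter zeroBefore where
  ep_nonneg x := by unfold zeroAfter; split_ifs <;> omega
  de_nonneg x := by unfold zeroBefore; split_ifs <;> omega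
  ep_edge {x y} e := by
    obtain ⟨a, d, b, h, h1, -, h2⟩ := e.exists hn
    rw [h.zero.1, h2.zero.1]; split_ifs <;> omega
  de_edge {x y} e := by
    obtain ⟨a, d, b, h, h1, -, h2⟩ := e.exists hn
    have := h.hb
    rw [h.zero.2, h2.zero.2]; split_ifs <;> omega
  exists_down {x} h0 := by
    obtain ⟨a, v, d, b, h⟩ := x.2.exists_config
    rw [h.zero.1] at h0
    obtain ⟨rfl, ha⟩ : v = 0 ∧ 1 ≤ a := by by_contra hcon; rw [if_neg hcon] at h0; omega
    obtain ⟨S, hc, hS⟩ := h.exists_lowered x.2 hn ha; exact ⟨⟨S, hc.right⟩, h.lowerZero_eq ha hc hS⟩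
  exists_up {x} h0 := by
    obtain ⟨a, v, d, b, h⟩ := x.2.exists_config
    rw [h.zero.2] at h0
    have hv : v = 1 ∨ a = 0 ∧ 1 ≤ b := by by_contra hcon; rw [if_neg hcon] at h0; omega
    have h2 := h.hb; have h4 := h.hd'; have h3 := h.hv'; have h5 := h.hv; have h6 := h.hd; have h7 := h.hva
    by_cases hv1 : v = 1
    · subst hv1
      obtain ⟨S, hc, hS⟩ := h.exists x.2 hn (a' := a+1) (v' := 0) (b' := b) (by omega) (by omega) (by omega) (by omega)
        (by omega) (by omega) (by omega)
      refine ⟨⟨S, hc.right⟩, hS.lowerZero_eq (by omega) hc.symm ?_⟩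
      unfold Lowered; rwa [if_pos (by omega), if_pos (by omega), add_sub_cancel_right]
    · obtain rfl : v = 0 := by omega
      obtain rfl : a = 0 := by omega
      obtain rfl : d = 0 := by omega
      obtain ⟨S, hc, hS⟩ := h.exists x.2 hn (a' := 1) (v' := 0) (b' := b-1) (by omega) (by omega) (by omega) (by omega)
        (by omega) (by omega) (by omega)
      refine ⟨⟨S, hc.right⟩, hS.lowerZero_eq (by omega) hc.symm ?_⟩
      unfold Lowered; rwa [if_neg (by omega), if_neg (by omega), sub_self, sub_add_cancel]
  func h h' := Subtype.ext (Option.some.inj (h.symm.trans h'))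
  inj {x y z} h h' := by
    obtain ⟨a, d, b, k1, k2, k3, k4⟩ := h.exists hn
    obtain ⟨a', d', b', l1, l2, l3, l4⟩ := h'.exists hn
    obtain ⟨e1, e2, e3, e4⟩ := k4.unique l4
    obtain rfl : a' = a := by omega
    obtain rfl : b' = b := by split_ifs at e4 <;> omega
    subst e3; exact Subtype.ext (k1.eq l1 (k3.trans l3.symm))

lemma zeroFar (hn : 2 ≤ n) (hj : (j+2 : ℕ) ≤ n) (h : 2 ≤ j) :
    Far (ZeroEdge (γ := γ) (n := n)) (Edge j) (edgesAfter j) (edgesBefore j) ∧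
    Far (Edge (γ := γ) (n := n) j) ZeroEdge zeroAfter zeroBefore := by
  have agree : ∀ {x u : SSHT γ n}, ZeroEdge x u → Agree γ j x.1 u.1 := fun hu => by
    obtain ⟨a, d, b, -, -, hc, -⟩ := hu.exists hn; exact hc.agree (by omega)
  have sq : ∀ {x u v : SSHT γ n}, ZeroEdge x u → Edge j x v → ∃ y, Edge j u y ∧ ZeroEdge v y := fun {x u v} hu hv => by
    have au := agree hu; have fv := (edge_iff hj).1 hv
    obtain ⟨a, d, b, cx, ha, hc, cu⟩ := hu.exists hn
    have cv : Config γ v.1 a 0 d b := cx.congr (fun m hm => fv.1.lay_eq m (by omega)) (fv.1.site_eq (by omega))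
    obtain ⟨S, hc', hS⟩ := cv.exists_lowered v.2 hn ha
    obtain ⟨y, hy⟩ := (strings (γ := γ) hj).exists_down (x := u) (by rw [au.edgesAfter_eq]; exact fv.maxOf.1)
    have fy := (edge_iff hj).1 hy
    refine ⟨y, hy, ?_⟩
    have e1 := au.flip fv fy
    have : S = y.1 := by
      refine hc'.right.ext_lay y.2 fun m => ?_
      by_cases h1 : m ≤ 5
      · rw [fy.1.lay_eq m (by omega)]
        obtain hm | rfl | rfl | rfl | rfl : m ≤ 2*0+1 ∨ m = 2 ∨ m = 3 ∨ m = 4 ∨ m = 5 := by omega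
        · rw [hc'.lay_eq m (Or.inl hm), hc.lay_eq m (Or.inl hm), fv.1.lay_eq m (by omega)]
        · rw [hS.lay2, cu.lay2]
        · rw [hS.lay3, cu.lay3]
        · rw [hS.lay4, cu.lay4]
        · rw [hS.lay5, cu.lay5]
      rw [hc'.lay_eq m (by omega)]
      by_cases h2 : 2*j+2 ≤ m ∧ m ≤ 2*j+5
      · rw [e1 m h2.1 h2.2]
      · rw [fy.1.lay_eq m (by omega), hc.lay_eq m (by omega), fv.1.lay_eq m (by omega)]
    exact (cv.lowerZero_eq ha hc' hS).trans (congrArg some this)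
  refine ⟨⟨fun hu => (agree hu).edgesAfter_eq, fun hu => (agree hu).edgesBefore_eq, sq⟩, ⟨fun hv => ?_, fun hv => ?_,
    fun hv hu => ?_⟩⟩
  · have fv := (edge_iff hj).1 hv
    unfold zeroAfter
    rw [fv.1.lay_eq 4 (by omega), fv.1.lay_eq 3 (by omega)]
  · have fv := (edge_iff hj).1 hv
    unfold zeroBefore
    rw [fv.1.lay_eq 4 (by omega), fv.1.lay_eq 3 (by omega), fv.1.lay_eq 5 (by omega)]
  · obtain ⟨y, h1, h2⟩ := sq hu hv; exact ⟨y, h2, h1⟩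

/-! #### The colours 0 and 1 -/

lemma Edge.config (hn : 2 ≤ n) (h : Config γ x.1 a v d b) (e : Edge 0 x y) : 1 ≤ a-v-d ∧ Changed γ n 0 x.1 y.1 ∧
    ∃ v', v' = (if v = 0 ∧ a = d+1 ∧ 1 ≤ d then 1 else v) ∧ Config γ y.1 (a-1) v' d (b+1+v-v') := by
  have hj : (0+2 : ℕ) ≤ n := by exact_mod_cast hn
  have hf := (edge_iff hj).1 e; have h1 := hf.maxOf.1
  rw [h.stats.1] at h1
  obtain ⟨a', v', d', b', h'⟩ := y.2.exists_config
  obtain ⟨e1, e2⟩ := h.site_unique h' (hf.1.site_eq (by omega))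
  have e3 := hf.weight_eq 0
  rw [h.weight.1, h'.weight.1, if_neg (by omega), if_pos rfl] at e3
  have e4 := (strings hj).ep_edge e
  rw [h.stats.1, h'.stats.1] at e4
  obtain rfl : a' = a-1 := by omega
  subst e2
  refine ⟨by omega, hf.1, v', ?_, by rwa [show b+1+v-v' = b' by omega]⟩
  have := h'.hv; have := h'.hv'; have := h'.hva; have := h'.hd'; have := h.hv; have := h.hv'; have := h.hd
  split_ifs <;> omega

lemma Edge.of_config (hn : 2 ≤ n) (h : Config γ x.1 a v d b) (h1 : 1 ≤ a-v-d) (hc : Changed γ n 0 x.1 y.1)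
    (hv : v' = if v = 0 ∧ a = d+1 ∧ 1 ≤ d then 1 else v) (hb : b' = b+1+v-v') (h' : Config γ y.1 (a-1) v' d b') :
    Edge 0 x y := by
  have hj : (0+2 : ℕ) ≤ n := by exact_mod_cast hn
  obtain ⟨y', e⟩ := (strings (γ := γ) hj).exists_down (x := x) (by rw [h.stats.1]; omega)
  obtain ⟨-, hc', v'', rfl, h''⟩ := e.config hn h
  rw [← hv, ← hb] at h''
  have : y' = y := Subtype.ext (h''.eq h' (hc'.symm.trans hc)); exact this ▸ e

lemma zero_end_one (hn : 2 ≤ n) (e : ZeroEdge u x) (h : edgesBefore 0 x = edgesBefore 0 u+1) :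
    edgesAfter 0 x = 0 ∧ Edge 0 u x := by
  obtain ⟨a, d, b, hu, ha, hc, hx⟩ := e.exists hn
  rw [hx.stats.2, hu.stats.2] at h
  rw [hx.stats.1]
  have := hu.hd'; have := hu.hd
  refine ⟨by split_ifs at * <;> omega, Edge.of_config hn hu (by omega) hc ?_ ?_ hx⟩ <;> split_ifs at * <;> omega

lemma zero_square_one (hn : 2 ≤ n) (hx : Edge 0 x z) (hy : ZeroEdge y z) (hne : x ≠ y) :
    ∃ w, Edge 0 w y ∧ ZeroEdge w x := by
  obtain ⟨a, d, b, cy, ha, hc, cz⟩ := hy.exists hn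
  obtain ⟨a', v, d', b', cx⟩ := x.2.exists_config
  obtain ⟨h1, hc', v', ev, cz'⟩ := hx.config hn cx
  obtain ⟨e1, e2, e3, e4⟩ := cz.unique cz'
  obtain rfl : a' = a := by omega
  subst e3
  have h5 := cx.hb
  by_cases hv : v = 1
  · obtain rfl : b' = b-1 := by split_ifs at * <;> omega
    subst hv
    obtain ⟨S, hS, cS⟩ := cy.exists y.2 hn (a' := a'+1) (v' := 0) (b' := b-1) (by omega) (by omega) (by omega) (by omega)
      (by omega) (by omega) (by omega)
    refine ⟨⟨S, hS.right⟩, Edge.of_config hn cS (by omega) hS.symm (v' := 0) (b' := b) ?_ (by omega) ?_,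
      cS.lowerZero_eq (by omega) (hS.symm.trans (hc.trans hc'.symm)) ?_⟩
    · rw [if_neg (by omega)]
    · rwa [add_sub_cancel_right]
    · unfold Lowered; rwa [if_pos (by omega), if_pos (by omega), add_sub_cancel_right]
  · obtain rfl : v = 0 := by omega
    obtain rfl : b' = b := by split_ifs at * <;> omega
    exact absurd (Subtype.ext (cx.eq cy (hc'.trans hc.symm))) hne

/-! #### The colours 0 and 2 -/

/-- The queer lowering operator changes the word of the values `2` and `3` in a controlled way. -/
lemma ZeroEdge.word (hn : 2 ≤ n) (e : ZeroEdge u x) (w : WordOf γ u.1 1 W1 W2) : ∃ a d b, Config γ u.1 a 0 d b ∧ 1 ≤ a ∧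
    WordOf γ x.1 1 (insert (zeroPlace a W2) W1) (zeroSet a W2) ∧
    (∀ p ∈ W1, zeroPlace a W2 < p ∧ -1 ≤ p ∧ (p ≠ 0 ∨ 2 ≤ a)) ∧ (-1 ∉ W2 ∨ a ≠ 1) := by
  obtain ⟨a, d, b, hu, ha, hc, hx⟩ := e.exists hn
  refine ⟨a, d, b, hu, ha, ?_⟩
  unfold WordOf at w ⊢; simp only [Nat.reduceMul, Nat.reduceAdd] at w ⊢
  have e6 := hc.lay_eq 6 (by omega); have e7 := hc.lay_eq 7 (by omega)
  rw [hx.lay4, hx.lay5, e6, e7]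
  rw [hu.lay4, hu.lay5] at w
  by_cases h2 : 2 ≤ a
  · have z1 : zeroPlace a W2 = -1-(a-1) := by unfold zeroPlace; rw [if_pos h2]; ring
    have z2 : zeroSet a W2 = W2 := if_neg (by omega)
    rw [z1, z2, if_pos h2, if_pos h2]
    have e4 : Ico (a-1) (a-1+1) = insert (a-1) (Ico a (a+0)) := by
      ext c; simp only [mem_insert, mem_Ico]; omega
    rw [e4, show a-1+1 = a+0 by ring]
    refine ⟨w.insert_mark (a-1), fun p hp => ?_, Or.inr (by omega)⟩
    have : -1 ≤ p := by
      obtain ⟨V, H, g, r, -, h⟩ := w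
      have hH : ∀ c ∈ H, 0 ≤ c := fun c hc => by
        have h1 := (r.union c).2 (Or.inr hc); have := u.2.lay_nonneg (m := 6) c
        simp only [mem_union, mem_Ico] at h1
        rcases h1 with (h1 | h1) | h1; exacts [h1.1, by omega, this h1]
      rcases h with ⟨-, rfl⟩ | ⟨-, rfl⟩
      · simp only [mem_union, mem_refl, mem_Ico] at hp
        have := hH p; grind
      · simp only [mem_union, mem_refl, mem_Ico, mem_insert, mem_erase] at hp
        have := hH p; grind
    omega
  · obtain rfl : a = 1 := by omega
    have hd : d = 0 := by have h1 := hu.hd'; have h2 := hu.hd; omega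
    subst hd
    have hs : ∀ c, 1 ≤ c → site γ u.1 (2*2+1) c = ind {1+b} c := fun c hc => by
      rw [show 2*2+1 = 5 from rfl, hu.site5 c hc, ind_of_not_mem (X := {0}) (by rw [mem_singleton]; omega)]
      simp
    obtain ⟨v, hv, hv', -, h6⟩ := (u.2.layer 2).hV.eq_Ico (u.2.layer 2).zero hs (by have := hu.hb; omega)
    rw [show 2*2+2 = 6 from rfl] at h6
    rw [h6] at w ⊢; simp only [if_neg h2]
    have := word_row (W1 := W1) (W2 := W2) (H3 := lay γ u.1 7) hu.hb hv hv' (fun c => u.2.lay_nonneg (m := 7) c) (by simpa using w)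
    refine ⟨?_, fun p hp => ⟨(this.2.1 p hp).1, by have := (this.2.1 p hp).2; omega, Or.inl (by have := (this.2.1 p hp).2; omega)⟩,
      Or.inl this.2.2⟩
    simpa [add_comm b 1] using this.1

lemma zero_two (hn : 2 ≤ n) (e : ZeroEdge u x) : (edgesAfter 1 x = edgesAfter 1 u+1 ∨
    (edgesAfter 1 x = 0 ∧ edgesAfter 1 u = 0)) ∧
    edgesBefore 1 x-edgesBefore 1 u = edgesAfter 1 x-edgesAfter 1 u-1 := by
  constructor
  · obtain ⟨W1, W2, w, hM⟩ := edgesAfter_spec 1 u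
    obtain ⟨a, d, b, -, ha, w', h1, h2⟩ := e.word hn w
    have hq := fun p hp => (h1 p hp).1
    rcases eq_or_lt_of_le hM.nonneg with h0 | h0
    · obtain ⟨W1', W2', w2, hN⟩ := edgesAfter_spec 1 x
      obtain ⟨rfl, rfl⟩ := w'.unique w2
      rcases hN.eq with h | ⟨c, h⟩
      · exact Or.inr ⟨h, h0.symm⟩
      · have := hM.le c; have := (ht_zero hq h2 c).2.1; have := hN.nonneg; omega
    · obtain ⟨p, hf⟩ := hM.firstMax h0; exact Or.inl (edgesAfter_eq ⟨_, _, w', (hf.zero hq h2).isMax⟩)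
  · obtain ⟨a, d, b, hu, -, hc, hx⟩ := e.exists hn
    unfold edgesBefore
    have h2 : weight γ x.1 2 = weight γ u.1 2 := by
      unfold weight; rw [hc.lay_eq _ (by omega), hc.lay_eq _ (by omega)]
    rw [show 1+1 = 2 from rfl, h2, hu.weight.2, hx.weight.2]
    split_ifs <;> omega

lemma zero_square_two (hj : (1+2 : ℕ) ≤ n) (hx : Edge 1 z x) (hy : ZeroEdge z y) :
    ∃ w, Edge 1 y w ∧ ZeroEdge x w := by
  have hn : 2 ≤ n := hy.two_le
  obtain ⟨hc, W1, W2, p, w, hf, wx⟩ := (edge_iff hj).1 hx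
  obtain ⟨a, d, b, cz, ha, wy, h1, h2⟩ := hy.word hn w
  have hq := fun p hp => (h1 p hp).1; have hp := h1 p hf.mem.1; have hf' := hf.zero hq h2
  obtain ⟨t, ht⟩ := (strings (γ := γ) hj).exists_down (x := y)
    (by rw [edgesAfter_eq ⟨_, _, wy, hf'.isMax⟩]; exact hf'.pos)
  refine ⟨t, ht, ?_⟩
  obtain ⟨hct, W3, W4, p', w3, hf3, wt⟩ := (edge_iff hj).1 ht
  obtain ⟨rfl, rfl⟩ := wy.unique w3
  obtain ⟨-, rfl⟩ := hf'.unique hf3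
  obtain ⟨a', v, d', b', cx⟩ := x.2.exists_config
  have e3 := hc.lay_eq 3 (by omega)
  obtain rfl : a' = a := by
    have := congrArg Finset.card (cx.lay3.symm.trans (e3.trans cz.lay3))
    rw [Int.card_Ico, Int.card_Ico] at this
    have := cx.ha; omega
  obtain rfl : v = 0 := by
    have := cx.hv; have := cx.hv'
    by_contra hv
    obtain ⟨V, H, g, r, -, hF⟩ := wx
    have hH : ∀ c ∈ H, 0 ≤ c := fun c hc => by
      rcases (r.union c).2 (Or.inr hc) with h | h; exacts [x.2.lay_nonneg c h, x.2.lay_nonneg c h]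
    have h4 : a' ∈ lay γ x.1 4 := by rw [cx.lay4, mem_Ico]; omega
    have := h1 _ (mem_of_mem_erase ((Front.mem_neg hF hH ha).2 h4)); omega
  obtain ⟨S, hS, cS⟩ := cx.exists_lowered x.2 hn ha
  have es := cx.lowerZero_eq ha hS cS
  obtain ⟨a2, d2, b2, cx', -, ws, -, -⟩ := ZeroEdge.word (x := ⟨S, hS.right⟩) hn es wx
  obtain ⟨rfl, -⟩ := cx.unique cx'
  obtain ⟨z1, z2⟩ := zero_insert (a := a2) (W2 := W2) (p := p) (by omega) hp.2.2
  rw [z1, z2] at ws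
  rw [Finset.erase_insert_of_ne (ne_of_lt hp.1)] at wt
  obtain ⟨q1, q2, q3, q4⟩ := Word.injective ws wt (hS.right.nonneg2 1) (t.2.nonneg2 1) (hS.right.layer 1).zero (t.2.layer 1).zero
  obtain ⟨a3, d3, b3, cz', -, hcy, cy⟩ := hy.exists hn
  obtain ⟨e1, -⟩ := cz.unique cz'
  have : S = t.1 := by
    refine hS.right.ext_lay t.2 fun m => ?_
    obtain hm | rfl | rfl | rfl | rfl | rfl | rfl : (m ≤ 1 ∨ 8 ≤ m) ∨ m = 2 ∨ m = 3 ∨ m = 4 ∨ m = 5 ∨ m = 6 ∨ m = 7 := by omega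
    · rw [hS.lay_eq m (by omega), hc.lay_eq m (by omega), hct.lay_eq m (by omega), hcy.lay_eq m (by omega)]
    · rw [cS.lay2, hct.lay_eq 2 (by omega), cy.lay2]
    · rw [cS.lay3, hct.lay_eq 3 (by omega), cy.lay3, e1]
    exacts [q1, q2, q3, q4]
  exact es.trans (congrArg some this)

lemma edgesAfter_one_of_empty (h4 : lay γ x.1 4 = ∅) (h5 : lay γ x.1 5 = ∅) : edgesAfter 1 x = 0 := by
  obtain ⟨W1, W2, w, hM⟩ := edgesAfter_spec 1 x
  have h := (x.2.card_word w).1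
  unfold weight at h
  rw [show 2*1+2 = 4 from rfl, show 2*1+3 = 5 from rfl, h4, h5] at h
  obtain rfl : W1 = ∅ := Finset.card_eq_zero.1 (by simpa using h.symm)
  rcases hM.eq with h | ⟨c, h⟩
  · exact h
  · have := hM.nonneg; have := cnt_nonneg W2 c
    unfold ht at h
    rw [cnt_eq_zero (X := ∅) (by simp)] at h; omega

lemma queerCrystal_edge_zero : (queerCrystal γ n).edge 0 x y ↔ ZeroEdge x y :=
  ⟨fun h => h.2, fun h => ⟨lt_of_lt_of_le (by norm_num) h.two_le, h⟩⟩

lemma queerCrystal_edge_succ (hj : (j+2 : ℕ) ≤ n) : (queerCrystal γ n).edge (j+1) = Edge j := by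
  rw [← positivePart_edge hj]
  funext x y; exact propext (iff_self_and.2 fun _ => j.succ_ne_zero)

lemma queerCrystal_strings (hj : (j+2 : ℕ) ≤ n) :
    Strings ((queerCrystal γ n).edge (j+1)) (edgesAfter j) (edgesBefore j) :=
  queerCrystal_edge_succ hj ▸ strings hj

lemma queerCrystal_strings_zero (hn : 2 ≤ n) : Strings ((queerCrystal γ n).edge 0) zeroAfter zeroBefore := by
  rw [show (queerCrystal γ n).edge 0 = ZeroEdge by funext x y; exact propext queerCrystal_edge_zero]
  exact zeroStrings hn

lemma mem_colors (h : i+1 ∈ (queerCrystal γ n).colors) : (i+2 : ℕ) ≤ n := by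
  exact_mod_cast Order.add_one_le_of_lt (show ((i+1 : ℕ) : ℕ∞) < n from h)

/-- The changes along an edge of colour `0`. -/
lemma ZeroEdge.changes_one {u : SSHT γ n} (h : ZeroEdge u x) : ∃ t, (t = 0 ∨ t = 1) ∧
    (queerCrystal γ n).dDelta 1 u x = t ∧ (queerCrystal γ n).dEps 1 u x = 2-t := by
  have hn := h.two_le; have k := (queerCrystal_strings (γ := γ) (n := n) (j := 0) (by exact_mod_cast hn)).changes u x
  obtain ⟨a, d, b, c, ha, -, c'⟩ := h.exists hn
  unfold Lowered at c'
  have h1 := c.stats; have h2 := c'.stats; have h4 := c.hd'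
  refine ⟨_, ?_, rfl, ?_⟩ <;>
  · rw [k.1]
    try rw [k.2]
    rw [h1.2, h2.2]
    try rw [h1.1, h2.1]
    split_ifs <;> omega

lemma ZeroEdge.changes_two {u : SSHT γ n} (h : ZeroEdge u x) : ∃ t, (t = 0 ∨ t = -1) ∧
    (queerCrystal γ n).dEps 2 u x = t ∧ (t = 0 ↔ (queerCrystal γ n).eps 2 x = 0) ∧
    (2 ∈ (queerCrystal γ n).colors → (queerCrystal γ n).dDelta 2 u x = -1-t) := by
  have hn := h.two_le
  by_cases h2 : 2 ∈ (queerCrystal γ n).colors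
  · have s := queerCrystal_strings (γ := γ) (mem_colors h2); have k := s.changes u x; have e := (s.stats x).1
    have := s.ep_nonneg u
    obtain ⟨h3, h4⟩ := zero_two hn h
    refine ⟨_, ?_, rfl, ?_, fun _ => ?_⟩
    · rw [show 2 = 1+1 from rfl, k.2]; omega
    · rw [show 2 = 1+1 from rfl, k.2]; omega
    · rw [show 2 = 1+1 from rfl, k.1, k.2]; omega
  · have s := Strings.of_not_mem h2; have := (s.stats x).1
    exact ⟨0, Or.inl rfl, (s.changes u x).2, by simpa using this, fun h => (h2 h).elim⟩

lemma ZeroEdge.changes_far {u : SSHT γ n} (h : ZeroEdge u x) (hi : i ∈ (queerCrystal γ n).colors) (h3 : 3 ≤ i) :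
    (queerCrystal γ n).dDelta i u x = 0 ∧ (queerCrystal γ n).dEps i u x = 0 := by
  obtain ⟨j, rfl⟩ : ∃ j, i = j+1 := ⟨i-1, by omega⟩
  have hj := mem_colors hi; have f := (zeroFar (γ := γ) h.two_le hj (by omega)).1
  have k := (queerCrystal_strings (γ := γ) hj).changes u x
  rw [k.1, k.2, f.ep h, f.de h, sub_self, sub_self]; exact ⟨rfl, rfl⟩

lemma queerCrystal_zero_edge (x : SSHT γ n) (h : 1 < (queerCrystal γ n).delta 1 x+(queerCrystal γ n).eps 1 x +
    (queerCrystal γ n).eps 2 x) : (queerCrystal γ n).delta 0 x+(queerCrystal γ n).eps 0 x = 1 := by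
  by_cases hn : 2 ≤ n
  · have s := (queerCrystal_strings_zero (γ := γ) hn).stats x
    have s1 := (queerCrystal_strings (γ := γ) (n := n) (j := 0) (by exact_mod_cast hn)).stats x
    obtain ⟨a, v, d, b, c⟩ := x.2.exists_config
    have h1 := c.ha; have h2 := c.hb; have h3 := c.hv; have h4 := c.hv'; have h5 := c.hva
    rw [c.zero.1, c.zero.2] at s
    by_cases h0 : a = 0 ∧ b = 0
    · obtain ⟨rfl, rfl⟩ := h0
      obtain rfl : v = 0 := by omega
      obtain rfl : d = 0 := by have := c.hd; have := c.hd'; omega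
      have e2 : (queerCrystal γ n).eps 2 x = 0 := by
        by_cases h2 : 2 ∈ (queerCrystal γ n).colors
        · have := ((queerCrystal_strings (γ := γ) (mem_colors h2)).stats x).1
          rw [edgesAfter_one_of_empty (by simp [c.lay4]) (by simp [c.lay5])] at this
          exact_mod_cast this
        · have := ((Strings.of_not_mem h2).stats x).1
          exact_mod_cast this
      rw [c.stats.1, c.stats.2] at s1
      rw [zero_add] at s1; omega
    · zify
      rw [s.1, s.2]
      split_ifs <;> omega
  · have h1 : ∀ i, 1 ≤ i → i ∉ (queerCrystal γ n).colors := fun i hi h => hn (by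
      obtain ⟨j, rfl⟩ : ∃ j, i = j+1 := ⟨i-1, by omega⟩
      exact le_trans (by exact_mod_cast (by omega : 2 ≤ j+2)) (mem_colors h))
    have s1 := (Strings.of_not_mem (h1 1 le_rfl)).stats x; have s2 := (Strings.of_not_mem (h1 2 (by norm_num))).stats x
    omega

lemma queerCrystal_isQueerRegular : (queerCrystal γ n).IsQueerRegular where
  regular := positivePart_isRegular
  zero_path x y z h h' := by
    rw [queerCrystal_edge_zero] at h h'
    have s := zeroStrings (γ := γ) h.two_le; have h1 := s.ep_edge h; have h2 := s.ep_edge h'; have h3 := s.ep_nonneg z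
    have : zeroAfter x ≤ 1 := by unfold zeroAfter; split_ifs <;> omega
    omega
  zero_edge := queerCrystal_zero_edge
  unique_in x y z h h' := (zeroStrings (queerCrystal_edge_zero.1 h).two_le).inj (queerCrystal_edge_zero.1 h)
    (queerCrystal_edge_zero.1 h')
  unique_out x y z h h' := (zeroStrings (queerCrystal_edge_zero.1 h).two_le).func (queerCrystal_edge_zero.1 h)
    (queerCrystal_edge_zero.1 h')
  cartan i hi x u h := by
    have h' := queerCrystal_edge_zero.1 h
    obtain rfl | rfl | rfl | h3 : i = 0 ∨ i = 1 ∨ i = 2 ∨ 3 ≤ i := by omega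
    · have s := queerCrystal_strings_zero (γ := γ) h'.two_le
      rw [(s.changes u x).1, (s.changes u x).2, s.ep_edge h, s.de_edge h, if_pos (by omega)]; ring
    · obtain ⟨t, -, h1, h2⟩ := h'.changes_one
      rw [h1, h2, if_pos le_rfl]; ring
    · obtain ⟨t, -, h1, -, h2⟩ := h'.changes_two
      rw [h1, h2 hi]; norm_num
    · rw [(h'.changes_far hi h3).1, (h'.changes_far hi h3).2, if_neg (by omega), if_neg (by omega)]; rfl
  sign_one _ x u h := by
    obtain ⟨t, h0, h1, h2⟩ := (queerCrystal_edge_zero.1 h).changes_one; omega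
  sign_two hi x u h := by
    obtain ⟨t, h0, h1, -, h2⟩ := (queerCrystal_edge_zero.1 h).changes_two
    have := h2 hi; omega
  sign_far i hi h3 x u h := (queerCrystal_edge_zero.1 h).changes_far hi h3
  square_down i hi h2 x y z hx hy := by
    obtain ⟨j, rfl⟩ : ∃ j, i = j+1 := ⟨i-1, by omega⟩
    have hj := mem_colors hi; simp only [queerCrystal_edge_succ hj, queerCrystal_edge_zero] at hx hy ⊢
    rcases h2.eq_or_lt with h | h
    · obtain rfl : j = 1 := by omega
      exact zero_square_two hj hx hy
    · exact (zeroFar hy.two_le hj (by omega)).1.square hy hx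
  square_up i hi h2 x y z hx hy hne := by
    obtain ⟨j, rfl⟩ : ∃ j, i = j+1 := ⟨i-1, by omega⟩
    have hj := mem_colors hi; simp only [queerCrystal_edge_succ hj, queerCrystal_edge_zero] at hx hy ⊢
    rcases h2 with h | h
    · obtain rfl : j = 0 := by omega
      exact zero_square_one hy.two_le hx hy hne
    · obtain ⟨f, f'⟩ := zeroFar (γ := γ) hy.two_le hj (by omega)
      obtain ⟨w, h1, h2⟩ := f.square_up (zeroStrings hy.two_le) (strings hj) f' hy hx
      exact ⟨w, h2, h1⟩
  end_one x u h h1 := by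
    have h' := queerCrystal_edge_zero.1 h; have hj : (0+2 : ℕ) ≤ n := by exact_mod_cast h'.two_le
    have s := queerCrystal_strings (γ := γ) hj
    obtain ⟨h2, h3⟩ := zero_end_one h'.two_le h' (by
      have := (s.changes u x).1; rw [zero_add, h1] at this; omega)
    have := (s.stats x).1
    rw [zero_add, h2] at this
    exact ⟨by exact_mod_cast this, by rw [show 1 = 0+1 from rfl, queerCrystal_edge_succ hj]; exact h3⟩
  end_two x u h := by
    obtain ⟨t, -, h1, h2, -⟩ := (queerCrystal_edge_zero.1 h).changes_two
    rw [h1, h2]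

end

end Shifted

open Shifted in
theorem theorem4p5 (γ : Shifted.StrictPartition) (n : ℕ∞) :
    (2 ≤ n → ∀ i : ℕ, (i : ℕ∞) < n → ∀ T : Shifted.Filling, Shifted.IsSSHT γ n T →
      (∀ S, Shifted.lower γ i T = some S → Shifted.IsSSHT γ n S) ∧
      (1 ≤ i → 0 < Shifted.mMax i (Shifted.readingWord γ T) →
        ∃ S, Shifted.lower γ i T = some S)) ∧
    (Shifted.queerCrystal γ n).IsQueerRegular := by
  refine ⟨fun hn i hi T hT => ?_, queerCrystal_isQueerRegular⟩
  unfold lower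
  rcases i with _ | j
  · refine ⟨fun S h => ?_, fun h => by omega⟩
    obtain ⟨a, v, d, b, c⟩ := hT.exists_config; exact ((lowerZero_iff hT hn c).1 h).2.2.1.right
  · rw [if_neg j.succ_ne_zero]
    have hj := mem_colors (γ := γ) hi
    refine ⟨fun S h => ?_, fun _ h => exists_lowerPos_of_pos hT hj h⟩
    obtain ⟨M, h⟩ := (hT.flip_iff hj).1 h; exact h.1.right
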